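/- **Setting.** Units $c=\hbar=1$, metric $\eta=\mathrm{diag}(1,-1,-1,-1)$. Let $g\neq 0$, $\chi>0$, $\omega_0>0$, $\xi\in\mathbb R$, and let $v$ be a future-directed unit timelike vector. Put $\omega=k\cdot v$ and $\bar\omega^2=\omega_0^2(1+4\pi g^2\chi)$. The covariant Hopfield model has the fields $\Phi=(A^\mu,P^\mu,B)$, a multiplier $\lambda$ for the condition $v\cdot P=0$, and the Lagrangian $$\mathcal L=-\tfrac1{16\pi}F_{\mu\nu}F^{\mu\nu}-\tfrac1{2\chi\omega_0^2}(v\cdot\partial P_\mu)(v\cdot\partial P^\mu)+\tfrac1{2\chi}P_\mu P^\mu-\tfrac g2(v_\mu P_\nu-v_\nu P_\mu)F^{\mu\nu}+B\,\partial_\mu A^\mu+\tfrac\xi2B^2+\lambda\, v\cdot P ,$$ whose momentum-space matrix on $(A,P,B,\lambda)$ is (up to the irrelevant sign of $\lambda$) $$\mathcal M=\begin{pmatrix}\frac1{4\pi}(k^2\mathbb I-kk^t)& ig(\omega\mathbb I-vk^t)&-ik&0\\-ig(\omega\mathbb I-kv^t)&\frac1\chi\left(\frac{\omega^2}{\omega_0^2}-1\right)\mathbb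 I&0&v\\ ik^t&0&-\xi&0\\0&v^t&0&0\end{pmatrix}.$$ **Inverse.** Put $X=\frac{g^2\chi\omega_0^2}{\omega^2-\omega_0^2}$, $D=\frac{k^2}{4\pi}-X\omega^2$, $h=\left(\frac1{4\pi}-X\right)^{-1}$. For complex $k$, and with an arbitrary complex number $w\neq0$ in place of $\omega_0^2$, if $k^2\ne0$, $\omega^2\neq\omega_0^2$, $D\neq0$, $X\neq\frac1{4\pi}$, then $\mathcal M$ is invertible, and deleting the $\lambda$ row and column of $\mathcal M^{-1}$ gives $$\bar{\mathcal M}^{-1}=\begin{pmatrix}M^{-1}&N&-ik/k^2\\N^\dagger&Q&0\\ik^t/k^2&0&0\end{pmatrix},$$ where, with both indices up, $$M^{-1}=\frac{\eta}{D}+\left[\frac{\xi-h}{(k^2)^2}+\frac{hX}{Dk^2}\right]kk^t-\frac{hX}{D}\left[\frac{\omega}{k^2}(kv^t+vk^t)-vv^t\right],$$ $$N=-\frac{iX}{gD}\left[\omega\eta+\omega hX\left(vv^t+\frac{kk^t}{k^2}-\frac{\omega}{k^2}kv^t\right)-\frac h{4\pi}vk^t\right],$$ $$N^\dagger=\frac{iX}{gD}\left[\omega\eta+\omega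 hX\left(vv^t+\frac{kk^t}{k^2}-\frac{\omega}{k^2}vk^t\right)-\frac h{4\pi}kv^t\right],$$ $$Q=\frac{X^2}{g^2D}\left[\omega^2\eta+h\left(X\omega^2vv^t-\frac\omega{4\pi}(kv^t+vk^t)+\frac{kk^t}{4\pi}\right)\right]+\frac{X}{g^2}(\eta-vv^t).$$ **The Feynman propagator.** $\bar{\mathcal M}^{-1}_{i\varepsilon}(k)$ is obtained from these formulas by the substitution $k^2\to k^2+i\varepsilon$, $\omega_0^2\to\omega_0^2-i\varepsilon$ (the components of $k$ and $\omega=k\cdot v$ unchanged), and $$G_F(x)=\lim_{\varepsilon\to0^+}\int\frac{d^4k}{(2\pi)^4}e^{-ik\cdot x}\,\bar{\mathcal M}^{-1}_{i\varepsilon}(k)$$ as a tempered distribution. **The canonical propagator.** $G^{IJ}(x,y)=i\langle0|T(\Phi^I(x)\Phi^J(y))|0\rangle$, where $$\langle0|\Phi^I(x)\Phi^J(y)|0\rangle=\int\frac{d^3\vec k}{(2\pi)^3}e^{i\vec k\cdot(\vec x-\vec y)}\,W^{IJ}_{\vec k}(x^0-y^0)$$ is the vacuum two-point function of the canonical quantization: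 for almost every $\vec k$ both factors satisfy the field equations; the fields and their momenta $\Pi_A,\Pi_P$ have the equal-time commutators $[A^\mu,\Pi_A^\nu]=i\eta^{\mu\nu}\delta$, $[P^\mu,\Pi_P^\nu]=i(\eta^{\mu\nu}-v^\mu v^\nu)\delta$, all others $0$ (Dirac brackets); and $W_{\vec k}(t)$ is a finite sum of terms (polynomial in $t$)$\,\times e^{-ik^0t}$ with $k\cdot v>0$. **Statement.** Such a $W$ exists. For every such $W$, the distribution $G$ is well defined (by an absolutely convergent integral against test functions), and $$G(x,y)=G_F(x-y).$$ Moreover $G$ is Lorentz covariant: if $v$ is replaced by $Lv$, with $L$ a Lorentz transformation that keeps $v$ future-directed, then $G$ is transformed by $L$. Explicitly, $W$ is given almost everywhere by the following formulas. Let $k_+=(|\vec k|,\vec k)$ and $\omega_+=k_+\cdot v$; let $k_>$ have spatial part $\vec k$ and $k_>\cdot v=\bar\omega$; let $k_{(a)}$, $a=1,2$, be the momenta with spatial part $\vec k$, $\omega_{(a)}=k_{(a)}\cdot v$, at which $DR=\frac{k^2}{4\pi}-\frac{g^2\chi\omega_0^2\omega^2}{\omega^2-\omega_0^2}$ vanishes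 and $DR'=\partial DR/\partial k^0>0$ (for $\vec k\neq0$ there are exactly two); let $e^{(a)}_i$, $i=1,2$, satisfy $e_i\cdot e_j=-\delta_{ij}$, $e_i\cdot k_{(a)}=e_i\cdot v=0$. Write $E^{\mu\nu}_a=\sum_i e_i^{(a)\mu}e_i^{(a)\nu}/DR'_{(a)}$. Then: * $\displaystyle W^{A^\mu A^\nu}=F^{\mu\nu}+\frac{8\pi^2g^2\chi\omega_0^2}{\bar\omega v^0}\,\frac{e^{-ik_>^0t}}{\bar\omega^2-k_>^2}\Big(v^\mu-\frac{\bar\omega}{k_>^2}k_>^\mu\Big)\Big(v^\nu-\frac{\bar\omega}{k_>^2}k_>^\nu\Big)+\sum_a e^{-ik^0_{(a)}t}E_a^{\mu\nu}$, where $F^{\mu\nu}$ is minus the residue of $e^{-ik^0t}(M^{-1})^{\mu\nu}$ at $k^0=|\vec k|$ (written out explicitly in the formal statement). For $\vec v=0$, $$F^{\mu\nu}=\pi e^{-i|\vec k|t}\Big\{-\frac{v^\mu k_+^\nu+v^\nu k_+^\mu}{|\vec k|\omega_+}\Big(\frac\xi{4\pi}+\frac{\omega_+^2-\omega_0^2}{\omega_+^2-\bar\omega^2}\Big)+\frac{it\,k_+^\mu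 k_+^\nu}{|\vec k|\omega_+}\Big(\frac\xi{4\pi}-\frac{\omega_+^2-\omega_0^2}{\omega_+^2-\bar\omega^2}\Big)$$ $$\qquad+\frac{\frac\xi{4\pi}(\omega_+^2-\bar\omega^2)^2+(\omega_+^2-\omega_0^2)(\omega_+^2-\bar\omega^2)-8\pi\omega_+^2g^2\chi\omega_0^2}{\omega_+^2|\vec k|(\omega_+^2-\bar\omega^2)^2}k_+^\mu k_+^\nu\Big\}.$$ * $\displaystyle W^{A^\mu P^\nu}=\frac{2\pi ig\chi\omega_0^2}{|\vec k|\omega_+}\,\frac{\omega_+k_+^\mu v^\nu-k_+^\mu k_+^\nu}{\omega_+^2-\bar\omega^2}e^{-i|\vec k|t}-\frac{2\pi ig\chi\omega_0^2}{\bar\omega v^0}\,\frac{e^{-ik_>^0t}}{\bar\omega^2-k_>^2}\Big(v^\mu-\frac{\bar\omega}{k_>^2}k_>^\mu\Big)(\bar\omega v^\nu-k_>^\nu)-ig\chi\omega_0^2\sum_a\frac{\omega_{(a)}e^{-ik^0_{(a)}t}}{\omega_{(a)}^2-\omega_0^2}E_a^{\mu\nu}$. * $\displaystyle W^{A^\mu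 B}=\frac i2\frac{k_+^\mu}{|\vec k|}e^{-i|\vec k|t}$. * $\displaystyle W^{P^\mu P^\nu}=\frac{\chi\omega_0^2}{2\bar\omega v^0}\,\frac{e^{-ik_>^0t}}{\bar\omega^2-k_>^2}(\bar\omega v^\mu-k_>^\mu)(\bar\omega v^\nu-k_>^\nu)+g^2\chi^2\omega_0^4\sum_a\frac{\omega_{(a)}^2e^{-ik^0_{(a)}t}}{(\omega_{(a)}^2-\omega_0^2)^2}E_a^{\mu\nu}$. * $W^{P^\mu B}=0$, $W^{BB}=0$, and $W^{JI}_{\vec k}(t)=\overline{W^{IJ}_{\vec k}(-t)}$. -/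

import Mathlib

/-! # The relativistic covariant Hopfield model: canonical and Feynman propagators

Units `c = ħ = 1`, signature `(+,-,-,-)`.  Four-vectors carry upper indices. -/

namespace Hopfield

/-- The data of the model: coupling `g`, susceptibility `χ`, resonance frequency `ω₀`,
gauge-fixing constant `ξ`, four-velocity `v` of the medium. -/
structure Medium where
  g : ℝ
  χ : ℝ
  ω₀ : ℝ
  ξ : ℝ
  v : Fin 4 → ℝ

/-- Labels of the nine field components: `A^μ`, `P^μ`, `B`. -/
abbrev FieldIx : Type := Fin 4 ⊕ Fin 4 ⊕ Unit

/-- Label of `A^μ`. -/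
abbrev iA (μ : Fin 4) : FieldIx := Sum.inl μ

/-- Label of `P^μ`. -/
abbrev iP (μ : Fin 4) : FieldIx := Sum.inr (Sum.inl μ)

/-- Label of `B`. -/
abbrev iB : FieldIx := Sum.inr (Sum.inr ())

/-- Labels of the nine field components and of the Lagrange multiplier `λ`. -/
abbrev ExtIx : Type := FieldIx ⊕ Unit

/-! ## Minkowski space -/

/-- The Minkowski product. -/
def mink {R : Type*} [CommRing R] (a b : Fin 4 → R) : R :=
  a 0 * b 0 - a 1 * b 1 - a 2 * b 2 - a 3 * b 3

/-- The components `η_{μν} = η^{μν}` of the metric. -/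
def eta (μ ν : Fin 4) : ℂ := if μ = ν then (if μ = 0 then 1 else -1) else 0

/-- Lowering an index. -/
def lower (a : Fin 4 → ℂ) (μ : Fin 4) : ℂ := if μ = 0 then a 0 else -a μ

/-- The vector `(s, q)` with time component `s` and space components `q`. -/
def four (s : ℝ) (q : Fin 3 → ℝ) : Fin 4 → ℝ := Matrix.vecCons s q

/-- The same with a complex time component. -/
noncomputable def fourC (s : ℂ) (q : Fin 3 → ℝ) : Fin 4 → ℂ :=
  Matrix.vecCons s (fun j => (q j : ℂ))

/-- A real vector as a complex one. -/
noncomputable def toC (k : Fin 4 → ℝ) : Fin 4 → ℂ := fun μ => (k μ : ℂ)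

/-- The Euclidean length of a spatial vector. -/
noncomputable def len (q : Fin 3 → ℝ) : ℝ := Real.sqrt (∑ j, q j ^ 2)

/-! ## The momentum-space matrix and the Feynman propagator -/

/-- The four-velocity as a complex vector. -/
noncomputable def Medium.vC (p : Medium) : Fin 4 → ℂ := toC p.v

/-- The invariant frequency `ω = k · v`, for a complex `k`. -/
noncomputable def Medium.omC (p : Medium) (k : Fin 4 → ℂ) : ℂ := mink k p.vC

/-- The matrix `𝓜` of the quadratic action, `S = -½ ∫ V(-k)ᵀ 𝓜(k) V(k)`, `V = (A, P, B, λ)`,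
as a bilinear form on vectors with upper indices, so that its entries carry lower indices
and the entries of its inverse carry upper indices; `w` stands for `ω₀²`. -/
noncomputable def fieldMatrix (p : Medium) (w : ℂ) (k : Fin 4 → ℂ) : Matrix ExtIx ExtIx ℂ :=
  Matrix.of fun a b =>
    match a, b with
    | .inl (.inl μ), .inl (.inl ν) =>
        1 / (4 * Real.pi) * (mink k k * eta μ ν - lower k μ * lower k ν)
    | .inl (.inl μ), .inl (.inr (.inl ν)) =>
        Complex.I * p.g * (p.omC k * eta μ ν - lower p.vC μ * lower k ν)
    | .inl (.inl μ), .inl (.inr (.inr _)) => -Complex.I * lower k μ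
    | .inl (.inl _), .inr _ => 0
    | .inl (.inr (.inl μ)), .inl (.inl ν) =>
        -Complex.I * p.g * (p.omC k * eta μ ν - lower k μ * lower p.vC ν)
    | .inl (.inr (.inl μ)), .inl (.inr (.inl ν)) => 1 / p.χ * (p.omC k ^ 2 / w - 1) * eta μ ν
    | .inl (.inr (.inl _)), .inl (.inr (.inr _)) => 0
    | .inl (.inr (.inl μ)), .inr _ => lower p.vC μ
    | .inl (.inr (.inr _)), .inl (.inl ν) => Complex.I * lower k ν
    | .inl (.inr (.inr _)), .inl (.inr (.inl _)) => 0
    | .inl (.inr (.inr _)), .inl (.inr (.inr _)) => -p.ξ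
    | .inl (.inr (.inr _)), .inr _ => 0
    | .inr _, .inl (.inl _) => 0
    | .inr _, .inl (.inr (.inl ν)) => lower p.vC ν
    | .inr _, .inl (.inr (.inr _)) => 0
    | .inr _, .inr _ => 0

/-- `X = g² χ w / (ω² - w)`. -/
noncomputable def polX (p : Medium) (w : ℂ) (k : Fin 4 → ℂ) : ℂ :=
  p.g ^ 2 * p.χ * w / (p.omC k ^ 2 - w)

/-- `D = s / 4π - g² χ w ω² / (ω² - w)`. -/
noncomputable def dispC (p : Medium) (s w : ℂ) (k : Fin 4 → ℂ) : ℂ :=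
  s / (4 * Real.pi) - polX p w k * p.omC k ^ 2

/-- The closed form of the reduced inverse of `𝓜`, as a function of `k`, of `s` (standing for
`k²`) and of `w` (standing for `ω₀²`). -/
noncomputable def propMatrix (p : Medium) (s w : ℂ) (k : Fin 4 → ℂ) :
    Matrix FieldIx FieldIx ℂ :=
  let v := p.vC
  let om := p.omC k
  let X := polX p w k
  let D := dispC p s w k
  let h : ℂ := 1 / (1 / (4 * Real.pi) - X)
  Matrix.of fun a b =>
    match a, b with
    | .inl μ, .inl ν =>
        1 / D * eta μ ν
          + (1 / s ^ 2 * (p.ξ - h) + 1 / D * (1 / s) * h * X) * (k μ * k ν)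
          - 1 / D * h * X * (om * (k μ * v ν + v μ * k ν) / s - v μ * v ν)
    | .inl μ, .inr (.inl ν) =>
        -Complex.I * p.g * (p.χ * w / (om ^ 2 - w)) * (1 / D)
          * (om * eta μ ν
            + om * h * X * (v μ * v ν + k μ * k ν / s - om / s * (k μ * v ν))
            - h / (4 * Real.pi) * (v μ * k ν))
    | .inl μ, .inr (.inr _) => -Complex.I * k μ / s
    | .inr (.inl μ), .inl ν =>
        Complex.I * p.g * (p.χ * w / (om ^ 2 - w)) * (1 / D)
          * (om * eta μ ν
            + om * h * X * (v μ * v ν + k μ * k ν / s - om / s * (v μ * k ν))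
            - h / (4 * Real.pi) * (k μ * v ν))
    | .inr (.inl μ), .inr (.inl ν) =>
        p.g ^ 2 * (p.χ * w / (om ^ 2 - w)) ^ 2 * (1 / D)
          * (om ^ 2 * eta μ ν
            + h * (X * om ^ 2 * (v μ * v ν)
                - om / (4 * Real.pi) * (k μ * v ν + v μ * k ν)
                + 1 / (4 * Real.pi) * (k μ * k ν)))
        + p.χ * w / (om ^ 2 - w) * (eta μ ν - v μ * v ν)
    | .inr (.inl _), .inr (.inr _) => 0
    | .inr (.inr _), .inl ν => Complex.I * k ν / s
    | .inr (.inr _), .inr (.inl _) => 0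
    | .inr (.inr _), .inr (.inr _) => 0

/-- The reduced inverse matrix with the Feynman-Stückelberg prescription
`k² → k² + iε`, `ω₀² → ω₀² - iε`. -/
noncomputable def regMatrix (p : Medium) (ε : ℝ) (k : Fin 4 → ℝ) : Matrix FieldIx FieldIx ℂ :=
  propMatrix p (mink (toC k) (toC k) + Complex.I * ε) ((p.ω₀ : ℂ) ^ 2 - Complex.I * ε) (toC k)

/-- `∫ f(x) e^{-i k·x} d⁴x`. -/
noncomputable def fourier4 (f : SchwartzMap (Fin 4 → ℝ) ℂ) (k : Fin 4 → ℝ) : ℂ :=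
  ∫ x : Fin 4 → ℝ, f x * Complex.exp (-Complex.I * (mink k x : ℝ))

/-- The integrand of the regularized Feynman propagator paired with a test function. -/
noncomputable def feynmanIntegrand (p : Medium) (ε : ℝ) (a b : FieldIx)
    (f : SchwartzMap (Fin 4 → ℝ) ℂ) (k : Fin 4 → ℝ) : ℂ :=
  1 / (2 * Real.pi) ^ 4 * (regMatrix p ε k a b * fourier4 f k)

/-- The regularized Feynman propagator `∫ d⁴k/(2π)⁴ e^{-ik·x} 𝓜̄⁻¹_{iε}(k)`, as a distribution. -/
noncomputable def feynman (p : Medium) (ε : ℝ) (a b : FieldIx)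
    (f : SchwartzMap (Fin 4 → ℝ) ℂ) : ℂ :=
  ∫ k : Fin 4 → ℝ, feynmanIntegrand p ε a b f k

/-- `T` is the distribution `G_F^{ab}`, the limit `ε → 0⁺` of the regularized ones. -/
def IsFeynmanPropagator (p : Medium) (a b : FieldIx)
    (T : SchwartzMap (Fin 4 → ℝ) ℂ → ℂ) : Prop :=
  ∀ f : SchwartzMap (Fin 4 → ℝ) ℂ,
    (∀ ε : ℝ, 0 < ε → MeasureTheory.Integrable (feynmanIntegrand p ε a b f)) ∧
    Filter.Tendsto (fun ε : ℝ => feynman p ε a b f) (nhdsWithin 0 (Set.Ioi 0)) (nhds (T f))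

/-! ## Canonical quantization

By translation invariance the vacuum two-point functions of the fields are written as
`⟨0|Φ^a(x) Φ^b(y)|0⟩ = ∫ d³q/(2π)³ e^{i q·(x-y)} W q (x⁰-y⁰) a b`. -/

/-- The coefficients of `𝓜` as a polynomial of degree two in `k⁰`, with `k⃗ = q`. -/
noncomputable def opCoeff (p : Medium) (q : Fin 3 → ℝ) : Fin 3 → Matrix ExtIx ExtIx ℂ :=
  let M : ℂ → Matrix ExtIx ExtIx ℂ := fun s => fieldMatrix p ((p.ω₀ : ℂ) ^ 2) (fourC s q)
  ![M 0, (1 / 2 : ℂ) • (M 1 - M (-1)), (1 / 2 : ℂ) • (M 1 + M (-1) - (2 : ℂ) • M 0)]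

/-- The field equations `𝓜 V = 0` (with `k⁰ = i ∂_t`, `k⃗ = q`) for the first index of `U`,
with a Lagrange multiplier `l` for the condition `v · P = 0`. -/
def SolvesFieldEq (p : Medium) (q : Fin 3 → ℝ) (U : ℝ → Matrix FieldIx FieldIx ℂ) : Prop :=
  ∃ l : ℝ → FieldIx → ℂ,
    let V : ExtIx → FieldIx → ℝ → ℂ :=
      fun c b t => Sum.elim (fun a => U t a b) (fun _ => l t b) c
    ∀ (t : ℝ) (r : ExtIx) (b : FieldIx),
      ∑ c : ExtIx, (opCoeff p q 0 r c * V c b t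
        + Complex.I * opCoeff p q 1 r c * deriv (V c b) t
        - opCoeff p q 2 r c * deriv (deriv (V c b)) t) = 0

/-- Labels of the canonical variables `A^μ`, `Π_A^μ`, `P^μ`, `Π_P^μ`. -/
abbrev CanIx : Type := Fin 4 ⊕ Fin 4 ⊕ Fin 4 ⊕ Fin 4

/-- The components `∂^j = -i q_j` of the spatial gradient with upper index, in Fourier space;
the time component is set to zero. -/
noncomputable def gradC (q : Fin 3 → ℝ) : Fin 4 → ℂ := Matrix.vecCons 0 (fun j => -Complex.I * q j)

/-- Together with `canVel`: the canonical variables as linear combinations of the fields and of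
their time derivatives,
`Π_A^μ = ∂L/∂(∂₀A_μ) = -(1/4π) (∂⁰A^μ - ∂^μA⁰) - g (v⁰P^μ - v^μP⁰) + η^{0μ} B`,
`Π_P^μ = ∂L/∂(∂₀P_μ) = -(v⁰/(χω₀²)) v^ρ∂_ρ P^μ`. This is the part without time derivatives. -/
noncomputable def canPos (p : Medium) (q : Fin 3 → ℝ) : Matrix CanIx FieldIx ℂ :=
  Matrix.of fun z a =>
    match z, a with
    | .inl μ, .inl ν => if μ = ν then 1 else 0
    | .inr (.inl μ), .inl ν => if ν = 0 then 1 / (4 * Real.pi) * gradC q μ else 0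
    | .inr (.inl μ), .inr (.inl ν) =>
        -p.g * ((if μ = ν then (p.v 0 : ℂ) else 0) - (if ν = 0 then (p.v μ : ℂ) else 0))
    | .inr (.inl μ), .inr (.inr _) => eta 0 μ
    | .inr (.inr (.inl μ)), .inr (.inl ν) => if μ = ν then 1 else 0
    | .inr (.inr (.inr μ)), .inr (.inl ν) =>
        if μ = ν then -(p.v 0 / (p.χ * p.ω₀ ^ 2))
          * (Complex.I * ∑ j : Fin 3, (p.v j.succ : ℂ) * q j) else 0
    | _, _ => 0

/-- The coefficients of the time derivatives of the fields in the canonical variables. -/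
noncomputable def canVel (p : Medium) : Matrix CanIx FieldIx ℂ :=
  Matrix.of fun z a =>
    match z, a with
    | .inr (.inl μ), .inl ν => if μ = ν ∧ μ ≠ 0 then -(1 / (4 * Real.pi)) else 0
    | .inr (.inr (.inr μ)), .inr (.inl ν) =>
        if μ = ν then -(p.v 0 ^ 2 / (p.χ * p.ω₀ ^ 2)) else 0
    | _, _ => 0

/-- The Dirac brackets of the canonical variables: `{A^μ, Π_A^ν} = η^{μν}`,
`{P^μ, Π_P^ν} = η^{μν} - v^μ v^ν` (constraints `v · P = 0`, `v · Π_P = 0`), others zero. -/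
noncomputable def diracBracket (p : Medium) : Matrix CanIx CanIx ℂ :=
  Matrix.of fun z z' =>
    match z, z' with
    | .inl μ, .inr (.inl ν) => eta μ ν
    | .inr (.inl μ), .inl ν => -eta μ ν
    | .inr (.inr (.inl μ)), .inr (.inr (.inr ν)) => eta μ ν - p.v μ * p.v ν
    | .inr (.inr (.inr μ)), .inr (.inr (.inl ν)) => -(eta μ ν - p.v μ * p.v ν)
    | _, _ => 0

/-- The `n`-th derivative at `t = 0` of the commutator function
`C(t) = W q t - (W (-q) (-t))ᵀ`, i.e. of the Fourier transform of
`⟨0|[Φ^a(x), Φ^b(y)]|0⟩`. -/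
noncomputable def commDeriv (W : (Fin 3 → ℝ) → ℝ → Matrix FieldIx FieldIx ℂ) (q : Fin 3 → ℝ)
    (n : ℕ) : Matrix FieldIx FieldIx ℂ :=
  Matrix.of fun a b => iteratedDeriv n (fun t : ℝ => W q t a b - W (-q) (-t) b a) 0

/-- `W` is the vacuum two-point function of the canonically quantized fields: both factors
satisfy the field equations, the canonical variables have the equal-time commutators
`i ×` Dirac bracket, and the vacuum is annihilated by the positive-frequency part of the
fields, where the sign of the frequency is the sign of `ω = k · v` (polynomials in the time
occur because of the multiple roots of `det 𝓜`). -/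
structure IsVacuumTwoPoint (p : Medium) (W : (Fin 3 → ℝ) → ℝ → Matrix FieldIx FieldIx ℂ) :
    Prop where
  left_eq : ∀ᵐ q : Fin 3 → ℝ, SolvesFieldEq p q (W q)
  right_eq : ∀ᵐ q : Fin 3 → ℝ, SolvesFieldEq p q (fun t => (W (-q) (-t)).transpose)
  positive : ∀ᵐ q : Fin 3 → ℝ, ∃ (S : Finset ℝ) (c : ℝ → FieldIx → FieldIx → Polynomial ℂ),
    (∀ s ∈ S, 0 < mink (four s q) p.v) ∧
    ∀ (t : ℝ) (a b : FieldIx),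
      W q t a b = ∑ s ∈ S, (c s a b).eval (t : ℂ) * Complex.exp (-Complex.I * s * t)
  commutators : ∀ᵐ q : Fin 3 → ℝ,
    canPos p q * commDeriv W q 0 * (canPos p (-q)).transpose
      + canVel p * commDeriv W q 1 * (canPos p (-q)).transpose
      - canPos p q * commDeriv W q 1 * (canVel p).transpose
      - canVel p * commDeriv W q 2 * (canVel p).transpose
      = Complex.I • diracBracket p

/-- `∫ f(t, x) e^{i q·x} d³x`. -/
noncomputable def fourier3 (f : SchwartzMap (Fin 4 → ℝ) ℂ) (t : ℝ) (q : Fin 3 → ℝ) : ℂ :=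
  ∫ x : Fin 3 → ℝ, f (four t x) * Complex.exp (Complex.I * (∑ j, q j * x j : ℝ))

/-- The integrand of the propagator
`G^{ab}(x,y) = i ⟨0|T(Φ^a(x) Φ^b(y))|0⟩
  = i (θ(x⁰-y⁰) ⟨0|Φ^a(x) Φ^b(y)|0⟩ + θ(y⁰-x⁰) ⟨0|Φ^b(y) Φ^a(x)|0⟩)`,
paired with a test function of `x - y`. -/
noncomputable def propagatorIntegrand (W : (Fin 3 → ℝ) → ℝ → Matrix FieldIx FieldIx ℂ)
    (a b : FieldIx) (f : SchwartzMap (Fin 4 → ℝ) ℂ) (z : ℝ × (Fin 3 → ℝ)) : ℂ :=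
  1 / (2 * Real.pi) ^ 3
    * (Complex.I * (if 0 ≤ z.1 then W z.2 z.1 a b else W (-z.2) (-z.1) b a) * fourier3 f z.1 z.2)

/-- The propagator `G^{ab}` as a distribution in `x - y`. -/
noncomputable def propagator (W : (Fin 3 → ℝ) → ℝ → Matrix FieldIx FieldIx ℂ)
    (a b : FieldIx) (f : SchwartzMap (Fin 4 → ℝ) ℂ) : ℂ :=
  ∫ z : ℝ × (Fin 3 → ℝ), propagatorIntegrand W a b f z

/-! ## The explicit two-point functions -/

/-- `ω̄² = ω₀² (1 + 4π g² χ)`. -/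
noncomputable def barSq (p : Medium) : ℝ := p.ω₀ ^ 2 * (1 + 4 * Real.pi * p.g ^ 2 * p.χ)

/-- `ω̄`. -/
noncomputable def bar (p : Medium) : ℝ := Real.sqrt (barSq p)

/-- `e^{-i k⁰ t}`. -/
noncomputable def phase (s t : ℝ) : ℂ := Complex.exp (-Complex.I * s * t)

/-- The free photon momentum `k_+ = (|q|, q)`. -/
noncomputable def kPlus (q : Fin 3 → ℝ) : Fin 4 → ℝ := four (len q) q

/-- `ω_+ = k_+ · v`. -/
noncomputable def omPlus (p : Medium) (q : Fin 3 → ℝ) : ℝ := mink (kPlus q) p.v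

/-- The momentum `k_>` of the b-mode, the solution of `k · v = ω̄` with `k⃗ = q`. -/
noncomputable def kBar (p : Medium) (q : Fin 3 → ℝ) : Fin 4 → ℝ :=
  four ((bar p + ∑ j : Fin 3, p.v j.succ * q j) / p.v 0) q

/-- The dispersion function `k²/4π - g² χ ω₀² ω² / (ω² - ω₀²)` of the transverse modes, as a
function of `k⁰ = s`. -/
noncomputable def DR (p : Medium) (q : Fin 3 → ℝ) (s : ℝ) : ℝ :=
  mink (four s q) (four s q) / (4 * Real.pi)
    - p.g ^ 2 * p.χ * p.ω₀ ^ 2 * mink (four s q) p.v ^ 2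
      / (mink (four s q) p.v ^ 2 - p.ω₀ ^ 2)

/-- The values of `k⁰` of the transverse modes of positive norm: the zeros of `DR` at which its
derivative with respect to `k⁰` is positive. -/
def transverseModes (p : Medium) (q : Fin 3 → ℝ) : Set ℝ :=
  {s | mink (four s q) p.v ^ 2 ≠ p.ω₀ ^ 2 ∧ DR p q s = 0 ∧ 0 < deriv (DR p q) s}

/-- `e q s i`, `i = 1, 2`, are polarization vectors of the transverse modes: spacelike,
orthonormal, and orthogonal to `k` and `v`. -/
def IsPolarization (p : Medium) (e : (Fin 3 → ℝ) → ℝ → Fin 2 → Fin 4 → ℝ) : Prop :=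
  ∀ (q : Fin 3 → ℝ), ∀ s ∈ transverseModes p q, ∀ i : Fin 2,
    mink (e q s i) (four s q) = 0 ∧ mink (e q s i) p.v = 0 ∧
    ∀ j : Fin 2, mink (e q s i) (e q s j) = if i = j then -1 else 0

/-- `∑_a ∑_i c(ω_(a)) e_i^μ e_i^ν e^{-i k⁰_(a) t} / DR'_(a)`. -/
noncomputable def transverseSum (p : Medium) (e : (Fin 3 → ℝ) → ℝ → Fin 2 → Fin 4 → ℝ)
    (c : ℝ → ℂ) (q : Fin 3 → ℝ) (t : ℝ) (μ ν : Fin 4) : ℂ :=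
  ∑ᶠ s ∈ transverseModes p q, ∑ i : Fin 2,
    phase s t * c (mink (four s q) p.v) * ((e q s i μ * e q s i ν / deriv (DR p q) s : ℝ) : ℂ)

/-- The free photon part of `⟨A^μ A^ν⟩`: minus the residue at the double pole
`k⁰ = |q|`. -/
noncomputable def photonAA (p : Medium) (q : Fin 3 → ℝ) (t : ℝ) (μ ν : Fin 4) : ℂ :=
  let k := kPlus q
  let om := omPlus p q
  let h := (om ^ 2 - p.ω₀ ^ 2) / (om ^ 2 - barSq p)
  let d := p.ξ - 4 * Real.pi * h
  phase (len q) t *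
    ( -((2 * Real.pi * h / (len q * om) * (k μ * p.v ν + p.v μ * k ν - k μ * k ν / om) : ℝ) : ℂ)
      + Complex.I * t * ((d / (4 * len q ^ 2) * (k μ * k ν) : ℝ) : ℂ)
      + ((d / (4 * len q ^ 3) * (k μ * k ν) : ℝ) : ℂ)
      - ((d / (4 * len q ^ 2) * ((if μ = 0 then k ν else 0) + (if ν = 0 then k μ else 0)) : ℝ) : ℂ)
      - ((8 * Real.pi ^ 2 * p.g ^ 2 * p.χ * p.ω₀ ^ 2 * om * p.v 0
            / (len q ^ 2 * (om ^ 2 - barSq p) ^ 2) * (k μ * k ν) : ℝ) : ℂ) )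

/-- The covariant form of the free photon part of `⟨A^μ A^ν⟩`, in the rest frame of the
medium, where `(x - y) · v = t`. -/
noncomputable def photonAArest (p : Medium) (q : Fin 3 → ℝ) (t : ℝ) (μ ν : Fin 4) : ℂ :=
  let k := kPlus q
  let om := omPlus p q
  let h := (om ^ 2 - p.ω₀ ^ 2) / (om ^ 2 - barSq p)
  phase (len q) t *
    ( -(((p.v μ * k ν + p.v ν * k μ) / (len q * om)
          * Real.pi * (p.ξ / (4 * Real.pi) + h) : ℝ) : ℂ)
      + Complex.I * ((t / (len q * om) * (p.ξ / (4 * Real.pi) - h) * Real.pi * k μ * k ν : ℝ) : ℂ)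
      + (((p.ξ / (4 * Real.pi) * (om ^ 2 - barSq p) ^ 2
            + (om ^ 2 - p.ω₀ ^ 2) * (om ^ 2 - barSq p)
            - 8 * Real.pi * om ^ 2 * p.g ^ 2 * p.χ * p.ω₀ ^ 2)
          / (om ^ 2 * len q * (om ^ 2 - barSq p) ^ 2) * Real.pi * k μ * k ν : ℝ) : ℂ) )

/-- The b-mode part of `⟨A^μ A^ν⟩`. -/
noncomputable def bAA (p : Medium) (q : Fin 3 → ℝ) (t : ℝ) (μ ν : Fin 4) : ℂ :=
  let k := kBar p q
  let kk := mink k k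
  phase (k 0) t *
    ((8 * Real.pi ^ 2 * p.g ^ 2 * p.χ * p.ω₀ ^ 2 / (bar p * p.v 0) * (1 / (barSq p - kk))
      * (p.v μ - bar p / kk * k μ) * (p.v ν - bar p / kk * k ν) : ℝ) : ℂ)

/-- `⟨A^μ P^ν⟩`. -/
noncomputable def twoPointAP (p : Medium) (e : (Fin 3 → ℝ) → ℝ → Fin 2 → Fin 4 → ℝ)
    (q : Fin 3 → ℝ) (t : ℝ) (μ ν : Fin 4) : ℂ :=
  let k := kPlus q
  let om := omPlus p q
  let l := kBar p q
  let ll := mink l l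
  Complex.I * phase (len q) t *
      ((2 * Real.pi * p.g * p.χ * p.ω₀ ^ 2 / (len q * om)
        * (om * k μ * p.v ν - k μ * k ν) / (om ^ 2 - barSq p) : ℝ) : ℂ)
    - Complex.I * phase (l 0) t *
      ((2 * Real.pi * p.g * p.χ * p.ω₀ ^ 2 / (bar p * p.v 0) * (1 / (barSq p - ll))
        * (p.v μ - bar p / ll * l μ) * (bar p * p.v ν - l ν) : ℝ) : ℂ)
    + transverseSum p e (fun om' => -Complex.I *
        ((p.g * p.χ * p.ω₀ ^ 2 * om' / (om' ^ 2 - p.ω₀ ^ 2) : ℝ) : ℂ)) q t μ ν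

/-- `⟨A^μ B⟩`. -/
noncomputable def twoPointAB (q : Fin 3 → ℝ) (t : ℝ) (μ : Fin 4) : ℂ :=
  Complex.I / 2 * phase (len q) t * ((kPlus q μ / len q : ℝ) : ℂ)

/-- `⟨P^μ P^ν⟩`. -/
noncomputable def twoPointPP (p : Medium) (e : (Fin 3 → ℝ) → ℝ → Fin 2 → Fin 4 → ℝ)
    (q : Fin 3 → ℝ) (t : ℝ) (μ ν : Fin 4) : ℂ :=
  let l := kBar p q
  phase (l 0) t *
      ((p.χ * p.ω₀ ^ 2 / (2 * bar p * p.v 0) * (1 / (barSq p - mink l l))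
        * (bar p * p.v μ - l μ) * (bar p * p.v ν - l ν) : ℝ) : ℂ)
    + transverseSum p e (fun om' =>
        ((p.g ^ 2 * p.χ ^ 2 * p.ω₀ ^ 4 * om' ^ 2 / (om' ^ 2 - p.ω₀ ^ 2) ^ 2 : ℝ) : ℂ)) q t μ ν

/-- The action of a Lorentz transformation `L` on the nine field components. -/
def fieldRep (L : Matrix (Fin 4) (Fin 4) ℝ) : Matrix FieldIx FieldIx ℝ :=
  Matrix.fromBlocks L 0 0 (Matrix.fromBlocks L 0 0 1)

end Hopfield

/-!
The reduced inverse of `𝓜` is verified by multiplication (`fieldMatrix_inv`). As a function of the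
energy `z = k⁰` it is rational, and for almost every spatial momentum `q` its poles are real: the
free photon `k² = 0` (double), the b-mode `ω² = ω̄²` and the transverse modes `D = 0`. It vanishes at
infinity, so that it is the sum of its principal parts (`resolvent_eq_fracSum`). The two-point function
is `vacuumFunction`, minus the sum of the residues of `e^{-izt} 𝓜̄⁻¹(z)` at the poles with `ω > 0`;
evaluating the residues gives the explicit formulas.

*Existence.* Residues of an inverse of `𝓜` solve the field equations. By the symmetry `k ↦ -k` the
commutator is minus the sum of all residues, and its derivatives at time zero are the coefficients of the
expansion of `𝓜̄⁻¹` at large energy (`hasExp_resolvent`).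

*Uniqueness.* By the field equations the equal-time commutators fix all time derivatives of the
commutator at time zero (`canonical_data`, `KernelCol.eq_zero`), so that two candidates have the same
commutator. An exponential polynomial determines its frequencies, and the condition `ω > 0` separates
the two terms of the commutator (`IsVacuumTwoPoint.unique`).

*Feynman propagator.* For `ε > 0` no pole lies in the lower left or the upper right quadrant with vertex
at `ω = 0`. For `t > 0` the integral over `k⁰` can therefore be moved to a contour that comes from `-i∞`,
crosses the real axis at `ω = 0` and leaves above it to the right (`integral_eq_cornerIntegral`).
The denominators are bounded below on this contour uniformly in `ε`, which gives a bound that is integrable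
against test functions; as `ε → 0` the contour closes around the poles with `ω > 0`
(`tendsto_kernel_pos`). The case `t < 0` follows by `k ↦ -k`. The entries that mix `A` and `B`
decay too slowly for this and are transformed explicitly (`mixedKernel`). Dominated convergence gives
`IsVacuumTwoPoint.tendsto_feynman`.

*Covariance.* The regularized propagators are covariant by a change of variables (`feynman_lorentz`),
hence so is their limit.
-/

namespace Hopfield

noncomputable section

open Complex (I)
open Complex renaming exp → cexp
open Filter Topology Asymptotics MeasureTheory Set
open scoped Real SchwartzMap ComplexConjugate

local notation "ℝ³" => Fin 3 → ℝ
local notation "ℝ⁴" => Fin 4 → ℝ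
local notation "ℂ⁴" => Fin 4 → ℂ

theorem piC_ne : (π : ℂ) ≠ 0 := by simp [Real.pi_ne_zero]

/-! ### The inverse of the matrix of the action -/

/-- The general tensor built from `η^{μν}` and two vectors `k`, `v`. -/
def tens (k v : ℂ⁴) (a b c d e : ℂ) (μ ν : Fin 4) : ℂ :=
  a * eta μ ν + b * (k μ * k ν) + c * (k μ * v ν) + d * (v μ * k ν) + e * (v μ * v ν)

theorem sum_eta_mul_tens (k v : ℂ⁴) (a b c d e : ℂ) (μ ρ : Fin 4) :
    ∑ ν, eta μ ν * tens k v a b c d e ν ρ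
      = a * (if μ = ρ then 1 else 0) + b * (lower k μ * k ρ) + c * (lower k μ * v ρ)
        + d * (lower v μ * k ρ) + e * (lower v μ * v ρ) := by
  fin_cases μ <;> fin_cases ρ <;> simp [eta, tens, lower] <;> ring

theorem sum_lower_mul_tens (x k v : ℂ⁴) (a b c d e : ℂ) (ρ : Fin 4) :
    ∑ ν, lower x ν * tens k v a b c d e ν ρ
      = a * x ρ + b * (mink x k * k ρ) + c * (mink x k * v ρ)
        + d * (mink x v * k ρ) + e * (mink x v * v ρ) := by
  fin_cases ρ <;> simp [Fin.sum_univ_four, eta, tens, lower, mink] <;> ring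

theorem sum_eta_mul_vec (x : ℂ⁴) (μ : Fin 4) : ∑ ν, eta μ ν * x ν = lower x μ := by
  fin_cases μ <;> simp [eta, lower]

theorem sum_lower_mul_vec (x y : ℂ⁴) : ∑ ν, lower x ν * y ν = mink x y := by
  simp [Fin.sum_univ_four, lower, mink]; ring

theorem mink_comm' {R : Type*} [CommRing R] (a b : Fin 4 → R) : mink a b = mink b a := by
  simp [mink]; ring

theorem eta_comm (μ ν : Fin 4) : eta μ ν = eta ν μ := by
  fin_cases μ <;> fin_cases ν <;> simp [eta]

/-- `u = ω² - w`, the denominator of the polarizability `X`. -/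
def denU (p : Medium) (w : ℂ) (k : ℂ⁴) : ℂ := p.omC k ^ 2 - w

/-- `Δ = u D`, the dispersion function of the transverse modes cleared of its denominator. -/
def denD (p : Medium) (s w : ℂ) (k : ℂ⁴) : ℂ :=
  s * denU p w k / (4 * π) - p.g ^ 2 * p.χ * w * p.omC k ^ 2

/-- `H = 4π u (1/4π - X) = ω² - w (1 + 4π g² χ)`. -/
def denH (p : Medium) (w : ℂ) (k : ℂ⁴) : ℂ :=
  denU p w k - 4 * π * p.g ^ 2 * p.χ * w

/-- The reduced inverse of the matrix of the action with the denominators `u` cleared: it agrees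
with `propMatrix` where `u ≠ 0`, and has no singularity at `u = 0`. -/
def regProp (p : Medium) (s w : ℂ) (k : ℂ⁴) : Matrix FieldIx FieldIx ℂ :=
  let v := p.vC
  let om := p.omC k
  let u := denU p w k
  let Δ := denD p s w k
  let H := denH p w k
  let y : ℂ := 4 * π * p.g ^ 2 * p.χ * w
  Matrix.of fun a b =>
    match a, b with
    | .inl μ, .inl ν =>
        tens k v (u / Δ) (p.ξ / s ^ 2 - 4 * π * u / (H * s ^ 2) + y * u / (H * Δ * s))
          (-(y * u * om / (H * Δ * s))) (-(y * u * om / (H * Δ * s))) (y * u / (H * Δ)) μ ν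
    | .inl μ, .inr (.inl ν) =>
        -I * p.g * p.χ * w * tens k v (om / Δ) (y * om / (H * Δ * s))
          (-(y * om ^ 2 / (H * Δ * s))) (-(u / (H * Δ))) (y * om / (H * Δ)) μ ν
    | .inl μ, .inr (.inr _) => -I * k μ / s
    | .inr (.inl μ), .inl ν =>
        I * p.g * p.χ * w * tens k v (om / Δ) (y * om / (H * Δ * s))
          (-(u / (H * Δ))) (-(y * om ^ 2 / (H * Δ * s))) (y * om / (H * Δ)) μ ν
    | .inr (.inl μ), .inr (.inl ν) =>
        tens k v (p.χ * w * s / (4 * π * Δ)) (p.g ^ 2 * p.χ ^ 2 * w ^ 2 / (Δ * H))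
          (-(p.g ^ 2 * p.χ ^ 2 * w ^ 2 * om / (Δ * H)))
          (-(p.g ^ 2 * p.χ ^ 2 * w ^ 2 * om / (Δ * H)))
          (p.χ * w * (p.g ^ 2 * p.χ * w * (s + om ^ 2) - s * u / (4 * π)) / (Δ * H)) μ ν
    | .inr (.inl _), .inr (.inr _) => 0
    | .inr (.inr _), .inl ν => I * k ν / s
    | .inr (.inr _), .inr (.inl _) => 0
    | .inr (.inr _), .inr (.inr _) => 0

theorem pi4_ne : (4 * (π : ℂ)) ≠ 0 := by
  simp [Real.pi_ne_zero]

theorem propMatrix_eq_regProp (p : Medium) (s w : ℂ) (k : ℂ⁴)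
    (hs : s ≠ 0) (hu : denU p w k ≠ 0) (hD : denD p s w k ≠ 0) (hH : denH p w k ≠ 0) :
    propMatrix p s w k = regProp p s w k := by
  have hπ := piC_ne
  have eD : dispC p s w k = denD p s w k / denU p w k := by
    have : p.omC k ^ 2 - w ≠ 0 := hu
    simp only [dispC, polX, denD, denU]; field_simp
  have eX : polX p w k = p.g ^ 2 * p.χ * w / denU p w k := rfl
  have eh : (1 : ℂ) / (1 / (4 * π) - p.g ^ 2 * p.χ * w / denU p w k)
      = 4 * π * denU p w k / denH p w k := by
    have : (1 : ℂ) / (4 * π) - p.g ^ 2 * p.χ * w / denU p w k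
        = denH p w k / (4 * π * denU p w k) := by
      simp only [denH]; field_simp
    rw [this, one_div_div]
  have hDdef : denD p s w k = s * denU p w k / (4 * π)
    - p.g ^ 2 * p.χ * w * p.omC k ^ 2 := rfl
  have hHdef : denH p w k = denU p w k - 4 * π * p.g ^ 2 * p.χ * w := rfl
  have eu : p.omC k ^ 2 - w = denU p w k := rfl
  ext a b
  rcases a with μ | μ | _ <;> rcases b with ν | ν | _ <;>
    simp only [propMatrix, regProp, Matrix.of_apply, eD, eX, eh, tens, eu]
  · field_simp; ring
  · field_simp; ring
  · field_simp; ring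
  · generalize p.omC k = om at *
    generalize denU p w k = u at *
    generalize denD p s w k = Δ at *
    generalize denH p w k = H at *
    have h1 : p.g ^ 2 * p.χ * w * om ^ 2 = s * u / (4 * π) - Δ := by rw [hDdef]; ring
    field_simp
    rw [hDdef, hHdef]
    field_simp
    ring

/-- The inverse of the matrix of the action, with the row and the column of the multiplier. -/
def extProp (p : Medium) (s w : ℂ) (k : ℂ⁴) : Matrix ExtIx ExtIx ℂ :=
  Matrix.of fun a b =>
    match a, b with
    | .inl a, .inl b => regProp p s w k a b
    | .inl (.inr (.inl μ)), .inr _ => p.vC μ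
    | .inl _, .inr _ => 0
    | .inr _, .inl (.inr (.inl ν)) => p.vC ν
    | .inr _, .inl _ => 0
    | .inr _, .inr _ => -(1 / p.χ * (p.omC k ^ 2 / w - 1))

theorem fieldMatrix_mul_extProp (p : Medium) (w : ℂ) (k : ℂ⁴) (hχ : p.χ ≠ 0)
    (hv : mink p.v p.v = 1) (hw : w ≠ 0)
    (hs : mink k k ≠ 0) (hD : denD p (mink k k) w k ≠ 0) (hH : denH p w k ≠ 0) :
    fieldMatrix p w k * extProp p (mink k k) w k = 1 := by
  have hπ := piC_ne
  have hχ' : (p.χ : ℂ) ≠ 0 := by exact_mod_cast hχ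
  have hvv : mink p.vC p.vC = 1 := by
    have := congrArg (fun x : ℝ => (x : ℂ)) hv
    simpa [mink, Medium.vC, toC] using this
  have hkv : mink k p.vC = p.omC k := rfl
  have hvk : mink p.vC k = p.omC k := mink_comm' _ _
  set s := mink k k with hsdef
  have hDdef : denD p s w k = s * denU p w k / (4 * π)
    - p.g ^ 2 * p.χ * w * p.omC k ^ 2 := rfl
  have hHdef : denH p w k = denU p w k - 4 * π * p.g ^ 2 * p.χ * w := rfl
  have eu : denU p w k = p.omC k ^ 2 - w := rfl
  have hI : I ^ 2 = -1 := Complex.I_sq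
  have A1 : ∀ (x y : ℂ) (a b c d e : ℂ) (z z' : ℂ⁴) (c0 : ℂ) (μ ρ : Fin 4),
      ∑ ν, x * (y * eta μ ν - lower z μ * lower z' ν) * (c0 * tens k p.vC a b c d e ν ρ)
      = x * c0 * (y * (a * (if μ = ρ then 1 else 0) + b * (lower k μ * k ρ)
          + c * (lower k μ * p.vC ρ)
        + d * (lower p.vC μ * k ρ) + e * (lower p.vC μ * p.vC ρ)) - lower z μ *
        (a * z' ρ + b * (mink z' k * k ρ) + c * (mink z' k * p.vC ρ)
        + d * (mink z' p.vC * k ρ) + e * (mink z' p.vC * p.vC ρ))) := by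
    intro x y a b c d e z z' c0 μ ρ
    rw [← sum_eta_mul_tens, ← sum_lower_mul_tens, Finset.mul_sum, Finset.mul_sum,
      ← Finset.sum_sub_distrib, Finset.mul_sum]
    refine Finset.sum_congr rfl fun ν _ => by ring
  have A2 : ∀ (x : ℂ) (a b c d e : ℂ) (c0 : ℂ) (μ ρ : Fin 4),
      ∑ ν, x * eta μ ν * (c0 * tens k p.vC a b c d e ν ρ)
      = x * c0 * (a * (if μ = ρ then 1 else 0) + b * (lower k μ * k ρ)
          + c * (lower k μ * p.vC ρ)
        + d * (lower p.vC μ * k ρ) + e * (lower p.vC μ * p.vC ρ)) := by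
    intro x a b c d e c0 μ ρ
    rw [← sum_eta_mul_tens, Finset.mul_sum]
    refine Finset.sum_congr rfl fun ν _ => by ring
  have A3 : ∀ (x y : ℂ) (z z' r : ℂ⁴) (c0 : ℂ) (μ : Fin 4),
      ∑ ν, x * (y * eta μ ν - lower z μ * lower z' ν) * (c0 * r ν)
      = x * c0 * (y * lower r μ - lower z μ * mink z' r) := by
    intro x y z z' r c0 μ
    rw [← sum_lower_mul_vec, ← sum_eta_mul_vec r, Finset.mul_sum, Finset.mul_sum,
      ← Finset.sum_sub_distrib, Finset.mul_sum]
    refine Finset.sum_congr rfl fun ν _ => by ring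
  have A4 : ∀ (x : ℂ) (z : ℂ⁴) (a b c d e : ℂ) (c0 : ℂ) (ρ : Fin 4),
      ∑ ν, x * lower z ν * (c0 * tens k p.vC a b c d e ν ρ) = x * c0 *
        (a * z ρ + b * (mink z k * k ρ) + c * (mink z k * p.vC ρ)
        + d * (mink z p.vC * k ρ) + e * (mink z p.vC * p.vC ρ)) := by
    intro x z a b c d e c0 ρ
    rw [← sum_lower_mul_tens, Finset.mul_sum]
    refine Finset.sum_congr rfl fun ν _ => by ring
  have A5 : ∀ (x : ℂ) (z r : ℂ⁴) (c0 : ℂ),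
      ∑ ν, x * lower z ν * (c0 * r ν) = x * c0 * mink z r := by
    intro x z r c0
    rw [← sum_lower_mul_vec, Finset.mul_sum]
    refine Finset.sum_congr rfl fun ν _ => by ring
  have A6 : ∀ (x : ℂ) (r : ℂ⁴) (c0 : ℂ) (μ : Fin 4),
      ∑ ν, x * eta μ ν * (c0 * r ν) = x * c0 * lower r μ := by
    intro x r c0 μ
    rw [← sum_eta_mul_vec, Finset.mul_sum]
    refine Finset.sum_congr rfl fun ν _ => by ring
  have N : ∀ (a b c d e : ℂ) (μ ρ : Fin 4),
      tens k p.vC a b c d e μ ρ = 1 * tens k p.vC a b c d e μ ρ := fun _ _ _ _ _ _ _ =>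
    (one_mul _).symm
  have N' : ∀ (x : ℂ⁴) (μ : Fin 4), x μ = 1 * x μ := fun _ _ => (one_mul _).symm
  have L' : ∀ (z : ℂ⁴) (ν : Fin 4), lower z ν = 1 * lower z ν := fun _ _ =>
    (one_mul _).symm
  have Q : ∀ (c : ℂ) (r : ℂ⁴) (s : ℂ) (ν : Fin 4), c * r ν / s = (c / s) * r ν :=
    fun c r s ν => by ring
  have A7 : ∀ (z : ℂ⁴) (a b c d e : ℂ) (c0 : ℂ) (ρ : Fin 4),
      ∑ ν, lower z ν * (c0 * tens k p.vC a b c d e ν ρ) = c0 *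
        (a * z ρ + b * (mink z k * k ρ) + c * (mink z k * p.vC ρ)
        + d * (mink z p.vC * k ρ) + e * (mink z p.vC * p.vC ρ)) := by
    intro z a b c d e c0 ρ
    simpa using A4 1 z a b c d e c0 ρ
  have B1 := fun x y a b c d e z z' μ ρ => A1 x y a b c d e z z' 1 μ ρ
  have B2 := fun x a b c d e μ ρ => A2 x a b c d e 1 μ ρ
  have B3 := fun x y z z' r μ => A3 x y z z' r 1 μ
  have B4 := fun x z a b c d e ρ => A4 x z a b c d e 1 ρ
  have B5 := fun x z r => A5 x z r 1
  have B6 := fun x r μ => A6 x r 1 μ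
  have B7 := fun z a b c d e ρ => A7 z a b c d e 1 ρ
  have B8 := fun z r => A5 1 z r 1
  have B9 := fun z r c0 => A5 1 z r c0
  simp only [one_mul] at B1 B2 B3 B4 B5 B6 B7 B8 B9
  ext i j
  rcases i with (μ | μ | _) | _ <;> rcases j with (ρ | ρ | _) | _ <;>
    simp only [Matrix.mul_apply, Fintype.sum_sum_type, Finset.univ_unique, Finset.sum_singleton,
      fieldMatrix, extProp, regProp, Matrix.of_apply, Q, A1, A2, A3, A4, A5, A7,
      B1, B2, B3, B4, B6, B7, B8, Matrix.one_apply, Sum.inl.injEq, Sum.inr.injEq, hkv, hvk,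
      hvv, ← hsdef, reduceCtorEq, if_false, if_true, mul_zero, zero_mul, Finset.sum_const_zero,
      add_zero, zero_add]
  all_goals
    first
    | done
    | (field_simp
       done)
    | (field_simp
       ring1)
    | (field_simp
       simp only [Complex.I_sq, hDdef, hHdef, eu]
       field_simp
       ring1)
    | (rw [mul_assoc, div_mul_cancel₀ _ hs]
       simp)

theorem denU_ne_zero_iff {p : Medium} {w : ℂ} {k : ℂ⁴} :
    denU p w k ≠ 0 ↔ p.omC k ^ 2 ≠ w := sub_ne_zero

theorem denD_eq (p : Medium) (s w : ℂ) (k : ℂ⁴) (hu : denU p w k ≠ 0) :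
    denD p s w k = denU p w k * dispC p s w k := by
  have hu' : p.omC k ^ 2 - w ≠ 0 := hu
  have hπ := piC_ne
  simp only [denD, dispC, denU, polX]; field_simp

theorem denH_eq (p : Medium) (w : ℂ) (k : ℂ⁴) (hu : denU p w k ≠ 0) :
    denH p w k = 4 * π * denU p w k * (1 / (4 * π) - polX p w k) := by
  have hu' : p.omC k ^ 2 - w ≠ 0 := hu
  have hπ := piC_ne
  simp only [denH, denU, polX]; field_simp

/-- The reduced inverse of the matrix of the action is `propMatrix`. -/
theorem fieldMatrix_inv (p : Medium) (hχ : p.χ ≠ 0) (hv : mink p.v p.v = 1)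
    (w : ℂ) (k : ℂ⁴) (hw : w ≠ 0) (hs : mink k k ≠ 0) (hu : p.omC k ^ 2 ≠ w)
    (hD : dispC p (mink k k) w k ≠ 0) (hX : polX p w k ≠ 1 / (4 * π)) :
    IsUnit (fieldMatrix p w k).det ∧
      (fieldMatrix p w k)⁻¹.submatrix Sum.inl Sum.inl = propMatrix p (mink k k) w k := by
  have hu' := denU_ne_zero_iff.2 hu
  have hD' : denD p (mink k k) w k ≠ 0 := by
    rw [denD_eq _ _ _ _ hu']; exact mul_ne_zero hu' hD
  have hH' : denH p w k ≠ 0 := by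
    rw [denH_eq _ _ _ hu']
    exact mul_ne_zero (mul_ne_zero pi4_ne hu') (sub_ne_zero.2 hX.symm)
  have h := fieldMatrix_mul_extProp p w k hχ hv hw hs hD' hH'
  refine ⟨(Matrix.isUnit_iff_isUnit_det _).1 (IsUnit.of_mul_eq_one _ h), ?_⟩
  rw [Matrix.inv_eq_right_inv h, propMatrix_eq_regProp p _ _ _ hs hu' hD' hH']
  rfl

theorem omC_neg (p : Medium) (k : ℂ⁴) : p.omC (-k) = -p.omC k := by
  simp [Medium.omC, mink]; ring

theorem denU_neg (p : Medium) (w : ℂ) (k : ℂ⁴) : denU p w (-k) = denU p w k := by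
  simp [denU, omC_neg]

theorem denD_neg (p : Medium) (s w : ℂ) (k : ℂ⁴) :
    denD p s w (-k) = denD p s w k := by
  simp [denD, denU_neg, omC_neg]

theorem denH_neg (p : Medium) (w : ℂ) (k : ℂ⁴) : denH p w (-k) = denH p w k := by
  simp [denH, denU_neg]

/-- Reflection of the momentum transposes the propagator. -/
theorem regProp_neg (p : Medium) (s w : ℂ) (k : ℂ⁴) (a b : FieldIx) :
    regProp p s w (-k) a b = regProp p s w k b a := by
  have he : ∀ μ ν, eta μ ν = eta ν μ := by
    intro μ ν; fin_cases μ <;> fin_cases ν <;> simp [eta]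
  rcases a with μ | μ | _ <;> rcases b with ν | ν | _ <;>
    simp only [regProp, Matrix.of_apply, denU_neg, denD_neg, denH_neg, omC_neg, tens, Pi.neg_apply,
      he] <;> ring

/-- Reflection of the momentum transposes the propagator. -/
theorem propMatrix_neg (p : Medium) (s w : ℂ) (k : ℂ⁴) (a b : FieldIx) :
    propMatrix p s w (-k) a b = propMatrix p s w k b a := by
  have he : ∀ μ ν, eta μ ν = eta ν μ := by
    intro μ ν; fin_cases μ <;> fin_cases ν <;> simp [eta]
  have hX : polX p w (-k) = polX p w k := by simp [polX, omC_neg]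
  have hD : dispC p s w (-k) = dispC p s w k := by simp [dispC, hX, omC_neg]
  rcases a with μ | μ | _ <;> rcases b with ν | ν | _ <;>
    simp only [propMatrix, Matrix.of_apply, hX, hD, omC_neg, Pi.neg_apply,
      he, neg_sq] <;> ring

/-! ### Bounds on the entries of the propagator -/

/-- The estimate `‖x‖ ≤ c Bⁿ`. -/
def Bd (B c : ℝ) (n : ℕ) (x : ℂ) : Prop := ‖x‖ ≤ c * B ^ n

theorem Bd.mul {B c c' : ℝ} {m n : ℕ} {x y : ℂ} (hx : Bd B c m x) (hy : Bd B c' n y) :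
    Bd B (c * c') (m + n) (x * y) := by
  unfold Bd at *
  rw [norm_mul, pow_add]
  calc ‖x‖ * ‖y‖ ≤ (c * B ^ m) * (c' * B ^ n) :=
        mul_le_mul hx hy (norm_nonneg _) ((norm_nonneg _).trans hx)
    _ = _ := by ring

theorem Bd.weaken {B c c' : ℝ} {m n : ℕ} {x : ℂ} (hB : 1 ≤ B) (hx : Bd B c m x) (hc : c ≤ c')
    (h0 : 0 ≤ c') (h : m ≤ n) : Bd B c' n x := by
  unfold Bd at *
  calc ‖x‖ ≤ c * B ^ m := hx
    _ ≤ c' * B ^ m := by gcongr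
    _ ≤ c' * B ^ n := by gcongr

theorem Bd.nonneg {B c : ℝ} {m : ℕ} {x : ℂ} (hB : 1 ≤ B) (hx : Bd B c m x) : 0 ≤ c := by
  have h1 : 0 ≤ c * B ^ m := (norm_nonneg _).trans hx
  exact nonneg_of_mul_nonneg_left h1 (by positivity)

theorem Bd.add {B c c' : ℝ} {m n : ℕ} {x y : ℂ} (hB : 1 ≤ B) (hx : Bd B c m x)
    (hy : Bd B c' n y) : Bd B (c + c') (max m n) (x + y) := by
  have h1 := hx.weaken hB le_rfl (hx.nonneg hB) (le_max_left m n)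
  have h2 := hy.weaken hB le_rfl (hy.nonneg hB) (le_max_right m n)
  unfold Bd at *
  calc ‖x + y‖ ≤ _ := norm_add_le _ _
    _ ≤ _ := add_le_add h1 h2
    _ = _ := by ring

theorem Bd.neg {B c : ℝ} {m : ℕ} {x : ℂ} (hx : Bd B c m x) : Bd B c m (-x) := by
  unfold Bd at *; rwa [norm_neg]

theorem Bd.sub {B c c' : ℝ} {m n : ℕ} {x y : ℂ} (hB : 1 ≤ B) (hx : Bd B c m x)
    (hy : Bd B c' n y) : Bd B (c + c') (max m n) (x - y) := by
  rw [sub_eq_add_neg]; exact hx.add hB hy.neg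

theorem Bd.of_le {B : ℝ} {x : ℂ} (hx : ‖x‖ ≤ B) : Bd B 1 1 x := by
  unfold Bd; simpa using hx

theorem Bd.of_le_one {B : ℝ} {x : ℂ} (hx : ‖x‖ ≤ 1) : Bd B 1 0 x := by
  unfold Bd; simpa using hx

theorem norm_eta_le (μ ν : Fin 4) : ‖eta μ ν‖ ≤ 1 := by
  unfold eta; split_ifs <;> simp

theorem inv_pi4_le : ‖(4 * (π : ℂ))⁻¹‖ ≤ 1 := by
  have := Real.pi_gt_three
  rw [norm_inv, norm_mul, Complex.norm_real, Real.norm_of_nonneg Real.pi_pos.le]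
  apply inv_le_one_of_one_le₀
  simp; linarith

/-- The entries of the propagator, except those that mix `A` and `B`, are `O(ρ⁻²)` if `ρ` bounds
the momentum and the denominators have the size `ρ²` that they have at large momentum. -/
theorem norm_propMatrix_le (p : Medium) (s w : ℂ) (k : ℂ⁴) {B ρ : ℝ} (hB : 1 ≤ B)
    (hρ : 0 < ρ) (hg : p.g ≠ 0) (hs : ‖s⁻¹‖ ≤ B / ρ ^ 2) (hD : ‖(dispC p s w k)⁻¹‖ ≤ B / ρ ^ 2)
    (hh : ‖(1 / (4 * π) - polX p w k)⁻¹‖ ≤ B) (hX : ‖polX p w k‖ ≤ B / (1 + ρ ^ 2))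
    (hk : ∀ μ, ‖k μ‖ ≤ B * ρ) (hom : ‖p.omC k‖ ≤ B * ρ) (hv : ∀ μ, ‖p.vC μ‖ ≤ B)
    (hξ : ‖(p.ξ : ℂ)‖ ≤ B) (hgB : ‖(p.g : ℂ)⁻¹‖ ≤ B) (a b : FieldIx)
    (hab : ∀ μ, ¬(a = iA μ ∧ b = iB) ∧ ¬(a = iB ∧ b = iA μ)) :
    ‖propMatrix p s w k a b‖ ≤ 10 * B ^ 12 / ρ ^ 2 := by
  have hρ' : (ρ : ℂ) ≠ 0 := by exact_mod_cast hρ.ne'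
  have hg' : (p.g : ℂ) ≠ 0 := by exact_mod_cast hg
  have h1ρ : ((1 : ℂ) + (ρ : ℂ) ^ 2) ≠ 0 := by
    have : (1 + ρ ^ 2 : ℝ) ≠ 0 := by positivity
    exact_mod_cast this
  have n1ρ : ‖(1 : ℂ) + (ρ : ℂ) ^ 2‖ = 1 + ρ ^ 2 := by
    rw [show (1 : ℂ) + (ρ : ℂ) ^ 2 = ((1 + ρ ^ 2 : ℝ) : ℂ) by push_cast; ring, Complex.norm_real,
      Real.norm_of_nonneg (by positivity)]
  have nρ : ‖(ρ : ℂ)‖ = ρ := by rw [Complex.norm_real, Real.norm_of_nonneg hρ.le]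
  -- the rescaled quantities, all of which are bounded by `B`
  obtain ⟨k', hk'⟩ : ∃ k' : ℂ⁴, ∀ μ, k μ = ρ * k' μ :=
    ⟨fun μ => k μ / ρ, fun μ => by field_simp⟩
  obtain ⟨o, ho⟩ : ∃ o : ℂ, p.omC k = ρ * o := ⟨p.omC k / ρ, by field_simp⟩
  obtain ⟨σ, hσ⟩ : ∃ σ : ℂ, s⁻¹ = σ / ρ ^ 2 := ⟨s⁻¹ * ρ ^ 2, by field_simp⟩
  obtain ⟨d, hd⟩ : ∃ d : ℂ, (dispC p s w k)⁻¹ = d / ρ ^ 2 :=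
    ⟨(dispC p s w k)⁻¹ * ρ ^ 2, by field_simp⟩
  obtain ⟨X, hX'⟩ : ∃ X : ℂ, polX p w k = X / (1 + ρ ^ 2) :=
    ⟨polX p w k * (1 + ρ ^ 2), by field_simp⟩
  have bk : ∀ μ, Bd B 1 1 (k' μ) := fun μ => by
    have := hk μ
    rw [hk', norm_mul, nρ, mul_comm] at this
    exact Bd.of_le (le_of_mul_le_mul_right this hρ)
  have bo : Bd B 1 1 o := by
    rw [ho, norm_mul, nρ, mul_comm] at hom
    exact Bd.of_le (le_of_mul_le_mul_right hom hρ)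
  have bσ : Bd B 1 1 σ := by
    rw [hσ, norm_div, norm_pow, nρ] at hs
    exact Bd.of_le (by rwa [div_le_div_iff_of_pos_right (by positivity)] at hs)
  have bd : Bd B 1 1 d := by
    rw [hd, norm_div, norm_pow, nρ] at hD
    exact Bd.of_le (by rwa [div_le_div_iff_of_pos_right (by positivity)] at hD)
  have bX : Bd B 1 1 X := by
    rw [hX', norm_div, n1ρ] at hX
    exact Bd.of_le (by rwa [div_le_div_iff_of_pos_right (by positivity)] at hX)
  have bh : Bd B 1 1 (1 / (4 * π) - polX p w k)⁻¹ := Bd.of_le hh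
  have bv : ∀ μ, Bd B 1 1 (p.vC μ) := fun μ => Bd.of_le (hv μ)
  have bξ : Bd B 1 1 (p.ξ : ℂ) := Bd.of_le hξ
  have bg : Bd B 1 1 (p.g : ℂ)⁻¹ := Bd.of_le hgB
  have be : ∀ μ ν, Bd B 1 0 (eta μ ν) := fun μ ν => Bd.of_le_one (norm_eta_le μ ν)
  have bπ : Bd B 1 0 (4 * (π : ℂ))⁻¹ := Bd.of_le_one inv_pi4_le
  have bI : Bd B 1 0 I := Bd.of_le_one (by simp)
  have br0 : Bd B 1 0 ((1 : ℂ) / (1 + ρ ^ 2)) := Bd.of_le_one (by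
    rw [norm_div, n1ρ, norm_one, div_le_one (by positivity)]; nlinarith [sq_nonneg ρ])
  have br1 : Bd B 1 0 ((ρ : ℂ) / (1 + ρ ^ 2)) := Bd.of_le_one (by
    rw [norm_div, n1ρ, nρ, div_le_one (by positivity)]; nlinarith [sq_nonneg (ρ - 1)])
  have br2 : Bd B 1 0 ((ρ : ℂ) ^ 2 / (1 + ρ ^ 2)) := Bd.of_le_one (by
    rw [norm_div, n1ρ, norm_pow, nρ, div_le_one (by positivity)]; nlinarith [sq_nonneg (ρ - 1)])
  set h : ℂ := (1 / (4 * π) - polX p w k)⁻¹ with hhdef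
  have hχw : (p.χ : ℂ) * w / ((p.omC k) ^ 2 - w) = (p.g : ℂ)⁻¹ * ((p.g : ℂ)⁻¹ *
      (X * (1 / (1 + ρ ^ 2)))) := by
    rw [show X * (1 / (1 + (ρ : ℂ) ^ 2)) = polX p w k by rw [hX']; ring]
    simp only [polX]; field_simp
  have hXb : polX p w k = X * (1 / (1 + ρ ^ 2)) := by rw [hX']; ring
  have fin : ∀ {x y : ℂ} {c : ℝ} {n : ℕ}, Bd B c n y → c ≤ 10 → n ≤ 12 → x = y / ρ ^ 2 →
      ‖x‖ ≤ 10 * B ^ 12 / ρ ^ 2 := by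
    intro x y c n hy hc hn hxy
    rw [hxy, norm_div, norm_pow, nρ]
    gcongr
    exact hy.weaken hB hc (by norm_num) hn
  have bX0 := bX.mul br0
  have hAP : ∀ μ ν, ‖propMatrix p s w k (iA μ) (iP ν)‖ ≤ 10 * B ^ 12 / ρ ^ 2 := by
    intro μ ν
    refine fin (y := -(I * ((p.g : ℂ)⁻¹ * (X * (ρ / (1 + ρ ^ 2)))) * d
      * (o * eta μ ν + o * h * (X * (1 / (1 + ρ ^ 2)))
        * (p.vC μ * p.vC ν + k' μ * k' ν * σ - o * σ * (k' μ * p.vC ν))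
        - h * (4 * (π : ℂ))⁻¹ * (p.vC μ * k' ν))))
      ((((bI.mul (bg.mul (bX.mul br1))).mul bd).mul (((bo.mul (be μ ν)).add hB
        (((bo.mul bh).mul bX0).mul ((((bv μ).mul (bv ν)).add hB (((bk μ).mul (bk ν)).mul bσ)).sub
          hB ((bo.mul bσ).mul ((bk μ).mul (bv ν)))))).sub hB
            ((bh.mul bπ).mul ((bv μ).mul (bk ν))))).neg) (by norm_num) (by norm_num) ?_
    simp only [propMatrix, Matrix.of_apply, one_div, div_eq_mul_inv _ s, hχw]
    simp only [← one_div (4 * (π : ℂ)), ← one_div (1 + (ρ : ℂ) ^ 2), ← hXb, ← hhdef, hσ, hd,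
      hk', ho]
    field_simp
    simp only [hX']
    field_simp
  rcases a with μ | μ | μ <;> rcases b with ν | ν | ν
  · refine fin (y := d * eta μ ν
      + (σ * σ * (p.ξ - h) + d * σ * h * (X * (1 / (1 + ρ ^ 2)))) * (k' μ * k' ν)
      - d * h * (X * (1 / (1 + ρ ^ 2)))
        * (o * (k' μ * p.vC ν + p.vC μ * k' ν) * σ - p.vC μ * p.vC ν))
      ((((bd.mul (be μ ν)).add hB (((((bσ.mul bσ).mul (bξ.sub hB bh)).add hB
        (((bd.mul bσ).mul bh).mul bX0))).mul ((bk μ).mul (bk ν)))).sub hB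
        (((bd.mul bh).mul bX0).mul ((((bo.mul (((bk μ).mul (bv ν)).add hB
          ((bv μ).mul (bk ν)))).mul bσ)).sub hB ((bv μ).mul (bv ν)))))) (by norm_num)
        (by norm_num) ?_
    simp only [propMatrix, Matrix.of_apply, one_div, ← inv_pow, div_eq_mul_inv _ s]
    simp only [← one_div (4 * (π : ℂ)), ← hhdef, hσ, hd, hk', ho]
    field_simp
    simp only [hX']
    field_simp
  · exact hAP μ ν
  · exact absurd ⟨rfl, rfl⟩ (hab μ).1
  · rw [show propMatrix p s w k (iP μ) (iA ν) = -propMatrix p s w k (iA ν) (iP μ) by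
      simp only [propMatrix, Matrix.of_apply, eta_comm ν]; ring, norm_neg]
    exact hAP ν μ
  · refine fin (y := ((p.g : ℂ)⁻¹ * (X * (ρ / (1 + ρ ^ 2)))) * ((p.g : ℂ)⁻¹
        * (X * (ρ / (1 + ρ ^ 2)))) * d
      * (o * o * eta μ ν + h * ((X * (1 / (1 + ρ ^ 2))) * (o * o) * (p.vC μ * p.vC ν)
        - o * (4 * (π : ℂ))⁻¹ * (k' μ * p.vC ν + p.vC μ * k' ν)
        + (4 * (π : ℂ))⁻¹ * (k' μ * k' ν)))
      + (p.g : ℂ)⁻¹ * ((p.g : ℂ)⁻¹ * (X * (ρ ^ 2 / (1 + ρ ^ 2))))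
        * (eta μ ν - p.vC μ * p.vC ν))
      ((((((bg.mul (bX.mul br1))).mul (bg.mul (bX.mul br1))).mul bd).mul
        (((bo.mul bo).mul (be μ ν)).add hB (bh.mul ((((bX0.mul (bo.mul bo)).mul
          ((bv μ).mul (bv ν))).sub hB ((bo.mul bπ).mul (((bk μ).mul (bv ν)).add hB
            ((bv μ).mul (bk ν))))).add hB (bπ.mul ((bk μ).mul (bk ν))))))).add hB
            ((bg.mul (bg.mul (bX.mul br2))).mul ((be μ ν).sub hB ((bv μ).mul (bv ν)))))
        (by norm_num) (by norm_num) ?_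
    simp only [propMatrix, Matrix.of_apply, one_div, hχw]
    simp only [← one_div (4 * (π : ℂ)), ← one_div (1 + (ρ : ℂ) ^ 2), ← hXb, ← hhdef, hd,
      hk', ho]
    field_simp
    simp only [hX']
    field_simp
  · simp only [propMatrix, Matrix.of_apply, norm_zero]; positivity
  · exact absurd ⟨rfl, rfl⟩ (hab ν).2
  · simp only [propMatrix, Matrix.of_apply, norm_zero]; positivity
  · simp only [propMatrix, Matrix.of_apply, norm_zero]; positivity

/-! ### Lower bounds on the denominators off the real axis -/

/-- The polarizability `X` as a function of `ζ`, where `ω = v⁰ ζ`. -/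
def polS (v0 α w ε : ℝ) (ζ : ℂ) : ℂ :=
  α * (w - I * ε) / (v0 ^ 2 * ζ ^ 2 - (w - I * ε))

/-- `k² + iε` as a function of `ζ = k⁰ - x`, where `x` is the energy at which `ω = 0` and `-m` is
the value of `k²` there. -/
def sqS (x m ε : ℝ) (ζ : ℂ) : ℂ := -m + 2 * x * ζ + ζ ^ 2 + I * ε

/-- `4π D` as a function of `ζ`. -/
def dispS (x m v0 α w ε : ℝ) (ζ : ℂ) : ℂ :=
  sqS x m ε ζ - 4 * π * polS v0 α w ε ζ * (v0 ^ 2 * ζ ^ 2)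

/-- The closed upper right quadrant, or the closed upper half-plane if `ε = 0`. -/
def InQuad (ε : ℝ) (ζ : ℂ) : Prop := 0 ≤ ζ.im ∧ 0 ≤ ε * ζ.re ∧ 0 < ζ.im + ε * ζ.re

/-- `InQuad` up to the reflection `ζ ↦ -ζ`. -/
def InQuads (ε : ℝ) (ζ : ℂ) : Prop := InQuad ε ζ ∨ InQuad ε (-ζ)

theorem polS_neg (v0 α w ε : ℝ) (ζ : ℂ) : polS v0 α w ε (-ζ) = polS v0 α w ε ζ := by
  simp [polS]

theorem sqS_neg (x m ε : ℝ) (ζ : ℂ) : sqS (-x) m ε (-ζ) = sqS x m ε ζ := by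
  simp [sqS]

theorem dispS_neg (x m v0 α w ε : ℝ) (ζ : ℂ) :
    dispS (-x) m v0 α w ε (-ζ) = dispS x m v0 α w ε ζ := by
  simp [dispS, sqS_neg, polS_neg]

theorem InQuad.ne_zero {ε : ℝ} {ζ : ℂ} (h : InQuad ε ζ) : ζ ≠ 0 := by
  rintro rfl; simp [InQuad] at h

theorem conj_mul_im_le (z ζ : ℂ) : (z * (starRingEnd ℂ) ζ).im ≤ ‖z‖ * ‖ζ‖ := by
  calc _ ≤ ‖z * (starRingEnd ℂ) ζ‖ := (le_abs_self _).trans (Complex.abs_im_le_norm _)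
    _ = _ := by rw [norm_mul, RCLike.norm_conj]

theorem sqS_im (x m ε : ℝ) (ζ : ℂ) : (sqS x m ε ζ * (starRingEnd ℂ) ζ).im
    = ζ.im * (m + ‖ζ‖ ^ 2) + ε * ζ.re := by
  rw [← Complex.normSq_eq_norm_sq, Complex.normSq_apply]
  simp [sqS, pow_two]; ring

/-- `-1 / (X ζ)` up to the factor `α`; it maps the quadrant to the upper half-plane. -/
theorem polS_im {v0 w ε : ℝ} (α : ℝ) (hw : 0 < w) (hv0 : 0 < v0) {ζ : ℂ} (h : InQuad ε ζ) :
    (v0 ^ 2 * ζ ^ 2 - (w - I * ε) ≠ 0) ∧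
    ∃ T : ℂ, polS v0 α w ε ζ * ζ * T = α ∧ 0 < T.im ∧
      ζ.im * (v0 ^ 2 * w / (w ^ 2 + ε ^ 2) + 1 / ‖ζ‖ ^ 2) ≤ T.im := by
  have hζ := h.ne_zero
  have hwε : (w : ℂ) - I * ε ≠ 0 := by
    intro h0
    have := congrArg Complex.re h0
    simp at this; exact hw.ne' this
  have hn : 0 < ‖ζ‖ ^ 2 := by positivity
  have hp : 0 < w ^ 2 + ε ^ 2 := by positivity
  set T : ℂ := v0 ^ 2 * ζ / (w - I * ε) - 1 / ζ with hT
  have him : T.im = (v0 ^ 2 * (w * ζ.im + ε * ζ.re)) / (w ^ 2 + ε ^ 2) + ζ.im / ‖ζ‖ ^ 2 := by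
    rw [hT, ← Complex.normSq_eq_norm_sq]
    simp [Complex.div_im, Complex.normSq_apply, pow_two]
    field_simp
    ring
  have hlow : ζ.im * (v0 ^ 2 * w / (w ^ 2 + ε ^ 2) + 1 / ‖ζ‖ ^ 2) ≤ T.im := by
    rw [him]
    have : 0 ≤ v0 ^ 2 * (ε * ζ.re) / (w ^ 2 + ε ^ 2) :=
      div_nonneg (mul_nonneg (sq_nonneg _) h.2.1) hp.le
    have e : (v0 ^ 2 * (w * ζ.im + ε * ζ.re)) / (w ^ 2 + ε ^ 2) + ζ.im / ‖ζ‖ ^ 2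
        = ζ.im * (v0 ^ 2 * w / (w ^ 2 + ε ^ 2) + 1 / ‖ζ‖ ^ 2)
          + v0 ^ 2 * (ε * ζ.re) / (w ^ 2 + ε ^ 2) := by ring
    rw [e]; linarith
  have hpos : 0 < T.im := by
    rw [him]
    have h1 : 0 ≤ ζ.im / ‖ζ‖ ^ 2 := div_nonneg h.1 hn.le
    rcases h.1.lt_or_eq with h2 | h2
    · have : 0 < v0 ^ 2 * (w * ζ.im + ε * ζ.re) / (w ^ 2 + ε ^ 2) := by
        apply div_pos _ hp
        have := mul_pos hw h2
        have := h.2.1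
        positivity
      linarith
    · have h3 := h.2.2
      rw [← h2, zero_add] at h3
      have : 0 < v0 ^ 2 * (w * ζ.im + ε * ζ.re) / (w ^ 2 + ε ^ 2) := by
        apply div_pos _ hp
        rw [← h2]; simp only [mul_zero, zero_add]; positivity
      linarith
  have hTne : T ≠ 0 := by
    intro h0; rw [h0] at hpos; simp at hpos
  have hden : v0 ^ 2 * ζ ^ 2 - (w - I * ε) = (w - I * ε) * ζ * T := by
    rw [hT]; field_simp
  have hden0 : v0 ^ 2 * ζ ^ 2 - (w - I * ε) ≠ 0 := by
    rw [hden]; exact mul_ne_zero (mul_ne_zero hwε hζ) hTne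
  refine ⟨hden0, T, ?_, hpos, hlow⟩
  rw [polS, hden]
  field_simp

theorem neg_polS_im {v0 w ε α : ℝ} (hα : 0 < α) (hw : 0 < w) (hv0 : 0 < v0) {ζ : ℂ}
    (h : InQuad ε ζ) : 0 < -(polS v0 α w ε ζ * ζ).im := by
  obtain ⟨-, T, hT, hpos, -⟩ := polS_im α hw hv0 h
  have hTne : T ≠ 0 := by
    intro h0; rw [h0] at hpos; simp at hpos
  have e : polS v0 α w ε ζ * ζ = α / T := by
    rw [eq_div_iff hTne, hT]
  rw [e, Complex.div_im]
  simp only [Complex.ofReal_im, Complex.ofReal_re, zero_mul, zero_div, zero_sub, neg_neg]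
  have := Complex.normSq_pos.2 hTne
  positivity

theorem dispS_im_ge {x m v0 w ε α : ℝ} (hα : 0 < α) (hw : 0 < w) (hv0 : 0 < v0) {ζ : ℂ}
    (h : InQuad ε ζ) : (sqS x m ε ζ * (starRingEnd ℂ) ζ).im
      ≤ (dispS x m v0 α w ε ζ * (starRingEnd ℂ) ζ).im := by
  have h1 := neg_polS_im hα hw hv0 h
  have e : dispS x m v0 α w ε ζ * (starRingEnd ℂ) ζ = sqS x m ε ζ * (starRingEnd ℂ) ζ
      - ((4 * π * v0 ^ 2 * ‖ζ‖ ^ 2 : ℝ) : ℂ) * (polS v0 α w ε ζ * ζ) := by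
    have h3 := Complex.mul_conj ζ
    rw [Complex.normSq_eq_norm_sq] at h3
    simp only [dispS]
    push_cast at h3 ⊢
    linear_combination (-4 * π * polS v0 α w ε ζ * v0 ^ 2 * ζ) * h3
  rw [e, Complex.sub_im, Complex.im_ofReal_mul]
  have : 0 ≤ (4 * π * v0 ^ 2 * ‖ζ‖ ^ 2) * -(polS v0 α w ε ζ * ζ).im := by
    have := Real.pi_pos
    positivity
  linarith

section quads

variable {x m v0 w ε α : ℝ} {ζ : ℂ}

theorem le_norm_sqS (h : InQuads ε ζ) :
    |ζ.im| * (m + ‖ζ‖ ^ 2) + |ε * ζ.re| ≤ ‖sqS x m ε ζ‖ * ‖ζ‖ := by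
  rcases h with h | h
  · have := conj_mul_im_le (sqS x m ε ζ) ζ
    rw [sqS_im] at this
    rwa [abs_of_nonneg h.1, abs_of_nonneg h.2.1]
  · have := conj_mul_im_le (sqS (-x) m ε (-ζ)) (-ζ)
    rw [sqS_im, sqS_neg, norm_neg] at this
    have h1 := h.1
    have h2 := h.2.1
    have e1 : |ζ.im| = (-ζ).im := by rw [Complex.neg_im] at h1 ⊢; rw [abs_of_nonpos (by linarith)]
    have e2 : |ε * ζ.re| = ε * (-ζ).re := by
      rw [Complex.neg_re] at h2 ⊢; rw [abs_of_nonpos (by linarith)]; ring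
    rwa [e1, e2]

theorem le_norm_dispS (hα : 0 < α) (hw : 0 < w) (hv0 : 0 < v0) (h : InQuads ε ζ) :
    |ζ.im| * (m + ‖ζ‖ ^ 2) + |ε * ζ.re| ≤ ‖dispS x m v0 α w ε ζ‖ * ‖ζ‖ := by
  rcases h with h | h
  · have := (dispS_im_ge (x := x) (m := m) hα hw hv0 h).trans (conj_mul_im_le _ ζ)
    rw [sqS_im] at this
    rwa [abs_of_nonneg h.1, abs_of_nonneg h.2.1]
  · have := (dispS_im_ge (x := -x) (m := m) hα hw hv0 h).trans (conj_mul_im_le _ (-ζ))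
    rw [sqS_im, dispS_neg, norm_neg] at this
    have h1 := h.1
    have h2 := h.2.1
    have e1 : |ζ.im| = (-ζ).im := by rw [Complex.neg_im] at h1 ⊢; rw [abs_of_nonpos (by linarith)]
    have e2 : |ε * ζ.re| = ε * (-ζ).re := by
      rw [Complex.neg_re] at h2 ⊢; rw [abs_of_nonpos (by linarith)]; ring
    rwa [e1, e2]

theorem InQuads.pos (h : InQuads ε ζ) (hm : 0 ≤ m) :
    0 < |ζ.im| * (m + ‖ζ‖ ^ 2) + |ε * ζ.re| := by
  have key : ∀ {ζ : ℂ}, InQuad ε ζ → 0 < |ζ.im| * (m + ‖ζ‖ ^ 2) + |ε * ζ.re| := by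
    intro ζ h
    have hn : 0 < ‖ζ‖ ^ 2 := by have := h.ne_zero; positivity
    rw [abs_of_nonneg h.1, abs_of_nonneg h.2.1]
    rcases h.1.lt_or_eq with h2 | h2
    · have := h.2.1; positivity
    · have h3 := h.2.2
      rw [← h2] at h3 ⊢; linarith
  rcases h with h | h
  · exact key h
  · have := key h
    simpa using this

theorem sqS_ne_zero (h : InQuads ε ζ) (hm : 0 ≤ m) : sqS x m ε ζ ≠ 0 := by
  intro h0
  have := (h.pos hm).trans_le (le_norm_sqS (x := x) h)
  rw [h0] at this; simp at this

theorem dispS_ne_zero (hα : 0 < α) (hw : 0 < w) (hv0 : 0 < v0) (h : InQuads ε ζ) (hm : 0 ≤ m) :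
    dispS x m v0 α w ε ζ ≠ 0 := by
  intro h0
  have := (h.pos hm).trans_le (le_norm_dispS (x := x) hα hw hv0 h)
  rw [h0] at this; simp at this

theorem polS_den_ne_zero (hw : 0 < w) (hv0 : 0 < v0) (h : InQuads ε ζ) :
    v0 ^ 2 * ζ ^ 2 - (w - I * ε) ≠ 0 := by
  rcases h with h | h
  · exact (polS_im 1 hw hv0 h).1
  · simpa using (polS_im 1 hw hv0 h).1

theorem resS_pos (hα : 0 < α) (hw : 0 < w) (hv0 : 0 < v0) (h : InQuads ε ζ) :
    1 / (4 * π : ℂ) - polS v0 α w ε ζ ≠ 0 ∧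
    |ζ.im| / (4 * π) ≤ ‖1 / (4 * π : ℂ) - polS v0 α w ε ζ‖ * ‖ζ‖ := by
  have key : ∀ {ζ : ℂ}, InQuad ε ζ → 1 / (4 * π : ℂ) - polS v0 α w ε ζ ≠ 0 ∧
      |ζ.im| / (4 * π) ≤ ‖1 / (4 * π : ℂ) - polS v0 α w ε ζ‖ * ‖ζ‖ := by
    intro ζ h
    have h1 := neg_polS_im hα hw hv0 h
    have e : ((1 / (4 * π : ℂ) - polS v0 α w ε ζ) * ζ).im
        = ζ.im / (4 * π) + -(polS v0 α w ε ζ * ζ).im := by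
      rw [show (1 / (4 * π : ℂ) - polS v0 α w ε ζ) * ζ
        = ((1 / (4 * π) : ℝ) : ℂ) * ζ - polS v0 α w ε ζ * ζ by push_cast; ring,
        Complex.sub_im, Complex.im_ofReal_mul]; ring
    have hnn : 0 ≤ ζ.im / (4 * π) := div_nonneg h.1 (by positivity)
    constructor
    · intro h0
      rw [h0, zero_mul, Complex.zero_im] at e
      linarith
    · rw [← norm_mul, abs_of_nonneg h.1]
      refine le_trans ?_ ((le_abs_self _).trans (Complex.abs_im_le_norm _))
      rw [e]; linarith
  rcases h with h | h
  · exact key h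
  · have := key h
    rw [polS_neg] at this
    simpa using this

theorem norm_polS_le (hα : 0 < α) (hw : 0 < w) (hv0 : 0 < v0) (h : InQuads ε ζ) :
    ‖polS v0 α w ε ζ‖ * (|ζ.im| * (1 + v0 ^ 2 * w / (w ^ 2 + ε ^ 2) * ‖ζ‖ ^ 2)) ≤ α * ‖ζ‖ := by
  have key : ∀ {ζ : ℂ}, InQuad ε ζ → ‖polS v0 α w ε ζ‖ *
      (|ζ.im| * (1 + v0 ^ 2 * w / (w ^ 2 + ε ^ 2) * ‖ζ‖ ^ 2)) ≤ α * ‖ζ‖ := by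
    intro ζ h
    obtain ⟨-, T, hT, hpos, hlow⟩ := polS_im α hw hv0 h
    have hn : 0 < ‖ζ‖ := by have := h.ne_zero; positivity
    have h1 : ‖polS v0 α w ε ζ‖ * ‖ζ‖ * ‖T‖ = α := by
      rw [← norm_mul, ← norm_mul, hT, Complex.norm_real, Real.norm_of_nonneg hα.le]
    have h2 : T.im ≤ ‖T‖ := (le_abs_self _).trans (Complex.abs_im_le_norm _)
    rw [abs_of_nonneg h.1]
    calc ‖polS v0 α w ε ζ‖ * (ζ.im * (1 + v0 ^ 2 * w / (w ^ 2 + ε ^ 2) * ‖ζ‖ ^ 2))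
        = ‖polS v0 α w ε ζ‖ * ‖ζ‖ * (ζ.im * (v0 ^ 2 * w / (w ^ 2 + ε ^ 2) + 1 / ‖ζ‖ ^ 2))
          * ‖ζ‖ := by field_simp; ring
      _ ≤ ‖polS v0 α w ε ζ‖ * ‖ζ‖ * ‖T‖ * ‖ζ‖ := by gcongr; exact hlow.trans h2
      _ = α * ‖ζ‖ := by rw [h1]
  rcases h with h | h
  · exact key h
  · have := key h
    rw [polS_neg] at this
    simpa using this

end quads

/-- Away from a ball that contains all zeros of the denominators, these have the size of their
leading terms. -/
theorem large_bounds {x m v0 w ε α Q : ℝ} {ζ : ℂ} (hα : 0 < α) (hw : 0 < w) (hv0 : 1 ≤ v0)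
    (hQ : 0 ≤ Q) (hx : |x| ≤ Q) (hm0 : 0 ≤ m) (hm : m ≤ Q ^ 2) (hε : 0 ≤ ε)
    (hζ : (10 + 2 * (w + 1) + 32 * π * α * (w + 1)) * (1 + Q + ε) ≤ ‖ζ‖) :
    ‖ζ‖ ^ 2 / 2 ≤ ‖sqS x m ε ζ‖ ∧ ‖ζ‖ ^ 2 / 4 ≤ ‖dispS x m v0 α w ε ζ‖ ∧
    1 / (8 * π) ≤ ‖1 / (4 * π : ℂ) - polS v0 α w ε ζ‖ ∧
    ‖polS v0 α w ε ζ‖ ≤ 2 * α * ((w + 1) * (1 + Q + ε)) / ‖ζ‖ ^ 2 := by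
  have hπ := Real.pi_gt_three
  set A := 10 + 2 * (w + 1) + 32 * π * α * (w + 1) with hA
  set r := 1 + Q + ε with hr
  have hr1 : 1 ≤ r := by rw [hr]; linarith
  have hA10 : 10 ≤ A := by rw [hA]; have : 0 ≤ 32 * π * α * (w + 1) := by positivity
                           linarith
  have hn : A * r ≤ ‖ζ‖ := hζ
  have h10 : 10 * r ≤ ‖ζ‖ := le_trans (by nlinarith) hn
  have hn0 : 0 < ‖ζ‖ := by nlinarith
  have hsq : A * r ≤ ‖ζ‖ ^ 2 := by nlinarith
  have hwε : ‖(w : ℂ) - I * ε‖ ≤ (w + 1) * r := by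
    refine (norm_sub_le _ _).trans ?_
    rw [norm_mul, Complex.norm_I, one_mul, Complex.norm_real, Complex.norm_real,
      Real.norm_of_nonneg hw.le, Real.norm_of_nonneg hε]
    nlinarith [mul_nonneg hw.le hQ, mul_nonneg hw.le hε]
  have hS : ‖ζ‖ ^ 2 / 2 ≤ ‖sqS x m ε ζ‖ := by
    have e : ζ ^ 2 = sqS x m ε ζ + (m - 2 * x * ζ - I * ε) := by simp only [sqS]; ring
    have h1 : ‖ζ‖ ^ 2 ≤ ‖sqS x m ε ζ‖ + (m + 2 * |x| * ‖ζ‖ + ε) := by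
      rw [← norm_pow, e]
      refine (norm_add_le _ _).trans ?_
      gcongr
      refine (norm_sub_le _ _).trans ?_
      gcongr
      · refine (norm_sub_le _ _).trans ?_
        gcongr
        · rw [Complex.norm_real, Real.norm_of_nonneg hm0]
        · rw [norm_mul, norm_mul, Complex.norm_real]; simp
      · simp [abs_of_nonneg hε]
    nlinarith [mul_le_mul_of_nonneg_right hx hn0.le, abs_nonneg x, mul_nonneg hQ hε]
  have hden : ‖ζ‖ ^ 2 / 2 ≤ ‖v0 ^ 2 * ζ ^ 2 - (w - I * ε)‖ * (1 / v0 ^ 2) := by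
    have h1 : v0 ^ 2 * ‖ζ‖ ^ 2 - (w + 1) * r ≤ ‖v0 ^ 2 * ζ ^ 2 - (w - I * ε)‖ := by
      refine le_trans ?_ (norm_sub_norm_le _ _)
      rw [norm_mul, norm_pow, norm_pow, Complex.norm_real, Real.norm_of_nonneg (by linarith)]
      linarith
    have h2 : 2 * ((w + 1) * r) ≤ A * r := by
      have : 0 ≤ 32 * π * α * (w + 1) := by positivity
      nlinarith
    have h3 : 1 ≤ v0 ^ 2 := by nlinarith
    rw [mul_one_div, le_div_iff₀ (by positivity)]
    nlinarith [mul_le_mul_of_nonneg_right h3 (sq_nonneg ‖ζ‖)]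
  have hX0 : ‖polS v0 α w ε ζ‖ * v0 ^ 2 ≤ 2 * α * ((w + 1) * r) / ‖ζ‖ ^ 2 := by
    have hv2 : 0 < v0 ^ 2 := by positivity
    have hd0 : 0 < ‖v0 ^ 2 * ζ ^ 2 - (w - I * ε)‖ := by
      by_contra h0
      have : ‖v0 ^ 2 * ζ ^ 2 - (w - I * ε)‖ = 0 :=
        le_antisymm (not_lt.1 h0) (norm_nonneg _)
      rw [this] at hden
      have : 0 < ‖ζ‖ ^ 2 := by positivity
      linarith
    rw [polS, norm_div, norm_mul, Complex.norm_real, Real.norm_of_nonneg hα.le]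
    rw [le_div_iff₀ (by positivity), div_mul_eq_mul_div, div_mul_eq_mul_div,
      div_le_iff₀ hd0]
    have h4 : ‖ζ‖ ^ 2 * v0 ^ 2 ≤ 2 * ‖v0 ^ 2 * ζ ^ 2 - (w - I * ε)‖ := by
      rw [mul_one_div, le_div_iff₀ hv2] at hden
      linarith
    calc α * ‖(w : ℂ) - I * ε‖ * v0 ^ 2 * ‖ζ‖ ^ 2
        = α * ‖(w : ℂ) - I * ε‖ * (‖ζ‖ ^ 2 * v0 ^ 2) := by ring
      _ ≤ α * ((w + 1) * r) * (2 * ‖v0 ^ 2 * ζ ^ 2 - (w - I * ε)‖) := by gcongr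
      _ = _ := by ring
  have hX : ‖polS v0 α w ε ζ‖ ≤ 2 * α * ((w + 1) * r) / ‖ζ‖ ^ 2 := by
    refine le_trans ?_ hX0
    have : 1 ≤ v0 ^ 2 := by nlinarith
    exact le_mul_of_one_le_right (norm_nonneg _) this
  refine ⟨hS, ?_, ?_, hX⟩
  · have h1 : ‖sqS x m ε ζ‖ ≤ ‖dispS x m v0 α w ε ζ‖ + 8 * π * α * ((w + 1) * r) := by
      have e : sqS x m ε ζ = dispS x m v0 α w ε ζ
          + 4 * π * polS v0 α w ε ζ * (v0 ^ 2 * ζ ^ 2) := by simp only [dispS]; ring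
      rw [e]
      refine (norm_add_le _ _).trans ?_
      gcongr
      rw [le_div_iff₀ (by positivity)] at hX0
      simp only [norm_mul, norm_pow, Complex.norm_real, Complex.norm_ofNat]
      rw [Real.norm_of_nonneg Real.pi_pos.le, Real.norm_of_nonneg (by linarith : 0 ≤ v0)]
      nlinarith
    have h2 : 32 * π * α * ((w + 1) * r) ≤ A * r := by
      have : 0 ≤ (10 + 2 * (w + 1)) * r := by positivity
      nlinarith
    linarith
  · have h2 : 2 * α * ((w + 1) * r) / ‖ζ‖ ^ 2 ≤ 1 / (8 * π) := by
      rw [div_le_div_iff₀ (by positivity) (by positivity)]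
      have : 0 ≤ (10 + 2 * (w + 1)) * r := by positivity
      nlinarith
    have h3 : ‖1 / (4 * π : ℂ)‖ = 1 / (4 * π) := by
      rw [norm_div, norm_mul, Complex.norm_real, Real.norm_of_nonneg Real.pi_pos.le]; simp
    have h4 := norm_sub_norm_le (1 / (4 * π : ℂ)) (polS v0 α w ε ζ)
    rw [h3] at h4
    have h5 : 1 / (4 * π) = 1 / (8 * π) + 1 / (8 * π) := by
      field_simp; norm_num
    linarith

/-! ### The propagator at complex energy -/

/-- The standing assumptions on the medium. -/
structure Medium.Good (p : Medium) : Prop where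
  hg : p.g ≠ 0
  hχ : 0 < p.χ
  hω : 0 < p.ω₀
  hv : mink p.v p.v = 1
  hv0 : 0 < p.v 0

/-- The energy at which `ω = k · v` vanishes, for spatial momentum `q`. -/
def xStar (p : Medium) (q : ℝ³) : ℝ := (∑ j : Fin 3, p.v j.succ * q j) / p.v 0

/-- Minus the value of `k²` at `ω = 0`. -/
def mSq (p : Medium) (q : ℝ³) : ℝ := ∑ j, q j ^ 2 - xStar p q ^ 2

/-- The regularized propagator at complex energy `z`. -/
def contMatrix (p : Medium) (ε : ℝ) (q : ℝ³) (z : ℂ) :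
    Matrix FieldIx FieldIx ℂ :=
  propMatrix p (mink (fourC z q) (fourC z q) + I * ε)
    ((p.ω₀ : ℂ) ^ 2 - I * ε) (fourC z q)

theorem toC_four (s : ℝ) (q : ℝ³) : toC (four s q) = fourC s q := by
  ext μ; refine Fin.cases ?_ (fun j => ?_) μ <;> simp [toC, four, fourC]

theorem regMatrix_four (p : Medium) (ε s : ℝ) (q : ℝ³) :
    regMatrix p ε (four s q) = contMatrix p ε q s := by
  rw [regMatrix, toC_four]; rfl

theorem mink_fourC (z : ℂ) (q : ℝ³) :
    mink (fourC z q) (fourC z q) = z ^ 2 - ((∑ j, q j ^ 2 : ℝ) : ℂ) := by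
  simp [mink, fourC, Fin.sum_univ_three]
  ring

theorem len_sq (q : ℝ³) : len q ^ 2 = ∑ j, q j ^ 2 :=
  Real.sq_sqrt (Finset.sum_nonneg fun _ _ => sq_nonneg _)

theorem len_nonneg (q : ℝ³) : 0 ≤ len q := Real.sqrt_nonneg _

theorem abs_le_len (q : ℝ³) (j : Fin 3) : |q j| ≤ len q := by
  apply Real.abs_le_sqrt
  exact Finset.single_le_sum (f := fun j => q j ^ 2) (fun _ _ => sq_nonneg _) (Finset.mem_univ j)

theorem len_pos {q : ℝ³} (hq : q ≠ 0) : 0 < len q := by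
  obtain ⟨j, hj⟩ := Function.ne_iff.1 hq
  exact (abs_pos.2 hj).trans_le (abs_le_len q j)

theorem len_neg (q : ℝ³) : len (-q) = len q := by simp [len]

section good

variable {p : Medium} (hp : p.Good)
include hp

theorem Medium.Good.ne_zero : (p.g : ℂ) ≠ 0 ∧ (p.χ : ℂ) ≠ 0 ∧ (p.ω₀ : ℂ) ≠ 0 := by
  exact_mod_cast And.intro hp.hg (And.intro hp.hχ.ne' hp.hω.ne')

theorem Medium.Good.v_sq : p.v 0 ^ 2 = 1 + ∑ j : Fin 3, p.v j.succ ^ 2 := by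
  have h := hp.hv
  simp only [mink] at h
  simp only [Fin.sum_univ_three]
  have h1 : (Fin.succ 0 : Fin 4) = 1 := rfl
  have h2 : (Fin.succ 1 : Fin 4) = 2 := rfl
  have h3 : (Fin.succ 2 : Fin 4) = 3 := rfl
  rw [h1, h2, h3]; linarith

theorem Medium.Good.one_le : 1 ≤ p.v 0 := by
  have h := hp.v_sq
  have : 0 ≤ ∑ j : Fin 3, p.v j.succ ^ 2 := Finset.sum_nonneg fun _ _ => sq_nonneg _
  nlinarith [hp.hv0]

theorem Medium.Good.abs_v_le (μ : Fin 4) : |p.v μ| ≤ p.v 0 := by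
  refine Fin.cases ?_ (fun j => ?_) μ
  · rw [abs_of_pos hp.hv0]
  · apply abs_le_of_sq_le_sq _ hp.hv0.le
    rw [hp.v_sq]
    have := Finset.single_le_sum (f := fun j : Fin 3 => p.v j.succ ^ 2)
      (fun _ _ => sq_nonneg _) (Finset.mem_univ j)
    linarith

theorem xStar_sq_le (q : ℝ³) :
    p.v 0 ^ 2 * xStar p q ^ 2 ≤ (p.v 0 ^ 2 - 1) * len q ^ 2 := by
  rw [xStar, div_pow, mul_div_cancel₀ _ (pow_ne_zero 2 hp.hv0.ne'), len_sq, hp.v_sq]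
  have := Finset.sum_mul_sq_le_sq_mul_sq Finset.univ (fun j : Fin 3 => p.v j.succ) q
  simpa using this

theorem abs_xStar_le (q : ℝ³) : |xStar p q| ≤ len q := by
  apply abs_le_of_sq_le_sq _ (len_nonneg q)
  have := xStar_sq_le hp q
  have h1 : 0 < p.v 0 ^ 2 := by have := hp.hv0; positivity
  have h2 := sq_nonneg (len q)
  by_contra hc
  nlinarith

theorem le_mSq (q : ℝ³) : len q ^ 2 ≤ p.v 0 ^ 2 * mSq p q := by
  have := xStar_sq_le hp q
  rw [mSq, ← len_sq]
  nlinarith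

theorem mSq_nonneg (q : ℝ³) : 0 ≤ mSq p q := by
  have h1 : 0 < p.v 0 ^ 2 := by have := hp.hv0; positivity
  exact nonneg_of_mul_nonneg_right ((sq_nonneg _).trans (le_mSq hp q)) h1

theorem mSq_pos {q : ℝ³} (hq : q ≠ 0) : 0 < mSq p q := by
  have h1 : 0 < p.v 0 ^ 2 := by have := hp.hv0; positivity
  have h2 : 0 < len q ^ 2 := by have := len_pos hq; positivity
  exact pos_of_mul_pos_right (h2.trans_le (le_mSq hp q)) h1.le

omit hp in
theorem mSq_le (q : ℝ³) : mSq p q ≤ len q ^ 2 := by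
  rw [mSq, ← len_sq]; linarith [sq_nonneg (xStar p q)]

theorem omC_fourC (z : ℂ) (q : ℝ³) : p.omC (fourC z q) = p.v 0 * (z - xStar p q) := by
  have h0 : (p.v 0 : ℂ) ≠ 0 := by exact_mod_cast hp.hv0.ne'
  have h2 : (Matrix.vecCons z (fun j => (q j : ℂ)) : ℂ⁴) 2 = q 1 := rfl
  have h3 : (Matrix.vecCons z (fun j => (q j : ℂ)) : ℂ⁴) 3 = q 2 := rfl
  have h1' : (Fin.succ 0 : Fin 4) = 1 := rfl
  have h2' : (Fin.succ 1 : Fin 4) = 2 := rfl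
  have h3' : (Fin.succ 2 : Fin 4) = 3 := rfl
  simp only [Medium.omC, mink, Medium.vC, toC, fourC, xStar, Fin.sum_univ_three, h1', h2', h3', h2,
    h3, Matrix.cons_val_zero, Matrix.cons_val_one]
  push_cast
  field_simp
  ring

omit hp in
theorem sq_add_eq_sqS (ε : ℝ) (q : ℝ³) (ζ : ℂ) :
    mink (fourC (xStar p q + ζ) q) (fourC (xStar p q + ζ) q) + I * ε
      = sqS (xStar p q) (mSq p q) ε ζ := by
  rw [mink_fourC]; simp only [sqS, mSq]; push_cast; ring

theorem polX_eq_polS (ε : ℝ) (q : ℝ³) (ζ : ℂ) :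
    polX p ((p.ω₀ : ℂ) ^ 2 - I * ε) (fourC (xStar p q + ζ) q)
      = polS (p.v 0) (p.g ^ 2 * p.χ) (p.ω₀ ^ 2) ε ζ := by
  rw [polX, omC_fourC hp]; simp only [polS]; push_cast; ring_nf

theorem dispC_eq_dispS (ε : ℝ) (q : ℝ³) (ζ : ℂ) :
    dispC p (mink (fourC (xStar p q + ζ) q) (fourC (xStar p q + ζ) q) + I * ε)
      ((p.ω₀ : ℂ) ^ 2 - I * ε) (fourC (xStar p q + ζ) q)
      = dispS (xStar p q) (mSq p q) (p.v 0) (p.g ^ 2 * p.χ) (p.ω₀ ^ 2) ε ζ / (4 * π) := by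
  have hπ := piC_ne
  rw [dispC, polX_eq_polS hp, sq_add_eq_sqS, omC_fourC hp]; simp only [dispS]
  field_simp; ring

theorem Medium.Good.α_pos : 0 < p.g ^ 2 * p.χ := by
  have := hp.hg; have := hp.hχ; positivity

theorem Medium.Good.w_pos : 0 < p.ω₀ ^ 2 := by
  have := hp.hω; positivity

/-- A constant that bounds the coefficients in the propagator. -/
def _root_.Hopfield.Medium.size (p : Medium) : ℝ := 1 + 3 * p.v 0 + |p.ξ| + |p.g|⁻¹

omit hp in
/-- The pairs of field components whose propagator decays quadratically at large energy: all but
those that mix `A` and `B`. -/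
def _root_.Hopfield.Diag (a b : FieldIx) : Prop :=
  ∀ μ, ¬(a = iA μ ∧ b = iB) ∧ ¬(a = iB ∧ b = iA μ)

theorem norm_contMatrix_le_of {ε : ℝ} {q : ℝ³} {ζ : ℂ} {B ρ : ℝ} (hB : p.size ≤ B)
    (hρ : 0 < ρ) (hS : ρ ^ 2 ≤ B * ‖sqS (xStar p q) (mSq p q) ε ζ‖)
    (hD : 4 * π * ρ ^ 2 ≤ B * ‖dispS (xStar p q) (mSq p q) (p.v 0) (p.g ^ 2 * p.χ)
      (p.ω₀ ^ 2) ε ζ‖)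
    (hh : 1 ≤ B * ‖1 / (4 * π : ℂ) - polS (p.v 0) (p.g ^ 2 * p.χ) (p.ω₀ ^ 2) ε ζ‖)
    (hX : ‖polS (p.v 0) (p.g ^ 2 * p.χ) (p.ω₀ ^ 2) ε ζ‖ * (1 + ρ ^ 2) ≤ B)
    (hζ : ‖ζ‖ ≤ ρ) (hm : mSq p q ≤ ρ ^ 2) {a b : FieldIx} (hab : Diag a b) :
    ‖contMatrix p ε q (xStar p q + ζ) a b‖ ≤ 10 * B ^ 12 / ρ ^ 2 := by
  have hv1 := hp.one_le
  have hsz : 1 + 3 * p.v 0 + |p.ξ| + |p.g|⁻¹ ≤ B := hB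
  have hg0 : 0 ≤ |p.g|⁻¹ := by positivity
  have hξ0 := abs_nonneg p.ξ
  have hB0 : 0 < B := by linarith
  have hlen : len q ≤ p.v 0 * ρ := by
    apply le_of_sq_le_sq _ (by positivity)
    rw [mul_pow]
    exact (le_mSq hp q).trans (by gcongr)
  have hinv : ∀ {y : ℝ} {z : ℂ}, 0 < y → y ≤ B * ‖z‖ → ‖z⁻¹‖ ≤ B / y := by
    intro y z hy h
    have hz : 0 < ‖z‖ := by
      by_contra h0
      have : ‖z‖ = 0 := le_antisymm (not_lt.1 h0) (norm_nonneg _)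
      rw [this] at h; simp at h; linarith
    rw [norm_inv, inv_eq_one_div, div_le_div_iff₀ hz hy]; linarith
  have hπ := Real.pi_pos
  have hom : p.omC (fourC (xStar p q + ζ) q) = p.v 0 * ζ := by rw [omC_fourC hp]; ring
  refine norm_propMatrix_le p _ _ _ (by linarith) hρ hp.hg ?_ ?_ ?_ ?_ ?_ ?_ ?_ ?_ ?_ a b hab
  · rw [sq_add_eq_sqS]; exact hinv (by positivity) hS
  · rw [dispC_eq_dispS hp, inv_div, norm_div, norm_mul, Complex.norm_real,
      Real.norm_of_nonneg hπ.le]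
    have h1 := hinv (by positivity) hD
    rw [norm_inv] at h1
    calc _ = (4 * π) * (‖dispS (xStar p q) (mSq p q) (p.v 0) (p.g ^ 2 * p.χ)
      (p.ω₀ ^ 2) ε ζ‖)⁻¹ := by simp [div_eq_mul_inv]
      _ ≤ (4 * π) * (B / (4 * π * ρ ^ 2)) := by gcongr
      _ = B / ρ ^ 2 := by field_simp
  · rw [polX_eq_polS hp]; simpa using hinv one_pos hh
  · rw [polX_eq_polS hp, le_div_iff₀ (by positivity)]; exact hX
  · intro μ
    refine Fin.cases ?_ (fun j => ?_) μ
    · have : fourC (xStar p q + ζ) q 0 = xStar p q + ζ := rfl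
      rw [this]
      refine (norm_add_le _ _).trans ?_
      rw [Complex.norm_real, Real.norm_eq_abs]
      have := (abs_xStar_le hp q).trans hlen
      nlinarith
    · have : fourC (xStar p q + ζ) q j.succ = q j := rfl
      rw [this, Complex.norm_real, Real.norm_eq_abs]
      have := (abs_le_len q j).trans hlen
      nlinarith
  · rw [hom, norm_mul, Complex.norm_real, Real.norm_of_nonneg hp.hv0.le]
    have := mul_le_mul_of_nonneg_left hζ hp.hv0.le
    nlinarith
  · intro μ
    have := hp.abs_v_le μ
    simp only [Medium.vC, toC, Complex.norm_real, Real.norm_eq_abs]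
    linarith
  · rw [Complex.norm_real, Real.norm_eq_abs]; linarith
  · rw [norm_inv, Complex.norm_real, Real.norm_eq_abs]; linarith

theorem Medium.Good.one_le_size : 1 ≤ p.size := by
  unfold Medium.size
  have := hp.hv0
  have : 0 ≤ |p.ξ| + |p.g|⁻¹ := by positivity
  linarith

/-- The radius outside of which the denominators of the propagator have the size of their
leading terms, relative to `1 + |q| + ε`. -/
def _root_.Hopfield.Medium.rad (p : Medium) : ℝ :=
  10 + 2 * (p.ω₀ ^ 2 + 1) + 32 * π * (p.g ^ 2 * p.χ) * (p.ω₀ ^ 2 + 1)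

theorem Medium.Good.le_rad : 10 ≤ p.rad := by
  have := hp.α_pos; have := hp.w_pos; have := Real.pi_pos
  unfold Medium.rad
  have : 0 ≤ 32 * π * (p.g ^ 2 * p.χ) * (p.ω₀ ^ 2 + 1) := by positivity
  linarith

theorem norm_contMatrix_le_large {ε : ℝ} (hε : 0 ≤ ε) {q : ℝ³} {ζ : ℂ}
    (hζ : p.rad * (1 + len q + ε) ≤ ‖ζ‖) {a b : FieldIx} (hab : Diag a b) :
    ‖contMatrix p ε q (xStar p q + ζ) a b‖
      ≤ 10 * ((p.size + 120 + 6 * (p.g ^ 2 * p.χ) * (p.ω₀ ^ 2 + 1)) * (1 + len q + ε)) ^ 12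
        / (mSq p q + ‖ζ‖ ^ 2) := by
  have hα := hp.α_pos; have hw := hp.w_pos; have hπ := Real.pi_gt_three
  have hπ4 := Real.pi_lt_four
  have hQ := len_nonneg q
  have hm0 := mSq_nonneg hp q
  have hm := mSq_le (p := p) q
  obtain ⟨h1, h2, h3, h4⟩ := large_bounds hα hw hp.one_le hQ (abs_xStar_le hp q) hm0 hm hε hζ
  have hrad := hp.le_rad
  have hv1 := hp.one_le
  set Q := len q
  set r := 1 + Q + ε with hr
  have hr1 : 1 ≤ r := by rw [hr]; linarith
  have h10 : 10 * r ≤ ‖ζ‖ := le_trans (by nlinarith) hζ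
  have hQζ : mSq p q ≤ ‖ζ‖ ^ 2 := by
    refine hm.trans ?_
    have : Q ≤ ‖ζ‖ := by linarith
    gcongr
  have h1ζ : 1 ≤ ‖ζ‖ ^ 2 := by nlinarith
  have hn0 : ‖ζ‖ ≠ 0 := by intro h0; rw [h0] at h1ζ; norm_num at h1ζ
  have hsz : 1 ≤ p.size := hp.one_le_size
  have hπ' := Real.pi_lt_d2
  have hC : 0 ≤ 6 * (p.g ^ 2 * p.χ) * (p.ω₀ ^ 2 + 1) := by positivity
  set C := p.size + 120 + 6 * (p.g ^ 2 * p.χ) * (p.ω₀ ^ 2 + 1) with hCdef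
  have hC1 : 121 ≤ C := by linarith
  have hB : 121 ≤ C * r := by nlinarith
  have hρ : 0 < mSq p q + ‖ζ‖ ^ 2 := by linarith
  have hsq : √(mSq p q + ‖ζ‖ ^ 2) ^ 2 = mSq p q + ‖ζ‖ ^ 2 := Real.sq_sqrt hρ.le
  rw [← hsq]
  have hpC : p.size ≤ C := by linarith
  refine norm_contMatrix_le_of hp (by nlinarith) (Real.sqrt_pos.2 hρ) ?_ ?_ ?_ ?_ ?_ ?_ hab
  · rw [hsq]
    have : 121 * ‖sqS (xStar p q) (mSq p q) ε ζ‖ ≤ C * r * ‖sqS (xStar p q) (mSq p q) ε ζ‖ := by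
      gcongr
    linarith
  · rw [hsq]
    refine le_trans ?_ (mul_le_mul_of_nonneg_right hB (norm_nonneg _))
    nlinarith
  · refine le_trans ?_ (mul_le_mul_of_nonneg_right hB (norm_nonneg _))
    rw [div_le_iff₀ (by positivity)] at h3
    nlinarith [norm_nonneg (1 / (4 * π : ℂ)
      - polS (p.v 0) (p.g ^ 2 * p.χ) (p.ω₀ ^ 2) ε ζ)]
  · rw [hsq]
    calc _ ≤ 2 * (p.g ^ 2 * p.χ) * ((p.ω₀ ^ 2 + 1) * r) / ‖ζ‖ ^ 2 * (3 * ‖ζ‖ ^ 2) := by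
          gcongr; linarith
      _ = (6 * (p.g ^ 2 * p.χ) * (p.ω₀ ^ 2 + 1)) * r := by field_simp; ring
      _ ≤ C * r := by gcongr; linarith
  · exact Real.le_sqrt_of_sq_le (by linarith)
  · rw [hsq]; nlinarith

omit hp in
theorem pol_bound_aux {X α κ c d m n Q : ℝ} (hX0 : 0 ≤ X) (hX1 : X * (1 + c * n) ≤ α * κ)
    (hc1 : 1 ≤ d * c) (hm : m ≤ Q ^ 2) (hQ : 0 ≤ Q) (hn : 0 ≤ n) (hc0 : 0 ≤ c)
    (hd0 : 0 ≤ d) : X * (1 + (m + n)) ≤ α * (1 + d) * (κ * (1 + Q) ^ 2) := by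
  have h5 : 1 + (m + n) ≤ (1 + Q) ^ 2 * ((1 + d) * (1 + c * n)) := by
    have e1 : 1 + n ≤ (1 + d) * (1 + c * n) := by
      have := mul_le_mul_of_nonneg_right hc1 hn
      have : 0 ≤ c * n := by positivity
      nlinarith
    have e2 : 1 + (m + n) ≤ (1 + Q) ^ 2 * (1 + n) := by
      nlinarith [mul_nonneg (by nlinarith : 0 ≤ 2 * Q + Q ^ 2) hn]
    exact e2.trans (by gcongr)
  calc X * (1 + (m + n))
      ≤ X * ((1 + Q) ^ 2 * ((1 + d) * (1 + c * n))) := by gcongr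
    _ = (X * (1 + c * n)) * ((1 + d) * (1 + Q) ^ 2) := by ring
    _ ≤ (α * κ) * ((1 + d) * (1 + Q) ^ 2) := by gcongr
    _ = _ := by ring

set_option maxHeartbeats 400000 in
theorem norm_contMatrix_le_near {ε : ℝ} (hε : 0 ≤ ε) (hε1 : ε ≤ 1) {q : ℝ³} {ζ : ℂ}
    (hζ : InQuads ε ζ) {κ : ℝ} (hκ1 : 1 ≤ κ) (hκ : ‖ζ‖ ≤ κ * |ζ.im|) {a b : FieldIx}
    (hab : Diag a b) :
    ‖contMatrix p ε q (xStar p q + ζ) a b‖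
      ≤ 10 * ((p.size + 16 + p.g ^ 2 * p.χ * (1 + (p.ω₀ ^ 4 + 1) / p.ω₀ ^ 2))
        * (κ * (1 + len q) ^ 2)) ^ 12 / (mSq p q + ‖ζ‖ ^ 2) := by
  have hα := hp.α_pos; have hw := hp.w_pos; have hπ := Real.pi_gt_three
  have hπ' := Real.pi_lt_d2
  have hQ := len_nonneg q
  have hm0 := mSq_nonneg hp q
  have hm := mSq_le (p := p) q
  have hv1 := hp.one_le
  have hsz : 1 ≤ p.size := hp.one_le_size
  have hζ0 : ζ ≠ 0 := by
    rintro rfl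
    rcases hζ with h | h
    · exact h.ne_zero rfl
    · exact h.ne_zero (by simp)
  have hn : 0 < ‖ζ‖ := norm_pos_iff.2 hζ0
  have him : 0 < |ζ.im| := pos_of_mul_pos_right (hn.trans_le hκ) (by linarith)
  have h1 := le_norm_sqS (x := xStar p q) (m := mSq p q) hζ
  have h2 := le_norm_dispS (x := xStar p q) (m := mSq p q) hα hw hp.hv0 hζ
  have h3 := (resS_pos hα hw hp.hv0 hζ).2
  have h4 := norm_polS_le hα hw hp.hv0 hζ
  have hε' := abs_nonneg (ε * ζ.re)
  set S := ‖sqS (xStar p q) (mSq p q) ε ζ‖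
  set D := ‖dispS (xStar p q) (mSq p q) (p.v 0) (p.g ^ 2 * p.χ) (p.ω₀ ^ 2) ε ζ‖ with hDdef
  set R := ‖1 / (4 * π : ℂ) - polS (p.v 0) (p.g ^ 2 * p.χ) (p.ω₀ ^ 2) ε ζ‖ with hRdef
  set X := ‖polS (p.v 0) (p.g ^ 2 * p.χ) (p.ω₀ ^ 2) ε ζ‖ with hXdef
  have hS0 : 0 ≤ S := norm_nonneg _
  have hD0 : 0 ≤ D := norm_nonneg _
  have hR0 : 0 ≤ R := norm_nonneg _
  have hX0 : 0 ≤ X := norm_nonneg _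
  set C := p.size + 16 + p.g ^ 2 * p.χ * (1 + (p.ω₀ ^ 4 + 1) / p.ω₀ ^ 2) with hCdef
  have hC0 : 0 ≤ p.g ^ 2 * p.χ * (1 + (p.ω₀ ^ 4 + 1) / p.ω₀ ^ 2) := by positivity
  have hQ1 : 1 ≤ (1 + len q) ^ 2 := by nlinarith
  have hκ0 : 0 ≤ κ := by linarith
  have hπ16 : 4 * π ≤ 16 := by linarith
  have hC16 : 16 ≤ C := by linarith
  have hκQ : κ ≤ κ * (1 + len q) ^ 2 := le_mul_of_one_le_right (by linarith) hQ1
  have hCκ : 16 * κ ≤ C * (κ * (1 + len q) ^ 2) := by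
    apply mul_le_mul hC16 hκQ (by linarith) (by linarith)
  have hρ : 0 < mSq p q + ‖ζ‖ ^ 2 := by positivity
  have hsq : √(mSq p q + ‖ζ‖ ^ 2) ^ 2 = mSq p q + ‖ζ‖ ^ 2 := Real.sq_sqrt hρ.le
  have hS1 : mSq p q + ‖ζ‖ ^ 2 ≤ κ * S := by
    have : |ζ.im| * (mSq p q + ‖ζ‖ ^ 2) ≤ |ζ.im| * (κ * S) := by
      linarith [mul_le_mul_of_nonneg_left hκ hS0]
    exact le_of_mul_le_mul_left this him
  have hD1 : mSq p q + ‖ζ‖ ^ 2 ≤ κ * D := by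
    have : |ζ.im| * (mSq p q + ‖ζ‖ ^ 2) ≤ |ζ.im| * (κ * D) := by
      linarith [mul_le_mul_of_nonneg_left hκ hD0]
    exact le_of_mul_le_mul_left this him
  have hR1 : 1 ≤ 4 * π * (κ * R) := by
    rw [div_le_iff₀ (by positivity)] at h3
    have : |ζ.im| * 1 ≤ |ζ.im| * (4 * π * (κ * R)) := by
      have := mul_le_mul_of_nonneg_left hκ (by positivity : 0 ≤ 4 * π * R)
      linarith
    exact le_of_mul_le_mul_left this him
  have hX1 : X * (1 + p.v 0 ^ 2 * p.ω₀ ^ 2 / ((p.ω₀ ^ 2) ^ 2 + ε ^ 2) * ‖ζ‖ ^ 2)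
      ≤ p.g ^ 2 * p.χ * κ := by
    have : |ζ.im| * (X * (1 + p.v 0 ^ 2 * p.ω₀ ^ 2 / ((p.ω₀ ^ 2) ^ 2 + ε ^ 2) * ‖ζ‖ ^ 2))
        ≤ |ζ.im| * (p.g ^ 2 * p.χ * κ) := by
      have := mul_le_mul_of_nonneg_left hκ hα.le
      linarith
    exact le_of_mul_le_mul_left this him
  rw [← hsq]
  refine norm_contMatrix_le_of hp ?_ (Real.sqrt_pos.2 hρ) ?_ ?_ ?_ ?_ ?_ ?_ hab
  · have : p.size ≤ C := by linarith
    calc p.size ≤ C * 1 := by linarith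
      _ ≤ C * (κ * (1 + len q) ^ 2) :=
          mul_le_mul_of_nonneg_left (hκ1.trans hκQ) (by linarith)
  · rw [hsq]
    have := mul_le_mul_of_nonneg_right hCκ hS0
    have := mul_nonneg hκ0 hS0
    linarith
  · rw [hsq, ← hDdef]
    have h6 := mul_le_mul_of_nonneg_right hCκ hD0
    refine le_trans ?_ h6
    calc 4 * π * (mSq p q + ‖ζ‖ ^ 2) ≤ 16 * (κ * D) :=
          mul_le_mul hπ16 hD1 hρ.le (by norm_num)
      _ = 16 * κ * D := by ring
  · rw [← hRdef]
    have h6 := mul_le_mul_of_nonneg_right hCκ hR0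
    refine (hR1.trans ?_).trans h6
    calc 4 * π * (κ * R) ≤ 16 * (κ * R) :=
          mul_le_mul_of_nonneg_right hπ16 (mul_nonneg hκ0 hR0)
      _ = 16 * κ * R := by ring
  · rw [hsq, ← hXdef]
    set c := p.v 0 ^ 2 * p.ω₀ ^ 2 / ((p.ω₀ ^ 2) ^ 2 + ε ^ 2) with hc
    have hc1 : 1 ≤ (p.ω₀ ^ 4 + 1) / p.ω₀ ^ 2 * c := by
      rw [hc, div_mul_div_comm, le_div_iff₀ (by positivity)]
      have e1 : 1 ≤ p.v 0 ^ 2 := one_le_pow₀ hv1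
      have e2 : ε ^ 2 ≤ 1 := pow_le_one₀ hε hε1
      calc 1 * (p.ω₀ ^ 2 * ((p.ω₀ ^ 2) ^ 2 + ε ^ 2)) = (p.ω₀ ^ 4 + ε ^ 2) * (1 * p.ω₀ ^ 2) := by
            ring
        _ ≤ (p.ω₀ ^ 4 + 1) * (p.v 0 ^ 2 * p.ω₀ ^ 2) := by gcongr
    refine (pol_bound_aux hX0 hX1 hc1 hm hQ (sq_nonneg _) (by positivity)
      (by positivity)).trans ?_
    have : p.g ^ 2 * p.χ * (1 + (p.ω₀ ^ 4 + 1) / p.ω₀ ^ 2) ≤ C := by linarith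
    exact mul_le_mul_of_nonneg_right this (by positivity)
  · exact Real.le_sqrt_of_sq_le (by linarith)
  · rw [hsq]; linarith [sq_nonneg ‖ζ‖]

/-- A constant that dominates all coefficients in the bounds on the propagator. -/
def _root_.Hopfield.Medium.const (p : Medium) : ℝ :=
  (p.size + 120 + 6 * (p.g ^ 2 * p.χ) * (p.ω₀ ^ 2 + 1)
    + p.g ^ 2 * p.χ * (1 + (p.ω₀ ^ 4 + 1) / p.ω₀ ^ 2)) * (2 * p.rad)

theorem Medium.Good.const_bounds : 1 ≤ p.const ∧
    (p.size + 120 + 6 * (p.g ^ 2 * p.χ) * (p.ω₀ ^ 2 + 1)) * 2 ≤ p.const ∧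
    (p.size + 16 + p.g ^ 2 * p.χ * (1 + (p.ω₀ ^ 4 + 1) / p.ω₀ ^ 2)) * (2 * p.rad) ≤ p.const := by
  have hα := hp.α_pos; have hw := hp.w_pos
  have h1 := hp.le_rad
  have h2 := hp.one_le_size
  have h3 : 0 ≤ 6 * (p.g ^ 2 * p.χ) * (p.ω₀ ^ 2 + 1) := by positivity
  have h4 : 0 ≤ p.g ^ 2 * p.χ * (1 + (p.ω₀ ^ 4 + 1) / p.ω₀ ^ 2) := by positivity
  unfold Medium.const
  refine ⟨by nlinarith, ?_, ?_⟩
  · apply mul_le_mul <;> linarith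
  · exact mul_le_mul_of_nonneg_right (by linarith) (by linarith)

/-- The bound on the imaginary axis of `ω`. -/
theorem norm_contMatrix_le_axis {ε : ℝ} (hε : 0 ≤ ε) (hε1 : ε ≤ 1) (q : ℝ³) {y : ℝ}
    (hy : y ≠ 0) {a b : FieldIx} (hab : Diag a b) :
    ‖contMatrix p ε q (xStar p q + y * I) a b‖
      ≤ 10 * (p.const * (1 + len q) ^ 3) ^ 12 / (mSq p q + y ^ 2) := by
  have hq : InQuads ε (y * I) := by
    rcases lt_or_gt_of_ne hy with h | h
    · right; simp [InQuad, h, h.le]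
    · left; simp [InQuad, h, h.le]
  have h := norm_contMatrix_le_near hp hε hε1 (q := q) hq (κ := 1) le_rfl (by simp) hab
  have e : ‖(y : ℂ) * I‖ ^ 2 = y ^ 2 := by simp
  rw [e] at h
  refine h.trans ?_
  have hm0 := mSq_nonneg hp q
  have hQ := len_nonneg q
  have hc := hp.const_bounds
  have hc0 : 0 ≤ p.const := by linarith [hc.1]
  have hrad := hp.le_rad
  have hsz := hp.one_le_size
  have hα := hp.α_pos; have hw := hp.w_pos
  have h4 : 0 ≤ p.g ^ 2 * p.χ * (1 + (p.ω₀ ^ 4 + 1) / p.ω₀ ^ 2) := by positivity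
  have : 0 < y ^ 2 := by positivity
  have e1 : p.size + 16 + p.g ^ 2 * p.χ * (1 + (p.ω₀ ^ 4 + 1) / p.ω₀ ^ 2) ≤ p.const := by
    refine le_trans ?_ hc.2.2
    exact le_mul_of_one_le_right (by linarith) (by linarith)
  have e2 : (1 + len q) ^ 2 ≤ (1 + len q) ^ 3 := pow_le_pow_right₀ (by linarith) (by norm_num)
  rw [one_mul]
  gcongr

/-- The bound above the positive real axis of `ω`. -/
theorem norm_contMatrix_le_strip {ε : ℝ} (hε : 0 ≤ ε) (hε1 : ε ≤ 1) (q : ℝ³) {ζ : ℂ}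
    (hre : 0 ≤ ζ.re) (him : 0 < ζ.im) (him1 : ζ.im ≤ 1) {a b : FieldIx} (hab : Diag a b) :
    ‖contMatrix p ε q (xStar p q + ζ) a b‖
      ≤ 10 * (p.const * ((1 + len q) ^ 3 / ζ.im)) ^ 12 / (mSq p q + ‖ζ‖ ^ 2) := by
  have hm0 := mSq_nonneg hp q
  have hQ := len_nonneg q
  have hc := hp.const_bounds
  have hc0 : 0 ≤ p.const := by linarith [hc.1]
  have hrad := hp.le_rad
  have hsz := hp.one_le_size
  have hα := hp.α_pos; have hw := hp.w_pos
  have hn : 0 < ‖ζ‖ := norm_pos_iff.2 (by rintro rfl; simp at him)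
  have h4 : 0 ≤ p.g ^ 2 * p.χ * (1 + (p.ω₀ ^ 4 + 1) / p.ω₀ ^ 2) := by positivity
  have h5 : 0 ≤ 6 * (p.g ^ 2 * p.χ) * (p.ω₀ ^ 2 + 1) := by positivity
  rcases le_total (p.rad * (1 + len q + ε)) ‖ζ‖ with h | h
  · refine (norm_contMatrix_le_large hp hε h hab).trans ?_
    gcongr 10 * ?_ ^ 12 / _
    have e : 1 + len q ≤ (1 + len q) ^ 3 / ζ.im := by
      rw [le_div_iff₀ him]
      nlinarith [pow_le_pow_right₀ (by linarith : 1 ≤ 1 + len q) (by norm_num : 1 ≤ 3)]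
    calc _ ≤ (p.size + 120 + 6 * (p.g ^ 2 * p.χ) * (p.ω₀ ^ 2 + 1)) * (2 * (1 + len q)) := by
          gcongr; linarith
      _ = (p.size + 120 + 6 * (p.g ^ 2 * p.χ) * (p.ω₀ ^ 2 + 1)) * 2 * (1 + len q) := by ring
      _ ≤ p.const * (1 + len q) := mul_le_mul_of_nonneg_right hc.2.1 (by linarith)
      _ ≤ _ := by gcongr
  · have hq : InQuads ε ζ := Or.inl ⟨him.le, mul_nonneg hε hre, by
      have := mul_nonneg hε hre; linarith⟩
    have hκ : ‖ζ‖ ≤ 2 * p.rad * (1 + len q) / ζ.im * |ζ.im| := by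
      rw [abs_of_pos him, div_mul_cancel₀ _ him.ne']
      refine h.trans ?_
      nlinarith
    have hκ1 : 1 ≤ 2 * p.rad * (1 + len q) / ζ.im := by
      rw [le_div_iff₀ him]; nlinarith
    refine (norm_contMatrix_le_near hp hε hε1 (q := q) hq hκ1 hκ hab).trans ?_
    gcongr 10 * ?_ ^ 12 / _
    calc _ = (p.size + 16 + p.g ^ 2 * p.χ * (1 + (p.ω₀ ^ 4 + 1) / p.ω₀ ^ 2)) * (2 * p.rad)
          * ((1 + len q) ^ 3 / ζ.im) := by ring
      _ ≤ _ := by gcongr; exact hc.2.2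

end good

/-! ### The transverse modes -/

/-- Beyond the resonance the polynomial whose zeros are the frequencies of the transverse modes
becomes positive. -/
theorem exists_quartic_pos {m C v o : ℝ} (x : ℝ) (hm : 0 < m) (hC : 0 < C) (hv : 0 < v)
    (ho : 0 < o) : ∃ M, o / v < M ∧
      0 < (-m + 2 * x * M + M ^ 2) * ((v * M) ^ 2 - o ^ 2) - 4 * π * (C * (v * M) ^ 2) := by
  have hx0 := abs_nonneg x
  obtain ⟨D, hD⟩ : ∃ D, D = 4 * π * C := ⟨_, rfl⟩
  have hD0 : 0 < D := by rw [hD]; positivity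
  have hy : 0 < o / v := by positivity
  have hvy : v * (o / v) = o := by field_simp
  obtain ⟨M, hM⟩ : ∃ M, M = 1 + 2 * |x| + m + 2 * D + 2 * (o / v) := ⟨_, rfl⟩
  have hM1 : 1 ≤ M := by linarith
  refine ⟨M, by linarith, ?_⟩
  have h1 : 2 * D ≤ -m + 2 * x * M + M ^ 2 := by
    have e1 : -(2 * |x|) * M ≤ 2 * x * M :=
      mul_le_mul_of_nonneg_right (by linarith [neg_abs_le x]) (by linarith)
    have e2 : M * (2 * |x| + m + 2 * D) ≤ M * M :=
      mul_le_mul_of_nonneg_left (by linarith) (by linarith)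
    have e3 : m + 2 * D ≤ M * (m + 2 * D) := le_mul_of_one_le_left (by linarith) hM1
    linarith
  have h2 : 2 * o ≤ v * M := by
    have : v * (2 * (o / v)) ≤ v * M := mul_le_mul_of_nonneg_left (by linarith) hv.le
    linarith
  have h3 : (2 * o) ^ 2 ≤ (v * M) ^ 2 := by gcongr
  have h4 : 0 < o ^ 2 := by positivity
  have h5 : 2 * D * ((v * M) ^ 2 - o ^ 2)
      ≤ (-m + 2 * x * M + M ^ 2) * ((v * M) ^ 2 - o ^ 2) :=
    mul_le_mul_of_nonneg_right h1 (by linarith)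
  generalize (v * M) ^ 2 = U at *
  have h6 : D * (2 * (U - o ^ 2) - U) > 0 := mul_pos hD0 (by linarith)
  have h7 : 4 * π * (C * U) = D * U := by rw [hD]; ring
  linarith

section good

variable {p : Medium} (hp : p.Good)
include hp

theorem mink_four_v (q : ℝ³) (s : ℝ) : mink (four s q) p.v = p.v 0 * (s - xStar p q) := by
  have h := omC_fourC hp (s : ℂ) q
  rw [← toC_four] at h
  have e : p.omC (toC (four s q)) = ((mink (four s q) p.v : ℝ) : ℂ) := by
    simp [Medium.omC, Medium.vC, toC, mink]
  rw [e] at h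
  exact_mod_cast h

omit hp in
theorem mink_four_self (q : ℝ³) (s : ℝ) : mink (four s q) (four s q)
    = -mSq p q + 2 * xStar p q * (s - xStar p q) + (s - xStar p q) ^ 2 := by
  have h := mink_fourC (s : ℂ) q
  rw [← toC_four] at h
  have e : mink (toC (four s q)) (toC (four s q)) = ((mink (four s q) (four s q) : ℝ) : ℂ) := by
    simp [toC, mink]
  rw [e] at h
  have h' : mink (four s q) (four s q) = s ^ 2 - ∑ j, q j ^ 2 := by exact_mod_cast h
  rw [h', mSq]; ring

theorem DR_eq (q : ℝ³) (s : ℝ) : DR p q s =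
    (-mSq p q + 2 * xStar p q * (s - xStar p q) + (s - xStar p q) ^ 2) / (4 * π)
      - p.g ^ 2 * p.χ * p.ω₀ ^ 2 * (p.v 0 * (s - xStar p q)) ^ 2
        / ((p.v 0 * (s - xStar p q)) ^ 2 - p.ω₀ ^ 2) := by
  rw [DR, mink_four_v hp, mink_four_self]

/-- The derivative of the dispersion function. -/
theorem hasDerivAt_DR (q : ℝ³) (s : ℝ)
    (hu : (p.v 0 * (s - xStar p q)) ^ 2 ≠ p.ω₀ ^ 2) :
    HasDerivAt (DR p q) ((2 * xStar p q + 2 * (s - xStar p q)) / (4 * π)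
      + 2 * p.g ^ 2 * p.χ * p.ω₀ ^ 4 * p.v 0 ^ 2 * (s - xStar p q)
        / ((p.v 0 * (s - xStar p q)) ^ 2 - p.ω₀ ^ 2) ^ 2) s := by
  have hu' := sub_ne_zero.2 hu
  have h0 : HasDerivAt (fun s : ℝ => s - xStar p q) 1 s := (hasDerivAt_id s).sub_const _
  have h1 := ((h0.const_mul (p.v 0)).pow 2)
  have h2 := (((h0.const_mul (2 * xStar p q)).const_add (-mSq p q)).add (h0.pow 2)).div_const
    (4 * π)
  have h3 := (h1.const_mul (p.g ^ 2 * p.χ * p.ω₀ ^ 2)).div (h1.sub_const (p.ω₀ ^ 2)) hu'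
  have h4 := h2.sub h3
  have hfun : DR p q = fun s => _ := funext (DR_eq hp q)
  rw [hfun]
  refine h4.congr_deriv ?_
  simp only [Pi.pow_apply]
  generalize s - xStar p q = a at *
  rw [mul_pow, mul_comm] at hu'
  simp only [mul_pow]
  field_simp
  ring

theorem mul_deriv_DR (q : ℝ³) (s : ℝ)
    (hu : (p.v 0 * (s - xStar p q)) ^ 2 ≠ p.ω₀ ^ 2) :
    (s - xStar p q) * deriv (DR p q) s = DR p q s
      + ((s - xStar p q) ^ 2 + mSq p q) / (4 * π)
      + p.g ^ 2 * p.χ * p.ω₀ ^ 2 * (p.v 0 * (s - xStar p q)) ^ 2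
        * ((p.v 0 * (s - xStar p q)) ^ 2 + p.ω₀ ^ 2)
        / ((p.v 0 * (s - xStar p q)) ^ 2 - p.ω₀ ^ 2) ^ 2 := by
  have hu' := sub_ne_zero.2 hu
  rw [(hasDerivAt_DR hp q s hu).deriv, DR_eq hp]
  generalize s - xStar p q = a at *
  rw [mul_pow, mul_comm] at hu'
  simp only [mul_pow]
  field_simp
  ring

/-- At a zero of the dispersion function its derivative has the sign of `ω`. -/
theorem mul_deriv_DR_pos {q : ℝ³} (hq : q ≠ 0) {s : ℝ}
    (hu : (p.v 0 * (s - xStar p q)) ^ 2 ≠ p.ω₀ ^ 2) (h : DR p q s = 0) :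
    0 < (s - xStar p q) * deriv (DR p q) s := by
  rw [mul_deriv_DR hp q s hu, h]
  have := mSq_pos hp hq
  have := hp.α_pos
  have := Real.pi_pos
  have h1 : 0 < ((s - xStar p q) ^ 2 + mSq p q) / (4 * π) := by positivity
  have h2 : 0 ≤ p.g ^ 2 * p.χ * p.ω₀ ^ 2 * (p.v 0 * (s - xStar p q)) ^ 2
        * ((p.v 0 * (s - xStar p q)) ^ 2 + p.ω₀ ^ 2)
        / ((p.v 0 * (s - xStar p q)) ^ 2 - p.ω₀ ^ 2) ^ 2 := by positivity
  linarith

theorem mem_transverseModes_iff {q : ℝ³} (hq : q ≠ 0) {s : ℝ} :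
    s ∈ transverseModes p q ↔ (p.v 0 * (s - xStar p q)) ^ 2 ≠ p.ω₀ ^ 2 ∧ DR p q s = 0
      ∧ xStar p q < s := by
  rw [transverseModes, Set.mem_ofPred_eq, mink_four_v hp]
  constructor
  · rintro ⟨h1, h2, h3⟩
    have h4 := mul_deriv_DR_pos hp hq h1 h2
    have := pos_of_mul_pos_left h4 h3.le
    exact ⟨h1, h2, by linarith⟩
  · rintro ⟨h1, h2, h3⟩
    have h4 := mul_deriv_DR_pos hp hq h1 h2
    exact ⟨h1, h2, pos_of_mul_pos_right h4 (by linarith)⟩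

/-- Between two zeros of the dispersion function with `ω > 0` lies the resonance. -/
theorem DR_roots_separated {q : ℝ³} (hq : q ≠ 0) {s t : ℝ}
    (hs : s ∈ transverseModes p q) (ht : t ∈ transverseModes p q) (hst : s < t) :
    (p.v 0 * (s - xStar p q)) ^ 2 < p.ω₀ ^ 2 ∧ p.ω₀ ^ 2 < (p.v 0 * (t - xStar p q)) ^ 2 := by
  obtain ⟨hus, hs0, hsx⟩ := (mem_transverseModes_iff hp hq).1 hs
  obtain ⟨hut, ht0, htx⟩ := (mem_transverseModes_iff hp hq).1 ht
  rw [DR_eq hp] at hs0 ht0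
  have hm := mSq_pos hp hq
  have hα := hp.α_pos
  have hw := hp.w_pos
  have hv := hp.hv0
  have hπ := Real.pi_pos
  obtain ⟨a, ha⟩ : ∃ a, a = s - xStar p q := ⟨_, rfl⟩
  obtain ⟨b, hb⟩ : ∃ b, b = t - xStar p q := ⟨_, rfl⟩
  have ha0 : 0 < a := by rw [ha]; linarith
  have hab : a < b := by rw [ha, hb]; linarith
  rw [← ha] at hus hs0 ⊢
  rw [← hb] at hut ht0 ⊢
  generalize mSq p q = m at *
  generalize xStar p q = x at *
  have hus' := sub_ne_zero.2 hus
  have hut' := sub_ne_zero.2 hut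
  rw [mul_pow, mul_comm] at hus' hut'
  have hb0 : 0 < b := by linarith
  have key : (m / (a * b) + 1) * (b - a) / (4 * π)
      + p.g ^ 2 * p.χ * p.ω₀ ^ 2 * p.v 0 ^ 2 * (b - a) * (p.v 0 ^ 2 * a * b + p.ω₀ ^ 2)
        / (((p.v 0 * a) ^ 2 - p.ω₀ ^ 2) * ((p.v 0 * b) ^ 2 - p.ω₀ ^ 2)) = 0 := by
    have e : (m / (a * b) + 1) * (b - a) / (4 * π)
      + p.g ^ 2 * p.χ * p.ω₀ ^ 2 * p.v 0 ^ 2 * (b - a) * (p.v 0 ^ 2 * a * b + p.ω₀ ^ 2)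
        / (((p.v 0 * a) ^ 2 - p.ω₀ ^ 2) * ((p.v 0 * b) ^ 2 - p.ω₀ ^ 2))
      = ((-m + 2 * x * b + b ^ 2) / (4 * π)
      - p.g ^ 2 * p.χ * p.ω₀ ^ 2 * (p.v 0 * b) ^ 2
        / ((p.v 0 * b) ^ 2 - p.ω₀ ^ 2)) / b - ((-m + 2 * x * a + a ^ 2) / (4 * π)
      - p.g ^ 2 * p.χ * p.ω₀ ^ 2 * (p.v 0 * a) ^ 2
        / ((p.v 0 * a) ^ 2 - p.ω₀ ^ 2)) / a := by
      field_simp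
      ring
    rw [e, hs0, ht0]; simp
  have h1 : 0 < (m / (a * b) + 1) * (b - a) / (4 * π) := by
    have : 0 < b - a := by linarith
    positivity
  have hneg : ((p.v 0 * a) ^ 2 - p.ω₀ ^ 2) * ((p.v 0 * b) ^ 2 - p.ω₀ ^ 2) < 0 := by
    by_contra hc
    have h2 : 0 ≤ p.g ^ 2 * p.χ * p.ω₀ ^ 2 * p.v 0 ^ 2 * (b - a) * (p.v 0 ^ 2 * a * b + p.ω₀ ^ 2)
        / (((p.v 0 * a) ^ 2 - p.ω₀ ^ 2) * ((p.v 0 * b) ^ 2 - p.ω₀ ^ 2)) := by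
      have : 0 < b - a := by linarith
      apply div_nonneg (by positivity) (not_lt.1 hc)
    linarith
  have hlt : (p.v 0 * a) ^ 2 < (p.v 0 * b) ^ 2 := by gcongr
  constructor
  · by_contra hc
    have h2 : 0 < (p.v 0 * b) ^ 2 - p.ω₀ ^ 2 := by linarith
    nlinarith
  · by_contra hc
    have h2 : (p.v 0 * a) ^ 2 - p.ω₀ ^ 2 < 0 := by linarith
    nlinarith

theorem exists_transverseModes {q : ℝ³} (hq : q ≠ 0) :
    ∃ s t, s < t ∧ s ∈ transverseModes p q ∧ t ∈ transverseModes p q := by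
  have hm := mSq_pos hp hq
  have hα := hp.α_pos
  have hw := hp.w_pos
  have hv := hp.hv0
  have hπ := Real.pi_pos
  have hω := hp.hω
  obtain ⟨x, hx⟩ : ∃ x, x = xStar p q := ⟨_, rfl⟩
  obtain ⟨m, hmm⟩ : ∃ m, m = mSq p q := ⟨_, rfl⟩
  rw [← hmm] at hm
  obtain ⟨N, hN⟩ : ∃ N : ℝ → ℝ, N = fun a => (-m + 2 * x * a + a ^ 2)
    * ((p.v 0 * a) ^ 2 - p.ω₀ ^ 2) - 4 * π * (p.g ^ 2 * p.χ * p.ω₀ ^ 2 * (p.v 0 * a) ^ 2) :=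
    ⟨_, rfl⟩
  have hNc : Continuous N := by rw [hN]; fun_prop
  have hy : 0 < p.ω₀ / p.v 0 := by positivity
  have hvy : p.v 0 * (p.ω₀ / p.v 0) = p.ω₀ := by field_simp
  have hN0 : 0 < N 0 := by rw [hN]; simp; positivity
  have hN1 : N (p.ω₀ / p.v 0) < 0 := by
    rw [hN]; simp only [hvy]; simp; positivity
  have hroot : ∀ a, 0 < a → N a = 0 → a ≠ p.ω₀ / p.v 0 → x + a ∈ transverseModes p q := by
    intro a ha hNa hne
    rw [mem_transverseModes_iff hp hq]
    have h1 : x + a - xStar p q = a := by rw [hx]; ring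
    rw [DR_eq hp, h1, ← hx, ← hmm]
    have hu : (p.v 0 * a) ^ 2 ≠ p.ω₀ ^ 2 := by
      intro h
      rw [sq_eq_sq₀ (by positivity) hω.le] at h
      apply hne; field_simp; linarith
    have hu' := sub_ne_zero.2 hu
    refine ⟨hu, ?_, by linarith⟩
    have e : N a / (4 * π * ((p.v 0 * a) ^ 2 - p.ω₀ ^ 2)) = 0 := by rw [hNa, zero_div]
    rw [← e, hN]
    beta_reduce
    generalize (p.v 0 * a) ^ 2 = U at *
    field_simp
  obtain ⟨a, ⟨ha0, ha1⟩, haN⟩ : (0 : ℝ) ∈ N '' Set.Ioo 0 (p.ω₀ / p.v 0) :=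
    intermediate_value_Ioo' hy.le hNc.continuousOn ⟨hN1, hN0⟩
  obtain ⟨M, hM1, hM2⟩ : ∃ M, p.ω₀ / p.v 0 < M ∧ 0 < N M := by
    rw [hN]
    exact exists_quartic_pos x hm (by positivity) hv hω
  obtain ⟨b, ⟨hb0, hb1⟩, hbN⟩ : (0 : ℝ) ∈ N '' Set.Ioo (p.ω₀ / p.v 0) M :=
    intermediate_value_Ioo hM1.le hNc.continuousOn ⟨hN1, hM2⟩
  exact ⟨x + a, x + b, by linarith, hroot a ha0 haN ha1.ne, hroot b (hy.trans hb0) hbN hb0.ne'⟩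

/-- There are exactly two transverse modes with `ω > 0`. -/
theorem transverseModes_eq_pair {q : ℝ³} (hq : q ≠ 0) :
    ∃ s t, s < t ∧ transverseModes p q = {s, t} := by
  obtain ⟨s, t, hst, hs, ht⟩ := exists_transverseModes hp hq
  refine ⟨s, t, hst, Set.eq_of_subset_of_subset ?_ (by
    rintro r (rfl | rfl) <;> assumption)⟩
  intro r hr
  have h1 := DR_roots_separated hp hq hs ht hst
  by_contra hne
  simp only [Set.mem_insert_iff, Set.mem_singleton_iff, not_or] at hne
  rcases lt_or_gt_of_ne hne.1 with h | h
  · have := DR_roots_separated hp hq hr hs h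
    linarith [h1.1, this.2]
  · have h2 := DR_roots_separated hp hq hs hr h
    rcases lt_or_gt_of_ne hne.2 with h' | h'
    · have := DR_roots_separated hp hq hr ht h'
      linarith [h2.2, this.1]
    · have := DR_roots_separated hp hq ht hr h'
      linarith [h1.2, this.1]

theorem ncard_transverseModes {q : ℝ³} (hq : q ≠ 0) : (transverseModes p q).ncard = 2 := by
  obtain ⟨s, t, hst, h⟩ := transverseModes_eq_pair hp hq
  rw [h, Set.ncard_pair hst.ne]

theorem finite_transverseModes {q : ℝ³} (hq : q ≠ 0) : (transverseModes p q).Finite := by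
  obtain ⟨s, t, -, h⟩ := transverseModes_eq_pair hp hq
  rw [h]; exact Set.toFinite _

omit hp in
theorem xStar_neg (q : ℝ³) : xStar p (-q) = -xStar p q := by
  simp [xStar, neg_div]

omit hp in
theorem mSq_neg (q : ℝ³) : mSq p (-q) = mSq p q := by
  simp [mSq, xStar_neg]

theorem DR_neg (q : ℝ³) (s : ℝ) : DR p (-q) (-s) = DR p q s := by
  rw [DR_eq hp, DR_eq hp, xStar_neg, mSq_neg,
    show -s - -xStar p q = -(s - xStar p q) by ring]
  ring_nf

/-- The zeros of the dispersion function with `ω < 0` are the reflections of those with `ω > 0` at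
the opposite momentum. -/
theorem zero_DR_cases {q : ℝ³} (hq : q ≠ 0) {s : ℝ}
    (hu : (p.v 0 * (s - xStar p q)) ^ 2 ≠ p.ω₀ ^ 2) (h : DR p q s = 0) :
    s ∈ transverseModes p q ∨ -s ∈ transverseModes p (-q) := by
  have h1 := mul_deriv_DR_pos hp hq hu h
  have h2 : s - xStar p q ≠ 0 := by intro h0; rw [h0] at h1; simp at h1
  rcases lt_or_gt_of_ne h2 with h3 | h3
  · right
    rw [mem_transverseModes_iff hp (neg_ne_zero.2 hq), DR_neg hp, xStar_neg,
      show -s - -xStar p q = -(s - xStar p q) by ring, mul_neg, neg_sq]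
    exact ⟨hu, h, by linarith⟩
  · left
    rw [mem_transverseModes_iff hp hq]
    exact ⟨hu, h, by linarith⟩

end good

/-! ### Partial fractions -/

/-- The principal part of `f` at `a` is `c / (z - a) + d / (z - a)²`. -/
def HasPole (f : ℂ → ℂ) (a c d : ℂ) : Prop :=
  (fun z => f z - (c / (z - a) + d / (z - a) ^ 2)) =O[𝓝[≠] a] (fun _ => (1 : ℝ))

namespace HasPole

variable {f g φ : ℂ → ℂ} {a c d c' d' : ℂ}

theorem congr (hf : HasPole f a c d) (h : f =ᶠ[𝓝[≠] a] g) : HasPole g a c d :=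
  hf.congr' (h.mono fun z hz => by simp only [hz]) EventuallyEq.rfl

theorem add (hf : HasPole f a c d) (hg : HasPole g a c' d') :
    HasPole (fun z => f z + g z) a (c + c') (d + d') :=
  (IsBigO.add hf hg).congr_left fun z => by ring

theorem of_continuousAt (h : ContinuousAt φ a) : HasPole φ a 0 0 := by
  have : φ =O[𝓝[≠] a] (fun _ => (1 : ℝ)) :=
    (h.tendsto.mono_left nhdsWithin_le_nhds).isBigO_one ℝ
  refine this.congr_left fun z => by simp

/-- Multiplication by a holomorphic function. -/
theorem mul (hf : HasPole f a c d) (hφ : AnalyticAt ℂ φ a) :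
    HasPole (fun z => φ z * f z) a (φ a * c + deriv φ a * d) (φ a * d) := by
  obtain ⟨s, hs, hd⟩ : ∃ s ∈ 𝓝 a, DifferentiableOn ℂ φ s := by
    obtain ⟨s, hs, ho⟩ := hφ.exists_mem_nhds_analyticOnNhd
    exact ⟨s, hs, ho.differentiableOn⟩
  have hd1 := (Complex.differentiableOn_dslope hs).2 hd
  have hd2 := (Complex.differentiableOn_dslope hs).2 hd1
  have b0 : φ =O[𝓝[≠] a] (fun _ => (1 : ℝ)) :=
    (hφ.continuousAt.tendsto.mono_left nhdsWithin_le_nhds).isBigO_one ℝ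
  have b1 : dslope φ a =O[𝓝[≠] a] (fun _ => (1 : ℝ)) :=
    ((hd1.differentiableAt hs).continuousAt.tendsto.mono_left nhdsWithin_le_nhds).isBigO_one ℝ
  have b2 : dslope (dslope φ a) a =O[𝓝[≠] a] (fun _ => (1 : ℝ)) :=
    ((hd2.differentiableAt hs).continuousAt.tendsto.mono_left nhdsWithin_le_nhds).isBigO_one ℝ
  have h0 := b0.mul hf
  simp only [mul_one] at h0
  have h1 := (h0.add (b1.const_mul_left c)).add (b2.const_mul_left d)
  refine h1.congr' ?_ EventuallyEq.rfl
  filter_upwards [self_mem_nhdsWithin] with z hz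
  have hz' : z - a ≠ 0 := sub_ne_zero.2 hz
  have e1 : φ z = φ a + (z - a) * dslope φ a z := by
    have := sub_smul_dslope φ a z
    rw [smul_eq_mul] at this; linear_combination -this
  have e2 : dslope φ a z = deriv φ a + (z - a) * dslope (dslope φ a) a z := by
    have := sub_smul_dslope (dslope φ a) a z
    rw [smul_eq_mul, dslope_same] at this; linear_combination -this
  generalize dslope (dslope φ a) a z = y at *
  generalize dslope φ a z = x at *
  rw [e1, e2]
  field_simp
  ring

theorem const_mul (hf : HasPole f a c d) (r : ℂ) :
    HasPole (fun z => r * f z) a (r * c) (r * d) :=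
  ((IsBigO.const_mul_left hf r)).congr_left fun z => by ring

theorem sum {ι : Type*} {s : Finset ι} {f : ι → ℂ → ℂ} {c d : ι → ℂ}
    (h : ∀ i ∈ s, HasPole (f i) a (c i) (d i)) :
    HasPole (fun z => ∑ i ∈ s, f i z) a (∑ i ∈ s, c i) (∑ i ∈ s, d i) := by
  refine (IsBigO.sum h).congr_left fun z => ?_
  simp [Finset.sum_div, Finset.sum_add_distrib]

/-- A quotient with a simple zero in the denominator. -/
theorem simple {N P : ℂ → ℂ} (hN : AnalyticAt ℂ N a) (hP : AnalyticAt ℂ P a) (h0 : P a = 0)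
    (h1 : deriv P a ≠ 0) : HasPole (fun z => N z / P z) a (N a / deriv P a) 0 := by
  obtain ⟨s, hs, hd⟩ : ∃ s ∈ 𝓝 a, DifferentiableOn ℂ P s := by
    obtain ⟨s, hs, ho⟩ := hP.exists_mem_nhds_analyticOnNhd
    exact ⟨s, hs, ho.differentiableOn⟩
  have hd1 := (Complex.differentiableOn_dslope hs).2 hd
  have ha : AnalyticAt ℂ (dslope P a) a := hd1.analyticAt hs
  have hne : dslope P a a ≠ 0 := by rwa [dslope_same]
  have hb : HasPole (fun z => 1 / (z - a)) a 1 0 := by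
    have : (fun _ : ℂ => (0 : ℂ)) =O[𝓝[≠] a] (fun _ => (1 : ℝ)) := isBigO_zero _ _
    exact this.congr_left fun z => by simp
  have h := hb.mul (hN.div ha hne)
  simp only [Pi.div_apply, dslope_same, mul_one, mul_zero, add_zero] at h
  refine h.congr ?_
  filter_upwards [self_mem_nhdsWithin] with z hz
  have hz' : z - a ≠ 0 := sub_ne_zero.2 hz
  have := sub_smul_dslope P a z
  rw [smul_eq_mul, h0, sub_zero] at this
  rw [← this]
  field_simp

/-- A function which becomes holomorphic when multiplied by `(z - a)²`. -/
theorem double {G : ℂ → ℂ} (hG : AnalyticAt ℂ G a) :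
    HasPole (fun z => G z / (z - a) ^ 2) a (deriv G a) (G a) := by
  have hb : HasPole (fun z => 1 / (z - a) ^ 2) a 0 1 := by
    have : (fun _ : ℂ => (0 : ℂ)) =O[𝓝[≠] a] (fun _ => (1 : ℝ)) := isBigO_zero _ _
    exact this.congr_left fun z => by simp
  have h := hb.mul hG
  simp only [mul_one, mul_zero, zero_add] at h
  exact h.congr (.of_forall fun z => by ring)

theorem unique (h : HasPole f a c d) (h' : HasPole f a c' d') : c = c' ∧ d = d' := by
  have h1 : (fun z => (c - c') / (z - a) + (d - d') / (z - a) ^ 2)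
      =O[𝓝[≠] a] (fun _ => (1 : ℝ)) := (IsBigO.sub h' h).congr_left fun z => by ring
  have hz : Tendsto (fun z : ℂ => z - a) (𝓝[≠] a) (𝓝 0) := by
    have : Tendsto (fun z : ℂ => z - a) (𝓝 a) (𝓝 (a - a)) := by
      exact (continuous_id.sub continuous_const).tendsto a
    rw [sub_self] at this
    exact this.mono_left nhdsWithin_le_nhds
  have hz1 : (fun z : ℂ => z - a) =o[𝓝[≠] a] (fun _ => (1 : ℝ)) := (isLittleO_one_iff ℝ).2 hz
  have hd : d - d' = 0 := by
    have h2 := (hz1.mul_isBigO (hz1.isBigO.mul h1))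
    simp only [mul_one] at h2
    have h3 := (isLittleO_one_iff ℝ).1 h2
    have h4 : Tendsto (fun z : ℂ => (z - a) * (c - c') + (d - d')) (𝓝[≠] a) (𝓝 (d - d')) := by
      simpa using (hz.mul_const (c - c')).add_const (d - d')
    refine tendsto_nhds_unique (h4.congr' ?_) h3
    filter_upwards [self_mem_nhdsWithin] with z hz
    have hz' : z - a ≠ 0 := sub_ne_zero.2 hz
    field_simp
  have hc : c - c' = 0 := by
    have h2 := hz1.mul_isBigO h1
    simp only [mul_one] at h2
    have h3 := (isLittleO_one_iff ℝ).1 h2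
    refine tendsto_nhds_unique (tendsto_const_nhds.congr' ?_) h3
    filter_upwards [self_mem_nhdsWithin] with z hz
    have hz' : z - a ≠ 0 := sub_ne_zero.2 hz
    rw [hd]
    field_simp
    ring
  exact ⟨sub_eq_zero.1 hc, sub_eq_zero.1 hd⟩

end HasPole

/-- The sum of principal parts with poles in `A`. -/
def fracSum (A : Finset ℂ) (c d : ℂ → ℂ) (z : ℂ) : ℂ :=
  ∑ a ∈ A, (c a / (z - a) + d a / (z - a) ^ 2)

theorem hasPole_fracSum {A : Finset ℂ} {c d : ℂ → ℂ} {a : ℂ} (ha : a ∈ A) :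
    HasPole (fracSum A c d) a (c a) (d a) := by
  classical
  have h0 : HasPole (fun z => c a / (z - a) + d a / (z - a) ^ 2) a (c a) (d a) := by
    have : (fun _ : ℂ => (0 : ℂ)) =O[𝓝[≠] a] (fun _ => (1 : ℝ)) := isBigO_zero _ _
    exact this.congr_left fun z => by simp
  have h1 : HasPole (fun z => ∑ b ∈ A.erase a, (c b / (z - b) + d b / (z - b) ^ 2)) a 0 0 := by
    apply HasPole.of_continuousAt
    refine tendsto_finsetSum _ fun b hb => ?_
    have hne : a - b ≠ 0 := sub_ne_zero.2 (Finset.ne_of_mem_erase hb).symm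
    have hne2 : (a - b) ^ 2 ≠ 0 := pow_ne_zero _ hne
    have : ContinuousAt (fun z : ℂ => c b / (z - b) + d b / (z - b) ^ 2) a := by fun_prop (disch := assumption)
    exact this
  have h2 := h0.add h1
  rw [add_zero, add_zero] at h2
  refine h2.congr (.of_forall fun z => ?_)
  simp only [fracSum]
  rw [Finset.add_sum_erase A (fun b => c b / (z - b) + d b / (z - b) ^ 2) ha]

theorem tendsto_inv_sub_cocompact (a : ℂ) :
    Tendsto (fun z : ℂ => (z - a)⁻¹) (cocompact ℂ) (𝓝 0) := by
  have : Tendsto (fun z : ℂ => z - a) (cocompact ℂ) (cocompact ℂ) := by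
    simpa [sub_eq_add_neg] using (Homeomorph.addRight (-a)).isClosedEmbedding.tendsto_cocompact
  exact tendsto_inv₀_cobounded.comp (by rwa [← Metric.cobounded_eq_cocompact] at this ⊢)

theorem tendsto_fracSum (A : Finset ℂ) (c d : ℂ → ℂ) :
    Tendsto (fracSum A c d) (cocompact ℂ) (𝓝 0) := by
  have : Tendsto (fracSum A c d) (cocompact ℂ) (𝓝 (∑ a ∈ A, (c a * 0 + d a * 0 ^ 2))) := by
    refine tendsto_finsetSum _ fun a _ => ?_
    have h := tendsto_inv_sub_cocompact a
    have h2 := (h.const_mul (c a)).add ((h.pow 2).const_mul (d a))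
    refine h2.congr fun z => ?_
    rw [div_eq_mul_inv, div_eq_mul_inv, inv_pow]
  simpa using this

/-- A function which is holomorphic except for poles of order at most two, and vanishes at
infinity, is the sum of its principal parts. -/
theorem eq_fracSum {A : Finset ℂ} {f c d : ℂ → ℂ} (hd : ∀ z ∉ A, DifferentiableAt ℂ f z)
    (hp : ∀ a ∈ A, HasPole f a (c a) (d a)) (hf : Tendsto f (cocompact ℂ) (𝓝 0)) :
    ∀ z ∉ A, f z = fracSum A c d z := by
  obtain ⟨g, hg⟩ : ∃ g, g = fun z => f z - fracSum A c d z := ⟨_, rfl⟩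
  have hgd : ∀ z ∉ A, DifferentiableAt ℂ g z := by
    intro z hz
    rw [hg]
    refine (hd z hz).sub (DifferentiableAt.fun_sum fun a ha => ?_)
    have : z - a ≠ 0 := sub_ne_zero.2 fun h => hz (h ▸ ha)
    have h2 : (z - a) ^ 2 ≠ 0 := pow_ne_zero _ this
    fun_prop (disch := assumption)
  have hev : ∀ a, ∀ᶠ z in 𝓝[≠] a, z ∉ A := by
    intro a
    have : (((A.erase a : Finset ℂ) : Set ℂ)ᶜ) ∈ 𝓝 a :=
      (A.erase a).finite_toSet.isClosed.isOpen_compl.mem_nhds (by simp)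
    filter_upwards [nhdsWithin_le_nhds this, self_mem_nhdsWithin] with z hz hne hzA
    exact hz (Finset.mem_coe.2 (Finset.mem_erase.2 ⟨hne, hzA⟩))
  obtain ⟨G, hG⟩ : ∃ G : ℂ → ℂ, G = fun a => limUnder (𝓝[≠] a) g := ⟨_, rfl⟩
  have hGg : ∀ z ∉ A, G z = g z := by
    intro z hz
    rw [hG]
    exact ((hgd z hz).continuousAt.tendsto.mono_left nhdsWithin_le_nhds).limUnder_eq
  have hGd : Differentiable ℂ G := by
    intro a
    by_cases ha : a ∈ A
    · have hbd : g =O[𝓝[≠] a] (fun _ => (1 : ℝ)) := by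
        have h1 := (hp a ha).sub (hasPole_fracSum (c := c) (d := d) ha)
        rw [hg]
        exact h1.congr_left fun z => by ring
      obtain ⟨C, hC⟩ := hbd.bound
      have hs := (hC.and (hev a))
      rw [eventually_nhdsWithin_iff] at hs
      have hsd : DifferentiableOn ℂ g ({z | z ∈ ({a}ᶜ : Set ℂ) → ‖g z‖ ≤ C * ‖(1 : ℝ)‖ ∧ z ∉ A} \ {a}) :=
        fun z hz => (hgd z (hz.1 hz.2).2).differentiableWithinAt
      have hU := Complex.differentiableOn_update_limUnder_of_bddAbove hs hsd ⟨C * ‖(1 : ℝ)‖, by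
        rintro _ ⟨z, hz, rfl⟩
        exact (hz.1 hz.2).1⟩
      refine (hU.differentiableAt hs).congr_of_eventuallyEq ?_
      have := hev a
      rw [eventually_nhdsWithin_iff] at this
      filter_upwards [this] with z hz
      by_cases hza : z = a
      · subst hza; simp [hG]
      · rw [Function.update_of_ne hza, hGg z (hz hza)]
    · refine (hgd a ha).congr_of_eventuallyEq ?_
      have : ((A : Set ℂ)ᶜ) ∈ 𝓝 a := A.finite_toSet.isClosed.isOpen_compl.mem_nhds (by simpa using ha)
      filter_upwards [this] with z hz using hGg z (by simpa using hz)
  have hGt : Tendsto G (cocompact ℂ) (𝓝 0) := by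
    have h1 : Tendsto g (cocompact ℂ) (𝓝 0) := by
      rw [hg]; simpa using hf.sub (tendsto_fracSum A c d)
    refine h1.congr' ?_
    filter_upwards [A.finite_toSet.isCompact.compl_mem_cocompact] with z hz
    exact (hGg z (by simpa using hz)).symm
  intro z hz
  have := hGd.apply_eq_of_tendsto_cocompact z hGt
  rw [hGg z hz, hg] at this
  exact sub_eq_zero.1 this

/-- Multiplication by `z` acts on the coefficients of a sum of principal parts. -/
theorem mul_fracSum {A : Finset ℂ} {c d : ℂ → ℂ} {z : ℂ} (hz : z ∉ A) :
    z * fracSum A c d z = ∑ a ∈ A, c a + fracSum A (fun a => a * c a + d a) (fun a => a * d a) z := by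
  rw [fracSum, fracSum, Finset.mul_sum, ← Finset.sum_add_distrib]
  refine Finset.sum_congr rfl fun a ha => ?_
  have : z - a ≠ 0 := sub_ne_zero.2 fun h => hz (h ▸ ha)
  field_simp
  ring

theorem eventually_notMem_cocompact (A : Finset ℂ) : ∀ᶠ z in cocompact ℂ, z ∉ A := by
  filter_upwards [A.finite_toSet.isCompact.compl_mem_cocompact] with z hz
  simpa using hz

/-- The sum of the residues is the coefficient of `1/z` at infinity. -/
theorem sum_coeff_eq {A : Finset ℂ} {f c d : ℂ → ℂ} {r : ℂ} (hf : ∀ z ∉ A, f z = fracSum A c d z)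
    (h : Tendsto (fun z => z * f z) (cocompact ℂ) (𝓝 r)) : ∑ a ∈ A, c a = r := by
  have h1 : Tendsto (fun z => ∑ a ∈ A, c a
      + fracSum A (fun a => a * c a + d a) (fun a => a * d a) z) (cocompact ℂ)
      (𝓝 (∑ a ∈ A, c a + 0)) := (tendsto_fracSum _ _ _).const_add _
  rw [add_zero] at h1
  refine tendsto_nhds_unique h1 (h.congr' ?_)
  filter_upwards [eventually_notMem_cocompact A] with z hz
  rw [hf z hz, mul_fracSum hz]

theorem sub_eq_fracSum {A : Finset ℂ} {f c d : ℂ → ℂ} {r : ℂ} (hf : ∀ z ∉ A, f z = fracSum A c d z)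
    (hr : ∑ a ∈ A, c a = r) : ∀ z ∉ A, z * f z - r
      = fracSum A (fun a => a * c a + d a) (fun a => a * d a) z := by
  intro z hz
  rw [hf z hz, mul_fracSum hz, hr]; ring

/-! ### Exponential polynomials -/

/-- The exponential polynomial `∑ (c - i t d) e^{-i a t}`: the sum of the residues of
`e^{-i z t} fracSum A c d z`. -/
def expSum (A : Finset ℂ) (c d : ℂ → ℂ) (t : ℝ) : ℂ :=
  ∑ a ∈ A, (c a - I * t * d a) * cexp (-I * a * t)

theorem hasDerivAt_expSum (A : Finset ℂ) (c d : ℂ → ℂ) (t : ℝ) :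
    HasDerivAt (expSum A c d)
      (-I * expSum A (fun a => a * c a + d a) (fun a => a * d a) t) t := by
  have h : ∀ a ∈ A, HasDerivAt (fun t : ℝ => (c a - I * t * d a)
      * cexp (-I * a * t)) (-(I * 1 * d a) * cexp (-I * a * t)
      + (c a - I * t * d a) * (cexp (-I * a * t) * (-I * a * 1))) t := by
    intro a _
    have h0 : HasDerivAt (fun t : ℝ => (t : ℂ)) 1 t := Complex.ofRealCLM.hasDerivAt
    exact (((h0.const_mul I).mul_const (d a)).const_sub (c a)).mul
      ((h0.const_mul (-I * a)).cexp)
  refine (HasDerivAt.fun_sum h).congr_deriv ?_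
  rw [expSum, Finset.mul_sum]
  refine Finset.sum_congr rfl fun a _ => ?_
  ring

theorem deriv_expSum (A : Finset ℂ) (c d : ℂ → ℂ) :
    deriv (expSum A c d)
      = fun t => -I * expSum A (fun a => a * c a + d a) (fun a => a * d a) t :=
  funext fun t => (hasDerivAt_expSum A c d t).deriv

theorem deriv_deriv_expSum (A : Finset ℂ) (c d : ℂ → ℂ) :
    deriv (deriv (expSum A c d)) = fun t => -expSum A (fun a => a * (a * c a + d a) + a * d a)
      (fun a => a * (a * d a)) t := by
  rw [deriv_expSum]
  funext t
  rw [((hasDerivAt_expSum A _ _ t).const_mul (-I)).deriv]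
  rw [← mul_assoc, show -I * -I = -1 by simp]; ring

theorem expSum_zero (A : Finset ℂ) (c d : ℂ → ℂ) : expSum A c d 0 = ∑ a ∈ A, c a := by
  simp [expSum]

/-! ### Deformation of the contour -/

/-- The region swept when the real axis is deformed to the contour which comes from `-i∞`, turns
right at `iδ` and goes to `+∞ + iδ`. -/
def cornerRegion (δ : ℝ) : Set ℂ :=
  {ζ | (ζ.re ≤ 0 ∧ ζ.im ≤ 0) ∨ (0 ≤ ζ.re ∧ 0 ≤ ζ.im ∧ ζ.im ≤ δ)}

/-- The integral over the contour which comes from `-i∞`, turns right at `iδ` and goes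
to `+∞ + iδ`. -/
def cornerIntegral (δ : ℝ) (G : ℂ → ℂ) : ℂ :=
  I * (∫ y in Iic δ, G (y * I)) + ∫ x in Ioi (0 : ℝ), G (x + δ * I)

theorem integrableOn_of_le {h : ℝ → ℂ} {S : Set ℝ} {C : ℝ} (hS : MeasurableSet S)
    (hc : ContinuousOn h S) (hb : ∀ x ∈ S, ‖h x‖ ≤ C / (1 + x ^ 2)) : IntegrableOn h S := by
  refine ((integrable_inv_one_add_sq.const_mul C).integrableOn (s := S)).mono'
    (hc.aestronglyMeasurable hS) ?_
  filter_upwards [ae_restrict_mem hS] with x hx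
  rw [← div_eq_mul_inv]; exact hb x hx

theorem div_one_add_le {C x y : ℝ} (hC : 0 ≤ C) (h : x ^ 2 ≤ y) : C / (1 + y) ≤ C / (1 + x ^ 2) := by
  have := sq_nonneg x
  gcongr

theorem tendsto_mul_div_one_add_sq (K : ℝ) :
    Tendsto (fun T : ℝ => T * (K / (1 + T ^ 2))) atTop (𝓝 0) := by
  have h : Tendsto (fun T : ℝ => |K| * T⁻¹) atTop (𝓝 0) := by
    simpa using tendsto_inv_atTop_zero.const_mul |K|
  refine squeeze_zero_norm' ?_ h
  filter_upwards [eventually_gt_atTop 0] with T hT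
  rw [norm_mul, norm_div, Real.norm_eq_abs, Real.norm_eq_abs, Real.norm_eq_abs, abs_of_pos hT,
    abs_of_pos (by positivity : 0 < 1 + T ^ 2)]
  rw [← div_eq_mul_inv, mul_div_assoc', div_le_div_iff₀ (by positivity) hT]
  nlinarith [abs_nonneg K]

theorem sq_le_norm_sq_re (ζ : ℂ) : ζ.re ^ 2 ≤ ‖ζ‖ ^ 2 := by
  rw [← sq_abs]; gcongr; exact Complex.abs_re_le_norm ζ

theorem sq_le_norm_sq_im (ζ : ℂ) : ζ.im ^ 2 ≤ ‖ζ‖ ^ 2 := by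
  rw [← sq_abs]; gcongr; exact Complex.abs_im_le_norm ζ

section corner

variable {G : ℂ → ℂ} {δ C : ℝ}

theorem bound_nonneg (hb : ∀ ζ ∈ cornerRegion δ, ‖G ζ‖ ≤ C / (1 + ‖ζ‖ ^ 2)) : 0 ≤ C := by
  have := (norm_nonneg _).trans (hb 0 (by simp [cornerRegion]))
  simpa using this

theorem integrableOn_vertical (hc : ContinuousOn G (cornerRegion δ))
    (hb : ∀ ζ ∈ cornerRegion δ, ‖G ζ‖ ≤ C / (1 + ‖ζ‖ ^ 2)) :
    IntegrableOn (fun y : ℝ => G (y * I)) (Iic δ) := by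
  have hm : MapsTo (fun y : ℝ => (y * I : ℂ)) (Iic δ) (cornerRegion δ) := by
    intro y hy
    have : y ≤ δ := hy
    rcases le_total y 0 with h | h <;> simp [cornerRegion, h, this]
  refine integrableOn_of_le (C := C) measurableSet_Iic (hc.comp (by fun_prop) hm) fun y hy => ?_
  refine (hb _ (hm hy)).trans (div_one_add_le (bound_nonneg hb) ?_)
  simp

theorem integrableOn_horizontal (hc : ContinuousOn G (cornerRegion δ))
    (hb : ∀ ζ ∈ cornerRegion δ, ‖G ζ‖ ≤ C / (1 + ‖ζ‖ ^ 2)) {b : ℝ} (hb0 : 0 ≤ b) (hbδ : b ≤ δ) :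
    IntegrableOn (fun x : ℝ => G (x + b * I)) (Ioi 0) := by
  have hm : MapsTo (fun x : ℝ => (x + b * I : ℂ)) (Ioi 0) (cornerRegion δ) := by
    intro x hx
    have : (0 : ℝ) ≤ x := le_of_lt hx
    simp [cornerRegion, hb0, hbδ, this]
  refine integrableOn_of_le (C := C) measurableSet_Ioi (hc.comp (by fun_prop) hm) fun y hy => ?_
  refine (hb _ (hm hy)).trans (div_one_add_le (bound_nonneg hb) ?_)
  simpa using sq_le_norm_sq_re (y + b * I)

theorem integrableOn_real_neg (hc : ContinuousOn G (cornerRegion δ))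
    (hb : ∀ ζ ∈ cornerRegion δ, ‖G ζ‖ ≤ C / (1 + ‖ζ‖ ^ 2)) :
    IntegrableOn (fun x : ℝ => G x) (Iic 0) := by
  have hm : MapsTo (fun x : ℝ => (x : ℂ)) (Iic 0) (cornerRegion δ) := by
    intro x hx
    have : x ≤ 0 := hx
    simp [cornerRegion, this]
  refine integrableOn_of_le (C := C) measurableSet_Iic (hc.comp (by fun_prop) hm) fun y hy => ?_
  refine (hb _ (hm hy)).trans (div_one_add_le (bound_nonneg hb) ?_)
  simp

/-- **Cauchy's theorem** for the contour of `cornerIntegral`. -/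
theorem integral_eq_cornerIntegral (hδ : 0 ≤ δ) (hd : DifferentiableOn ℂ G (cornerRegion δ))
    (hb : ∀ ζ ∈ cornerRegion δ, ‖G ζ‖ ≤ C / (1 + ‖ζ‖ ^ 2)) :
    ∫ x : ℝ, G x = cornerIntegral δ G := by
  have hC := bound_nonneg hb
  have hv := integrableOn_vertical hd.continuousOn hb
  have hn := integrableOn_real_neg hd.continuousOn hb
  have hp : IntegrableOn (fun x : ℝ => G x) (Ioi 0) := by
    simpa using integrableOn_horizontal hd.continuousOn hb le_rfl hδ
  have hh := integrableOn_horizontal hd.continuousOn hb hδ le_rfl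
  -- the quadrant
  have h1 : ∫ x in Iic (0 : ℝ), G x = I * ∫ y in Iic (0 : ℝ), G (y * I) := by
    have t1 : Tendsto (fun T : ℝ => ∫ x in (-T)..0, G x) atTop (𝓝 (∫ x in Iic (0 : ℝ), G x)) :=
      intervalIntegral_tendsto_integral_Iic 0 hn tendsto_neg_atTop_atBot
    have t2 : Tendsto (fun T : ℝ => I * ∫ y in (-T)..0, G (y * I)) atTop
        (𝓝 (I * ∫ y in Iic (0 : ℝ), G (y * I))) :=
      (intervalIntegral_tendsto_integral_Iic 0
        (hv.mono_set (Iic_subset_Iic.2 hδ)) tendsto_neg_atTop_atBot).const_mul _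
    have t3 : Tendsto (fun T : ℝ => ∫ x in (-T)..0, G (x + (-T : ℝ) * I)) atTop (𝓝 0) := by
      refine squeeze_zero_norm' ?_ (tendsto_mul_div_one_add_sq C)
      filter_upwards [eventually_ge_atTop 0] with T hT
      refine (intervalIntegral.norm_integral_le_of_norm_le_const (C := C / (1 + T ^ 2))
        fun x hx => ?_).trans_eq ?_
      · rw [uIoc_of_le (by linarith)] at hx
        refine (hb _ (Or.inl ?_)).trans (div_one_add_le hC ?_)
        · simp [hT, hx.2]
        · simpa using sq_le_norm_sq_im (x + (-T : ℝ) * I)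
      · rw [sub_neg_eq_add, zero_add, abs_of_nonneg hT, mul_comm]
    have t4 : Tendsto (fun T : ℝ => ∫ y in (-T)..0, G ((-T : ℝ) + y * I)) atTop (𝓝 0) := by
      refine squeeze_zero_norm' ?_ (tendsto_mul_div_one_add_sq C)
      filter_upwards [eventually_ge_atTop 0] with T hT
      refine (intervalIntegral.norm_integral_le_of_norm_le_const (C := C / (1 + T ^ 2))
        fun x hx => ?_).trans_eq ?_
      · rw [uIoc_of_le (by linarith)] at hx
        refine (hb _ (Or.inl ?_)).trans (div_one_add_le hC ?_)
        · simp [hT, hx.2]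
        · simpa using sq_le_norm_sq_re ((-T : ℝ) + x * I)
      · rw [sub_neg_eq_add, zero_add, abs_of_nonneg hT, mul_comm]
    refine tendsto_nhds_unique t1 ?_
    have t5 := (t2.add t3).sub (t4.const_mul I)
    rw [add_zero, mul_zero, sub_zero] at t5
    refine t5.congr' ?_
    filter_upwards [eventually_ge_atTop 0] with T hT
    have hr := Complex.integral_boundary_rect_eq_zero_of_differentiableOn G ⟨-T, -T⟩ 0 (hd.mono (by
      intro ζ hζ
      rw [Complex.zero_re, Complex.zero_im, uIcc_of_le (by simpa using hT), Complex.mem_reProdIm] at hζ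
      exact Or.inl ⟨hζ.1.2, hζ.2.2⟩))
    simp only [Complex.zero_re, Complex.zero_im, smul_eq_mul, Complex.ofReal_zero, zero_mul,
      add_zero, zero_add] at hr
    linear_combination hr
  -- the strip
  have h2 : ∫ x in Ioi (0 : ℝ), G x = (∫ x in Ioi (0 : ℝ), G (x + δ * I))
      + I * ∫ y in (0 : ℝ)..δ, G (y * I) := by
    have t1 : Tendsto (fun T : ℝ => ∫ x in (0 : ℝ)..T, G x) atTop (𝓝 (∫ x in Ioi (0 : ℝ), G x)) :=
      intervalIntegral_tendsto_integral_Ioi 0 hp tendsto_id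
    have t2 : Tendsto (fun T : ℝ => ∫ x in (0 : ℝ)..T, G (x + δ * I)) atTop
        (𝓝 (∫ x in Ioi (0 : ℝ), G (x + δ * I))) :=
      intervalIntegral_tendsto_integral_Ioi 0 hh tendsto_id
    have t3 : Tendsto (fun T : ℝ => ∫ y in (0 : ℝ)..δ, G ((T : ℝ) + y * I)) atTop (𝓝 0) := by
      have := (tendsto_mul_div_one_add_sq C).const_mul δ
      rw [mul_zero] at this
      refine squeeze_zero_norm' ?_ this
      filter_upwards [eventually_ge_atTop 1] with T hT
      refine (intervalIntegral.norm_integral_le_of_norm_le_const (C := C / (1 + T ^ 2))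
        fun x hx => ?_).trans ?_
      · rw [uIoc_of_le hδ] at hx
        refine (hb _ (Or.inr ?_)).trans (div_one_add_le hC ?_)
        · simp [hx.2, hx.1.le, zero_le_one.trans hT]
        · simpa using sq_le_norm_sq_re ((T : ℝ) + x * I)
      · rw [sub_zero, abs_of_nonneg hδ, mul_comm]
        refine mul_le_mul_of_nonneg_left (le_mul_of_one_le_left (by positivity) hT) hδ
    refine tendsto_nhds_unique t1 ?_
    have t5 := (t2.sub (t3.const_mul I)).add_const
      (I * ∫ y in (0 : ℝ)..δ, G (y * I))
    rw [mul_zero, sub_zero] at t5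
    refine t5.congr' ?_
    filter_upwards [eventually_ge_atTop 0] with T hT
    have hr := Complex.integral_boundary_rect_eq_zero_of_differentiableOn G 0 ⟨T, δ⟩ (hd.mono (by
      intro ζ hζ
      rw [Complex.zero_re, Complex.zero_im, uIcc_of_le hT, uIcc_of_le hδ, Complex.mem_reProdIm] at hζ
      exact Or.inr ⟨hζ.1.1, hζ.2⟩))
    simp only [Complex.zero_re, Complex.zero_im, smul_eq_mul, Complex.ofReal_zero, zero_mul,
      add_zero, zero_add] at hr
    linear_combination -hr
  have h3 : (∫ y in Iic (0 : ℝ), G (y * I)) + ∫ y in (0 : ℝ)..δ, G (y * I)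
      = ∫ y in Iic δ, G (y * I) :=
    by rw [← intervalIntegral.integral_Iic_sub_Iic (hv.mono_set (Iic_subset_Iic.2 hδ)) hv]; ring
  have h4 : ∫ x : ℝ, G x = (∫ x in Iic (0 : ℝ), G x) + ∫ x in Ioi (0 : ℝ), G x :=
    (intervalIntegral.integral_Iic_add_Ioi hn hp).symm
  rw [h4, h1, h2, cornerIntegral, ← h3]
  ring

end corner

/-! ### Fourier transforms of partial fractions -/

theorem integrableOn_mul_exp {μ : ℂ} (hμ : μ.re < 0) :
    IntegrableOn (fun t : ℝ => (t : ℂ) * cexp (μ * t)) (Ioi 0) := by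
  have h := integrableOn_rpow_mul_exp_neg_mul_rpow (s := 1) (p := 1) (b := -μ.re) (by norm_num)
    one_pos (by linarith)
  refine Integrable.mono' h (by fun_prop) ?_
  filter_upwards [ae_restrict_mem measurableSet_Ioi] with t ht
  simp [Complex.norm_exp, abs_of_pos (mem_Ioi.1 ht)]

theorem integral_mul_exp {μ : ℂ} (hμ : μ.re < 0) :
    ∫ t in Ioi (0 : ℝ), (t : ℂ) * cexp (μ * t) = 1 / μ ^ 2 := by
  have hμ0 : μ ≠ 0 := by rintro rfl; simp at hμ
  have hd : ∀ t ∈ Ici (0 : ℝ), HasDerivAt (fun t : ℝ => ((t : ℂ) / μ - 1 / μ ^ 2)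
      * cexp (μ * t)) ((t : ℂ) * cexp (μ * t)) t := by
    intro t _
    have h0 : HasDerivAt (fun t : ℝ => (t : ℂ)) 1 t := Complex.ofRealCLM.hasDerivAt
    refine (((h0.div_const μ).sub_const (1 / μ ^ 2)).mul (h0.const_mul μ).cexp).congr_deriv ?_
    field_simp; ring
  have e : ∀ n : ℕ, Tendsto (fun t : ℝ => (t : ℂ) ^ n * cexp (μ * t)) atTop (𝓝 0) := fun n => by
    rw [tendsto_zero_iff_norm_tendsto_zero]
    refine (tendsto_rpow_mul_exp_neg_mul_atTop_nhds_zero n (-μ.re) (by linarith)).congr' ?_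
    filter_upwards [eventually_gt_atTop 0] with t ht
    simp [Complex.norm_exp, abs_of_pos ht]
  have ht := ((e 1).const_mul (1 / μ)).sub ((e 0).const_mul (1 / μ ^ 2))
  simp only [mul_zero, sub_zero] at ht
  rw [integral_Ioi_of_hasDerivAt_of_tendsto' hd (integrableOn_mul_exp hμ)
    (ht.congr fun t => by ring)]
  simp

theorem integrableOn_linear_mul_exp {μ : ℂ} (hμ : μ.re < 0) (c d : ℂ) :
    IntegrableOn (fun t : ℝ => (c + t * d) * cexp (μ * t)) (Ioi 0) := by
  have h := ((integrableOn_exp_mul_complex_Ioi hμ 0).const_mul c).add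
    ((integrableOn_mul_exp hμ).const_mul d)
  refine IntegrableOn.congr_fun h (fun t _ => ?_) measurableSet_Ioi
  simp only [Pi.add_apply]; ring

theorem integral_linear_mul_exp {μ : ℂ} (hμ : μ.re < 0) (c d : ℂ) :
    ∫ t in Ioi (0 : ℝ), (c + t * d) * cexp (μ * t) = -c / μ + d / μ ^ 2 := by
  have e : ∀ t : ℝ, (c + t * d) * cexp (μ * t)
      = c * cexp (μ * t) + d * (t * cexp (μ * t)) := fun t => by ring
  simp_rw [e]
  rw [integral_add ((integrableOn_exp_mul_complex_Ioi hμ 0).const_mul c)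
    ((integrableOn_mul_exp hμ).const_mul d), integral_const_mul, integral_const_mul,
    integral_exp_mul_complex_Ioi hμ, integral_mul_exp hμ]
  simp; ring

/-- The function whose Fourier transform is `c / (s - a) + d / (s - a)²`. -/
def poleTransform (a c d : ℂ) (t : ℝ) : ℂ :=
  if a.im < 0 then
    (if 0 < t then -I * ((c - I * t * d) * cexp (-I * a * t)) else 0)
  else
    (if t < 0 then I * ((c - I * t * d) * cexp (-I * a * t)) else 0)

theorem poleTransform_spec {a : ℂ} (ha : a.im ≠ 0) (c d : ℂ) (s : ℝ) :
    Integrable (fun t : ℝ => cexp (I * s * t) * poleTransform a c d t) ∧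
    ∫ t : ℝ, cexp (I * s * t) * poleTransform a c d t
      = c / (s - a) + d / (s - a) ^ 2 := by
  have hsa : (s : ℂ) - a ≠ 0 := by
    intro h
    have := congrArg Complex.im h
    simp at this; exact ha this
  rcases lt_or_gt_of_ne ha with h | h
  · have hμ : (I * (s - a)).re < 0 := by simpa using h
    have e : (fun t : ℝ => cexp (I * s * t) * poleTransform a c d t)
        = indicator (Ioi 0) (fun t : ℝ => (-I * c + t * -d)
          * cexp (I * (s - a) * t)) := by
      funext t
      simp only [poleTransform, if_pos h, indicator, mem_Ioi]
      split_ifs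
      · rw [show I * (s - a) * t = I * s * t + -I * a * t by ring,
          Complex.exp_add]
        linear_combination (cexp (I * s * t) * cexp (-I * a * t)
          * t * d) * Complex.I_sq
      · simp
    rw [e, integrable_indicator_iff measurableSet_Ioi, integral_indicator measurableSet_Ioi]
    refine ⟨integrableOn_linear_mul_exp hμ _ _, ?_⟩
    rw [integral_linear_mul_exp hμ]
    have : I ^ 2 = -1 := Complex.I_sq
    rw [mul_pow, this]
    field_simp
  · have hμ : (-(I * (s - a))).re < 0 := by simpa using h
    have e : (fun t : ℝ => cexp (I * s * t) * poleTransform a c d t)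
        = fun t : ℝ => indicator (Ioi 0) (fun t : ℝ => (I * c + t * -d)
          * cexp (-(I * (s - a)) * t)) (-t) := by
      funext t
      simp only [poleTransform, if_neg h.not_gt, indicator, mem_Ioi, Left.neg_pos_iff]
      split_ifs
      · rw [show -(I * (s - a)) * ((-t : ℝ) : ℂ) = I * s * t + -I * a * t by
          push_cast; ring, Complex.exp_add]
        push_cast
        linear_combination (-cexp (I * s * t) * cexp (-I * a * t)
          * t * d) * Complex.I_sq
      · simp
    have hi := integrableOn_linear_mul_exp hμ (I * c) (-d)
    rw [e]
    refine ⟨(((integrable_indicator_iff measurableSet_Ioi).2 hi)).comp_neg, ?_⟩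
    rw [integral_neg_eq_self (fun t : ℝ => indicator (Ioi 0) (fun t : ℝ => (I * c + t * -d)
          * cexp (-(I * (s - a)) * t)) t), integral_indicator measurableSet_Ioi,
      integral_linear_mul_exp hμ]
    have : I ^ 2 = -1 := Complex.I_sq
    rw [neg_sq, mul_pow, this]
    field_simp

theorem continuousAt_poleTransform (a c d : ℂ) {t : ℝ} (ht : 0 < t) :
    ContinuousAt (poleTransform a c d) t := by
  by_cases h : a.im < 0
  · have : poleTransform a c d =ᶠ[𝓝 t] fun t : ℝ =>
        -I * ((c - I * t * d) * cexp (-I * a * t)) := by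
      filter_upwards [lt_mem_nhds ht] with s hs
      simp [poleTransform, h, hs]
    exact ContinuousAt.congr (by fun_prop) this.symm
  · have : poleTransform a c d =ᶠ[𝓝 t] fun t : ℝ => 0 := by
      filter_upwards [lt_mem_nhds ht] with s hs
      simp [poleTransform, h, hs.not_gt]
    exact ContinuousAt.congr (by fun_prop) this.symm

/-- The Fourier integral of partial fractions at a positive time: only the poles in the lower
half-plane contribute. The pole `b` in the upper half-plane makes the integral converge. -/
theorem integral_exp_mul_frac {a b : ℂ} (c d : ℂ) (ha : a.im ≠ 0) (hb : 0 < b.im)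
    (hi : Integrable fun s : ℝ => c / (s - a) + d / (s - a) ^ 2 - c / (s - b)) {t : ℝ} (ht : 0 < t) :
    ∫ s : ℝ, cexp (-I * s * t) * (c / (s - a) + d / (s - a) ^ 2 - c / (s - b))
      = -(2 * π * I) * if a.im < 0 then (c - I * t * d) * cexp (-I * a * t) else 0 := by
  obtain ⟨f, hf⟩ : ∃ f : ℝ → ℂ, f = fun s : ℝ => c / (s - a) + d / (s - a) ^ 2 - c / (s - b) :=
    ⟨_, rfl⟩
  have sa := poleTransform_spec ha c d
  have sb := poleTransform_spec hb.ne' c 0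
  have hgi : Integrable (poleTransform a c d - poleTransform b c 0) := by
    simpa using (sa 0).1.sub (sb 0).1
  have hF : ∀ w : ℝ, FourierTransform.fourier (poleTransform a c d - poleTransform b c 0) w
      = f (-(2 * π) * w) := by
    intro w
    rw [Real.fourier_real_eq_integral_exp_smul, hf]
    have h := integral_sub (sa (-(2 * π) * w)).1 (sb (-(2 * π) * w)).1
    rw [(sa _).2, (sb _).2, zero_div, add_zero] at h
    beta_reduce
    rw [← h]
    refine integral_congr_ae (.of_forall fun v => ?_)
    simp only [smul_eq_mul, Pi.sub_apply, ← mul_sub]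
    congr 2
    push_cast; ring
  have hFi : Integrable (FourierTransform.fourier (poleTransform a c d - poleTransform b c 0)) := by
    rw [funext hF]
    exact (hf ▸ hi : Integrable f).comp_mul_left' (by simp [Real.pi_ne_zero])
  have hinv := hgi.fourierInv_fourier_eq hFi
    ((continuousAt_poleTransform a c d ht).sub (continuousAt_poleTransform b c 0 ht))
  rw [Real.fourierInv_eq'] at hinv
  have hscale := Measure.integral_comp_mul_left (fun s : ℝ => cexp (-I * s * t) * f s) (-(2 * π))
  have e2 : ∀ w : ℝ, cexp (↑(2 * π * inner ℝ w t) * I) • f (-(2 * π) * w)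
      = cexp (-I * ((-(2 * π) * w : ℝ) : ℂ) * t) * f (-(2 * π) * w) := by
    intro w
    rw [smul_eq_mul]
    congr 2
    simp; ring
  simp_rw [hF, e2] at hinv
  rw [hscale, abs_inv, abs_neg, abs_of_pos Real.two_pi_pos, Complex.real_smul, Complex.ofReal_inv,
    inv_mul_eq_iff_eq_mul₀ (by simp [Real.pi_ne_zero]), hf] at hinv
  rw [hinv]
  simp only [Pi.sub_apply, poleTransform, if_pos ht, if_neg ht.not_gt, if_neg hb.not_gt]
  split_ifs
  · push_cast; ring
  · simp

/-! ### The contour integral of partial fractions -/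

theorem isClosed_cornerRegion (δ : ℝ) : IsClosed (cornerRegion δ) := by
  have h1 : IsClosed {ζ : ℂ | ζ.re ≤ 0 ∧ ζ.im ≤ 0} :=
    (isClosed_le Complex.continuous_re continuous_const).inter
      (isClosed_le Complex.continuous_im continuous_const)
  have h2 : IsClosed {ζ : ℂ | 0 ≤ ζ.re ∧ 0 ≤ ζ.im ∧ ζ.im ≤ δ} :=
    (isClosed_le continuous_const Complex.continuous_re).inter
      ((isClosed_le continuous_const Complex.continuous_im).inter
      (isClosed_le Complex.continuous_im continuous_const))
  exact h1.union h2

theorem norm_exp_le {ζ : ℂ} {t δ : ℝ} (ht : 0 ≤ t) (h : ζ.im ≤ δ) :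
    ‖cexp (-I * ζ * t)‖ ≤ Real.exp (δ * t) := by
  rw [Complex.norm_exp]
  apply Real.exp_le_exp.2
  have : (-I * ζ * t).re = ζ.im * t := by simp
  rw [this]
  gcongr

theorem im_le_of_mem_cornerRegion {δ : ℝ} (hδ : 0 ≤ δ) {ζ : ℂ} (h : ζ ∈ cornerRegion δ) : ζ.im ≤ δ := by
  rcases h with h | h
  · linarith [h.2]
  · exact h.2.2

/-- Away from its poles, a partial fraction without `1/z` term at infinity decays like `1/z²`. -/
theorem exists_bound_frac (a b c d : ℂ) {r : ℝ} (hr : 0 < r) : ∃ C, ∀ ζ : ℂ, r ≤ ‖ζ - a‖ →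
    r ≤ ‖ζ - b‖ → ‖c / (ζ - a) + d / (ζ - a) ^ 2 - c / (ζ - b)‖ ≤ C / (1 + ‖ζ‖ ^ 2) := by
  have key : ∀ a : ℂ, ∃ K, ∀ ζ : ℂ, r ≤ ‖ζ - a‖ → (‖ζ - a‖⁻¹) ^ 2 ≤ K / (1 + ‖ζ‖ ^ 2) := by
    refine fun a => ⟨2 + (1 + 2 * ‖a‖ ^ 2) / r ^ 2, fun ζ h => ?_⟩
    have h0 := hr.trans_le h
    have h1 : ‖ζ‖ ≤ ‖ζ - a‖ + ‖a‖ := by simpa using norm_add_le (ζ - a) a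
    have h2 : 1 + 2 * ‖a‖ ^ 2 ≤ (1 + 2 * ‖a‖ ^ 2) / r ^ 2 * ‖ζ - a‖ ^ 2 := by
      rw [div_mul_eq_mul_div, le_div_iff₀ (by positivity)]; gcongr
    rw [inv_pow, ← one_div, div_le_div_iff₀ (by positivity) (by positivity)]
    nlinarith [pow_le_pow_left₀ (norm_nonneg _) h1 2, sq_nonneg (‖ζ - a‖ - ‖a‖)]
  obtain ⟨K, hK⟩ := key a
  obtain ⟨K', hK'⟩ := key b
  refine ⟨‖c * (a - b)‖ * (K + K') + ‖d‖ * K, fun ζ ha hb => ?_⟩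
  have ha0 : ζ - a ≠ 0 := norm_pos_iff.1 (hr.trans_le ha)
  have hb0 : ζ - b ≠ 0 := norm_pos_iff.1 (hr.trans_le hb)
  have e : c / (ζ - a) + d / (ζ - a) ^ 2 - c / (ζ - b)
      = c * (a - b) * ((ζ - a)⁻¹ * (ζ - b)⁻¹) + d * (ζ - a)⁻¹ ^ 2 := by field_simp; ring
  rw [e, add_div, mul_div_assoc, mul_div_assoc, add_div]
  refine (norm_add_le _ _).trans (add_le_add ?_ ?_)
  · rw [norm_mul _ (_ * _), norm_mul (ζ - a)⁻¹, norm_inv, norm_inv]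
    refine mul_le_mul_of_nonneg_left ?_ (norm_nonneg _)
    nlinarith [hK ζ ha, hK' ζ hb, sq_nonneg (‖ζ - a‖⁻¹ - ‖ζ - b‖⁻¹), sq_nonneg ‖ζ - a‖⁻¹,
      sq_nonneg ‖ζ - b‖⁻¹]
  · rw [norm_mul, norm_pow, norm_inv]
    exact mul_le_mul_of_nonneg_left (hK ζ ha) (norm_nonneg _)

/-- The integral of `G` over the contour of `cornerIntegral` converges absolutely to `v`. -/
def HasCorner (δ : ℝ) (G : ℂ → ℂ) (v : ℂ) : Prop :=
  IntegrableOn (fun y : ℝ => G (y * I)) (Iic δ) ∧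
    IntegrableOn (fun x : ℝ => G (x + δ * I)) (Ioi 0) ∧ cornerIntegral δ G = v

theorem HasCorner.const_mul {δ : ℝ} {G : ℂ → ℂ} {v : ℂ} (h : HasCorner δ G v) (k : ℂ) :
    HasCorner δ (fun ζ => k * G ζ) (k * v) := by
  refine ⟨h.1.const_mul k, h.2.1.const_mul k, ?_⟩
  rw [← h.2.2, cornerIntegral, integral_const_mul, integral_const_mul, cornerIntegral]; ring

theorem HasCorner.sum {ι : Type*} {A : Finset ι} {δ : ℝ} {G : ι → ℂ → ℂ} {v : ι → ℂ}
    (h : ∀ i ∈ A, HasCorner δ (G i) (v i)) :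
    HasCorner δ (fun ζ => ∑ i ∈ A, G i ζ) (∑ i ∈ A, v i) := by
  refine ⟨integrable_finsetSum _ fun i hi => (h i hi).1,
    integrable_finsetSum _ fun i hi => (h i hi).2.1, ?_⟩
  rw [cornerIntegral, integral_finsetSum _ fun i hi => (h i hi).1,
    integral_finsetSum _ fun i hi => (h i hi).2.1, Finset.mul_sum, ← Finset.sum_add_distrib]
  exact Finset.sum_congr rfl fun i hi => (h i hi).2.2

theorem HasCorner.shift {δ σ : ℝ} {G : ℂ → ℂ} {v : ℂ}
    (h : HasCorner (δ - σ) (fun ζ => G (ζ + σ * I)) v) : HasCorner δ G v := by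
  have e1 : (fun y : ℝ => G (y * I + σ * I)) = (fun y : ℝ => G (y * I)) ∘ (· + σ) := by
    funext y; simp [add_mul]
  have e2 : (fun x : ℝ => G (x + (δ - σ : ℝ) * I + σ * I)) = fun x : ℝ => G (x + δ * I) := by
    funext x; congr 1; push_cast; ring
  have hm := measurePreserving_add_right (volume : Measure ℝ) σ
  have he := measurableEmbedding_addRight (G := ℝ) σ
  obtain ⟨h1, h2, h3⟩ := h
  rw [cornerIntegral] at h3
  beta_reduce at h2 h3
  rw [e1, ← preimage_add_const_Iic] at h1 h3
  rw [e2] at h2 h3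
  have e3 := hm.setIntegral_preimage_emb he (fun y : ℝ => G (y * I)) (Iic δ)
  exact ⟨(hm.integrableOn_comp_preimage he).1 h1, h2, by rw [← h3, cornerIntegral, ← e3]; rfl⟩

/-- The contour integral of a partial fraction whose poles lie off the region swept by the
contour. -/
theorem hasCorner_frac {a b : ℂ} (c d : ℂ) {δ t r : ℝ} (hδ : 0 ≤ δ) (ht : 0 < t) (hr : 0 < r)
    (ha : a.im ≠ 0) (hb : 0 < b.im) (hab : ∀ ζ ∈ cornerRegion δ, r ≤ ‖ζ - a‖ ∧ r ≤ ‖ζ - b‖) :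
    HasCorner δ (fun ζ => cexp (-I * ζ * t) * (c / (ζ - a) + d / (ζ - a) ^ 2 - c / (ζ - b)))
      (-(2 * π * I) * if a.im < 0 then (c - I * t * d) * cexp (-I * a * t) else 0) := by
  obtain ⟨C, hC⟩ := exists_bound_frac a b c d hr
  have hb0 : ∀ ζ ∈ cornerRegion δ, ‖c / (ζ - a) + d / (ζ - a) ^ 2 - c / (ζ - b)‖
      ≤ C / (1 + ‖ζ‖ ^ 2) := fun ζ hζ => hC ζ (hab ζ hζ).1 (hab ζ hζ).2
  have hd0 : DifferentiableOn ℂ (fun ζ => c / (ζ - a) + d / (ζ - a) ^ 2 - c / (ζ - b))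
      (cornerRegion δ) := by
    intro ζ hζ
    have h1 : ζ - a ≠ 0 := norm_pos_iff.1 (hr.trans_le (hab ζ hζ).1)
    have h2 : ζ - b ≠ 0 := norm_pos_iff.1 (hr.trans_le (hab ζ hζ).2)
    have h3 := pow_ne_zero 2 h1
    fun_prop (disch := assumption)
  have hb1 : ∀ ζ ∈ cornerRegion δ, ‖cexp (-I * ζ * t) * (c / (ζ - a) + d / (ζ - a) ^ 2
      - c / (ζ - b))‖ ≤ Real.exp (δ * t) * C / (1 + ‖ζ‖ ^ 2) := by
    intro ζ hζ
    rw [norm_mul, mul_div_assoc]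
    exact mul_le_mul (norm_exp_le ht.le (im_le_of_mem_cornerRegion hδ hζ)) (hb0 ζ hζ)
      (norm_nonneg _) (Real.exp_pos _).le
  have hd1 : DifferentiableOn ℂ (fun ζ => cexp (-I * ζ * t) * (c / (ζ - a) + d / (ζ - a) ^ 2
      - c / (ζ - b))) (cornerRegion δ) := DifferentiableOn.fun_mul (by fun_prop) hd0
  refine ⟨integrableOn_vertical hd1.continuousOn hb1,
    integrableOn_horizontal hd1.continuousOn hb1 hδ le_rfl, ?_⟩
  rw [← integral_eq_cornerIntegral hδ hd1 hb1]
  refine integral_exp_mul_frac c d ha hb ?_ ht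
  rw [← integrableOn_univ, ← Iic_union_Ioi (a := (0 : ℝ))]
  refine (integrableOn_real_neg hd0.continuousOn hb0).union ?_
  simpa using integrableOn_horizontal hd0.continuousOn hb0 le_rfl hδ

/-- The contour integral of a partial fraction with a real pole `a ≠ 0` and a pole above the
contour: the residue at `a` is picked up if `a` lies to the right of the corner. -/
theorem hasCorner_real {a : ℝ} (ha : a ≠ 0) (c d : ℂ) {δ t : ℝ} (hδ : 0 < δ) (ht : 0 < t) :
    HasCorner δ (fun ζ => cexp (-I * ζ * t) * (c / (ζ - a) + d / (ζ - a) ^ 2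
      - c / (ζ - (2 * δ : ℝ) * I)))
      (-(2 * π * I) * if 0 < a then (c - I * t * d) * cexp (-I * a * t) else 0) := by
  -- the contour is shifted vertically, so that `a` leaves the region it sweeps
  have key : ∀ σ : ℝ, (0 < a ↔ 0 < σ) → σ ≠ 0 → σ ≤ δ → -δ ≤ σ → HasCorner δ (fun ζ =>
      cexp (-I * ζ * t) * (c / (ζ - a) + d / (ζ - a) ^ 2 - c / (ζ - (2 * δ : ℝ) * I)))
      (-(2 * π * I) * if 0 < a then (c - I * t * d) * cexp (-I * a * t) else 0) := by
    intro σ h0 h1 h2 h3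
    refine HasCorner.shift (σ := σ) ?_
    convert (hasCorner_frac (a := a - σ * I) (b := (2 * δ - σ : ℝ) * I) (δ := δ - σ) c d
      (sub_nonneg.2 h2) ht (lt_min (abs_pos.2 ha) (lt_min (abs_pos.2 h1) hδ)) (by simpa using h1)
      (by simp; linarith) fun ζ hζ => ?_).const_mul (cexp (σ * t)) using 1
    · funext ζ
      rw [← mul_assoc, ← Complex.exp_add]
      congr 1
      · congr 1; linear_combination -σ * t * Complex.I_sq
      · push_cast; ring
    · have e : cexp (-I * a * t) = cexp (σ * t) * cexp (-I * (a - σ * I) * t) := by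
        rw [← Complex.exp_add]; congr 1; linear_combination -σ * t * Complex.I_sq
      have h4 : (a - σ * I : ℂ).im < 0 ↔ 0 < a := by simp [h0]
      rw [if_congr h4 rfl rfl, e]; split_ifs <;> ring
    · have hm := im_le_of_mem_cornerRegion (sub_nonneg.2 h2) hζ
      have hre := Complex.abs_re_le_norm (ζ - (a - σ * I))
      have him := Complex.abs_im_le_norm (ζ - (a - σ * I))
      simp only [Complex.sub_re, Complex.sub_im, Complex.ofReal_re, Complex.ofReal_im,
        Complex.re_ofReal_mul, Complex.im_ofReal_mul, Complex.I_re, Complex.I_im] at hre him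
      constructor
      · rcases lt_or_gt_of_ne ha with h | h
        · have h5 : σ < 0 := lt_of_le_of_ne (not_lt.1 fun h' => h.not_gt (h0.2 h')) h1
          rcases hζ with hζ | hζ
          · refine (min_le_right _ _).trans ((min_le_left _ _).trans (le_trans ?_ him))
            rw [abs_of_neg h5]; exact le_trans (by linarith [hζ.2]) (neg_le_abs _)
          · refine (min_le_left _ _).trans (le_trans ?_ hre)
            rw [abs_of_neg h]; exact le_trans (by linarith [hζ.1]) (le_abs_self _)
        · rcases hζ with hζ | hζ
          · refine (min_le_left _ _).trans (le_trans ?_ hre)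
            rw [abs_of_pos h]; exact le_trans (by linarith [hζ.1]) (neg_le_abs _)
          · refine (min_le_right _ _).trans ((min_le_left _ _).trans (le_trans ?_ him))
            rw [abs_of_pos (h0.1 h)]; exact le_trans (by linarith [hζ.2.1]) (le_abs_self _)
      · refine (min_le_right _ _).trans ((min_le_right _ _).trans
          (le_trans ?_ ((neg_le_abs _).trans (Complex.abs_im_le_norm _))))
        simp only [Complex.sub_im, Complex.im_ofReal_mul, Complex.I_im]; linarith
  rcases lt_or_gt_of_ne ha with h | h
  · exact key (-δ) (iff_of_false h.not_gt (by linarith)) (by linarith) (by linarith) le_rfl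
  · exact key δ (by simp [h, hδ]) hδ.ne' le_rfl (by linarith)

/-- The contour integral of partial fractions with real poles `a ≠ x` picks up the residues of the
poles with `x < a`. -/
theorem cornerIntegral_fracSum {A : Finset ℂ} {c d : ℂ → ℂ} (hc : ∑ a ∈ A, c a = 0) (x : ℝ)
    (hA : ∀ a ∈ A, a.im = 0 ∧ a.re ≠ x) {δ t : ℝ} (hδ : 0 < δ) (ht : 0 < t) :
    cornerIntegral δ (fun ζ => cexp (-I * (x + ζ) * t) * fracSum A c d (x + ζ))
      = -(2 * π * I) * expSum (A.filter (x < ·.re)) c d t := by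
  have hre : ∀ a ∈ A, a = (a.re : ℂ) := fun a ha => Complex.ext rfl (by simp [(hA a ha).1])
  have h := (HasCorner.sum (A := A) fun a ha => hasCorner_real (sub_ne_zero.2 (hA a ha).2) (c a) (d a)
    hδ ht).const_mul (cexp (-I * x * t))
  rw [expSum, Finset.sum_filter, Finset.mul_sum]
  convert h.2.2 using 2
  · funext ζ
    have e : fracSum A c d (x + ζ) = ∑ a ∈ A, (c a / (ζ - (a.re - x : ℝ))
        + d a / (ζ - (a.re - x : ℝ)) ^ 2 - c a / (ζ - (2 * δ : ℝ) * I)) := by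
      rw [Finset.sum_sub_distrib, ← Finset.sum_div, hc, zero_div, sub_zero]
      refine Finset.sum_congr rfl fun a ha => ?_
      conv_lhs => rw [hre a ha]
      push_cast
      rw [show ζ - ((a.re : ℂ) - x) = x + ζ - a.re by ring, ← hre a ha]
    rw [e, ← Finset.mul_sum, ← mul_assoc, ← Complex.exp_add]
    congr 2; ring
  · rw [Finset.mul_sum]
    refine Finset.sum_congr rfl fun a ha => ?_
    have e : cexp (-I * a * t) = cexp (-I * x * t) * cexp (-I * (a.re - x : ℝ) * t) := by
      rw [← Complex.exp_add, hre a ha]; push_cast; simp; ring_nf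
    rw [e, if_congr sub_pos rfl rfl]; split_ifs <;> ring

/-! ### The poles of the propagator -/

/-- `k²` as a function of the energy. -/
def zS (q : ℝ³) (z : ℂ) : ℂ := z ^ 2 - ((∑ j, q j ^ 2 : ℝ) : ℂ)

/-- `ω` as a function of the energy. -/
def zO (p : Medium) (q : ℝ³) (z : ℂ) : ℂ := p.v 0 * (z - xStar p q)

/-- `ω² - ω₀²` as a function of the energy. -/
def zU (p : Medium) (q : ℝ³) (z : ℂ) : ℂ := zO p q z ^ 2 - (p.ω₀ : ℂ) ^ 2

/-- `ω² - ω̄²` as a function of the energy. -/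
def zH (p : Medium) (q : ℝ³) (z : ℂ) : ℂ :=
  zU p q z - 4 * π * p.g ^ 2 * p.χ * (p.ω₀ : ℂ) ^ 2

/-- The dispersion function of the transverse modes, with its denominator cleared, as a function of
the energy. -/
def zD (p : Medium) (q : ℝ³) (z : ℂ) : ℂ :=
  zS q z * zU p q z / (4 * π) - p.g ^ 2 * p.χ * (p.ω₀ : ℂ) ^ 2 * zO p q z ^ 2

/-- The propagator without regularization, as a function of the energy. -/
def resolvent (p : Medium) (q : ℝ³) (z : ℂ) : Matrix FieldIx FieldIx ℂ :=
  regProp p (mink (fourC z q) (fourC z q)) ((p.ω₀ : ℂ) ^ 2) (fourC z q)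

/-- The momenta for which the poles of the propagator are as separated as they can be: neither the
free photon nor the transverse modes cross the b-mode. -/
structure Generic (p : Medium) (q : ℝ³) : Prop where
  ne_zero : q ≠ 0
  bar_ne_zero : ∀ z, zH p q z = 0 → zS q z ≠ 0
  bar_ne : ∀ z, zH p q z = 0 → zS q z ≠ (barSq p : ℂ)

/-- The energies at which the propagator has poles. -/
def nodeSet (p : Medium) (q : ℝ³) : Set ℂ :=
  {z | zS q z = 0 ∨ zH p q z = 0 ∨ zD p q z = 0}

open Classical in
/-- The energies at which the propagator has poles, as a finite set. -/
def nodes (p : Medium) (q : ℝ³) : Finset ℂ :=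
  if h : (nodeSet p q).Finite then h.toFinset else ∅

theorem mink_fourC_eq_zS (q : ℝ³) (z : ℂ) : mink (fourC z q) (fourC z q) = zS q z :=
  mink_fourC z q

@[fun_prop]
theorem analyticAt_zS (q : ℝ³) (a : ℂ) : AnalyticAt ℂ (zS q) a := by
  unfold zS; fun_prop

@[fun_prop]
theorem analyticAt_zO (p : Medium) (q : ℝ³) (a : ℂ) : AnalyticAt ℂ (zO p q) a := by
  unfold zO; fun_prop

@[fun_prop]
theorem analyticAt_zU (p : Medium) (q : ℝ³) (a : ℂ) : AnalyticAt ℂ (zU p q) a := by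
  unfold zU; fun_prop

@[fun_prop]
theorem analyticAt_zH (p : Medium) (q : ℝ³) (a : ℂ) : AnalyticAt ℂ (zH p q) a := by
  unfold zH; fun_prop

@[fun_prop]
theorem analyticAt_zD (p : Medium) (q : ℝ³) (a : ℂ) : AnalyticAt ℂ (zD p q) a := by
  unfold zD; fun_prop

@[fun_prop]
theorem analyticAt_fourC (q : ℝ³) (μ : Fin 4) (a : ℂ) :
    AnalyticAt ℂ (fun z => fourC z q μ) a := by
  refine Fin.cases ?_ (fun j => ?_) μ
  · simp only [fourC, Matrix.cons_val_zero]; fun_prop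
  · simp only [fourC, Matrix.cons_val_succ]; fun_prop

theorem hasDerivAt_zS (q : ℝ³) (a : ℂ) : HasDerivAt (zS q) (2 * a) a := by
  have := ((hasDerivAt_id a).pow 2).sub_const ((∑ j, q j ^ 2 : ℝ) : ℂ)
  refine this.congr_deriv ?_
  simp

theorem hasDerivAt_zO (p : Medium) (q : ℝ³) (a : ℂ) : HasDerivAt (zO p q) (p.v 0) a := by
  have := ((hasDerivAt_id a).sub_const (xStar p q : ℂ)).const_mul (p.v 0 : ℂ)
  exact this.congr_deriv (by simp)

theorem hasDerivAt_zU (p : Medium) (q : ℝ³) (a : ℂ) :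
    HasDerivAt (zU p q) (2 * p.v 0 * zO p q a) a := by
  have := ((hasDerivAt_zO p q a).pow 2).sub_const ((p.ω₀ : ℂ) ^ 2)
  exact this.congr_deriv (by simp; ring)

theorem hasDerivAt_zH (p : Medium) (q : ℝ³) (a : ℂ) :
    HasDerivAt (zH p q) (2 * p.v 0 * zO p q a) a :=
  (hasDerivAt_zU p q a).sub_const _

theorem hasDerivAt_zD (p : Medium) (q : ℝ³) (a : ℂ) :
    HasDerivAt (zD p q) ((2 * a * zU p q a + zS q a * (2 * p.v 0 * zO p q a)) / (4 * π)
      - p.g ^ 2 * p.χ * (p.ω₀ : ℂ) ^ 2 * (2 * p.v 0 * zO p q a)) a := by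
  have := (((hasDerivAt_zS q a).mul (hasDerivAt_zU p q a)).div_const (4 * π : ℂ)).sub
    (((hasDerivAt_zO p q a).pow 2).const_mul (p.g ^ 2 * p.χ * (p.ω₀ : ℂ) ^ 2))
  refine this.congr_deriv ?_
  push_cast
  ring

theorem zS_ofReal (q : ℝ³) (s : ℝ) : zS q s = (mink (four s q) (four s q) : ℝ) := by
  rw [← mink_fourC_eq_zS, ← toC_four]; simp [mink, toC]

theorem zS_neg (q : ℝ³) (z : ℂ) : zS (-q) (-z) = zS q z := by simp [zS]

theorem zO_neg (p : Medium) (q : ℝ³) (z : ℂ) : zO p (-q) (-z) = -zO p q z := by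
  simp [zO, xStar_neg]; ring

theorem zU_neg (p : Medium) (q : ℝ³) (z : ℂ) : zU p (-q) (-z) = zU p q z := by
  simp [zU, zO_neg]

theorem zH_neg (p : Medium) (q : ℝ³) (z : ℂ) : zH p (-q) (-z) = zH p q z := by
  simp [zH, zU_neg]

theorem zD_neg (p : Medium) (q : ℝ³) (z : ℂ) : zD p (-q) (-z) = zD p q z := by
  simp [zD, zU_neg, zS_neg, zO_neg]

theorem Generic.neg {p : Medium} {q : ℝ³} (h : Generic p q) : Generic p (-q) := by
  refine ⟨neg_ne_zero.2 h.ne_zero, fun z hz => ?_, fun z hz => ?_⟩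
  · have h1 := zH_neg p q (-z)
    have h2 := zS_neg q (-z)
    rw [neg_neg] at h1 h2
    rw [h2]; exact h.bar_ne_zero _ (by rw [← h1, hz])
  · have h1 := zH_neg p q (-z)
    have h2 := zS_neg q (-z)
    rw [neg_neg] at h1 h2
    rw [h2]; exact h.bar_ne _ (by rw [← h1, hz])

theorem zS_eq_zero_iff {q : ℝ³} {z : ℂ} : zS q z = 0 ↔ z = len q ∨ z = -len q := by
  rw [zS, ← len_sq, sub_eq_zero]; push_cast; rw [sq_eq_sq_iff_eq_or_eq_neg]

section good

variable {p : Medium} (hp : p.Good) {q : ℝ³}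
include hp

theorem bar_pos : 0 < bar p := by
  have := hp.w_pos; have := hp.α_pos; have := Real.pi_pos
  rw [bar, barSq]
  apply Real.sqrt_pos.2
  have : 0 < p.ω₀ ^ 2 * (1 + 4 * π * (p.g ^ 2 * p.χ)) := by positivity
  linarith

theorem bar_sq : bar p ^ 2 = barSq p := by
  have h := bar_pos hp
  rw [bar] at h ⊢
  exact Real.sq_sqrt (Real.sqrt_pos.1 h).le

omit hp in
theorem zH_eq (q : ℝ³) (z : ℂ) : zH p q z = zO p q z ^ 2 - (barSq p : ℂ) := by
  rw [zH, zU, barSq]; push_cast; ring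

theorem v0_ne : (p.v 0 : ℂ) ≠ 0 := by exact_mod_cast hp.hv0.ne'

theorem zH_eq_zero_iff {z : ℂ} :
    zH p q z = 0 ↔ z = xStar p q + bar p / p.v 0 ∨ z = xStar p q - bar p / p.v 0 := by
  have h0 := v0_ne hp
  rw [zH_eq, ← bar_sq hp, sub_eq_zero]; push_cast
  rw [sq_eq_sq_iff_eq_or_eq_neg, zO]
  constructor
  · rintro (h | h)
    · left; field_simp; linear_combination h
    · right; field_simp; linear_combination h
  · rintro (h | h)
    · left; rw [h]; field_simp; ring
    · right; rw [h]; field_simp; ring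

theorem zO_real (s : ℝ) : zO p q s = (mink (four s q) p.v : ℝ) := by
  rw [mink_four_v hp, zO]; push_cast; ring

theorem zU_ne_zero_of_zD {z : ℂ} (h : zD p q z = 0) : zU p q z ≠ 0 := by
  intro hu
  obtain ⟨hg, hχ, hw⟩ := hp.ne_zero
  have h2 : zO p q z ^ 2 = (p.ω₀ : ℂ) ^ 2 := sub_eq_zero.1 hu
  rw [zD, hu, h2] at h
  simp [hw, hg, hχ] at h

theorem im_eq_zero_of_zD (q : ℝ³) {z : ℂ} (h : zD p q z = 0) : z.im = 0 := by
  by_contra him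
  have hu := zU_ne_zero_of_zD hp h
  obtain ⟨ζ, hζ⟩ : ∃ ζ, z = xStar p q + ζ := ⟨z - xStar p q, by ring⟩
  have hζim : ζ.im = z.im := by rw [hζ]; simp
  have hquad : InQuads 0 ζ := by
    rcases lt_or_gt_of_ne him with h | h
    · right; refine ⟨?_, ?_, ?_⟩ <;> (try simp) <;> linarith
    · left; refine ⟨?_, ?_, ?_⟩ <;> (try simp) <;> linarith
  have h1 := dispS_ne_zero (x := xStar p q) hp.α_pos hp.w_pos hp.hv0 hquad (mSq_nonneg hp q)
  have h2 := dispC_eq_dispS hp 0 q ζ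
  rw [← hζ] at h2
  simp only [Complex.ofReal_zero, mul_zero, add_zero, sub_zero] at h2
  have h3 := denD_eq p (mink (fourC z q) (fourC z q)) ((p.ω₀ : ℂ) ^ 2) (fourC z q) (by
    rw [denU, omC_fourC hp]; exact hu)
  have h4 : denD p (mink (fourC z q) (fourC z q)) ((p.ω₀ : ℂ) ^ 2) (fourC z q) = zD p q z := by
    rw [denD, denU, omC_fourC hp, mink_fourC_eq_zS]; rfl
  rw [h4, h, h2] at h3
  have h5 : denU p ((p.ω₀ : ℂ) ^ 2) (fourC z q) ≠ 0 := by
    rw [denU, omC_fourC hp]; exact hu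
  exact mul_ne_zero h5 (div_ne_zero h1 pi4_ne) h3.symm

theorem zD_ofReal (s : ℝ) (hu : (p.v 0 * (s - xStar p q)) ^ 2 ≠ p.ω₀ ^ 2) :
    zD p q s = zU p q s * (DR p q s : ℝ) := by
  have hu' : (mink (four s q) p.v ^ 2 - p.ω₀ ^ 2 : ℝ) ≠ 0 := by
    rw [mink_four_v hp]; exact sub_ne_zero.2 hu
  have hπ := piC_ne
  rw [zD, zU, zO_real hp, zS_ofReal, DR]
  generalize mink (four s q) p.v = o at *
  generalize mink (four s q) (four s q) = S at *
  have hu2 : ((o : ℂ) ^ 2 - (p.ω₀ : ℂ) ^ 2) ≠ 0 := by exact_mod_cast hu'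
  push_cast
  field_simp

omit hp in
theorem zU_ofReal (s : ℝ) : zU p q s = (((p.v 0 * (s - xStar p q)) ^ 2 - p.ω₀ ^ 2 : ℝ) : ℂ) := by
  rw [zU, zO]; push_cast; ring

/-- The zeros of `zD` are the transverse modes and their reflections. -/
theorem zD_eq_zero_iff (hq : q ≠ 0) {z : ℂ} : zD p q z = 0 ↔
    ∃ s : ℝ, z = s ∧ (s ∈ transverseModes p q ∨ -s ∈ transverseModes p (-q)) := by
  constructor
  · intro h
    obtain ⟨s, hs⟩ : ∃ s : ℝ, z = s := ⟨z.re, Complex.ext rfl (by simpa using im_eq_zero_of_zD hp q h)⟩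
    refine ⟨s, hs, ?_⟩
    subst hs
    have hu := zU_ne_zero_of_zD hp h
    rw [zU_ofReal] at hu
    have hu' : (p.v 0 * (s - xStar p q)) ^ 2 ≠ p.ω₀ ^ 2 := by
      intro h0; rw [h0] at hu; simp at hu
    rw [zD_ofReal hp s hu'] at h
    have hD : DR p q s = 0 := by
      rcases mul_eq_zero.1 h with h | h
      · rw [zU_ofReal] at h; exact absurd h hu
      · exact_mod_cast h
    exact zero_DR_cases hp hq hu' hD
  · rintro ⟨s, rfl, h | h⟩
    · obtain ⟨h1, h2, -⟩ := (mem_transverseModes_iff hp hq).1 h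
      rw [zD_ofReal hp s h1, h2]; simp
    · obtain ⟨h1, h2, -⟩ := (mem_transverseModes_iff hp (neg_ne_zero.2 hq)).1 h
      rw [← zD_neg]
      have := zD_ofReal hp (q := -q) (-s) h1
      rw [h2] at this
      simpa using this

theorem zO_ne_zero_of_zD (hq : q ≠ 0) {z : ℂ} (h : zD p q z = 0) : zO p q z ≠ 0 := by
  obtain ⟨s, rfl, hs⟩ := (zD_eq_zero_iff hp hq).1 h
  rw [zO]
  refine mul_ne_zero (v0_ne hp) (sub_ne_zero.2 fun h => ?_)
  have h' : s = xStar p q := by exact_mod_cast h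
  rcases hs with hs | hs
  · have := ((mem_transverseModes_iff hp hq).1 hs).2.2
    linarith
  · have := ((mem_transverseModes_iff hp (neg_ne_zero.2 hq)).1 hs).2.2
    rw [xStar_neg] at this
    linarith

/-- The derivative of `zD` at a transverse mode. -/
theorem deriv_zD {s : ℝ} (hu : (p.v 0 * (s - xStar p q)) ^ 2 ≠ p.ω₀ ^ 2) (h : DR p q s = 0) :
    deriv (zD p q) s = zU p q s * (deriv (DR p q) s : ℝ) := by
  rw [(hasDerivAt_zD p q s).deriv, (hasDerivAt_DR hp q s hu).deriv]
  rw [DR_eq hp] at h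
  have hu' : (p.v 0 * (s - xStar p q)) ^ 2 - p.ω₀ ^ 2 ≠ 0 := sub_ne_zero.2 hu
  rw [zU_ofReal, zO, zS_ofReal, mink_four_self]
  have key : (2 * s * ((p.v 0 * (s - xStar p q)) ^ 2 - p.ω₀ ^ 2)
      + (-mSq p q + 2 * xStar p q * (s - xStar p q) + (s - xStar p q) ^ 2)
        * (2 * p.v 0 * (p.v 0 * (s - xStar p q)))) / (4 * π)
      - p.g ^ 2 * p.χ * p.ω₀ ^ 2 * (2 * p.v 0 * (p.v 0 * (s - xStar p q)))
      = ((p.v 0 * (s - xStar p q)) ^ 2 - p.ω₀ ^ 2) *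
      ((2 * xStar p q + 2 * (s - xStar p q)) / (4 * π)
      + 2 * p.g ^ 2 * p.χ * p.ω₀ ^ 4 * p.v 0 ^ 2 * (s - xStar p q)
        / ((p.v 0 * (s - xStar p q)) ^ 2 - p.ω₀ ^ 2) ^ 2) := by
    have e1 : (-mSq p q + 2 * xStar p q * (s - xStar p q) + (s - xStar p q) ^ 2) / (4 * π)
      = p.g ^ 2 * p.χ * p.ω₀ ^ 2 * (p.v 0 * (s - xStar p q)) ^ 2
        / ((p.v 0 * (s - xStar p q)) ^ 2 - p.ω₀ ^ 2) := by linarith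
    have e2 : 2 * s = 2 * xStar p q + 2 * (s - xStar p q) := by ring
    rw [add_div, mul_div_right_comm, mul_div_right_comm _ (2 * p.v 0 * (p.v 0 * (s - xStar p q))), e1,
      e2]
    generalize s - xStar p q = y at *
    rw [mul_pow, mul_comm] at hu'
    simp only [mul_pow]
    field_simp
    ring
  exact_mod_cast congrArg (fun r : ℝ => (r : ℂ)) key

theorem deriv_zD_ne_zero (hq : q ≠ 0) {z : ℂ} (h : zD p q z = 0) : deriv (zD p q) z ≠ 0 := by
  have hu := zU_ne_zero_of_zD hp h
  obtain ⟨s, rfl⟩ : ∃ s : ℝ, z = s := ⟨z.re, Complex.ext rfl (by simpa using im_eq_zero_of_zD hp q h)⟩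
  have hu' : (p.v 0 * (s - xStar p q)) ^ 2 ≠ p.ω₀ ^ 2 := by
    intro h0; rw [zU_ofReal, h0] at hu; simp at hu
  have hD : DR p q s = 0 := by
    rw [zD_ofReal hp s hu'] at h
    exact_mod_cast (mul_eq_zero.1 h).resolve_left hu
  rw [deriv_zD hp hu' hD]
  have := right_ne_zero_of_mul (mul_deriv_DR_pos hp hq hu' hD).ne'
  exact mul_ne_zero hu (by exact_mod_cast this)

theorem zO_bar_ne_zero {z : ℂ} (h : zH p q z = 0) : zO p q z ≠ 0 := by
  intro h0
  rw [zH_eq, h0, ← bar_sq hp] at h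
  have := bar_pos hp
  simp at h
  linarith

theorem zO_photon_ne_zero (hq : q ≠ 0) {z : ℂ} (h : zS q z = 0) : zO p q z ≠ 0 := by
  intro h0
  have h1 : z = (xStar p q : ℝ) := by
    rcases mul_eq_zero.1 h0 with h | h
    · exact absurd h (v0_ne hp)
    · exact sub_eq_zero.1 h
  rw [h1, zS_ofReal, mink_four_self] at h
  have := mSq_pos hp hq
  have h2 : (-mSq p q + 2 * xStar p q * (xStar p q - xStar p q) + (xStar p q - xStar p q) ^ 2 : ℝ) = 0 := by
    exact_mod_cast h
  rw [sub_self] at h2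
  linarith

/-- The free photon does not cross the transverse modes. -/
theorem zD_ne_zero_of_zS (hq : q ≠ 0) {z : ℂ} (h : zS q z = 0) : zD p q z ≠ 0 := by
  intro h0
  have := zO_photon_ne_zero hp hq h
  obtain ⟨hg, hχ, hw⟩ := hp.ne_zero
  rw [zD, h] at h0
  simp [hw, hg, hχ, this] at h0

omit hp in
/-- The dispersion function of the transverse modes at the b-mode. -/
theorem zD_of_zH {z : ℂ} (h : zH p q z = 0) : zD p q z
    = p.g ^ 2 * p.χ * (p.ω₀ : ℂ) ^ 2 * (zS q z - (barSq p : ℂ)) := by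
  have h1 : zU p q z = 4 * π * p.g ^ 2 * p.χ * (p.ω₀ : ℂ) ^ 2 := sub_eq_zero.1 h
  have h2 : zO p q z ^ 2 = (barSq p : ℂ) := by rw [zH_eq] at h; exact sub_eq_zero.1 h
  have hπ := piC_ne
  rw [zD, h1, h2]; field_simp

theorem zD_ne_zero_of_zH (hG : Generic p q) {z : ℂ} (h : zH p q z = 0) : zD p q z ≠ 0 := by
  rw [zD_of_zH h]
  obtain ⟨hg, hχ, hw⟩ := hp.ne_zero
  simp [hw, hg, hχ, sub_ne_zero.2 (hG.bar_ne z h)]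

/-- All poles are real, and none has `ω = 0`. -/
theorem real_of_mem_nodeSet (hG : Generic p q) {z : ℂ} (h : z ∈ nodeSet p q) :
    z.im = 0 ∧ z.re ≠ xStar p q := by
  have key : z.im = 0 ∧ zO p q z ≠ 0 := by
    rcases h with h | h | h
    · refine ⟨?_, zO_photon_ne_zero hp hG.ne_zero h⟩
      rcases zS_eq_zero_iff.1 h with rfl | rfl <;> simp
    · refine ⟨?_, zO_bar_ne_zero hp h⟩
      rcases (zH_eq_zero_iff hp).1 h with rfl | rfl
      · rw [← Complex.ofReal_div, ← Complex.ofReal_add, Complex.ofReal_im]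
      · rw [← Complex.ofReal_div, ← Complex.ofReal_sub, Complex.ofReal_im]
    · exact ⟨im_eq_zero_of_zD hp q h, zO_ne_zero_of_zD hp hG.ne_zero h⟩
  refine ⟨key.1, fun h => key.2 ?_⟩
  have : z = (xStar p q : ℝ) := Complex.ext h (by simpa using key.1)
  rw [zO, this]; simp

theorem finite_nodeSet (hq : q ≠ 0) : (nodeSet p q).Finite := by
  have h1 : {z : ℂ | zS q z = 0}.Finite := by
    refine Set.Finite.subset (Set.toFinite {(len q : ℂ), -(len q : ℂ)}) fun z hz => ?_
    exact zS_eq_zero_iff.1 hz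
  have h2 : {z : ℂ | zH p q z = 0}.Finite := by
    refine Set.Finite.subset (Set.toFinite {(xStar p q + bar p / p.v 0 : ℂ),
      (xStar p q - bar p / p.v 0 : ℂ)}) fun z hz => ?_
    exact (zH_eq_zero_iff hp).1 hz
  have h3 : {z : ℂ | zD p q z = 0}.Finite := by
    refine Set.Finite.subset (((finite_transverseModes hp hq).image (fun s : ℝ => (s : ℂ))).union
      ((finite_transverseModes hp (neg_ne_zero.2 hq)).image (fun s : ℝ => -(s : ℂ)))) fun z hz => ?_
    obtain ⟨s, rfl, hs | hs⟩ := (zD_eq_zero_iff hp hq).1 hz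
    · exact Or.inl ⟨s, hs, rfl⟩
    · exact Or.inr ⟨-s, hs, by simp⟩
  exact (h1.union (h2.union h3)).subset fun z hz => by
    rcases hz with h | h | h
    · exact Or.inl h
    · exact Or.inr (Or.inl h)
    · exact Or.inr (Or.inr h)

theorem mem_nodes (hq : q ≠ 0) {z : ℂ} : z ∈ nodes p q ↔ zS q z = 0 ∨ zH p q z = 0 ∨ zD p q z = 0 := by
  rw [nodes, dif_pos (finite_nodeSet hp hq), Set.Finite.mem_toFinset]; rfl

/-- The dispersion function of the transverse modes, the one of the b-mode and `k²` have no common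
zeros at generic momentum. -/
theorem nodes_cases (hG : Generic p q) {a : ℂ} (ha : a ∈ nodes p q) :
    (zS q a = 0 ∧ zH p q a ≠ 0 ∧ zD p q a ≠ 0) ∨ (zS q a ≠ 0 ∧ zH p q a = 0 ∧ zD p q a ≠ 0)
      ∨ (zS q a ≠ 0 ∧ zH p q a ≠ 0 ∧ zD p q a = 0) := by
  have h1 := fun h => hG.bar_ne_zero a h
  have h2 := fun h => zD_ne_zero_of_zH hp hG (z := a) h
  have h3 := fun h => zD_ne_zero_of_zS hp hG.ne_zero (z := a) h
  rcases (mem_nodes hp hG.ne_zero).1 ha with h | h | h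
  · exact Or.inl ⟨h, fun h' => h1 h' h, h3 h⟩
  · exact Or.inr (Or.inl ⟨h1 h, h, h2 h⟩)
  · exact Or.inr (Or.inr ⟨fun h' => h3 h' h, fun h' => h2 h' h, h⟩)

theorem omC_eq_zO (q : ℝ³) (z : ℂ) : p.omC (fourC z q) = zO p q z := omC_fourC hp z q

theorem denU_eq_zU (q : ℝ³) (z : ℂ) : denU p ((p.ω₀ : ℂ) ^ 2) (fourC z q) = zU p q z := by
  rw [denU, omC_fourC hp]; rfl

theorem denH_eq_zH (q : ℝ³) (z : ℂ) : denH p ((p.ω₀ : ℂ) ^ 2) (fourC z q) = zH p q z := by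
  rw [denH, denU_eq_zU hp]; rfl

theorem denD_eq_zD (q : ℝ³) (z : ℂ) :
    denD p (zS q z) ((p.ω₀ : ℂ) ^ 2) (fourC z q) = zD p q z := by
  rw [denD, denU_eq_zU hp, omC_fourC hp]; rfl

theorem analyticAt_resolvent {z : ℂ} (hS : zS q z ≠ 0) (hH : zH p q z ≠ 0)
    (hD : zD p q z ≠ 0) (a b : FieldIx) : AnalyticAt ℂ (fun z => resolvent p q z a b) z := by
  have h1 : zH p q z * zD p q z * zS q z ≠ 0 := mul_ne_zero (mul_ne_zero hH hD) hS
  have h2 : zH p q z * zS q z ^ 2 ≠ 0 := mul_ne_zero hH (pow_ne_zero _ hS)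
  have h3 : zS q z ^ 2 ≠ 0 := pow_ne_zero _ hS
  have h4 : zH p q z * zD p q z ≠ 0 := mul_ne_zero hH hD
  have h5 : zD p q z * zH p q z ≠ 0 := mul_ne_zero hD hH
  have h6 : 4 * π * zD p q z ≠ 0 := mul_ne_zero pi4_ne hD
  have h7 := @pi4_ne
  simp only [resolvent, mink_fourC_eq_zS, regProp, omC_eq_zO hp, denU_eq_zU hp, denH_eq_zH hp,
    denD_eq_zD hp]
  rcases a with μ | μ | _ <;> rcases b with ν | ν | _ <;>
    simp only [Matrix.of_apply, tens] <;> fun_prop (disch := assumption)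

end good

/-! ### Principal parts of the propagator -/

/-- `4π g² χ ω₀²`, the difference `ω̄² - ω₀²`. -/
def gap (p : Medium) : ℂ := 4 * π * p.g ^ 2 * p.χ * (p.ω₀ : ℂ) ^ 2

theorem gap_ne_zero {p : Medium} (hp : p.Good) : gap p ≠ 0 := by
  simp [gap, Real.pi_ne_zero, hp.hg, hp.hχ.ne', hp.hω.ne']

theorem ofReal_v (p : Medium) (μ : Fin 4) : (p.v μ : ℂ) = p.vC μ := rfl

theorem hasPole_inv_zS {q : ℝ³} {a : ℂ} (ha : a ≠ 0) (h : zS q a = 0) :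
    HasPole (fun z => 1 / zS q z) a (1 / (2 * a)) 0 := by
  have := HasPole.simple (N := fun _ => (1 : ℂ)) analyticAt_const (analyticAt_zS q a) h (by
    rw [(hasDerivAt_zS q a).deriv]; simpa using ha)
  rwa [(hasDerivAt_zS q a).deriv] at this

theorem hasPole_inv_zS_sq {q : ℝ³} {a : ℂ} (ha : a ≠ 0) (h : zS q a = 0) :
    HasPole (fun z => 1 / zS q z ^ 2) a (-(1 / (4 * a ^ 3))) (1 / (4 * a ^ 2)) := by
  have h2 : (a + a) ^ 2 ≠ 0 := pow_ne_zero _ (by rw [← two_mul]; simpa using ha)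
  have hG : AnalyticAt ℂ (fun z => 1 / (z + a) ^ 2) a := by fun_prop (disch := assumption)
  have hd : deriv (fun z => 1 / (z + a) ^ 2) a = -(1 / (4 * a ^ 3)) := by
    have h0 := (((hasDerivAt_id a).add_const a).pow 2).inv h2
    have h1 : HasDerivAt (fun z => 1 / (z + a) ^ 2) (-(1 / (4 * a ^ 3))) a := by
      simp only [one_div]
      refine h0.congr_deriv ?_
      simp only [id, Pi.pow_apply]
      push_cast
      rw [← two_mul] at h2 ⊢
      field_simp
      ring
    exact h1.deriv
  have := HasPole.double hG
  rw [hd] at this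
  have e : 1 / (a + a) ^ 2 = 1 / (4 * a ^ 2) := by ring
  simp only [e] at this
  refine this.congr ?_
  have hev : ∀ᶠ z in 𝓝[≠] a, z + a ≠ 0 := by
    refine nhdsWithin_le_nhds (ContinuousAt.eventually_ne (g := fun z => z + a) (by fun_prop) ?_)
    intro h; exact h2 (by rw [h]; simp)
  filter_upwards [self_mem_nhdsWithin, hev] with z hz hz2
  have hz1 : z - a ≠ 0 := sub_ne_zero.2 hz
  have e2 : zS q z = (z - a) * (z + a) := by
    have h3 : zS q z = zS q z - zS q a := by rw [h, sub_zero]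
    rw [h3]; simp only [zS]; ring
  rw [e2]
  field_simp

/-- If `f` is regular, `f / zS` and `f / zS²` have the expected poles. -/
theorem HasPole.photon {q : ℝ³} {a : ℂ} (ha : a ≠ 0) (h : zS q a = 0) {f φ₀ φ₁ φ₂ : ℂ → ℂ}
    {φ' : ℂ} (hφ : AnalyticAt ℂ φ₀ a) (h1 : AnalyticAt ℂ φ₁ a) (h2 : AnalyticAt ℂ φ₂ a)
    (hd : HasDerivAt φ₂ φ' a)
    (hf : ∀ᶠ z in 𝓝[≠] a, f z = φ₀ z + φ₁ z / zS q z + φ₂ z / zS q z ^ 2) :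
    HasPole f a (φ₁ a / (2 * a) + φ' / (4 * a ^ 2) - φ₂ a / (4 * a ^ 3)) (φ₂ a / (4 * a ^ 2)) := by
  have e0 := HasPole.of_continuousAt hφ.continuousAt
  have e1 := (hasPole_inv_zS ha h).mul h1
  have e2 := (hasPole_inv_zS_sq ha h).mul h2
  have e3 := (e0.add e1).add e2
  rw [hd.deriv] at e3
  have c1 : 0 + (φ₁ a * (1 / (2 * a)) + deriv φ₁ a * 0)
      + (φ₂ a * -(1 / (4 * a ^ 3)) + φ' * (1 / (4 * a ^ 2)))
      = φ₁ a / (2 * a) + φ' / (4 * a ^ 2) - φ₂ a / (4 * a ^ 3) := by ring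
  have c2 : 0 + φ₁ a * 0 + φ₂ a * (1 / (4 * a ^ 2)) = φ₂ a / (4 * a ^ 2) := by ring
  rw [c1, c2] at e3
  refine e3.congr (hf.mono fun z hz => ?_)
  rw [hz]; ring

theorem HasPole.simple' {f N P : ℂ → ℂ} {a P' : ℂ} (hN : AnalyticAt ℂ N a) (hP : AnalyticAt ℂ P a)
    (h0 : P a = 0) (hd : HasDerivAt P P' a) (h1 : P' ≠ 0) (hf : ∀ᶠ z in 𝓝[≠] a, f z = N z / P z) :
    HasPole f a (N a / P') 0 := by
  have := HasPole.simple hN hP h0 (by rwa [hd.deriv])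
  rw [hd.deriv] at this
  exact this.congr (hf.mono fun z hz => hz.symm)

theorem eventually_ne_of_analyticAt {P : ℂ → ℂ} {a : ℂ} (hP : AnalyticAt ℂ P a) (h : P a ≠ 0) :
    ∀ᶠ z in 𝓝[≠] a, P z ≠ 0 :=
  nhdsWithin_le_nhds (hP.continuousAt.eventually_ne h)

section good

variable {p : Medium} (hp : p.Good) {q : ℝ³}
include hp

theorem resolvent_AA (q : ℝ³) (z : ℂ) (μ ν : Fin 4) : resolvent p q z (iA μ) (iA ν) =
    tens (fourC z q) p.vC (zU p q z / zD p q z) (p.ξ / zS q z ^ 2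
      - 4 * π * zU p q z / (zH p q z * zS q z ^ 2)
      + gap p * zU p q z / (zH p q z * zD p q z * zS q z))
      (-(gap p * zU p q z * zO p q z / (zH p q z * zD p q z * zS q z)))
      (-(gap p * zU p q z * zO p q z / (zH p q z * zD p q z * zS q z)))
      (gap p * zU p q z / (zH p q z * zD p q z)) μ ν := by
  simp only [resolvent, mink_fourC_eq_zS, regProp, omC_eq_zO hp, denU_eq_zU hp, denH_eq_zH hp,
    denD_eq_zD hp, Matrix.of_apply, gap]

theorem resolvent_AP (q : ℝ³) (z : ℂ) (μ ν : Fin 4) : resolvent p q z (iA μ) (iP ν) =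
    -I * p.g * p.χ * (p.ω₀ : ℂ) ^ 2 * tens (fourC z q) p.vC (zO p q z / zD p q z)
      (gap p * zO p q z / (zH p q z * zD p q z * zS q z))
      (-(gap p * zO p q z ^ 2 / (zH p q z * zD p q z * zS q z)))
      (-(zU p q z / (zH p q z * zD p q z)))
      (gap p * zO p q z / (zH p q z * zD p q z)) μ ν := by
  simp only [resolvent, mink_fourC_eq_zS, regProp, omC_eq_zO hp, denU_eq_zU hp, denH_eq_zH hp,
    denD_eq_zD hp, Matrix.of_apply, gap]

theorem resolvent_PP (q : ℝ³) (z : ℂ) (μ ν : Fin 4) : resolvent p q z (iP μ) (iP ν) =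
    tens (fourC z q) p.vC (p.χ * (p.ω₀ : ℂ) ^ 2 * zS q z / (4 * π * zD p q z))
      (p.g ^ 2 * p.χ ^ 2 * ((p.ω₀ : ℂ) ^ 2) ^ 2 / (zD p q z * zH p q z))
      (-(p.g ^ 2 * p.χ ^ 2 * ((p.ω₀ : ℂ) ^ 2) ^ 2 * zO p q z / (zD p q z * zH p q z)))
      (-(p.g ^ 2 * p.χ ^ 2 * ((p.ω₀ : ℂ) ^ 2) ^ 2 * zO p q z / (zD p q z * zH p q z)))
      (p.χ * (p.ω₀ : ℂ) ^ 2 * (p.g ^ 2 * p.χ * (p.ω₀ : ℂ) ^ 2 * (zS q z + zO p q z ^ 2)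
        - zS q z * zU p q z / (4 * π)) / (zD p q z * zH p q z)) μ ν := by
  simp only [resolvent, mink_fourC_eq_zS, regProp, omC_eq_zO hp, denU_eq_zU hp, denH_eq_zH hp,
    denD_eq_zD hp, Matrix.of_apply]

omit hp in
theorem resolvent_AB (q : ℝ³) (z : ℂ) (μ : Fin 4) :
    resolvent p q z (iA μ) iB = -I * fourC z q μ / zS q z := by
  simp only [resolvent, mink_fourC_eq_zS, regProp, Matrix.of_apply]

omit hp in
theorem resolvent_neg (q : ℝ³) (z : ℂ) (a b : FieldIx) :
    resolvent p (-q) (-z) a b = resolvent p q z b a := by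
  have e : fourC (-z) (-q) = -fourC z q := by
    ext μ; refine Fin.cases ?_ (fun j => ?_) μ <;> simp [fourC]
  have e2 : mink (-fourC z q) (-fourC z q) = mink (fourC z q) (fourC z q) := by simp [mink]
  rw [resolvent, e, e2, regProp_neg]; rfl

omit hp in
theorem hasDerivAt_fourC (q : ℝ³) (μ : Fin 4) (a : ℂ) :
    HasDerivAt (fun z => fourC z q μ) (if μ = 0 then 1 else 0) a := by
  refine Fin.cases ?_ (fun j => ?_) μ
  · simpa [fourC] using hasDerivAt_id' a
  · simpa [fourC] using hasDerivAt_const a (q j : ℂ)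

/-! #### The free photon -/

theorem hasPole_photon_AA {a : ℂ} (ha : a ≠ 0) (hS : zS q a = 0) (hH : zH p q a ≠ 0)
    (hD : zD p q a ≠ 0) (μ ν : Fin 4) :
    HasPole (fun z => resolvent p q z (iA μ) (iA ν)) a
      (tens (fourC a q) p.vC 0 (gap p * zU p q a / (zH p q a * zD p q a))
          (-(gap p * zU p q a * zO p q a / (zH p q a * zD p q a)))
          (-(gap p * zU p q a * zO p q a / (zH p q a * zD p q a))) 0 μ ν / (2 * a)
        + ((p.ξ - 4 * π * zU p q a / zH p q a)
            * ((if μ = 0 then 1 else 0) * fourC a q ν + fourC a q μ * (if ν = 0 then 1 else 0))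
          + 8 * π * gap p * p.v 0 * zO p q a / zH p q a ^ 2 * (fourC a q μ * fourC a q ν))
          / (4 * a ^ 2)
        - (p.ξ - 4 * π * zU p q a / zH p q a) * (fourC a q μ * fourC a q ν) / (4 * a ^ 3))
      ((p.ξ - 4 * π * zU p q a / zH p q a) * (fourC a q μ * fourC a q ν) / (4 * a ^ 2)) := by
  have hHD : zH p q a * zD p q a ≠ 0 := mul_ne_zero hH hD
  refine HasPole.photon ha hS (φ₀ := fun z => tens (fourC z q) p.vC (zU p q z / zD p q z) 0 0 0
      (gap p * zU p q z / (zH p q z * zD p q z)) μ ν)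
    (φ₁ := fun z => tens (fourC z q) p.vC 0 (gap p * zU p q z / (zH p q z * zD p q z))
          (-(gap p * zU p q z * zO p q z / (zH p q z * zD p q z)))
          (-(gap p * zU p q z * zO p q z / (zH p q z * zD p q z))) 0 μ ν)
    (φ₂ := fun z => (p.ξ - 4 * π * zU p q z / zH p q z) * (fourC z q μ * fourC z q ν))
    ?_ ?_ ?_ ?_ ?_
  · simp only [tens]; fun_prop (disch := assumption)
  · simp only [tens]; fun_prop (disch := assumption)
  · fun_prop (disch := assumption)
  · have h1 := ((hasDerivAt_zU p q a).const_mul (4 * π : ℂ)).div (hasDerivAt_zH p q a) hH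
    have h2 := (h1.const_sub (p.ξ : ℂ)).mul ((hasDerivAt_fourC q μ a).mul (hasDerivAt_fourC q ν a))
    refine h2.congr_deriv ?_
    have e : zU p q a = zH p q a + gap p := by rw [zH, gap]; ring
    simp only [Pi.mul_apply, Pi.div_apply, e]
    field_simp
    ring
  · filter_upwards [eventually_ne_of_analyticAt (analyticAt_zH p q a) hH,
      eventually_ne_of_analyticAt (analyticAt_zD p q a) hD,
      (hasDerivAt_zS q a).eventually_ne (c := 0) (by simpa using ha)] with z h1 h2 h3
    rw [resolvent_AA hp]
    simp only [tens]
    field_simp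
    ring

theorem hasPole_photon_AP {a : ℂ} (ha : a ≠ 0) (hS : zS q a = 0) (hH : zH p q a ≠ 0)
    (hD : zD p q a ≠ 0) (μ ν : Fin 4) :
    HasPole (fun z => resolvent p q z (iA μ) (iP ν)) a
      (-I * p.g * p.χ * (p.ω₀ : ℂ) ^ 2 * (tens (fourC a q) p.vC 0
          (gap p * zO p q a / (zH p q a * zD p q a))
          (-(gap p * zO p q a ^ 2 / (zH p q a * zD p q a))) 0 0 μ ν / (2 * a))) 0 := by
  have hHD : zH p q a * zD p q a ≠ 0 := mul_ne_zero hH hD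
  have := HasPole.photon ha hS (f := fun z => tens (fourC z q) p.vC (zO p q z / zD p q z)
      (gap p * zO p q z / (zH p q z * zD p q z * zS q z))
      (-(gap p * zO p q z ^ 2 / (zH p q z * zD p q z * zS q z)))
      (-(zU p q z / (zH p q z * zD p q z)))
      (gap p * zO p q z / (zH p q z * zD p q z)) μ ν)
    (φ₀ := fun z => tens (fourC z q) p.vC (zO p q z / zD p q z) 0 0
      (-(zU p q z / (zH p q z * zD p q z)))
      (gap p * zO p q z / (zH p q z * zD p q z)) μ ν)
    (φ₁ := fun z => tens (fourC z q) p.vC 0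
          (gap p * zO p q z / (zH p q z * zD p q z))
          (-(gap p * zO p q z ^ 2 / (zH p q z * zD p q z))) 0 0 μ ν)
    (φ₂ := fun _ => 0) (φ' := 0) (by simp only [tens]; fun_prop (disch := assumption))
    (by simp only [tens]; fun_prop (disch := assumption)) (by fun_prop) (hasDerivAt_const _ _) (by
      filter_upwards [eventually_ne_of_analyticAt (analyticAt_zH p q a) hH,
        eventually_ne_of_analyticAt (analyticAt_zD p q a) hD,
        (hasDerivAt_zS q a).eventually_ne (c := 0) (by simpa using ha)] with z h1 h2 h3
      simp only [tens]
      field_simp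
      ring)
  have h2 := this.const_mul (-I * p.g * p.χ * (p.ω₀ : ℂ) ^ 2)
  simp only [zero_div, add_zero, sub_zero, mul_zero] at h2
  exact h2.congr (.of_forall fun z => (resolvent_AP hp q z μ ν).symm)

theorem hasPole_photon_PP {a : ℂ} (hH : zH p q a ≠ 0)
    (hD : zD p q a ≠ 0) (μ ν : Fin 4) :
    HasPole (fun z => resolvent p q z (iP μ) (iP ν)) a 0 0 := by
  have hHD : zD p q a * zH p q a ≠ 0 := mul_ne_zero hD hH
  have h6 : 4 * π * zD p q a ≠ 0 := mul_ne_zero pi4_ne hD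
  have h7 := @pi4_ne
  refine (HasPole.of_continuousAt (AnalyticAt.continuousAt (𝕜 := ℂ) ?_)).congr
    (.of_forall fun z => (resolvent_PP hp q z μ ν).symm)
  simp only [tens]; fun_prop (disch := assumption)

omit hp in
theorem hasPole_photon_AB {a : ℂ} (ha : a ≠ 0) (hS : zS q a = 0) (μ : Fin 4) :
    HasPole (fun z => resolvent p q z (iA μ) iB) a (-I * fourC a q μ / (2 * a)) 0 := by
  have := (hasPole_inv_zS ha hS).mul (φ := fun z => -I * fourC z q μ) (by fun_prop)
  rw [mul_zero, add_zero, mul_zero, mul_one_div] at this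
  refine this.congr (.of_forall fun z => ?_)
  show -I * fourC z q μ * (1 / zS q z) = resolvent p q z (iA μ) iB
  rw [resolvent_AB]; ring

/-! #### The b-mode -/

theorem hasPole_bar_AA {a : ℂ} (hS : zS q a ≠ 0) (hH : zH p q a = 0)
    (hD : zD p q a ≠ 0) (μ ν : Fin 4) :
    HasPole (fun z => resolvent p q z (iA μ) (iA ν)) a
      (tens (fourC a q) p.vC 0 (-(4 * π * zU p q a / zS q a ^ 2)
          + gap p * zU p q a / (zD p q a * zS q a))
        (-(gap p * zU p q a * zO p q a / (zD p q a * zS q a)))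
        (-(gap p * zU p q a * zO p q a / (zD p q a * zS q a)))
        (gap p * zU p q a / zD p q a) μ ν / (2 * p.v 0 * zO p q a)) 0 := by
  have hne : 2 * p.v 0 * zO p q a ≠ 0 :=
    mul_ne_zero (mul_ne_zero two_ne_zero (v0_ne hp)) (zO_bar_ne_zero hp hH)
  have hS2 : zS q a ^ 2 ≠ 0 := pow_ne_zero _ hS
  have hDS : zD p q a * zS q a ≠ 0 := mul_ne_zero hD hS
  have := HasPole.simple' (f := fun z => resolvent p q z (iA μ) (iA ν))
    (N := fun z => tens (fourC z q) p.vC (zH p q z * zU p q z / zD p q z)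
      (zH p q z * p.ξ / zS q z ^ 2 + -(4 * π * zU p q z / zS q z ^ 2)
          + gap p * zU p q z / (zD p q z * zS q z))
        (-(gap p * zU p q z * zO p q z / (zD p q z * zS q z)))
        (-(gap p * zU p q z * zO p q z / (zD p q z * zS q z)))
        (gap p * zU p q z / zD p q z) μ ν)
    (by simp only [tens]; fun_prop (disch := assumption)) (analyticAt_zH p q a) hH
    (hasDerivAt_zH p q a) hne (by
      filter_upwards [eventually_ne_of_analyticAt (analyticAt_zS q a) hS,
        eventually_ne_of_analyticAt (analyticAt_zD p q a) hD,
        (hasDerivAt_zH p q a).eventually_ne (c := 0) hne] with z h1 h2 h3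
      rw [resolvent_AA hp]
      simp only [tens]
      field_simp
      ring)
  simpa only [hH, zero_mul, zero_div, zero_add] using this

theorem hasPole_bar_AP {a : ℂ} (hS : zS q a ≠ 0) (hH : zH p q a = 0)
    (hD : zD p q a ≠ 0) (μ ν : Fin 4) :
    HasPole (fun z => resolvent p q z (iA μ) (iP ν)) a
      (-I * p.g * p.χ * (p.ω₀ : ℂ) ^ 2 * tens (fourC a q) p.vC 0
        (gap p * zO p q a / (zD p q a * zS q a))
        (-(gap p * zO p q a ^ 2 / (zD p q a * zS q a)))
        (-(zU p q a / zD p q a)) (gap p * zO p q a / zD p q a) μ ν / (2 * p.v 0 * zO p q a)) 0 := by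
  have hne : 2 * p.v 0 * zO p q a ≠ 0 :=
    mul_ne_zero (mul_ne_zero two_ne_zero (v0_ne hp)) (zO_bar_ne_zero hp hH)
  have hDS : zD p q a * zS q a ≠ 0 := mul_ne_zero hD hS
  have := HasPole.simple' (f := fun z => resolvent p q z (iA μ) (iP ν))
    (N := fun z => -I * p.g * p.χ * (p.ω₀ : ℂ) ^ 2 * tens (fourC z q) p.vC
        (zH p q z * zO p q z / zD p q z)
        (gap p * zO p q z / (zD p q z * zS q z))
        (-(gap p * zO p q z ^ 2 / (zD p q z * zS q z)))
        (-(zU p q z / zD p q z)) (gap p * zO p q z / zD p q z) μ ν)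
    (by simp only [tens]; fun_prop (disch := assumption)) (analyticAt_zH p q a) hH
    (hasDerivAt_zH p q a) hne (by
      filter_upwards [eventually_ne_of_analyticAt (analyticAt_zS q a) hS,
        eventually_ne_of_analyticAt (analyticAt_zD p q a) hD,
        (hasDerivAt_zH p q a).eventually_ne (c := 0) hne] with z h1 h2 h3
      rw [resolvent_AP hp]
      simp only [tens]
      field_simp)
  simpa only [hH, zero_mul, zero_div, zero_add] using this

theorem hasPole_bar_PP {a : ℂ} (hH : zH p q a = 0)
    (hD : zD p q a ≠ 0) (μ ν : Fin 4) :
    HasPole (fun z => resolvent p q z (iP μ) (iP ν)) a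
      (tens (fourC a q) p.vC 0
        (p.g ^ 2 * p.χ ^ 2 * ((p.ω₀ : ℂ) ^ 2) ^ 2 / zD p q a)
        (-(p.g ^ 2 * p.χ ^ 2 * ((p.ω₀ : ℂ) ^ 2) ^ 2 * zO p q a / zD p q a))
        (-(p.g ^ 2 * p.χ ^ 2 * ((p.ω₀ : ℂ) ^ 2) ^ 2 * zO p q a / zD p q a))
        (p.χ * (p.ω₀ : ℂ) ^ 2 * (p.g ^ 2 * p.χ * (p.ω₀ : ℂ) ^ 2 * (zS q a + zO p q a ^ 2)
          - zS q a * zU p q a / (4 * π)) / zD p q a) μ ν / (2 * p.v 0 * zO p q a)) 0 := by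
  have hne : 2 * p.v 0 * zO p q a ≠ 0 :=
    mul_ne_zero (mul_ne_zero two_ne_zero (v0_ne hp)) (zO_bar_ne_zero hp hH)
  have h6 : 4 * π * zD p q a ≠ 0 := mul_ne_zero pi4_ne hD
  have h7 := @pi4_ne
  have hπ := piC_ne
  have := HasPole.simple' (f := fun z => resolvent p q z (iP μ) (iP ν))
    (N := fun z => tens (fourC z q) p.vC
        (zH p q z * (p.χ * (p.ω₀ : ℂ) ^ 2 * zS q z) / (4 * π * zD p q z))
        (p.g ^ 2 * p.χ ^ 2 * ((p.ω₀ : ℂ) ^ 2) ^ 2 / zD p q z)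
        (-(p.g ^ 2 * p.χ ^ 2 * ((p.ω₀ : ℂ) ^ 2) ^ 2 * zO p q z / zD p q z))
        (-(p.g ^ 2 * p.χ ^ 2 * ((p.ω₀ : ℂ) ^ 2) ^ 2 * zO p q z / zD p q z))
        (p.χ * (p.ω₀ : ℂ) ^ 2 * (p.g ^ 2 * p.χ * (p.ω₀ : ℂ) ^ 2 * (zS q z + zO p q z ^ 2)
          - zS q z * zU p q z / (4 * π)) / zD p q z) μ ν)
    (by simp only [tens]; fun_prop (disch := assumption)) (analyticAt_zH p q a) hH
    (hasDerivAt_zH p q a) hne (by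
      filter_upwards [eventually_ne_of_analyticAt (analyticAt_zD p q a) hD,
        (hasDerivAt_zH p q a).eventually_ne (c := 0) hne] with z h2 h3
      rw [resolvent_PP hp]
      simp only [tens]
      field_simp)
  simpa only [hH, zero_mul, zero_div, zero_add] using this

/-! #### The transverse modes -/

theorem hasPole_transverse_AA (hq : q ≠ 0) {a : ℂ} (hS : zS q a ≠ 0) (hH : zH p q a ≠ 0)
    (hD : zD p q a = 0) (μ ν : Fin 4) :
    HasPole (fun z => resolvent p q z (iA μ) (iA ν)) a
      (tens (fourC a q) p.vC (zU p q a) (gap p * zU p q a / (zH p q a * zS q a))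
        (-(gap p * zU p q a * zO p q a / (zH p q a * zS q a)))
        (-(gap p * zU p q a * zO p q a / (zH p q a * zS q a)))
        (gap p * zU p q a / zH p q a) μ ν / deriv (zD p q) a) 0 := by
  have hne := deriv_zD_ne_zero hp hq hD
  have hd := (hasDerivAt_zD p q a).differentiableAt.hasDerivAt
  have hS2 : zS q a ^ 2 ≠ 0 := pow_ne_zero _ hS
  have hHS2 : zH p q a * zS q a ^ 2 ≠ 0 := mul_ne_zero hH hS2
  have hHS : zH p q a * zS q a ≠ 0 := mul_ne_zero hH hS
  have := HasPole.simple' (f := fun z => resolvent p q z (iA μ) (iA ν))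
    (N := fun z => tens (fourC z q) p.vC (zU p q z)
      (zD p q z * (p.ξ / zS q z ^ 2 - 4 * π * zU p q z / (zH p q z * zS q z ^ 2))
          + gap p * zU p q z / (zH p q z * zS q z))
        (-(gap p * zU p q z * zO p q z / (zH p q z * zS q z)))
        (-(gap p * zU p q z * zO p q z / (zH p q z * zS q z)))
        (gap p * zU p q z / zH p q z) μ ν)
    (by simp only [tens]; fun_prop (disch := assumption)) (analyticAt_zD p q a) hD
    hd hne (by
      filter_upwards [eventually_ne_of_analyticAt (analyticAt_zS q a) hS,
        eventually_ne_of_analyticAt (analyticAt_zH p q a) hH,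
        hd.eventually_ne (c := 0) hne] with z h1 h2 h3
      rw [resolvent_AA hp]
      simp only [tens]
      field_simp)
  simpa only [hD, zero_mul, zero_add] using this

theorem hasPole_transverse_AP (hq : q ≠ 0) {a : ℂ} (hS : zS q a ≠ 0) (hH : zH p q a ≠ 0)
    (hD : zD p q a = 0) (μ ν : Fin 4) :
    HasPole (fun z => resolvent p q z (iA μ) (iP ν)) a
      (-I * p.g * p.χ * (p.ω₀ : ℂ) ^ 2 * tens (fourC a q) p.vC (zO p q a)
        (gap p * zO p q a / (zH p q a * zS q a))
        (-(gap p * zO p q a ^ 2 / (zH p q a * zS q a)))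
        (-(zU p q a / zH p q a)) (gap p * zO p q a / zH p q a) μ ν / deriv (zD p q) a) 0 := by
  have hne := deriv_zD_ne_zero hp hq hD
  have hd := (hasDerivAt_zD p q a).differentiableAt.hasDerivAt
  have hHS : zH p q a * zS q a ≠ 0 := mul_ne_zero hH hS
  exact HasPole.simple' (f := fun z => resolvent p q z (iA μ) (iP ν))
    (N := fun z => -I * p.g * p.χ * (p.ω₀ : ℂ) ^ 2 * tens (fourC z q) p.vC (zO p q z)
        (gap p * zO p q z / (zH p q z * zS q z))
        (-(gap p * zO p q z ^ 2 / (zH p q z * zS q z)))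
        (-(zU p q z / zH p q z)) (gap p * zO p q z / zH p q z) μ ν)
    (by simp only [tens]; fun_prop (disch := assumption)) (analyticAt_zD p q a) hD
    hd hne (by
      filter_upwards [eventually_ne_of_analyticAt (analyticAt_zS q a) hS,
        eventually_ne_of_analyticAt (analyticAt_zH p q a) hH,
        hd.eventually_ne (c := 0) hne] with z h1 h2 h3
      rw [resolvent_AP hp]
      simp only [tens]
      field_simp)

theorem hasPole_transverse_PP (hq : q ≠ 0) {a : ℂ} (hH : zH p q a ≠ 0)
    (hD : zD p q a = 0) (μ ν : Fin 4) :
    HasPole (fun z => resolvent p q z (iP μ) (iP ν)) a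
      (tens (fourC a q) p.vC (p.χ * (p.ω₀ : ℂ) ^ 2 * zS q a / (4 * π))
        (p.g ^ 2 * p.χ ^ 2 * ((p.ω₀ : ℂ) ^ 2) ^ 2 / zH p q a)
        (-(p.g ^ 2 * p.χ ^ 2 * ((p.ω₀ : ℂ) ^ 2) ^ 2 * zO p q a / zH p q a))
        (-(p.g ^ 2 * p.χ ^ 2 * ((p.ω₀ : ℂ) ^ 2) ^ 2 * zO p q a / zH p q a))
        (p.χ * (p.ω₀ : ℂ) ^ 2 * (p.g ^ 2 * p.χ * (p.ω₀ : ℂ) ^ 2 * (zS q a + zO p q a ^ 2)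
          - zS q a * zU p q a / (4 * π)) / zH p q a) μ ν / deriv (zD p q) a) 0 := by
  have hne := deriv_zD_ne_zero hp hq hD
  have hd := (hasDerivAt_zD p q a).differentiableAt.hasDerivAt
  have h7 := @pi4_ne
  have hπ := piC_ne
  exact HasPole.simple' (f := fun z => resolvent p q z (iP μ) (iP ν))
    (N := fun z => tens (fourC z q) p.vC (p.χ * (p.ω₀ : ℂ) ^ 2 * zS q z / (4 * π))
        (p.g ^ 2 * p.χ ^ 2 * ((p.ω₀ : ℂ) ^ 2) ^ 2 / zH p q z)
        (-(p.g ^ 2 * p.χ ^ 2 * ((p.ω₀ : ℂ) ^ 2) ^ 2 * zO p q z / zH p q z))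
        (-(p.g ^ 2 * p.χ ^ 2 * ((p.ω₀ : ℂ) ^ 2) ^ 2 * zO p q z / zH p q z))
        (p.χ * (p.ω₀ : ℂ) ^ 2 * (p.g ^ 2 * p.χ * (p.ω₀ : ℂ) ^ 2 * (zS q z + zO p q z ^ 2)
          - zS q z * zU p q z / (4 * π)) / zH p q z) μ ν)
    (by simp only [tens]; fun_prop (disch := assumption)) (analyticAt_zD p q a) hD
    hd hne (by
      filter_upwards [eventually_ne_of_analyticAt (analyticAt_zH p q a) hH,
        hd.eventually_ne (c := 0) hne] with z h2 h3
      rw [resolvent_PP hp]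
      simp only [tens]
      field_simp)

end good

/-! ### Expansion of the propagator at large energy -/

/-- `f(z) = O(zⁿ)` at infinity. -/
def Ord (n : ℤ) (f : ℂ → ℂ) : Prop := f =O[cocompact ℂ] fun z => z ^ n

theorem eventually_ne_cocompact (a : ℂ) : ∀ᶠ z in cocompact ℂ, z ≠ a := by
  filter_upwards [(isCompact_singleton (x := a)).compl_mem_cocompact] with z hz
  simpa using hz

theorem eventually_one_le_norm : ∀ᶠ z in cocompact ℂ, (1 : ℝ) ≤ ‖z‖ :=
  (tendsto_norm_cocompact_atTop (E := ℂ)).eventually_ge_atTop 1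

namespace Ord

variable {f g : ℂ → ℂ} {m n : ℤ}

theorem mul (hf : Ord m f) (hg : Ord n g) : Ord (m + n) (fun z => f z * g z) := by
  refine (IsBigO.mul hf hg).congr' EventuallyEq.rfl ?_
  filter_upwards [eventually_ne_cocompact 0] with z hz
  rw [zpow_add₀ hz]

theorem mono (h : m ≤ n) (hf : Ord m f) : Ord n f := by
  refine IsBigO.trans hf (IsBigO.of_bound 1 ?_)
  filter_upwards [eventually_one_le_norm] with z hz
  rw [one_mul, norm_zpow, norm_zpow]
  exact zpow_le_zpow_right₀ hz h

theorem add (hf : Ord n f) (hg : Ord n g) : Ord n (fun z => f z + g z) := IsBigO.add hf hg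

theorem const (r : ℂ) : Ord 0 (fun _ => r) := by
  simpa [Ord] using isBigO_const_const r (one_ne_zero : (1 : ℂ) ≠ 0) (cocompact ℂ)

theorem const_mul (r : ℂ) (hf : Ord n f) : Ord n (fun z => r * f z) := IsBigO.const_mul_left hf r

theorem congr (hf : Ord n f) (h : ∀ᶠ z in cocompact ℂ, f z = g z) : Ord n g :=
  IsBigO.congr' hf h EventuallyEq.rfl

theorem id : Ord 1 (fun z => z) := by simpa [Ord] using isBigO_refl (fun z : ℂ => z) _

theorem inv_pow (n : ℕ) : Ord (-n) (fun z => 1 / z ^ n) := by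
  refine (isBigO_refl (fun z : ℂ => z ^ (-(n : ℤ))) _).congr_left fun z => ?_
  rw [zpow_neg, zpow_natCast, one_div]

theorem tendsto_zero (hf : Ord (-1) f) : Tendsto f (cocompact ℂ) (𝓝 0) := by
  refine IsBigO.trans_tendsto hf ?_
  have := tendsto_inv_sub_cocompact 0
  simpa [zpow_neg_one] using this

end Ord

/-- A function with a nonzero limit when divided by `zⁿ` has an inverse of order `-n`. -/
theorem Ord.inv {f : ℂ → ℂ} {n : ℕ} {l : ℂ} (hl : l ≠ 0)
    (h : Tendsto (fun z => f z / z ^ n) (cocompact ℂ) (𝓝 l)) :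
    (∀ᶠ z in cocompact ℂ, f z ≠ 0) ∧ Ord (-n) (fun z => 1 / f z) := by
  have h1 := h.eventually_ne hl
  have h2 : ∀ᶠ z in cocompact ℂ, f z ≠ 0 := h1.mono fun z hz h0 => hz (by rw [h0, zero_div])
  refine ⟨h2, ?_⟩
  have h3 := (h.inv₀ hl).isBigO_one ℂ
  have h4 := (h3.mul (Ord.inv_pow n))
  refine h4.congr' ?_ (.of_forall fun z => one_mul _)
  filter_upwards [h2, eventually_ne_cocompact 0] with z hz hz0
  field_simp

section good

variable {p : Medium} (hp : p.Good) (q : ℝ³)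

theorem tendsto_zS : Tendsto (fun z => zS q z / z ^ 2) (cocompact ℂ) (𝓝 1) := by
  have h := tendsto_inv_sub_cocompact 0
  have h2 := ((h.pow 2).const_mul ((∑ j, q j ^ 2 : ℝ) : ℂ)).const_sub 1
  have e : (1 : ℂ) - ((∑ j, q j ^ 2 : ℝ) : ℂ) * 0 ^ 2 = 1 := by simp
  rw [e] at h2
  refine h2.congr' ?_
  filter_upwards [eventually_ne_cocompact 0] with z hz
  rw [zS]; field_simp; simp

theorem tendsto_zO : Tendsto (fun z => zO p q z / z) (cocompact ℂ) (𝓝 (p.v 0)) := by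
  have h := tendsto_inv_sub_cocompact 0
  have h2 := (h.const_mul (p.v 0 * xStar p q : ℂ)).const_sub (p.v 0 : ℂ)
  rw [mul_zero, sub_zero] at h2
  refine h2.congr' ?_
  filter_upwards [eventually_ne_cocompact 0] with z hz
  rw [zO]; field_simp; simp

theorem tendsto_zU : Tendsto (fun z => zU p q z / z ^ 2) (cocompact ℂ) (𝓝 ((p.v 0 : ℂ) ^ 2)) := by
  have h := tendsto_inv_sub_cocompact 0
  have h2 := ((tendsto_zO (p := p) q).pow 2).sub ((h.pow 2).const_mul ((p.ω₀ : ℂ) ^ 2))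
  have e : (p.v 0 : ℂ) ^ 2 - (p.ω₀ : ℂ) ^ 2 * 0 ^ 2 = (p.v 0 : ℂ) ^ 2 := by simp
  rw [e] at h2
  refine h2.congr' ?_
  filter_upwards [eventually_ne_cocompact 0] with z hz
  rw [zU]; field_simp; simp; ring

theorem tendsto_zH : Tendsto (fun z => zH p q z / z ^ 2) (cocompact ℂ) (𝓝 ((p.v 0 : ℂ) ^ 2)) := by
  have h := tendsto_inv_sub_cocompact 0
  have h2 := (tendsto_zU (p := p) q).sub ((h.pow 2).const_mul (gap p))
  have e : (p.v 0 : ℂ) ^ 2 - gap p * 0 ^ 2 = (p.v 0 : ℂ) ^ 2 := by simp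
  rw [e] at h2
  refine h2.congr' ?_
  filter_upwards [eventually_ne_cocompact 0] with z hz
  rw [zH, gap]; field_simp; simp; ring

theorem tendsto_zD : Tendsto (fun z => zD p q z / z ^ 4) (cocompact ℂ)
    (𝓝 ((p.v 0 : ℂ) ^ 2 / (4 * π))) := by
  have h := tendsto_inv_sub_cocompact 0
  have h2 := (((tendsto_zS q).mul (tendsto_zU (p := p) q)).div_const (4 * π : ℂ)).sub
    (((h.pow 2).mul ((tendsto_zO (p := p) q).pow 2)).const_mul (p.g ^ 2 * p.χ * (p.ω₀ : ℂ) ^ 2))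
  have e : 1 * (p.v 0 : ℂ) ^ 2 / (4 * π) - p.g ^ 2 * p.χ * (p.ω₀ : ℂ) ^ 2
      * (0 ^ 2 * (p.v 0 : ℂ) ^ 2) = (p.v 0 : ℂ) ^ 2 / (4 * π) := by simp
  rw [e] at h2
  refine h2.congr' ?_
  filter_upwards [eventually_ne_cocompact 0] with z hz
  have hπ := piC_ne
  rw [zD]; field_simp; simp; ring

theorem Ord.of_tendsto {f : ℂ → ℂ} {n : ℕ} {l : ℂ}
    (h : Tendsto (fun z => f z / z ^ n) (cocompact ℂ) (𝓝 l)) : Ord n f := by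
  have h1 : (fun z : ℂ => z ^ n) =O[cocompact ℂ] fun z : ℂ => z ^ (n : ℤ) := by
    simpa using isBigO_refl (fun z : ℂ => z ^ n) (cocompact ℂ)
  refine ((h.isBigO_one ℂ).mul h1).congr' ?_ (.of_forall fun z => one_mul _)
  filter_upwards [eventually_ne_cocompact 0] with z hz
  field_simp

theorem ord_zO : Ord 1 (zO p q) := by
  have : Tendsto (fun z => zO p q z / z ^ 1) (cocompact ℂ) (𝓝 (p.v 0)) := by
    simpa using tendsto_zO (p := p) q
  exact_mod_cast Ord.of_tendsto this

theorem ord_zU : Ord 2 (zU p q) := by exact_mod_cast Ord.of_tendsto (tendsto_zU (p := p) q)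

theorem ord_zS : Ord 2 (zS q) := by exact_mod_cast Ord.of_tendsto (tendsto_zS q)

theorem ord_fourC (μ : Fin 4) : Ord 1 (fun z => fourC z q μ) := by
  refine Fin.cases ?_ (fun j => ?_) μ
  · simpa [fourC] using Ord.id
  · simpa [fourC] using (Ord.const (q j : ℂ)).mono zero_le_one

theorem ord_inv_zS : (∀ᶠ z in cocompact ℂ, zS q z ≠ 0) ∧ Ord (-2) (fun z => 1 / zS q z) := by
  exact_mod_cast Ord.inv one_ne_zero (tendsto_zS q)

include hp

theorem ord_inv_zU : (∀ᶠ z in cocompact ℂ, zU p q z ≠ 0) ∧ Ord (-2) (fun z => 1 / zU p q z) := by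
  exact_mod_cast Ord.inv (pow_ne_zero 2 (v0_ne hp)) (tendsto_zU q)

theorem ord_inv_zH : (∀ᶠ z in cocompact ℂ, zH p q z ≠ 0) ∧ Ord (-2) (fun z => 1 / zH p q z) := by
  exact_mod_cast Ord.inv (pow_ne_zero 2 (v0_ne hp)) (tendsto_zH q)

theorem ord_inv_zD : (∀ᶠ z in cocompact ℂ, zD p q z ≠ 0) ∧ Ord (-4) (fun z => 1 / zD p q z) := by
  exact_mod_cast Ord.inv (div_ne_zero (pow_ne_zero 2 (v0_ne hp)) pi4_ne) (tendsto_zD q)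

end good

/-- `f(z) = r₀/z + r₁/z² + r₂/z³ + o(1/z³)` at infinity. -/
def HasExp (f : ℂ → ℂ) (r₀ r₁ r₂ : ℂ) : Prop :=
  Tendsto (fun z => z ^ 3 * (f z - (r₀ / z + r₁ / z ^ 2 + r₂ / z ^ 3))) (cocompact ℂ) (𝓝 0)

namespace HasExp

variable {f g : ℂ → ℂ} {r₀ r₁ r₂ s₀ s₁ s₂ : ℂ}

theorem of_ord_sub (h : Ord (-4) (fun z => f z - (r₀ / z + r₁ / z ^ 2 + r₂ / z ^ 3))) :
    HasExp f r₀ r₁ r₂ :=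
  Ord.tendsto_zero (Ord.mul ((isBigO_refl (fun z : ℂ => z ^ 3) _).congr_right fun z => by
    norm_cast : Ord 3 _) h)

theorem of_ord (h : Ord (-4) f) : HasExp f 0 0 0 :=
  of_ord_sub (h.congr (.of_forall fun z => by simp))

theorem of_tendsto (h : Tendsto (fun z => z ^ 3 * f z) (cocompact ℂ) (𝓝 r₂)) : HasExp f 0 0 r₂ := by
  have := h.sub_const r₂
  rw [sub_self] at this
  refine this.congr' ?_
  filter_upwards [eventually_ne_cocompact 0] with z hz
  field_simp; ring

theorem add (hf : HasExp f r₀ r₁ r₂) (hg : HasExp g s₀ s₁ s₂) :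
    HasExp (fun z => f z + g z) (r₀ + s₀) (r₁ + s₁) (r₂ + s₂) := by
  have h := Tendsto.add hf hg
  rw [add_zero] at h
  exact h.congr fun z => by ring

theorem const_mul (r : ℂ) (hf : HasExp f r₀ r₁ r₂) :
    HasExp (fun z => r * f z) (r * r₀) (r * r₁) (r * r₂) := by
  have h := Tendsto.const_mul r hf
  rw [mul_zero] at h
  exact h.congr fun z => by ring

theorem congr (hf : HasExp f r₀ r₁ r₂) (h : ∀ᶠ z in cocompact ℂ, f z = g z) :
    HasExp g r₀ r₁ r₂ :=
  Tendsto.congr' (h.mono fun z hz => by rw [hz]) hf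

/-- The coefficients of the expansion at infinity in terms of the principal parts. -/
theorem sums {A : Finset ℂ} {c d : ℂ → ℂ} (h : HasExp f r₀ r₁ r₂)
    (hf : ∀ z ∉ A, f z = fracSum A c d z) :
    ∑ a ∈ A, c a = r₀ ∧ ∑ a ∈ A, (a * c a + d a) = r₁ ∧
      ∑ a ∈ A, (a * (a * c a + d a) + a * d a) = r₂ := by
  have hi := tendsto_inv_sub_cocompact 0
  simp only [sub_zero] at hi
  have ht : ∀ m : ℕ, m ≤ 3 → Tendsto (fun z => z ^ m * (f z - (r₀ / z + r₁ / z ^ 2 + r₂ / z ^ 3)))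
      (cocompact ℂ) (𝓝 0) := by
    intro m hm
    have h1 := (hi.pow (3 - m)).mul h
    rw [mul_zero] at h1
    refine h1.congr' ?_
    filter_upwards [eventually_ne_cocompact 0] with z hz
    rw [← mul_assoc, inv_pow, inv_mul_eq_div, pow_sub₀ _ hz hm]; field_simp
  have h0 : ∑ a ∈ A, c a = r₀ := by
    refine sum_coeff_eq hf ?_
    have := ((ht 1 (by norm_num)).add ((hi.const_mul r₁).add ((hi.pow 2).const_mul r₂))).const_add r₀
    norm_num at this
    refine this.congr' ?_
    filter_upwards [eventually_ne_cocompact 0] with z hz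
    field_simp; ring
  have hf1 := sub_eq_fracSum hf h0
  have h1 : ∑ a ∈ A, (a * c a + d a) = r₁ := by
    refine sum_coeff_eq hf1 ?_
    have := ((ht 2 (by norm_num)).add (hi.const_mul r₂)).const_add r₁
    norm_num at this
    refine this.congr' ?_
    filter_upwards [eventually_ne_cocompact 0] with z hz
    field_simp; ring
  have hf2 := sub_eq_fracSum hf1 h1
  refine ⟨h0, h1, sum_coeff_eq hf2 ?_⟩
  have := (ht 3 le_rfl).const_add r₂
  norm_num at this
  refine this.congr' ?_
  filter_upwards [eventually_ne_cocompact 0] with z hz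
  field_simp; ring

theorem tendsto_zero (h : HasExp f r₀ r₁ r₂) : Tendsto f (cocompact ℂ) (𝓝 0) := by
  have hi := tendsto_inv_sub_cocompact 0
  simp only [sub_zero] at hi
  have h2 := ((hi.pow 3).mul h).add
    (((hi.const_mul r₀).add ((hi.pow 2).const_mul r₁)).add ((hi.pow 3).const_mul r₂))
  norm_num at h2
  refine h2.congr' ?_
  filter_upwards [eventually_ne_cocompact 0] with z hz
  field_simp; ring

end HasExp

/-- `1 / k² = 1/z² + O(1/z⁴)`. -/
theorem hasExp_inv_zS (q : ℝ³) : HasExp (fun z => 1 / zS q z) 0 1 0 := by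
  have h := ((ord_inv_zS q).2.mul (Ord.inv_pow 2)).const_mul ((∑ j, q j ^ 2 : ℝ) : ℂ)
  refine .of_ord_sub (h.congr ?_)
  filter_upwards [(ord_inv_zS q).1, eventually_ne_cocompact 0] with z h1 h2
  have : zS q z = z ^ 2 - ((∑ j, q j ^ 2 : ℝ) : ℂ) := rfl
  field_simp
  rw [this]
  ring

/-- The time component of a vector as a coefficient of `z`. -/
def tCoeff (μ : Fin 4) : ℂ := if μ = 0 then 1 else 0

/-- The spatial part of the momentum. -/
def sCoeff (q : ℝ³) (μ : Fin 4) : ℂ := fourC 0 q μ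

theorem fourC_eq (q : ℝ³) (z : ℂ) (μ : Fin 4) :
    fourC z q μ = z * tCoeff μ + sCoeff q μ := by
  refine Fin.cases ?_ (fun j => ?_) μ <;> simp [fourC, tCoeff, sCoeff]

/-- `k^μ k^ν / (k²)² = n^μ n^ν / z² + (n^μ q^ν + q^μ n^ν) / z³ + O(1/z⁴)`. -/
theorem hasExp_kk (q : ℝ³) (μ ν : Fin 4) :
    HasExp (fun z => fourC z q μ * fourC z q ν / zS q z ^ 2) 0 (tCoeff μ * tCoeff ν)
      (tCoeff μ * sCoeff q ν + sCoeff q μ * tCoeff ν) := by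
  have hk := ord_fourC q
  have hS := (ord_inv_zS q).2
  have h1 := (((hk μ).mul (hk ν)).mul ((hS.mul hS).mul (Ord.inv_pow 2))).const_mul
    (2 * ((∑ j, q j ^ 2 : ℝ) : ℂ))
  have h2 := (((hk μ).mul (hk ν)).mul ((hS.mul hS).mul (Ord.inv_pow 4))).const_mul
    (-((∑ j, q j ^ 2 : ℝ) : ℂ) ^ 2)
  have h3 := (Ord.inv_pow 4).const_mul (sCoeff q μ * sCoeff q ν)
  refine .of_ord_sub ((((h1.mono (by norm_num)).add (h2.mono (by norm_num))).add h3).congr ?_)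
  filter_upwards [(ord_inv_zS q).1, eventually_ne_cocompact 0] with z h1 h2
  have : zS q z = z ^ 2 - ((∑ j, q j ^ 2 : ℝ) : ℂ) := rfl
  simp only [fourC_eq]
  field_simp
  rw [this]
  ring

section good

variable {p : Medium} (hp : p.Good) (q : ℝ³)
include hp

theorem hasExp_AA (μ ν : Fin 4) : HasExp (fun z => resolvent p q z (iA μ) (iA ν)) 0
    (4 * π * eta μ ν + (p.ξ - 4 * π) * (tCoeff μ * tCoeff ν))
    ((p.ξ - 4 * π) * (tCoeff μ * sCoeff q ν + sCoeff q μ * tCoeff ν)) := by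
  have hπ := piC_ne
  have m1 := ((hasExp_inv_zS q).const_mul (4 * π * eta μ ν)).add
    ((hasExp_kk q μ ν).const_mul (p.ξ - 4 * π))
  have oS := (ord_inv_zS q).2
  have oH := (ord_inv_zH hp q).2
  have oD := (ord_inv_zD hp q).2
  have oU := ord_zU (p := p) q
  have oO := ord_zO (p := p) q
  have ok := ord_fourC q
  -- the corrections, all of order `-4`
  have c1 := ((oO.mul oO).mul (oD.mul oS)).const_mul (gap p * eta μ ν)
  have c2 := (((ok μ).mul (ok ν)).mul ((oS.mul oS).mul oH)).const_mul (-(4 * π * gap p))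
  have c3 := (((ok μ).mul (ok ν)).mul ((oU.mul oH).mul (oD.mul oS))).const_mul (gap p)
  have c4 := (((ok μ).mul oO).mul ((oU.mul oH).mul (oD.mul oS))).const_mul (-(gap p * p.vC ν))
  have c5 := (((ok ν).mul oO).mul ((oU.mul oH).mul (oD.mul oS))).const_mul (-(gap p * p.vC μ))
  have c6 := (oU.mul (oH.mul oD)).const_mul (gap p * (p.vC μ * p.vC ν))
  have h := m1.add (HasExp.of_ord (((((c1.mono (by norm_num : _ ≤ (-4 : ℤ))).add
    (c2.mono (by norm_num))).add (c3.mono (by norm_num))).add (c4.mono (by norm_num))).add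
    ((c5.mono (by norm_num : _ ≤ (-4 : ℤ))).add (c6.mono (by norm_num)))))
  simp only [mul_zero, add_zero, mul_one, zero_add] at h
  refine h.congr ?_
  filter_upwards [(ord_inv_zS q).1, (ord_inv_zH hp q).1, (ord_inv_zD hp q).1] with z h1 h2 h3
  rw [resolvent_AA hp]
  simp only [tens]
  have eD : zD p q z = zS q z * zU p q z / (4 * π) - gap p / (4 * π) * zO p q z ^ 2 := by
    rw [zD, gap]; field_simp
  have eH : zU p q z = zH p q z + gap p := by rw [zH, gap]; ring
  have e1 : zU p q z / zD p q z = 4 * π * (1 / zS q z)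
      + gap p * (zO p q z * zO p q z * (1 / zD p q z * (1 / zS q z))) := by
    field_simp
    rw [eD]
    field_simp
    ring
  have e2 : 4 * π * zU p q z / (zH p q z * zS q z ^ 2) = 4 * π / zS q z ^ 2
      + 4 * π * gap p * (1 / zS q z * (1 / zS q z) * (1 / zH p q z)) := by
    rw [eH]; field_simp
  rw [e1, e2]
  field_simp
  ring

theorem hasExp_AP (μ ν : Fin 4) : HasExp (fun z => resolvent p q z (iA μ) (iP ν)) 0 0
    (-(4 * π * I * p.g * p.χ * (p.ω₀ : ℂ) ^ 2 / p.v 0 ^ 2)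
      * (p.v 0 * eta μ ν - p.vC μ * tCoeff ν)) := by
  have hπ := piC_ne
  have hv0 := v0_ne hp
  have hi := tendsto_inv_sub_cocompact 0
  simp only [sub_zero] at hi
  have tO := tendsto_zO (p := p) q
  have tk : ∀ μ, Tendsto (fun z => fourC z q μ / z) (cocompact ℂ) (𝓝 (tCoeff μ)) := fun μ => by
    have := (hi.const_mul (sCoeff q μ)).const_add (tCoeff μ)
    rw [mul_zero, add_zero] at this
    refine this.congr' ?_
    filter_upwards [eventually_ne_cocompact 0] with z hz
    rw [fourC_eq]; field_simp
  have tD := tendsto_zD (p := p) q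
  have tHD := (tendsto_zH (p := p) q).mul tD
  have hD : (p.v 0 : ℂ) ^ 2 / (4 * π) ≠ 0 := by simp [hv0, hπ]
  have hHD := mul_ne_zero (pow_ne_zero 2 hv0) hD
  have t := (((((tO.div tD hD).mul_const (eta μ ν)).add ((((tk μ).mul (tk ν)).mul
    (tO.div (tHD.mul (tendsto_zS q)) (mul_ne_zero hHD one_ne_zero))).mul ((hi.pow 2).const_mul
    (gap p)))).sub (((tk μ).mul ((tO.mul tO).div (tHD.mul (tendsto_zS q)) (mul_ne_zero hHD
    one_ne_zero))).mul ((hi.pow 2).const_mul (gap p * p.vC ν)))).sub ((((tendsto_zU (p := p) q).div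
    tHD hHD).mul (tk ν)).mul_const (p.vC μ))).add ((tO.div tHD hHD).mul ((hi.pow 2).const_mul
    (gap p * (p.vC μ * p.vC ν))))
  refine .of_tendsto ?_
  convert (t.const_mul (-I * p.g * p.χ * (p.ω₀ : ℂ) ^ 2)).congr' ?_ using 2
  · field_simp; ring
  · filter_upwards [(ord_inv_zS q).1, (ord_inv_zH hp q).1, (ord_inv_zD hp q).1,
      eventually_ne_cocompact 0] with z h1 h2 h3 h4
    rw [resolvent_AP hp]
    simp only [tens, Pi.div_apply]
    field_simp
    ring

theorem hasExp_PP (μ ν : Fin 4) : HasExp (fun z => resolvent p q z (iP μ) (iP ν)) 0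
    (p.χ * (p.ω₀ : ℂ) ^ 2 / p.v 0 ^ 2 * (eta μ ν - p.vC μ * p.vC ν))
    (2 * xStar p q * (p.χ * (p.ω₀ : ℂ) ^ 2 / p.v 0 ^ 2) * (eta μ ν - p.vC μ * p.vC ν)) := by
  have hπ := piC_ne
  have hv0 := v0_ne hp
  have oH := (ord_inv_zH hp q).2
  have oD := (ord_inv_zD hp q).2
  have oU := (ord_inv_zU hp q).2
  have oS := ord_zS q
  have oO := ord_zO (p := p) q
  have ok := ord_fourC q
  have eD : ∀ z, zD p q z = zS q z * zU p q z / (4 * π)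
      - gap p / (4 * π) * zO p q z ^ 2 := by
    intro z; rw [zD, gap]; field_simp
  have eH : ∀ z, zU p q z = zH p q z + gap p := fun z => by rw [zH, gap]; ring
  have l1 : HasExp (fun z => 1 / zU p q z) 0 (1 / p.v 0 ^ 2) (2 * xStar p q / p.v 0 ^ 2) := by
    have d1 := (Ord.inv_pow 2).mul oU
    have d2 := (Ord.inv_pow 3).mul oU
    refine .of_ord_sub ((((d1.const_mul (3 * xStar p q ^ 2 + (p.ω₀ : ℂ) ^ 2 / p.v 0 ^ 2)).mono
        (by norm_num : _ ≤ (-4 : ℤ))).add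
      ((d2.const_mul (-2 * xStar p q ^ 3 + 2 * xStar p q * (p.ω₀ : ℂ) ^ 2 / p.v 0 ^ 2)).mono
        (by norm_num))).congr ?_)
    filter_upwards [(ord_inv_zU hp q).1, eventually_ne_cocompact 0] with z h1 h2
    have eU : zU p q z = (p.v 0 * (z - xStar p q)) ^ 2 - (p.ω₀ : ℂ) ^ 2 := rfl
    field_simp
    rw [eU]
    ring
  obtain ⟨B, hB⟩ : ∃ B : ℂ, B = p.χ * (p.ω₀ : ℂ) ^ 2 := ⟨_, rfl⟩
  have c1 := ((oO.mul oO).mul (oD.mul oU)).const_mul (B * gap p / (4 * π) * eta μ ν)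
  have c2 := (((ok μ).mul (ok ν)).mul (oD.mul oH)).const_mul (p.g ^ 2 * B ^ 2)
  have c3 := (((ok μ).mul oO).mul (oD.mul oH)).const_mul (-(p.g ^ 2 * B ^ 2 * p.vC ν))
  have c4 := (((ok ν).mul oO).mul (oD.mul oH)).const_mul (-(p.g ^ 2 * B ^ 2 * p.vC μ))
  have c5 := (oS.mul (oD.mul oH)).const_mul (p.g ^ 2 * B ^ 2 * (p.vC μ * p.vC ν))
  have c6 := (oH.mul oU).const_mul (-(B * gap p * (p.vC μ * p.vC ν)))
  have h := (l1.const_mul (B * (eta μ ν - p.vC μ * p.vC ν))).add (HasExp.of_ord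
    (((c1.mono (by norm_num : _ ≤ (-4 : ℤ))).add (c2.mono (by norm_num))).add
    (((c3.mono (by norm_num : _ ≤ (-4 : ℤ))).add (c4.mono (by norm_num))).add
    ((c5.mono (by norm_num : _ ≤ (-4 : ℤ))).add (c6.mono (by norm_num))))))
  have h' : HasExp (fun z => resolvent p q z (iP μ) (iP ν)) _ _ _ := h.congr (by
    filter_upwards [(ord_inv_zU hp q).1, (ord_inv_zH hp q).1, (ord_inv_zD hp q).1] with z h1 h2 h3
    rw [resolvent_PP hp]
    have e1 : p.χ * (p.ω₀ : ℂ) ^ 2 * zS q z / (4 * π * zD p q z) = B * (1 / zU p q z)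
        + B * gap p / (4 * π) * (zO p q z * zO p q z * (1 / zD p q z * (1 / zU p q z))) := by
      rw [← hB]
      field_simp
      rw [eD]
      field_simp
      ring
    have e2 : p.χ * (p.ω₀ : ℂ) ^ 2 * (p.g ^ 2 * p.χ * (p.ω₀ : ℂ) ^ 2 * (zS q z + zO p q z ^ 2)
        - zS q z * zU p q z / (4 * π)) / (zD p q z * zH p q z) = -(B * (1 / zU p q z))
        + p.g ^ 2 * B ^ 2 * (zS q z * (1 / zD p q z * (1 / zH p q z)))
        + -(B * gap p * (1 / zH p q z * (1 / zU p q z))) := by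
      have e3 : p.g ^ 2 * p.χ * (p.ω₀ : ℂ) ^ 2 * (zS q z + zO p q z ^ 2)
        - zS q z * zU p q z / (4 * π) = p.g ^ 2 * B * zS q z - zD p q z := by
        rw [eD, hB, gap]; field_simp; ring
      have e4 : p.χ * (p.ω₀ : ℂ) ^ 2 = B := hB.symm
      rw [e3, e4]
      field_simp
      rw [eH]
      ring
    have e5 : p.g ^ 2 * p.χ ^ 2 * ((p.ω₀ : ℂ) ^ 2) ^ 2 = p.g ^ 2 * B ^ 2 := by rw [hB]; ring
    rw [e1, e2, e5]
    simp only [tens]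
    field_simp
    ring)
  have e1 : B * (eta μ ν - p.vC μ * p.vC ν) * (1 / p.v 0 ^ 2) + 0
      = p.χ * (p.ω₀ : ℂ) ^ 2 / p.v 0 ^ 2 * (eta μ ν - p.vC μ * p.vC ν) := by rw [hB]; ring
  have e2 : B * (eta μ ν - p.vC μ * p.vC ν) * (2 * xStar p q / p.v 0 ^ 2) + 0
      = 2 * xStar p q * (p.χ * (p.ω₀ : ℂ) ^ 2 / p.v 0 ^ 2) * (eta μ ν - p.vC μ * p.vC ν) := by
    rw [hB]; ring
  rw [e1, e2] at h'
  simpa using h'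

omit hp in
theorem hasExp_AB (μ : Fin 4) : HasExp (fun z => resolvent p q z (iA μ) iB)
    (-I * tCoeff μ) (-I * sCoeff q μ)
    (-I * ((∑ j, q j ^ 2 : ℝ) : ℂ) * tCoeff μ) := by
  have d1 := (Ord.inv_pow 2).mul (ord_inv_zS q).2
  have d2 := (Ord.inv_pow 3).mul (ord_inv_zS q).2
  refine .of_ord_sub ((((d1.const_mul (-I * ((∑ j, q j ^ 2 : ℝ) : ℂ) * sCoeff q μ)).mono
      (by norm_num : _ ≤ (-4 : ℤ))).add
    ((d2.const_mul (-I * ((∑ j, q j ^ 2 : ℝ) : ℂ) ^ 2 * tCoeff μ)).mono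
      (by norm_num))).congr ?_)
  filter_upwards [(ord_inv_zS q).1, eventually_ne_cocompact 0] with z h1 h2
  have eS : zS q z = z ^ 2 - ((∑ j, q j ^ 2 : ℝ) : ℂ) := rfl
  rw [resolvent_AB, fourC_eq]
  field_simp
  rw [eS]
  ring

end good

/-! ### Partial fractions of the propagator -/

theorem HasPole.comp_neg {f : ℂ → ℂ} {a c d : ℂ} (h : HasPole f a c d) :
    HasPole (fun z => f (-z)) (-a) (-c) d := by
  have ht : Tendsto (fun z : ℂ => -z) (𝓝[≠] (-a)) (𝓝[≠] a) := by
    refine tendsto_nhdsWithin_iff.2 ⟨?_, ?_⟩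
    · have : Tendsto (fun z : ℂ => -z) (𝓝 (-a)) (𝓝 (- -a)) := continuous_neg.tendsto _
      rw [neg_neg] at this
      exact this.mono_left nhdsWithin_le_nhds
    · filter_upwards [self_mem_nhdsWithin] with z hz h
      exact hz (by rw [Set.mem_singleton_iff] at h ⊢; rw [← h, neg_neg])
  refine (IsBigO.comp_tendsto h ht).congr_left fun z => ?_
  have e : -z - a = -(z - -a) := by ring
  simp only [Function.comp, e, div_neg, neg_sq, neg_div]

section

variable {p : Medium} (hp : p.Good) {q : ℝ³}
include hp

omit hp in
theorem ne_zero_of_zS (hq : q ≠ 0) {a : ℂ} (h : zS q a = 0) : a ≠ 0 := by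
  rintro rfl
  refine hq ?_
  have h1 : ((∑ j, q j ^ 2 : ℝ) : ℂ) = 0 := by simpa [zS] using h
  have h2 : ∑ j, q j ^ 2 = 0 := by exact_mod_cast h1
  ext j
  have := (Finset.sum_eq_zero_iff_of_nonneg fun j _ => sq_nonneg (q j)).1 h2 j (Finset.mem_univ _)
  simpa using this

/-- Above the diagonal. -/
theorem exists_hasPole_upper (hG : Generic p q) {z : ℂ} (hz : z ∈ nodes p q) (μ : Fin 4) :
    (∀ ν, ∃ c d, HasPole (fun y => resolvent p q y (iA μ) (iA ν)) z c d) ∧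
    (∀ ν, ∃ c d, HasPole (fun y => resolvent p q y (iA μ) (iP ν)) z c d) ∧
    (∃ c d, HasPole (fun y => resolvent p q y (iA μ) iB) z c d) ∧
    (∀ ν, ∃ c d, HasPole (fun y => resolvent p q y (iP μ) (iP ν)) z c d) := by
  have hAB : zS q z ≠ 0 → ∃ c d, HasPole (fun y => resolvent p q y (iA μ) iB) z c d := by
    intro hS
    refine ⟨0, 0, HasPole.of_continuousAt ?_⟩
    simp only [resolvent_AB]
    exact ((continuousAt_const.mul (analyticAt_fourC q μ z).continuousAt).div
      (analyticAt_zS q z).continuousAt hS)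
  rcases nodes_cases hp hG hz with ⟨hS, hH, hD⟩ | ⟨hS, hH, hD⟩ | ⟨hS, hH, hD⟩
  · have h0 := ne_zero_of_zS hG.ne_zero hS
    exact ⟨fun ν => ⟨_, _, hasPole_photon_AA hp h0 hS hH hD μ ν⟩,
      fun ν => ⟨_, _, hasPole_photon_AP hp h0 hS hH hD μ ν⟩,
      ⟨_, _, hasPole_photon_AB h0 hS μ⟩, fun ν => ⟨_, _, hasPole_photon_PP hp hH hD μ ν⟩⟩
  · exact ⟨fun ν => ⟨_, _, hasPole_bar_AA hp hS hH hD μ ν⟩,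
      fun ν => ⟨_, _, hasPole_bar_AP hp hS hH hD μ ν⟩, hAB hS,
      fun ν => ⟨_, _, hasPole_bar_PP hp hH hD μ ν⟩⟩
  · exact ⟨fun ν => ⟨_, _, hasPole_transverse_AA hp hG.ne_zero hS hH hD μ ν⟩,
      fun ν => ⟨_, _, hasPole_transverse_AP hp hG.ne_zero hS hH hD μ ν⟩, hAB hS,
      fun ν => ⟨_, _, hasPole_transverse_PP hp hG.ne_zero hH hD μ ν⟩⟩

theorem mem_nodes_neg (hq : q ≠ 0) {z : ℂ} : -z ∈ nodes p (-q) ↔ z ∈ nodes p q := by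
  rw [mem_nodes hp (neg_ne_zero.2 hq), mem_nodes hp hq, zS_neg, zH_neg, zD_neg]

theorem exists_hasPole (hG : Generic p q) {z : ℂ} (hz : z ∈ nodes p q) (a b : FieldIx) :
    ∃ c d, HasPole (fun y => resolvent p q y a b) z c d := by
  have key : ∀ a b, (∃ c d, HasPole (fun y => resolvent p (-q) y a b) (-z) c d) →
      ∃ c d, HasPole (fun y => resolvent p q y b a) z c d := by
    rintro a b ⟨c, d, h⟩
    refine ⟨-c, d, ?_⟩
    have := h.comp_neg
    simpa only [resolvent_neg, neg_neg] using this
  have h1 := exists_hasPole_upper hp hG hz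
  have h2 := exists_hasPole_upper hp hG.neg ((mem_nodes_neg hp hG.ne_zero).2 hz)
  rcases a with μ | μ | u <;> rcases b with ν | ν | u'
  · exact (h1 μ).1 ν
  · exact (h1 μ).2.1 ν
  · exact (h1 μ).2.2.1
  · exact key _ _ ((h2 ν).2.1 μ)
  · exact (h1 μ).2.2.2 ν
  · exact ⟨0, 0, HasPole.of_continuousAt continuousAt_const⟩
  · exact key _ _ (h2 ν).2.2.1
  · exact ⟨0, 0, HasPole.of_continuousAt continuousAt_const⟩
  · exact ⟨0, 0, HasPole.of_continuousAt continuousAt_const⟩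

end

open Classical in
/-- The coefficients of the principal part of an entry of the propagator. -/
def resPair (p : Medium) (q : ℝ³) (a b : FieldIx) (z : ℂ) : ℂ × ℂ :=
  Classical.epsilon fun cd => HasPole (fun y => resolvent p q y a b) z cd.1 cd.2

/-- The residue of an entry of the propagator. -/
def resC (p : Medium) (q : ℝ³) (a b : FieldIx) (z : ℂ) : ℂ :=
  (resPair p q a b z).1

/-- The coefficient of the double pole of an entry of the propagator. -/
def resD (p : Medium) (q : ℝ³) (a b : FieldIx) (z : ℂ) : ℂ :=
  (resPair p q a b z).2

theorem hasPole_resPair {p : Medium} {q : ℝ³} {a b : FieldIx} {z c d : ℂ}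
    (h : HasPole (fun y => resolvent p q y a b) z c d) :
    HasPole (fun y => resolvent p q y a b) z (resC p q a b z) (resD p q a b z) :=
  Classical.epsilon_spec
    (p := fun cd : ℂ × ℂ => HasPole (fun y => resolvent p q y a b) z cd.1 cd.2) ⟨(c, d), h⟩

theorem resPair_eq {p : Medium} {q : ℝ³} {a b : FieldIx} {z c d : ℂ}
    (h : HasPole (fun y => resolvent p q y a b) z c d) : resC p q a b z = c ∧ resD p q a b z = d :=
  (hasPole_resPair h).unique h

section

variable {p : Medium} (hp : p.Good) {q : ℝ³}
include hp

theorem hasPole_resolvent (hG : Generic p q) {z : ℂ} (hz : z ∈ nodes p q) (a b : FieldIx) :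
    HasPole (fun y => resolvent p q y a b) z (resC p q a b z) (resD p q a b z) := by
  obtain ⟨c, d, h⟩ := exists_hasPole hp hG hz a b
  exact hasPole_resPair h

theorem resPair_neg (hG : Generic p q) {z : ℂ} (hz : z ∈ nodes p q) (a b : FieldIx) :
    resC p (-q) b a (-z) = -resC p q a b z ∧ resD p (-q) b a (-z) = resD p q a b z := by
  refine resPair_eq ?_
  have := (hasPole_resolvent hp hG hz a b).comp_neg
  refine this.congr (.of_forall fun y => ?_)
  show resolvent p q (-y) a b = _
  rw [← resolvent_neg, neg_neg]

theorem tendsto_resolvent (q : ℝ³) (a b : FieldIx) :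
    Tendsto (fun z => resolvent p q z a b) (cocompact ℂ) (𝓝 0) := by
  have key : ∀ a b, Tendsto (fun z => resolvent p (-q) z a b) (cocompact ℂ) (𝓝 0) →
      Tendsto (fun z => resolvent p q z b a) (cocompact ℂ) (𝓝 0) := by
    intro a b h
    have ht : Tendsto (fun z : ℂ => -z) (cocompact ℂ) (cocompact ℂ) :=
      (Homeomorph.neg ℂ).isClosedEmbedding.tendsto_cocompact
    refine (h.comp ht).congr fun z => ?_
    simp only [Function.comp, resolvent_neg]
  rcases a with μ | μ | u <;> rcases b with ν | ν | u'
  · exact (hasExp_AA hp q μ ν).tendsto_zero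
  · exact (hasExp_AP hp q μ ν).tendsto_zero
  · exact (hasExp_AB q μ).tendsto_zero
  · exact key _ _ (hasExp_AP hp (-q) ν μ).tendsto_zero
  · exact (hasExp_PP hp q μ ν).tendsto_zero
  · exact tendsto_const_nhds
  · exact key _ _ (hasExp_AB (-q) ν).tendsto_zero
  · exact tendsto_const_nhds
  · exact tendsto_const_nhds

theorem resolvent_eq_fracSum (hG : Generic p q) (a b : FieldIx) :
    ∀ z ∉ nodes p q, resolvent p q z a b = fracSum (nodes p q) (resC p q a b) (resD p q a b) z := by
  refine eq_fracSum (f := fun z => resolvent p q z a b) (fun z hz => ?_)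
    (fun z hz => hasPole_resolvent hp hG hz a b) (tendsto_resolvent hp q a b)
  rw [mem_nodes hp hG.ne_zero] at hz
  push Not at hz
  exact (analyticAt_resolvent hp hz.1 hz.2.1 hz.2.2 a b).differentiableAt

end

/-! ### The candidate for the vacuum two-point function -/

/-- Minus the sum of the residues of `e^{-izt} 𝓜̄⁻¹(z)` at the poles with `ω > 0`. -/
def vacuumFunction (p : Medium) (q : ℝ³) (t : ℝ) : Matrix FieldIx FieldIx ℂ :=
  Matrix.of fun a b => -expSum ((nodes p q).filter (fun z => xStar p q < z.re))
    (resC p q a b) (resD p q a b) t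

section

variable {p : Medium} (hp : p.Good) {q : ℝ³}
include hp

theorem vacuumFunction_neg (hG : Generic p q) (t : ℝ) (a b : FieldIx) :
    vacuumFunction p (-q) (-t) b a = expSum ((nodes p q).filter (fun z => z.re < xStar p q))
      (resC p q a b) (resD p q a b) t := by
  simp only [vacuumFunction, Matrix.of_apply, expSum]
  rw [← Finset.sum_neg_distrib]
  refine Finset.sum_nbij' (fun z => -z) (fun z => -z) ?_ ?_ ?_ ?_ ?_
  · intro z hz
    rw [Finset.mem_filter] at hz ⊢
    refine ⟨(mem_nodes_neg hp hG.ne_zero).1 (by simpa using hz.1), ?_⟩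
    have := hz.2
    rw [xStar_neg] at this
    simp only [Complex.neg_re]; linarith
  · intro z hz
    rw [Finset.mem_filter] at hz ⊢
    refine ⟨(mem_nodes_neg hp hG.ne_zero).2 hz.1, ?_⟩
    rw [xStar_neg]
    simp only [Complex.neg_re]; linarith [hz.2]
  · intro z _; simp
  · intro z _; simp
  · intro z hz
    rw [Finset.mem_filter] at hz
    have h : -z ∈ nodes p q := (mem_nodes_neg hp hG.ne_zero).1 (by simpa using hz.1)
    have := resPair_neg hp hG h a b
    rw [neg_neg] at this
    rw [this.1, this.2]
    push_cast
    rw [show -I * z * -(t : ℂ) = -I * -z * t by ring]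
    ring

/-- The reflection `k ↦ -k` exchanges the poles with `ω > 0` and with `ω < 0`, so that the commutator
is the sum over all of them. -/
theorem vacuumFunction_sub (hG : Generic p q) (t : ℝ) (a b : FieldIx) :
    vacuumFunction p q t a b - vacuumFunction p (-q) (-t) b a
      = -expSum (nodes p q) (resC p q a b) (resD p q a b) t := by
  rw [vacuumFunction_neg hp hG]
  simp only [vacuumFunction, Matrix.of_apply]
  have : (nodes p q).filter (fun z => z.re < xStar p q)
      = (nodes p q).filter (fun z => ¬ xStar p q < z.re) := by
    refine Finset.filter_congr fun z hz => ?_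
    have h := real_of_mem_nodeSet hp hG ((mem_nodes hp hG.ne_zero).1 hz)
    exact ⟨fun h' => not_lt.2 h'.le, fun h' => lt_of_le_of_ne (not_lt.1 h') h.2⟩
  rw [this]
  simp only [expSum]
  rw [← Finset.sum_filter_add_sum_filter_not (nodes p q) (fun z => xStar p q < z.re)]
  ring

omit hp in
theorem lower_fourC (q : ℝ³) (z : ℂ) (μ : Fin 4) :
    lower (fourC z q) μ = z * lower tCoeff μ + lower (sCoeff q) μ := by
  simp only [lower, fourC_eq]
  split_ifs <;> ring

/-- The matrix of the action is a polynomial of degree two in the energy. -/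
theorem fieldMatrix_fourC (q : ℝ³) (z : ℂ) (r c : ExtIx) :
    fieldMatrix p ((p.ω₀ : ℂ) ^ 2) (fourC z q) r c
      = opCoeff p q 0 r c + z * opCoeff p q 1 r c + z ^ 2 * opCoeff p q 2 r c := by
  have e1 : ∀ z, mink (fourC z q) (fourC z q) = z ^ 2 - ((∑ j, q j ^ 2 : ℝ) : ℂ) :=
    fun z => mink_fourC_eq_zS q z
  have e2 : ∀ z, p.omC (fourC z q) = p.v 0 * (z - xStar p q) := fun z => omC_eq_zO hp q z
  have e3 := lower_fourC q
  simp only [opCoeff, Matrix.cons_val_zero, Matrix.cons_val_one, Matrix.cons_val,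
    Matrix.smul_apply, Matrix.sub_apply, Matrix.add_apply, smul_eq_mul]
  rcases r with (μ | μ | u) | u <;> rcases c with (ν | ν | u') | u' <;>
    simp only [fieldMatrix, Matrix.of_apply, e1, e2, e3] <;> ring

/-- The principal parts of the propagator are annihilated by the matrix of the action. -/
theorem fieldMatrix_res (hG : Generic p q) {z : ℂ} (hz : z ∈ nodes p q) (r : ExtIx) (b : FieldIx) :
    ∑ a, (fieldMatrix p ((p.ω₀ : ℂ) ^ 2) (fourC z q) r (.inl a) * resC p q a b z
      + (opCoeff p q 1 r (.inl a) + 2 * z * opCoeff p q 2 r (.inl a)) * resD p q a b z) = 0 ∧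
    ∑ a, fieldMatrix p ((p.ω₀ : ℂ) ^ 2) (fourC z q) r (.inl a) * resD p q a b z = 0 := by
  have hd : ∀ a : FieldIx, HasDerivAt
      (fun y => fieldMatrix p ((p.ω₀ : ℂ) ^ 2) (fourC y q) r (.inl a))
      (opCoeff p q 1 r (.inl a) + 2 * z * opCoeff p q 2 r (.inl a)) z := by
    intro a
    have h := ((hasDerivAt_const z (opCoeff p q 0 r (.inl a))).add
      ((hasDerivAt_id z).mul_const (opCoeff p q 1 r (.inl a)))).add
      ((hasDerivAt_pow 2 z).mul_const (opCoeff p q 2 r (.inl a)))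
    refine (h.congr_deriv (by simp)).congr_of_eventuallyEq (.of_forall fun y => ?_)
    exact fieldMatrix_fourC hp q y r (.inl a)
  have ha : ∀ a : FieldIx, AnalyticAt ℂ
      (fun y => fieldMatrix p ((p.ω₀ : ℂ) ^ 2) (fourC y q) r (.inl a)) z := by
    intro a
    simp only [fieldMatrix_fourC hp]
    fun_prop
  have h1 := HasPole.sum (s := Finset.univ) (a := z) fun a _ =>
    (hasPole_resolvent hp hG hz a b).mul (ha a)
  have h2 : HasPole (fun y => ∑ a, fieldMatrix p ((p.ω₀ : ℂ) ^ 2) (fourC y q) r (.inl a)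
      * resolvent p q y a b) z 0 0 := by
    refine (HasPole.of_continuousAt (φ := fun _ => (1 : Matrix ExtIx ExtIx ℂ) r (.inl b)
      - fieldMatrix p ((p.ω₀ : ℂ) ^ 2) (fourC 0 q) r (.inr ())
        * extProp p 0 0 0 (.inr ()) (.inl b)) continuousAt_const).congr ?_
    have hev : ∀ᶠ y in 𝓝[≠] z, y ∉ (nodes p q).erase z := by
      refine Filter.Eventually.filter_mono nhdsWithin_le_nhds ?_
      exact ((nodes p q).erase z).finite_toSet.isClosed.isOpen_compl.mem_nhds (by simp)
    filter_upwards [hev, self_mem_nhdsWithin] with y hy hyz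
    have hn : y ∉ nodes p q := fun h => hy (Finset.mem_erase.2 ⟨hyz, h⟩)
    rw [mem_nodes hp hG.ne_zero] at hn
    push Not at hn
    have hm := fieldMatrix_mul_extProp p ((p.ω₀ : ℂ) ^ 2) (fourC y q) hp.hχ.ne' hp.hv
      (pow_ne_zero 2 (by exact_mod_cast hp.hω.ne'))
      (by rw [mink_fourC_eq_zS]; exact hn.1)
      (by rw [mink_fourC_eq_zS, denD_eq_zD hp]; exact hn.2.2)
      (by rw [denH_eq_zH hp]; exact hn.2.1)
    have hm' := congrFun (congrFun hm r) (.inl b)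
    rw [Matrix.mul_apply, Fintype.sum_sum_type] at hm'
    rw [← hm']
    have l1 : fieldMatrix p ((p.ω₀ : ℂ) ^ 2) (fourC y q) r (.inr ())
        = fieldMatrix p ((p.ω₀ : ℂ) ^ 2) (fourC 0 q) r (.inr ()) := by
      rcases r with (μ | μ | u) | u <;> rfl
    have l2 : extProp p (mink (fourC y q) (fourC y q)) ((p.ω₀ : ℂ) ^ 2) (fourC y q) (.inr ())
        (.inl b) = extProp p 0 0 0 (.inr ()) (.inl b) := by
      rcases b with ν | ν | u <;> rfl
    simp only [Finset.univ_unique, Finset.sum_singleton]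
    change ∑ a, _ + fieldMatrix p ((p.ω₀ : ℂ) ^ 2) (fourC y q) r (.inr ())
      * extProp p (mink (fourC y q) (fourC y q)) ((p.ω₀ : ℂ) ^ 2) (fourC y q) (.inr ())
        (.inl b) - _ = _
    rw [l1, l2, add_sub_cancel_right]
    rfl
  have h3 := h1.unique h2
  refine ⟨?_, h3.2⟩
  rw [← h3.1]
  refine Finset.sum_congr rfl fun a _ => ?_
  rw [(hd a).deriv]

theorem solvesFieldEq_expSum (hG : Generic p q) {A : Finset ℂ} (hA : A ⊆ nodes p q) (y : ℂ)
    {U : ℝ → Matrix FieldIx FieldIx ℂ}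
    (hU : ∀ t a b, U t a b = y * expSum A (resC p q a b) (resD p q a b) t) :
    SolvesFieldEq p q U := by
  refine ⟨fun _ _ => 0, ?_⟩
  intro V t r b
  have hV : ∀ a : FieldIx, V (.inl a) b = fun t => y * expSum A (resC p q a b) (resD p q a b) t :=
    fun a => funext fun t => hU t a b
  have hV' : V (.inr ()) b = fun _ => 0 := rfl
  rw [Fintype.sum_sum_type]
  simp only [Finset.univ_unique, Finset.sum_singleton]
  change _ + (opCoeff p q 0 r (.inr ()) * V (.inr ()) b t
    + I * opCoeff p q 1 r (.inr ()) * deriv (V (.inr ()) b) t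
    - opCoeff p q 2 r (.inr ()) * deriv (deriv (V (.inr ()) b)) t) = 0
  rw [hV']
  have hd0 : deriv (fun _ : ℝ => (0 : ℂ)) = fun _ => 0 := deriv_const' 0
  simp only [hd0, mul_zero, add_zero, sub_zero]
  have hd1 : ∀ a : FieldIx, deriv (V (.inl a) b) = fun t => y * deriv (expSum A (resC p q a b)
      (resD p q a b)) t := by
    intro a; rw [hV]; funext t
    exact ((hasDerivAt_expSum A _ _ t).const_mul y).deriv.trans
      (by rw [(hasDerivAt_expSum A _ _ t).deriv])
  have hd2 : ∀ a : FieldIx, deriv (deriv (V (.inl a) b)) = fun t => y * deriv (deriv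
      (expSum A (resC p q a b) (resD p q a b))) t := by
    intro a; rw [hd1]; funext t
    rw [deriv_expSum]
    have := (hasDerivAt_expSum A (fun z => z * resC p q a b z + resD p q a b z)
      (fun z => z * resD p q a b z) t).const_mul (-I)
    rw [(this.const_mul y).deriv, this.deriv]
  have key : ∀ z ∈ A, ∑ a, ((fieldMatrix p ((p.ω₀ : ℂ) ^ 2) (fourC z q) r (.inl a) * resC p q a b z
      + (opCoeff p q 1 r (.inl a) + 2 * z * opCoeff p q 2 r (.inl a)) * resD p q a b z)
      - I * t * (fieldMatrix p ((p.ω₀ : ℂ) ^ 2) (fourC z q) r (.inl a)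
        * resD p q a b z)) = 0 := by
    intro z hz
    have := fieldMatrix_res hp hG (hA hz) r b
    rw [Finset.sum_sub_distrib, ← Finset.mul_sum, this.1, this.2]; ring
  have e : ∀ a : FieldIx, opCoeff p q 0 r (.inl a) * V (.inl a) b t
      + I * opCoeff p q 1 r (.inl a) * deriv (V (.inl a) b) t
      - opCoeff p q 2 r (.inl a) * deriv (deriv (V (.inl a) b)) t
      = ∑ z ∈ A, y * cexp (-I * z * t)
        * ((fieldMatrix p ((p.ω₀ : ℂ) ^ 2) (fourC z q) r (.inl a) * resC p q a b z
        + (opCoeff p q 1 r (.inl a) + 2 * z * opCoeff p q 2 r (.inl a)) * resD p q a b z)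
        - I * t * (fieldMatrix p ((p.ω₀ : ℂ) ^ 2) (fourC z q) r (.inl a)
          * resD p q a b z)) := by
    intro a
    rw [hd2, hd1, hV, deriv_deriv_expSum, deriv_expSum]
    simp only [expSum, Finset.mul_sum, ← Finset.sum_neg_distrib]
    rw [← Finset.sum_add_distrib, ← Finset.sum_sub_distrib]
    refine Finset.sum_congr rfl fun z _ => ?_
    rw [fieldMatrix_fourC hp]
    linear_combination (-(opCoeff p q 1 r (.inl a)) * y * cexp (-I * z * t)
      * ((z * resC p q a b z + resD p q a b z) - I * t * (z * resD p q a b z)))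
      * Complex.I_sq
  rw [Finset.sum_congr rfl fun a _ => e a, Finset.sum_comm]
  refine Finset.sum_eq_zero fun z hz => ?_
  rw [← Finset.mul_sum, key z hz, mul_zero]

theorem vacuumFunction_left_eq (hG : Generic p q) : SolvesFieldEq p q (vacuumFunction p q) :=
  solvesFieldEq_expSum hp hG (Finset.filter_subset _ _) (-1) fun t a b => by
    rw [neg_one_mul]; rfl

theorem vacuumFunction_right_eq (hG : Generic p q) :
    SolvesFieldEq p q (fun t => (vacuumFunction p (-q) (-t)).transpose) :=
  solvesFieldEq_expSum hp hG (Finset.filter_subset _ _) 1 fun t a b => by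
    rw [Matrix.transpose_apply, vacuumFunction_neg hp hG, one_mul]

theorem vacuumFunction_positive (hG : Generic p q) :
    ∃ (S : Finset ℝ) (c : ℝ → FieldIx → FieldIx → Polynomial ℂ),
    (∀ s ∈ S, 0 < mink (four s q) p.v) ∧
    ∀ (t : ℝ) (a b : FieldIx), vacuumFunction p q t a b
      = ∑ s ∈ S, (c s a b).eval (t : ℂ) * cexp (-I * s * t) := by
  classical
  refine ⟨((nodes p q).filter (fun z => xStar p q < z.re)).image Complex.re,
    fun s a b => -(Polynomial.C (resC p q a b s)
      - Polynomial.C (I * resD p q a b s) * Polynomial.X), ?_, ?_⟩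
  · intro s hs
    obtain ⟨z, hz, rfl⟩ := Finset.mem_image.1 hs
    rw [mink_four_v hp]
    exact mul_pos hp.hv0 (sub_pos.2 (Finset.mem_filter.1 hz).2)
  · intro t a b
    have hr : ∀ z ∈ (nodes p q).filter (fun z => xStar p q < z.re), ((z.re : ℝ) : ℂ) = z := by
      intro z hz
      have := (real_of_mem_nodeSet hp hG ((mem_nodes hp hG.ne_zero).1 (Finset.mem_filter.1 hz).1)).1
      exact Complex.ext (by simp) (by simp [this])
    rw [Finset.sum_image]
    · simp only [vacuumFunction, Matrix.of_apply, expSum]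
      rw [← Finset.sum_neg_distrib]
      refine Finset.sum_congr rfl fun z hz => ?_
      rw [hr z hz]
      simp
      ring
    · intro z hz y hy h
      rw [← hr z hz, ← hr y hy, h]

end

/-! ### Almost every momentum is generic -/

theorem finite_quadratic_zeros {a b c : ℝ} (ha : a ≠ 0) : {s : ℝ | a * s ^ 2 + b * s + c = 0}.Finite := by
  have h : ({s : ℝ | a * s ^ 2 + b * s + c = 0}) ⊆ ↑(Polynomial.C a * Polynomial.X ^ 2
      + Polynomial.C b * Polynomial.X + Polynomial.C c).roots.toFinset := by
    intro s hs
    have hne : Polynomial.C a * Polynomial.X ^ 2 + Polynomial.C b * Polynomial.X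
        + Polynomial.C c ≠ 0 := by
      intro h0
      have := congrArg (fun P => Polynomial.coeff P 2) h0
      simp at this
      exact ha this
    simp only [Finset.mem_coe, Multiset.mem_toFinset, Polynomial.mem_roots hne, Polynomial.IsRoot]
    simpa using hs
  exact (Finset.finite_toSet _).subset h

/-- A property of `q` whose exceptions on every line parallel to the first axis are countable holds
almost everywhere. -/
theorem ae_of_countable_lines {P : ℝ³ → Prop} (hm : MeasurableSet {q | ¬ P q})
    (h : ∀ y : Fin 2 → ℝ, {s : ℝ | ¬ P (Fin.cons s y)}.Countable) : ∀ᵐ q : ℝ³, P q := by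
  have hpres := volume_preserving_piFinSuccAbove (fun _ : Fin 3 => ℝ) 0
  rw [ae_iff, ← hpres.symm.measure_preimage hm.nullMeasurableSet]
  have hm' := hpres.symm.measurable hm
  rw [show (volume : Measure (ℝ × (Fin 2 → ℝ))) = (volume : Measure ℝ).prod volume from rfl,
    Measure.prod_apply_symm hm']
  refine (lintegral_congr fun y => ?_).trans lintegral_zero
  refine Set.Countable.measure_zero ?_ volume
  refine (h y).mono fun s hs => ?_
  have e : (MeasurableEquiv.piFinSuccAbove (fun _ : Fin 3 => ℝ) 0).symm (s, y) = Fin.cons s y := by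
    simp [MeasurableEquiv.piFinSuccAbove]; rfl
  change ¬ P ((MeasurableEquiv.piFinSuccAbove (fun _ : Fin 3 => ℝ) 0).symm (s, y)) at hs
  rwa [e] at hs

section

variable {p : Medium} (hp : p.Good)
include hp

theorem ae_bar_ne (c β : ℝ) : ∀ᵐ q : ℝ³, (xStar p q + β) ^ 2 - ∑ j, q j ^ 2 ≠ c := by
  refine ae_of_countable_lines ?_ fun y => ?_
  · refine (IsClosed.measurableSet ?_)
    simp only [ne_eq, not_not]
    refine isClosed_eq ?_ continuous_const
    unfold xStar
    fun_prop
  · have hv := hp.hv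
    have hv0 := hp.hv0
    have ha : (p.v 1 / p.v 0) ^ 2 - 1 ≠ 0 := by
      have : p.v 1 ^ 2 < p.v 0 ^ 2 := by
        simp only [mink] at hv
        nlinarith [sq_nonneg (p.v 2), sq_nonneg (p.v 3)]
      have h1 : (p.v 1 / p.v 0) ^ 2 < 1 := by
        rw [div_pow, div_lt_one (by positivity)]; exact this
      linarith
    refine (Set.Finite.subset (finite_quadratic_zeros (b := 2 * (p.v 1 / p.v 0)
      * ((p.v 2 * y 0 + p.v 3 * y 1) / p.v 0 + β))
      (c := ((p.v 2 * y 0 + p.v 3 * y 1) / p.v 0 + β) ^ 2 - (y 0 ^ 2 + y 1 ^ 2) - c) ha)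
      fun s hs => ?_).countable
    simp only [ne_eq, not_not, Set.mem_ofPred_eq, xStar, Fin.sum_univ_three] at hs ⊢
    rw [show (Fin.cons s y : ℝ³) 0 = s from rfl, show (Fin.cons s y : ℝ³) 1 = y 0 from rfl,
      show (Fin.cons s y : ℝ³) 2 = y 1 from rfl,
      show p.v (Fin.succ 0) = p.v 1 from rfl, show p.v (Fin.succ 1) = p.v 2 from rfl,
      show p.v (Fin.succ 2) = p.v 3 from rfl] at hs
    rw [← sub_eq_zero] at hs
    rw [← hs]
    field_simp
    ring

theorem ae_generic : ∀ᵐ q : ℝ³, Generic p q := by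
  have h0 : ∀ᵐ q : ℝ³, q ≠ 0 := by
    rw [ae_iff]; simp
  filter_upwards [h0, ae_bar_ne hp 0 (bar p / p.v 0), ae_bar_ne hp 0 (-(bar p / p.v 0)),
    ae_bar_ne hp (barSq p) (bar p / p.v 0), ae_bar_ne hp (barSq p) (-(bar p / p.v 0))]
    with q h0 h1 h2 h3 h4
  have key : ∀ c : ℝ, (xStar p q + bar p / p.v 0) ^ 2 - ∑ j, q j ^ 2 ≠ c →
      (xStar p q + -(bar p / p.v 0)) ^ 2 - ∑ j, q j ^ 2 ≠ c →
      ∀ z, zH p q z = 0 → zS q z ≠ (c : ℂ) := by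
    intro c ha hb z hz
    rcases (zH_eq_zero_iff hp).1 hz with rfl | rfl
    · intro h
      refine ha ?_
      have : (((xStar p q + bar p / p.v 0) ^ 2 - ∑ j, q j ^ 2 : ℝ) : ℂ) = c := by
        rw [← h, zS]; push_cast; ring
      exact_mod_cast this
    · intro h
      refine hb ?_
      have : (((xStar p q + -(bar p / p.v 0)) ^ 2 - ∑ j, q j ^ 2 : ℝ) : ℂ) = c := by
        rw [← h, zS]; push_cast; ring
      exact_mod_cast this
  exact ⟨h0, by simpa using key 0 h1 h2, key _ h3 h4⟩

end

/-! ### The equal-time commutators -/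

theorem HasExp.comp_neg {f : ℂ → ℂ} {r₀ r₁ r₂ : ℂ} (h : HasExp f r₀ r₁ r₂) :
    HasExp (fun z => f (-z)) (-r₀) r₁ (-r₂) := by
  have ht : Tendsto (fun z : ℂ => -z) (cocompact ℂ) (cocompact ℂ) :=
    (Homeomorph.neg ℂ).isClosedEmbedding.tendsto_cocompact
  have h1 := (Tendsto.comp h ht).neg
  rw [neg_zero] at h1
  refine h1.congr fun z => ?_
  simp only [Function.comp, div_neg, neg_sq, neg_div]
  rw [show (-z) ^ 3 = -z ^ 3 by ring, div_neg]; ring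

/-- The commutator function at time zero. -/
def commZero : Matrix FieldIx FieldIx ℂ := Matrix.of fun a b =>
  match a, b with
  | .inl μ, .inr (.inr _) => I * tCoeff μ
  | .inr (.inr _), .inl ν => -I * tCoeff ν
  | _, _ => 0

/-- The first time derivative of the commutator function at time zero. -/
def commOne (p : Medium) (q : ℝ³) : Matrix FieldIx FieldIx ℂ :=
  Matrix.of fun a b =>
  match a, b with
  | .inl μ, .inl ν =>
    I * (4 * π * eta μ ν + (p.ξ - 4 * π) * (tCoeff μ * tCoeff ν))
  | .inl μ, .inr (.inr _) => sCoeff q μ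
  | .inr (.inl μ), .inr (.inl ν) =>
    I * (p.χ * (p.ω₀ : ℂ) ^ 2 / p.v 0 ^ 2 * (eta μ ν - p.vC μ * p.vC ν))
  | .inr (.inr _), .inl ν => -sCoeff q ν
  | _, _ => 0

/-- The second time derivative of the commutator function at time zero. -/
def commTwo (p : Medium) (q : ℝ³) : Matrix FieldIx FieldIx ℂ :=
  Matrix.of fun a b =>
  match a, b with
  | .inl μ, .inl ν =>
    (p.ξ - 4 * π) * (tCoeff μ * sCoeff q ν + sCoeff q μ * tCoeff ν)
  | .inl μ, .inr (.inl ν) => -(4 * π * I * p.g * p.χ * (p.ω₀ : ℂ) ^ 2 / p.v 0 ^ 2)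
      * (p.v 0 * eta μ ν - p.vC μ * tCoeff ν)
  | .inr (.inl μ), .inl ν => 4 * π * I * p.g * p.χ * (p.ω₀ : ℂ) ^ 2 / p.v 0 ^ 2
      * (p.v 0 * eta μ ν - p.vC ν * tCoeff μ)
  | .inr (.inl μ), .inr (.inl ν) =>
    2 * xStar p q * (p.χ * (p.ω₀ : ℂ) ^ 2 / p.v 0 ^ 2) * (eta μ ν - p.vC μ * p.vC ν)
  | .inl μ, .inr (.inr _) => -I * ((∑ j, q j ^ 2 : ℝ) : ℂ) * tCoeff μ
  | .inr (.inr _), .inl ν => I * ((∑ j, q j ^ 2 : ℝ) : ℂ) * tCoeff ν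
  | _, _ => 0

theorem sCoeff_neg (q : ℝ³) (μ : Fin 4) : sCoeff (-q) μ = -sCoeff q μ := by
  refine Fin.cases ?_ (fun j => ?_) μ <;> simp [sCoeff, fourC]

section

variable {p : Medium} (hp : p.Good) {q : ℝ³}
include hp

theorem hasExp_resolvent (q : ℝ³) (a b : FieldIx) :
    HasExp (fun z => resolvent p q z a b) (-commZero a b) (-I * commOne p q a b)
      (commTwo p q a b) := by
  have hI : I * I = -1 := Complex.I_mul_I
  have key : ∀ (a b : FieldIx) (r₀ r₁ r₂ : ℂ),
      HasExp (fun z => resolvent p (-q) z b a) r₀ r₁ r₂ →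
      -r₀ = -commZero a b → r₁ = -I * commOne p q a b → -r₂ = commTwo p q a b →
      HasExp (fun z => resolvent p q z a b) (-commZero a b) (-I * commOne p q a b)
      (commTwo p q a b) := by
    intro a b r₀ r₁ r₂ h h0 h1 h2
    have := h.comp_neg
    simp only [resolvent_neg] at this
    rw [← h0, ← h1, ← h2]
    exact this
  have conv : ∀ (a b : FieldIx) (r₀ r₁ r₂ : ℂ), HasExp (fun z => resolvent p q z a b) r₀ r₁ r₂ →
      r₀ = -commZero a b → r₁ = -I * commOne p q a b → r₂ = commTwo p q a b →
      HasExp (fun z => resolvent p q z a b) (-commZero a b) (-I * commOne p q a b)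
      (commTwo p q a b) := by
    rintro a b r₀ r₁ r₂ h rfl rfl rfl; exact h
  have z3 : HasExp (fun _ : ℂ => (0 : ℂ)) 0 0 0 := HasExp.of_ord ((isBigO_zero _ _ : Ord (-4) _))
  rcases a with μ | μ | u <;> rcases b with ν | ν | u'
  · refine conv _ _ _ _ _ (hasExp_AA hp q μ ν) (by simp [commZero]) ?_ rfl
    simp only [commOne, Matrix.of_apply]
    linear_combination (4 * π * eta μ ν + (p.ξ - 4 * π) * (tCoeff μ * tCoeff ν)) * hI
  · refine conv _ _ _ _ _ (hasExp_AP hp q μ ν) ?_ ?_ ?_ <;>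
      simp only [commZero, commOne, commTwo, Matrix.of_apply] <;> ring
  · refine conv _ _ _ _ _ (hasExp_AB q μ) ?_ ?_ ?_ <;>
      simp only [commZero, commOne, commTwo, Matrix.of_apply] <;> ring
  · refine key _ _ _ _ _ (hasExp_AP hp (-q) ν μ) ?_ ?_ ?_ <;>
      simp only [commZero, commOne, commTwo, Matrix.of_apply, eta_comm ν μ] <;> ring
  · refine conv _ _ _ _ _ (hasExp_PP hp q μ ν) (by simp [commZero]) ?_ rfl
    simp only [commOne, Matrix.of_apply]
    linear_combination (p.χ * (p.ω₀ : ℂ) ^ 2 / p.v 0 ^ 2 * (eta μ ν - p.vC μ * p.vC ν)) * hI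
  · refine conv _ _ _ _ _ z3 ?_ ?_ ?_ <;>
      simp only [commZero, commOne, commTwo, Matrix.of_apply] <;> ring
  · refine key _ _ _ _ _ (hasExp_AB (-q) ν) ?_ ?_ ?_ <;>
      simp only [commZero, commOne, commTwo, Matrix.of_apply, sCoeff_neg, Pi.neg_apply, neg_sq] <;> ring
  · refine conv _ _ _ _ _ z3 ?_ ?_ ?_ <;>
      simp only [commZero, commOne, commTwo, Matrix.of_apply] <;> ring
  · refine conv _ _ _ _ _ z3 ?_ ?_ ?_ <;>
      simp only [commZero, commOne, commTwo, Matrix.of_apply] <;> ring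

/-- The commutator is minus the sum of all the residues, so that its time derivatives are coefficients of
the expansion of the propagator at large energy. -/
theorem commDeriv_vacuumFunction (hG : Generic p q) :
    commDeriv (vacuumFunction p) q 0 = commZero ∧ commDeriv (vacuumFunction p) q 1 = commOne p q ∧
      commDeriv (vacuumFunction p) q 2 = commTwo p q := by
  have hI : I * I = -1 := Complex.I_mul_I
  have h : ∀ a b, (fun t : ℝ => vacuumFunction p q t a b - vacuumFunction p (-q) (-t) b a)
      = fun t => -expSum (nodes p q) (resC p q a b) (resD p q a b) t :=
    fun a b => funext fun t => vacuumFunction_sub hp hG t a b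
  have hs := fun a b => (hasExp_resolvent hp q a b).sums (resolvent_eq_fracSum hp hG a b)
  have d1 : ∀ a b, deriv (fun t => -expSum (nodes p q) (resC p q a b) (resD p q a b) t)
      = fun t => -deriv (expSum (nodes p q) (resC p q a b) (resD p q a b)) t :=
    fun a b => funext fun t => deriv.fun_neg
  have d2 : ∀ a b, deriv (fun t => -deriv (expSum (nodes p q) (resC p q a b) (resD p q a b)) t)
      = fun t => -deriv (deriv (expSum (nodes p q) (resC p q a b) (resD p q a b))) t :=
    fun a b => funext fun t => deriv.fun_neg
  refine ⟨?_, ?_, ?_⟩ <;> ext a b <;> simp only [commDeriv, Matrix.of_apply, h]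
  · rw [iteratedDeriv_zero, expSum_zero, (hs a b).1, neg_neg]
  · rw [iteratedDeriv_one, d1, deriv_expSum]
    beta_reduce
    rw [expSum_zero, (hs a b).2.1]
    linear_combination (-commOne p q a b) * hI
  · rw [iteratedDeriv_succ, iteratedDeriv_one, d1, d2, deriv_deriv_expSum]
    beta_reduce
    rw [expSum_zero, (hs a b).2.2, neg_neg]

end

theorem canPos_mul (p : Medium) (q : ℝ³) {ι : Type*} (C : Matrix FieldIx ι ℂ) (b : ι) :
    (∀ μ, (canPos p q * C) (.inl μ) b = C (iA μ) b) ∧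
    (∀ μ, (canPos p q * C) (.inr (.inl μ)) b = 1 / (4 * π) * gradC q μ * C (iA 0) b
      - p.g * (p.v 0 * C (iP μ) b - p.v μ * C (iP 0) b) + tCoeff μ * C iB b) ∧
    (∀ μ, (canPos p q * C) (.inr (.inr (.inl μ))) b = C (iP μ) b) ∧
    (∀ μ, (canPos p q * C) (.inr (.inr (.inr μ))) b = -(p.v 0 / (p.χ * p.ω₀ ^ 2))
      * (I * ∑ j : Fin 3, (p.v j.succ : ℂ) * q j) * C (iP μ) b) := by
  refine ⟨fun μ => ?_, fun μ => ?_, fun μ => ?_, fun μ => ?_⟩ <;>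
    simp only [Matrix.mul_apply, Fintype.sum_sum_type, canPos, Matrix.of_apply, zero_mul,
      Finset.sum_const_zero, Finset.univ_unique, Finset.sum_singleton, ite_mul, one_mul,
      Finset.sum_ite_eq, Finset.sum_ite_eq', Finset.mem_univ, if_true, add_zero, zero_add, mul_sub,
      sub_mul, Finset.sum_sub_distrib, mul_ite, mul_zero]
  have : eta 0 μ = tCoeff μ := by fin_cases μ <;> simp [eta, tCoeff]
  rw [this]
  change _ + (_ + tCoeff μ * C iB b) = _
  ring

theorem canVel_mul (p : Medium) {ι : Type*} (C : Matrix FieldIx ι ℂ) (b : ι) :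
    (∀ μ, (canVel p * C) (.inl μ) b = 0) ∧
    (∀ μ, (canVel p * C) (.inr (.inl μ)) b
      = -(1 / (4 * π)) * (1 - tCoeff μ) * C (iA μ) b) ∧
    (∀ μ, (canVel p * C) (.inr (.inr (.inl μ))) b = 0) ∧
    (∀ μ, (canVel p * C) (.inr (.inr (.inr μ))) b = -(p.v 0 ^ 2 / (p.χ * p.ω₀ ^ 2)) * C (iP μ) b) := by
  refine ⟨fun μ => ?_, fun μ => ?_, fun μ => ?_, fun μ => ?_⟩ <;>
    simp only [Matrix.mul_apply, Fintype.sum_sum_type, canVel, Matrix.of_apply, zero_mul,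
      Finset.sum_const_zero, Finset.univ_unique, ite_mul,
      Finset.sum_ite_eq, Finset.mem_univ, if_true, add_zero, zero_add]
  by_cases h : μ = 0
  · simp [h, tCoeff]
  · simp [h, tCoeff]

theorem sandwich (K K' : Matrix CanIx FieldIx ℂ) (C : Matrix FieldIx FieldIx ℂ) (z z' : CanIx) :
    (K * C * K'.transpose) z z' = (K' * (K * C).transpose) z' z := by
  rw [Matrix.mul_apply, Matrix.mul_apply]
  exact Finset.sum_congr rfl fun a _ => by rw [Matrix.transpose_apply, Matrix.transpose_apply, mul_comm]

theorem sCoeff_eq (q : ℝ³) (μ : Fin 4) : gradC q μ = -I * sCoeff q μ := by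
  refine Fin.cases ?_ (fun j => ?_) μ <;> simp [sCoeff, fourC, gradC]

section

variable {p : Medium} (hp : p.Good) {q : ℝ³}
include hp

theorem commutator_relation (q : ℝ³) :
    canPos p q * commZero * (canPos p (-q)).transpose
      + canVel p * commOne p q * (canPos p (-q)).transpose
      - canPos p q * commOne p q * (canVel p).transpose
      - canVel p * commTwo p q * (canVel p).transpose
      = I • diracBracket p := by
  have hπ := piC_ne
  have hI : I * I = -1 := Complex.I_mul_I
  have hv := v0_ne hp
  obtain ⟨-, hχ, hω⟩ := hp.ne_zero
  have hx : ∑ j : Fin 3, p.vC j.succ * q j = p.vC 0 * xStar p q := by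
    have : ∑ j : Fin 3, p.v j.succ * q j = p.v 0 * xStar p q := by
      rw [xStar, mul_div_cancel₀ _ hp.hv0.ne']
    have h : ((∑ j : Fin 3, p.v j.succ * q j : ℝ) : ℂ) = p.v 0 * xStar p q := by
      exact_mod_cast this
    push_cast at h
    exact h
  have hx' : ∑ j : Fin 3, p.vC j.succ * ((-q) j : ℝ) = -(p.vC 0 * xStar p q) := by
    rw [← hx, ← Finset.sum_neg_distrib]
    exact Finset.sum_congr rfl fun j _ => by simp
  have hs0 : sCoeff q 0 = 0 := rfl
  have hv0 : p.vC 0 ≠ 0 := hv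
  ext z z'
  simp only [Matrix.sub_apply, Matrix.add_apply, sandwich, Matrix.smul_apply, smul_eq_mul]
  rcases z with μ | μ | μ | μ <;> rcases z' with ν | ν | ν | ν <;>
    simp only [(canPos_mul p _ _ _).1, (canPos_mul p _ _ _).2.1, (canPos_mul p _ _ _).2.2.1,
      (canPos_mul p _ _ _).2.2.2, (canVel_mul p _ _).1, (canVel_mul p _ _).2.1,
      (canVel_mul p _ _).2.2.1, (canVel_mul p _ _).2.2.2, Matrix.transpose_apply,
      commZero, commOne, commTwo, Matrix.of_apply, diracBracket, sCoeff_eq, sCoeff_neg, ofReal_v]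
  all_goals try rw [hx]
  all_goals try rw [hx']
  all_goals try (ring; done)
  all_goals try (field_simp; ring; done)
  all_goals try (field_simp; ring_nf; simp only [Complex.I_sq]; ring; done)
  all_goals fin_cases μ <;> fin_cases ν <;> simp [eta, tCoeff, hs0]
  all_goals try (field_simp; done)
  all_goals try (field_simp; ring; done)
  all_goals try (ring_nf; simp only [Complex.I_sq]; ring)
  all_goals try (right; right; ring)
  all_goals try (right; ring)

end

/-- The vacuum two-point function exists. -/
theorem isVacuumTwoPoint_vacuumFunction {p : Medium} (hp : p.Good) :
    IsVacuumTwoPoint p (vacuumFunction p) where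
  left_eq := (ae_generic hp).mono fun q h => vacuumFunction_left_eq hp h
  right_eq := (ae_generic hp).mono fun q h => vacuumFunction_right_eq hp h
  positive := (ae_generic hp).mono fun q h => vacuumFunction_positive hp h
  commutators := (ae_generic hp).mono fun q h => by
    obtain ⟨h0, h1, h2⟩ := commDeriv_vacuumFunction hp h
    rw [h0, h1, h2]
    exact commutator_relation hp q

/-! ### Exponential polynomials and uniqueness -/

/-- Exponential polynomials with different frequencies are linearly independent. -/
theorem expPoly_eq_zero (S : Finset ℝ) : ∀ c : ℝ → Polynomial ℂ,
    (∀ t : ℝ, ∑ s ∈ S, (c s).eval (t : ℂ) * cexp (-I * s * t) = 0) →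
    ∀ s ∈ S, c s = 0 := by
  induction S using Finset.induction_on with
  | empty => simp
  | insert s₀ S hs₀ ih =>
    have key : ∀ (n : ℕ) (c : ℝ → Polynomial ℂ), Polynomial.derivative^[n] (c s₀) = 0 →
        (∀ t : ℝ, ∑ s ∈ insert s₀ S, (c s).eval (t : ℂ) * cexp (-I * s * t) = 0) →
        ∀ s ∈ insert s₀ S, c s = 0 := by
      intro n
      induction n with
      | zero =>
        intro c h0 h
        have h0' : c s₀ = 0 := h0
        have h1 := ih c fun t => by
          have := h t
          rwa [Finset.sum_insert hs₀, h0', Polynomial.eval_zero, zero_mul, zero_add] at this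
        exact (Finset.forall_mem_insert _ _ _).2 ⟨h0', h1⟩
      | succ n ihn =>
        intro c h0 h
        -- multiply by `e^{i s₀ t}` and differentiate
        have h1 := ihn (fun s => (c s).derivative + Polynomial.C (-I * (s - s₀)) * c s)
          (by simpa using h0) fun t => by
          have hd : ∀ s ∈ insert s₀ S, HasDerivAt (fun t : ℝ => (c s).eval (t : ℂ)
              * cexp (-I * (s - s₀) * t)) (((c s).derivative
              + Polynomial.C (-I * (s - s₀)) * c s).eval (t : ℂ)
              * cexp (-I * (s - s₀) * t)) t := by
            intro s _
            have e0 : HasDerivAt (fun t : ℝ => (t : ℂ)) 1 t := Complex.ofRealCLM.hasDerivAt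
            have e1 := ((c s).hasDerivAt (t : ℂ)).comp_ofReal
            have e2 := ((e0.const_mul (-I * (s - s₀))).cexp)
            refine (e1.mul e2).congr_deriv ?_
            simp only [Polynomial.eval_add, Polynomial.eval_mul, Polynomial.eval_C]
            ring
          have hz : ∀ t : ℝ, ∑ s ∈ insert s₀ S, (c s).eval (t : ℂ)
              * cexp (-I * (s - s₀) * t) = 0 := by
            intro t
            have : ∀ s ∈ insert s₀ S, (c s).eval (t : ℂ) * cexp (-I * (s - s₀) * t)
                = cexp (I * s₀ * t)
                  * ((c s).eval (t : ℂ) * cexp (-I * s * t)) := by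
              intro s _
              rw [mul_left_comm, ← Complex.exp_add]
              congr 2; ring
            rw [Finset.sum_congr rfl this, ← Finset.mul_sum, h t, mul_zero]
          have h2 := (HasDerivAt.fun_sum hd).unique
            ((hasDerivAt_const t (0 : ℂ)).congr_of_eventuallyEq (.of_forall hz))
          have : ∀ s ∈ insert s₀ S, ((c s).derivative
              + Polynomial.C (-I * (s - s₀)) * c s).eval (t : ℂ)
              * cexp (-I * s * t) = cexp (-I * s₀ * t)
              * (((c s).derivative + Polynomial.C (-I * (s - s₀)) * c s).eval (t : ℂ)
              * cexp (-I * (s - s₀) * t)) := by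
            intro s _
            rw [mul_left_comm, ← Complex.exp_add]
            congr 2; ring
          rw [Finset.sum_congr rfl this, ← Finset.mul_sum, h2, mul_zero]
        have h3 : ∀ s ∈ S, c s = 0 := by
          intro s hs
          have hne : (-I * ((s : ℂ) - s₀)) ≠ 0 := by
            refine mul_ne_zero (by simp) (sub_ne_zero.2 ?_)
            intro e
            exact hs₀ (Complex.ofReal_injective e ▸ hs)
          by_contra hc
          have e := h1 s (Finset.mem_insert_of_mem hs)
          have e' : Polynomial.C (-I * ((s : ℂ) - s₀)) * c s = -(c s).derivative :=
            eq_neg_of_add_eq_zero_right e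
          have := Polynomial.degree_derivative_lt hc
          rw [← Polynomial.degree_neg, ← e', Polynomial.degree_C_mul hne] at this
          exact lt_irrefl _ this
        refine (Finset.forall_mem_insert _ _ _).2 ⟨?_, h3⟩
        refine Polynomial.eq_zero_of_infinite_isRoot _ ?_
        refine Set.Infinite.mono ?_ (Set.infinite_range_of_injective Complex.ofReal_injective)
        rintro _ ⟨t, rfl⟩
        have := h t
        rw [Finset.sum_insert hs₀, Finset.sum_eq_zero fun s hs => by rw [h3 s hs]; simp,
          add_zero] at this
        exact (mul_eq_zero.1 this).resolve_right (Complex.exp_ne_zero _)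
    intro c
    exact key _ c (Polynomial.iterate_derivative_eq_zero (Nat.lt_succ_self _))

theorem analyticAt_expPoly (S : Finset ℝ) (c : ℝ → Polynomial ℂ) (t : ℝ) :
    AnalyticAt ℝ (fun t : ℝ => ∑ s ∈ S, (c s).eval (t : ℂ) * cexp (-I * s * t)) t := by
  have h : AnalyticAt ℂ (fun z : ℂ => ∑ s ∈ S, (c s).eval z * cexp (-I * s * z)) t := by
    refine Finset.analyticAt_fun_sum _ fun s _ => ?_
    have := AnalyticAt.aeval_polynomial (analyticAt_id (𝕜 := ℂ) (z := (t : ℂ))) (c s)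
    simp only [id, Polynomial.coe_aeval_eq_eval] at this
    exact this.mul (by fun_prop)
  exact (h.restrictScalars (𝕜 := ℝ)).comp (Complex.ofRealCLM.analyticAt t)

/-- An analytic function whose derivatives vanish at a point vanishes. -/
theorem eq_zero_of_iteratedDeriv {f : ℝ → ℂ} (hf : ∀ t, AnalyticAt ℝ f t)
    (h : ∀ n, iteratedDeriv n f 0 = 0) : f = 0 := by
  have h1 : analyticOrderAt f 0 = ⊤ := by
    refine ENat.eq_top_iff_forall_ge.2 fun n => ?_
    exact (natCast_le_analyticOrderAt_iff_iteratedDeriv_eq_zero (hf 0)).2 fun i _ => h i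
  rw [analyticOrderAt_eq_top] at h1
  exact AnalyticOnNhd.eq_of_eventuallyEq (z₀ := 0) (fun t _ => hf t)
    (fun t _ => analyticAt_const) h1

/-- `f` is a column of solutions of the field equations, for some multiplier `l`. -/
structure KernelCol (p : Medium) (q : ℝ³) (f : FieldIx → ℝ → ℂ) : Prop where
  analytic : ∀ a t, AnalyticAt ℝ (f a) t
  eqn : ∃ l : ℝ → ℂ, ∀ (t : ℝ) (r : ExtIx), ∑ a : FieldIx, (opCoeff p q 0 r (.inl a) * f a t
      + I * opCoeff p q 1 r (.inl a) * deriv (f a) t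
      - opCoeff p q 2 r (.inl a) * deriv (deriv (f a)) t) + opCoeff p q 0 r (.inr ()) * l t = 0

theorem KernelCol.sub {p : Medium} {q : ℝ³} {f g : FieldIx → ℝ → ℂ} (hf : KernelCol p q f)
    (hg : KernelCol p q g) : KernelCol p q (fun a t => f a t - g a t) := by
  refine ⟨fun a t => (hf.analytic a t).sub (hg.analytic a t), ?_⟩
  obtain ⟨l, hl⟩ := hf.eqn
  obtain ⟨m, hm⟩ := hg.eqn
  refine ⟨fun t => l t - m t, fun t r => ?_⟩
  have d1 : ∀ a, deriv (fun t => f a t - g a t) = fun t => deriv (f a) t - deriv (g a) t :=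
    fun a => funext fun t => deriv_fun_sub (hf.analytic a t).differentiableAt
      (hg.analytic a t).differentiableAt
  have d2 : ∀ a, deriv (fun t => deriv (f a) t - deriv (g a) t)
      = fun t => deriv (deriv (f a)) t - deriv (deriv (g a)) t :=
    fun a => funext fun t => deriv_fun_sub (hf.analytic a t).deriv.differentiableAt
      (hg.analytic a t).deriv.differentiableAt
  simp only [d1, d2]
  rw [← sub_eq_zero.2 ((hl t r).trans (hm t r).symm), add_sub_add_comm, ← Finset.sum_sub_distrib,
    mul_sub]
  congr 1
  exact Finset.sum_congr rfl fun a _ => by ring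

theorem SolvesFieldEq.kernelCol {p : Medium} {q : ℝ³} {U : ℝ → Matrix FieldIx FieldIx ℂ}
    (h : SolvesFieldEq p q U) (ha : ∀ a b t, AnalyticAt ℝ (fun t => U t a b) t) (b : FieldIx) :
    KernelCol p q (fun a t => U t a b) := by
  obtain ⟨l, hl⟩ := h
  refine ⟨fun a t => ha a b t, fun t => l t b, fun t r => ?_⟩
  have := hl t r b
  rw [Fintype.sum_sum_type] at this
  have z : ∀ i : Fin 3, i ≠ 0 → opCoeff p q i r (.inr ()) = 0 := by
    intro i hi
    fin_cases i
    · exact absurd rfl hi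
    all_goals rcases r with (μ | μ | u) | u <;> simp [opCoeff, fieldMatrix] <;> ring
  simp only [Finset.univ_unique, Finset.sum_singleton, Sum.elim_inl] at this
  change _ + (opCoeff p q 0 r (.inr ()) * l t b
    + I * opCoeff p q 1 r (.inr ()) * deriv (fun t => l t b) t
    - opCoeff p q 2 r (.inr ()) * deriv (deriv (fun t => l t b)) t) = 0 at this
  rw [z 1 (by decide), z 2 (by decide)] at this
  rw [← this]
  ring

section

variable {p : Medium} (hp : p.Good)
include hp

/-- The entries of the coefficients that determine the highest time derivatives. -/
theorem opCoeff_entries (q : ℝ³) (μ ν : Fin 4) :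
    opCoeff p q 2 (.inl (iA μ)) (.inl (iA ν))
      = 1 / (4 * π) * (eta μ ν - tCoeff μ * tCoeff ν) ∧
    opCoeff p q 2 (.inl (iA μ)) (.inl (iP ν)) = 0 ∧
    opCoeff p q 2 (.inl (iA μ)) (.inl iB) = 0 ∧
    opCoeff p q 1 (.inl (iA μ)) (.inl iB) = -I * tCoeff μ ∧
    opCoeff p q 2 (.inl (iP μ)) (.inl (iA ν)) = 0 ∧
    opCoeff p q 2 (.inl (iP μ)) (.inl (iP ν))
      = p.v 0 ^ 2 / (p.χ * (p.ω₀ : ℂ) ^ 2) * eta μ ν ∧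
    opCoeff p q 2 (.inl (iP μ)) (.inl iB) = 0 ∧
    opCoeff p q 1 (.inl (iP μ)) (.inl iB) = 0 ∧
    opCoeff p q 1 (.inl iB) (.inl (iA ν)) = I * tCoeff ν ∧
    opCoeff p q 1 (.inl iB) (.inl (iP ν)) = 0 ∧
    opCoeff p q 1 (.inl iB) (.inl iB) = 0 ∧
    ∀ a, opCoeff p q 2 (.inl iB) (.inl a) = 0 := by
  have e1 : ∀ z, mink (fourC z q) (fourC z q) = z ^ 2 - ((∑ j, q j ^ 2 : ℝ) : ℂ) :=
    fun z => mink_fourC_eq_zS q z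
  have e2 : ∀ z, p.omC (fourC z q) = p.v 0 * (z - xStar p q) := fun z => omC_eq_zO hp q z
  have e4 : ∀ μ, lower tCoeff μ = tCoeff μ := by
    intro μ; by_cases h : μ = 0 <;> simp [lower, tCoeff, h]
  obtain ⟨-, hχ, hω⟩ := hp.ne_zero
  refine ⟨?_, ?_, ?_, ?_, ?_, ?_, ?_, ?_, ?_, ?_, ?_, fun a => ?_⟩
  on_goal 12 => rcases a with a | a | a
  all_goals simp only [opCoeff, Matrix.cons_val_one, Matrix.cons_val, Matrix.smul_apply,
    Matrix.sub_apply, Matrix.add_apply, smul_eq_mul, fieldMatrix, Matrix.of_apply, e1, e2,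
    lower_fourC, e4]
  all_goals ring

/-- On solutions the multiplier vanishes and the equations of motion of the polarization are not
constrained by it. -/
theorem KernelCol.multiplier {q : ℝ³} {f : FieldIx → ℝ → ℂ} (hf : KernelCol p q f)
    (t : ℝ) (r : ExtIx) : ∑ a : FieldIx, (opCoeff p q 0 r (.inl a) * f a t
      + I * opCoeff p q 1 r (.inl a) * deriv (f a) t
      - opCoeff p q 2 r (.inl a) * deriv (deriv (f a)) t) = 0 := by
  obtain ⟨l, hl⟩ := hf.eqn
  have hvv : ∑ μ, p.vC μ * lower p.vC μ = 1 := by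
    have := congrArg (fun x : ℝ => (x : ℂ)) hp.hv
    rw [Fin.sum_univ_four]
    simp [mink, lower, Medium.vC, toC] at this ⊢
    linear_combination this
  obtain ⟨w, hw⟩ : ∃ w : FieldIx → ℂ, w = fun a => opCoeff p q 0 (.inr ()) (.inl a) := ⟨_, rfl⟩
  -- `v · P = 0` at all times
  have h0 : ∀ t, ∑ a, w a * f a t = 0 := by
    intro t
    have h := hl t (.inr ())
    have z : ∀ a : FieldIx, opCoeff p q 1 (.inr ()) (.inl a) = 0 ∧
        opCoeff p q 2 (.inr ()) (.inl a) = 0 := by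
      intro a
      rcases a with a | a | a <;> simp [opCoeff, fieldMatrix] <;> ring
    rw [show opCoeff p q 0 (.inr ()) (.inr ()) = 0 from rfl, zero_mul, add_zero] at h
    rw [← h, hw]
    exact Finset.sum_congr rfl fun a _ => by rw [(z a).1, (z a).2]; ring
  have hd : ∀ {g : FieldIx → ℝ → ℂ}, (∀ a t, AnalyticAt ℝ (g a) t) → (∀ t, ∑ a, w a * g a t = 0) →
      ∀ t, ∑ a, w a * deriv (g a) t = 0 := by
    intro g hg h t
    have hd := HasDerivAt.fun_sum (u := Finset.univ) (x := t) fun a _ =>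
      ((hg a t).differentiableAt.hasDerivAt).const_mul (w a)
    exact hd.unique ((hasDerivAt_const t (0 : ℂ)).congr_of_eventuallyEq (.of_forall h))
  have h1 := hd hf.analytic h0
  have h2 := hd (fun a t => (hf.analytic a t).deriv) h1
  -- contraction of the equations of the polarization with `v`
  have hz : ∀ z : ℂ, ∃ c : ℂ, ∀ a : FieldIx, ∑ μ, p.vC μ * fieldMatrix p ((p.ω₀ : ℂ) ^ 2)
      (fourC z q) (.inl (iP μ)) (.inl a) = c * w a := by
    intro z
    have hk : p.omC (fourC z q) = ∑ μ, p.vC μ * lower (fourC z q) μ := by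
      rw [Fin.sum_univ_four]; simp [Medium.omC, mink, lower]; ring
    refine ⟨1 / p.χ * (p.omC (fourC z q) ^ 2 / (p.ω₀ : ℂ) ^ 2 - 1), ?_⟩
    rw [hw]
    rintro (ν | ν | u)
    · have : ∑ μ, p.vC μ * eta μ ν = lower p.vC ν := by fin_cases ν <;> simp [eta, lower]
      calc _ = -I * p.g * (p.omC (fourC z q) * ∑ μ, p.vC μ * eta μ ν
            - (∑ μ, p.vC μ * lower (fourC z q) μ) * lower p.vC ν) := by
            simp only [fieldMatrix, Matrix.of_apply, Fin.sum_univ_four]; ring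
        _ = _ := by rw [← hk, this]; simp [opCoeff, fieldMatrix]
    · fin_cases ν <;> simp [opCoeff, fieldMatrix, eta, lower] <;> ring
    · simp [opCoeff, fieldMatrix]
  obtain ⟨c0, e0⟩ := hz 0
  obtain ⟨c1, e1⟩ := hz 1
  obtain ⟨c2, e2⟩ := hz (-1)
  have hc : ∀ i : Fin 3, ∀ a, ∑ μ, p.vC μ * opCoeff p q i (.inl (iP μ)) (.inl a)
      = ![c0, (c1 - c2) / 2, (c1 + c2) / 2 - c0] i * w a := by
    intro i a
    have e0 := e0 a
    have e1 := e1 a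
    have e2 := e2 a
    simp only [Fin.sum_univ_four] at e0 e1 e2 ⊢
    fin_cases i <;> simp [opCoeff]
    · linear_combination e0
    · linear_combination (1 / 2) * e1 - (1 / 2) * e2
    · linear_combination (1 / 2) * e1 + (1 / 2) * e2 - e0
  have hlt : l t = 0 := by
    have h := Finset.sum_congr rfl fun μ (_ : μ ∈ Finset.univ) =>
      congrArg (p.vC μ * ·) (hl t (.inl (iP μ)))
    have e : ∑ μ, p.vC μ * ∑ a : FieldIx, (opCoeff p q 0 (.inl (iP μ)) (.inl a) * f a t
        + I * opCoeff p q 1 (.inl (iP μ)) (.inl a) * deriv (f a) t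
        - opCoeff p q 2 (.inl (iP μ)) (.inl a) * deriv (deriv (f a)) t) = 0 := by
      simp only [Finset.mul_sum]
      rw [Finset.sum_comm]
      trans ∑ a, (c0 * (w a * f a t) + I * (c1 - c2) / 2 * (w a * deriv (f a) t)
        - ((c1 + c2) / 2 - c0) * (w a * deriv (deriv (f a)) t))
      · refine Finset.sum_congr rfl fun a _ => ?_
        have g0 := hc 0 a
        have g1 := hc 1 a
        have g2 := hc 2 a
        simp only [Fin.sum_univ_four, Matrix.cons_val] at g0 g1 g2 ⊢
        linear_combination f a t * g0 + I * deriv (f a) t * g1 - deriv (deriv (f a)) t * g2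
      · rw [Finset.sum_sub_distrib, Finset.sum_add_distrib, ← Finset.mul_sum, ← Finset.mul_sum,
          ← Finset.mul_sum, h0, h1, h2]; ring
    have hl0 : ∀ μ, opCoeff p q 0 (.inl (iP μ)) (.inr ()) = lower p.vC μ := fun μ => rfl
    simp only [mul_add, Finset.sum_add_distrib, e, hl0, ← mul_assoc, ← Finset.sum_mul, hvv] at h
    simpa using h
  have := hl t r
  rwa [hlt, mul_zero, add_zero] at this

end

section

variable {p : Medium} (hp : p.Good)
include hp

/-- A solution of the field equations with vanishing canonical data vanishes. -/
theorem KernelCol.eq_zero {q : ℝ³} {f : FieldIx → ℝ → ℂ} (hf : KernelCol p q f)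
    (h0 : ∀ a, f a 0 = 0) (hA : ∀ j : Fin 3, deriv (f (iA j.succ)) 0 = 0)
    (hP : ∀ μ, deriv (f (iP μ)) 0 = 0) : ∀ a, f a = 0 := by
  have hd : ∀ n a t, AnalyticAt ℝ (iteratedDeriv n (f a)) t := by
    intro n a
    induction n with
    | zero => simpa [iteratedDeriv_zero] using hf.analytic a
    | succ n ih => rw [iteratedDeriv_succ]; exact fun t => (ih t).deriv
  -- the derivatives of the field equations
  have heq : ∀ (n : ℕ) (r : ExtIx) (t : ℝ), ∑ a : FieldIx,
      (opCoeff p q 0 r (.inl a) * iteratedDeriv n (f a) t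
      + I * opCoeff p q 1 r (.inl a) * iteratedDeriv (n + 1) (f a) t
      - opCoeff p q 2 r (.inl a) * iteratedDeriv (n + 2) (f a) t) = 0 := by
    intro n r
    induction n with
    | zero =>
      intro t
      have := hf.multiplier hp t r
      simpa only [iteratedDeriv_succ, iteratedDeriv_zero] using this
    | succ n ih =>
      intro t
      have hs : ∀ m a, HasDerivAt (iteratedDeriv m (f a)) (iteratedDeriv (m + 1) (f a) t) t := by
        intro m a
        rw [iteratedDeriv_succ]
        exact (hd m a t).differentiableAt.hasDerivAt
      have := HasDerivAt.fun_sum (u := Finset.univ) (x := t) fun (a : FieldIx) _ =>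
        (((hs n a).const_mul (opCoeff p q 0 r (.inl a))).add
          ((hs (n + 1) a).const_mul (I * opCoeff p q 1 r (.inl a)))).sub
          ((hs (n + 2) a).const_mul (opCoeff p q 2 r (.inl a)))
      exact this.unique ((hasDerivAt_const t (0 : ℂ)).congr_of_eventuallyEq (.of_forall ih))
  have hπ := piC_ne
  obtain ⟨-, hχ, hω⟩ := hp.ne_zero
  have key : ∀ n, (∀ a, iteratedDeriv n (f a) 0 = 0) ∧
      (∀ j : Fin 3, iteratedDeriv (n + 1) (f (iA j.succ)) 0 = 0) ∧
      ∀ μ, iteratedDeriv (n + 1) (f (iP μ)) 0 = 0 := by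
    intro n
    induction n with
    | zero => simpa only [iteratedDeriv_succ, iteratedDeriv_zero] using ⟨h0, hA, hP⟩
    | succ n ih =>
      obtain ⟨i0, iA', iP'⟩ := ih
      have e := fun μ ν => opCoeff_entries hp q μ ν
      obtain ⟨T, hT⟩ : ∃ T : ExtIx → FieldIx → ℂ, T = fun r a =>
        I * opCoeff p q 1 r (.inl a) * iteratedDeriv (n + 1) (f a) 0
          - opCoeff p q 2 r (.inl a) * iteratedDeriv (n + 2) (f a) 0 := ⟨_, rfl⟩
      have hx : ∀ r, ∑ μ, T r (iA μ) + (∑ μ, T r (iP μ) + T r iB) = 0 := fun r => by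
        have h := heq n r 0
        simp only [i0, mul_zero, zero_add, Fintype.sum_sum_type, Finset.univ_unique,
          Finset.sum_singleton] at h
        rw [hT]; exact h
      have a1 := iA' 0
      have a2 := iA' 1
      have a3 := iA' 2
      simp only [show Fin.succ (0 : Fin 3) = 1 from rfl, show Fin.succ (1 : Fin 3) = 2 from rfl,
        show Fin.succ (2 : Fin 3) = 3 from rfl] at a1 a2 a3
      have a0 : iteratedDeriv (n + 1) (f (iA 0)) 0 = 0 := by
        have h := hx (.inl iB)
        have e2 := (e 0 0).2.2.2.2.2.2.2.2.2.2.2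
        simp only [hT, e2, (e 0 _).2.2.2.2.2.2.2.2.2.1, iP', Fin.sum_univ_four, a1, a2, a3,
          (e 0 0).2.2.2.2.2.2.2.2.2.2.1] at h
        simpa [tCoeff, (e 0 0).2.2.2.2.2.2.2.2.1, e2] using h
      have b0 : iteratedDeriv (n + 1) (f iB) 0 = 0 := by
        have h := hx (.inl (iA 0))
        simp only [hT, (e 0 _).1, (e 0 _).2.1, iP', Fin.sum_univ_four, a0, a1, a2, a3,
          (e 0 0).2.2.2.1, (e 0 0).2.2.1] at h
        simpa [tCoeff, eta] using h
      have hA1 : ∀ μ, iteratedDeriv (n + 1) (f (iA μ)) 0 = 0 := by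
        intro μ; fin_cases μ <;> assumption
      refine ⟨?_, fun j => ?_, fun μ => ?_⟩
      · rintro (μ | μ | u)
        exacts [hA1 μ, iP' μ, b0]
      · have h := hx (.inl (iA j.succ))
        simp only [hT, (e j.succ _).1, (e j.succ _).2.1, iP', hA1, b0, (e j.succ 0).2.2.1] at h
        simpa [tCoeff, eta, Fin.succ_ne_zero, Real.pi_ne_zero] using h
      · have h := hx (.inl (iP μ))
        simp only [hT, (e μ _).2.2.2.2.1, (e μ _).2.2.2.2.2.1, iP', hA1, b0,
          (e μ 0).2.2.2.2.2.2.1] at h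
        by_cases h0 : μ = 0 <;> simpa [eta, h0, v0_ne hp, hχ, hω] using h
  exact fun a => eq_zero_of_iteratedDeriv (hf.analytic a) fun n => (key n).1 a

/-- The commutator relations determine the canonical data of the commutator function. -/
theorem canonical_data {q : ℝ³} {D : Fin 3 → Matrix FieldIx FieldIx ℂ}
    (h : canPos p q * D 0 * (canPos p (-q)).transpose
      + canVel p * D 1 * (canPos p (-q)).transpose
      - canPos p q * D 1 * (canVel p).transpose
      - canVel p * D 2 * (canVel p).transpose = 0) (b : FieldIx) :
    (∀ a, D 0 a b = 0) ∧ (∀ j : Fin 3, D 1 (iA j.succ) b = 0) ∧ ∀ μ, D 1 (iP μ) b = 0 := by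
  have hv := v0_ne hp
  obtain ⟨-, hχ, hω⟩ := hp.ne_zero
  have hz : ∀ z, (canPos p q * D 0) z b + (canVel p * D 1) z b = 0 := by
    intro z
    have h' := fun z' => congrFun (congrFun h z) z'
    simp only [Matrix.sub_apply, Matrix.add_apply, sandwich, Matrix.zero_apply] at h'
    rcases b with ν | ν | u
    · have := h' (.inl ν)
      simpa only [(canPos_mul p _ _ _).1, (canVel_mul p _ _).1, sub_zero,
        Matrix.transpose_apply] using this
    · have := h' (.inr (.inr (.inl ν)))
      simpa only [(canPos_mul p _ _ _).2.2.1, (canVel_mul p _ _).2.2.1, sub_zero,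
        Matrix.transpose_apply] using this
    · have := h' (.inr (.inl 0))
      have g0 : gradC (-q) 0 = 0 := rfl
      simpa only [(canPos_mul p _ _ _).2.1, (canVel_mul p _ _).2.1, sub_zero,
        Matrix.transpose_apply, g0, tCoeff, if_true, sub_self, mul_zero, zero_mul, zero_add,
        one_mul] using this
  have hA : ∀ μ, D 0 (iA μ) b = 0 := fun μ => by
    simpa only [(canPos_mul p _ _ _).1, (canVel_mul p _ _).1, add_zero] using hz (.inl μ)
  have hP : ∀ μ, D 0 (iP μ) b = 0 := fun μ => by
    simpa only [(canPos_mul p _ _ _).2.2.1, (canVel_mul p _ _).2.2.1, add_zero]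
      using hz (.inr (.inr (.inl μ)))
  have hB : D 0 iB b = 0 := by
    simpa [(canPos_mul p _ _ _).2.1, (canVel_mul p _ _).2.1, hA, hP, tCoeff] using hz (.inr (.inl 0))
  refine ⟨?_, fun j => ?_, fun μ => ?_⟩
  · rintro (μ | μ | u)
    · exact hA μ
    · exact hP μ
    · exact hB
  · simpa [(canPos_mul p _ _ _).2.1, (canVel_mul p _ _).2.1, hA, hP, hB, tCoeff, Fin.succ_ne_zero,
      Real.pi_ne_zero] using hz (.inr (.inl j.succ))
  · simpa [(canPos_mul p _ _ _).2.2.2, (canVel_mul p _ _).2.2.2, hP, hp.hv0.ne', hp.hχ.ne', hp.hω.ne'] using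
      hz (.inr (.inr (.inr μ)))

omit hp in
theorem ae_neg {P : ℝ³ → Prop} (h : ∀ᵐ q, P q) : ∀ᵐ q : ℝ³, P (-q) :=
  (Measure.measurePreserving_neg (volume : Measure ℝ³)).quasiMeasurePreserving.ae h

/-- The vacuum two-point function is unique. -/
theorem IsVacuumTwoPoint.unique {W W' : ℝ³ → ℝ → Matrix FieldIx FieldIx ℂ}
    (hW : IsVacuumTwoPoint p W) (hW' : IsVacuumTwoPoint p W') : ∀ᵐ q, W q = W' q := by
  filter_upwards [hW.left_eq, hW.right_eq, hW.positive, ae_neg hW.positive, hW.commutators,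
    hW'.left_eq, hW'.right_eq, hW'.positive, ae_neg hW'.positive, hW'.commutators]
    with q l1 r1 ⟨S, c, hS, e1⟩ ⟨T, d, hT, e2⟩ k1 l2 r2 ⟨S', c', hS', e1'⟩ ⟨T', d', hT', e2'⟩ k2
  have an : ∀ {U : ℝ → Matrix FieldIx FieldIx ℂ} {S : Finset ℝ}
      {c : ℝ → FieldIx → FieldIx → Polynomial ℂ}, (∀ (t : ℝ) (a b : FieldIx),
      U t a b = ∑ s ∈ S, (c s a b).eval (t : ℂ) * cexp (-I * s * t)) →
      ∀ a b t, AnalyticAt ℝ (fun t => U t a b) t := by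
    intro U S c h a b t
    simp only [h]
    exact analyticAt_expPoly S (fun s => c s a b) t
  have an' : ∀ {U : ℝ → Matrix FieldIx FieldIx ℂ}, (∀ a b t, AnalyticAt ℝ (fun t => U t a b) t) →
      ∀ a b t, AnalyticAt ℝ (fun t => (fun t => (U (-t)).transpose) t a b) t :=
    fun h a b t => (h b a (-t)).comp (f := fun t : ℝ => -t) (analyticAt_id.neg)
  have w1 := an e1
  have w2 := an' (an e2)
  have w1' := an e1'
  have w2' := an' (an e2')
  have hK := fun b => ((l1.kernelCol w1 b).sub (r1.kernelCol w2 b)).sub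
    ((l2.kernelCol w1' b).sub (r2.kernelCol w2' b))
  have hdata := fun b => canonical_data hp (q := q)
    (D := fun n => commDeriv W q n - commDeriv W' q n) (b := b) (by
      rw [← sub_eq_zero.2 (k1.trans k2.symm)]
      simp only [Matrix.mul_sub, Matrix.sub_mul]
      simp only [Fin.val_zero, Fin.val_one, Fin.val_two]
      abel)
  have hzero : ∀ a b t, W q t a b - W (-q) (-t) b a = W' q t a b - W' (-q) (-t) b a := by
    intro a b t
    have hn : ∀ (n : ℕ) a, iteratedDeriv n (fun t => W q t a b - (W (-q) (-t)).transpose a b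
        - (W' q t a b - (W' (-q) (-t)).transpose a b)) 0
        = commDeriv W q n a b - commDeriv W' q n a b := by
      intro n a
      exact iteratedDeriv_fun_sub (((w1 a b 0).sub (w2 a b 0)).contDiffAt)
        (((w1' a b 0).sub (w2' a b 0)).contDiffAt)
    have := (hK b).eq_zero hp (fun a => ?_) (fun j => ?_) (fun μ => ?_) a
    · exact sub_eq_zero.1 (congrFun this t)
    · exact (congrFun iteratedDeriv_zero 0).symm.trans ((hn 0 a).trans ((hdata b).1 a))
    · rw [← iteratedDeriv_one]; exact (hn 1 _).trans ((hdata b).2.1 j)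
    · rw [← iteratedDeriv_one]; exact (hn 1 _).trans ((hdata b).2.2 μ)
  -- separation of the frequencies
  ext t a b
  classical
  set N := fun (T : Finset ℝ) (d : ℝ → FieldIx → FieldIx → Polynomial ℂ) (s : ℝ) =>
    if -s ∈ T then (d (-s) b a).comp (-Polynomial.X) else 0 with hN
  set P := fun (S : Finset ℝ) (c : ℝ → FieldIx → FieldIx → Polynomial ℂ) (s : ℝ) =>
    if s ∈ S then c s a b else 0 with hPdef
  obtain ⟨A, hA⟩ : ∃ A : Finset ℝ, A = (S ∪ S') ∪ (T ∪ T').image (fun s => -s) := ⟨_, rfl⟩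
  have ePos : ∀ (S : Finset ℝ) (c : ℝ → FieldIx → FieldIx → Polynomial ℂ) (t : ℝ), S ⊆ A →
      ∑ s ∈ S, (c s a b).eval (t : ℂ) * cexp (-I * s * t)
      = ∑ s ∈ A, (P S c s).eval (t : ℂ) * cexp (-I * s * t) := by
    intro S c t h
    rw [← Finset.sum_subset h]
    · exact Finset.sum_congr rfl fun s hs => by simp [hPdef, hs]
    · intro s _ hs; simp [hPdef, hs]
  have eNeg : ∀ (T : Finset ℝ) (d : ℝ → FieldIx → FieldIx → Polynomial ℂ) (t : ℝ),
      T.image (fun s => -s) ⊆ A →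
      ∑ s ∈ T, (d s b a).eval ((-t : ℝ) : ℂ) * cexp (-I * s * (-t : ℝ))
      = ∑ s ∈ A, (N T d s).eval (t : ℂ) * cexp (-I * s * t) := by
    intro T d t h
    rw [← Finset.sum_subset h, Finset.sum_image (fun x _ y _ h => neg_injective h)]
    · refine Finset.sum_congr rfl fun s hs => ?_
      simp [hN, hs]
    · intro s _ hs
      have : -s ∉ T := fun h => hs (Finset.mem_image.2 ⟨-s, h, neg_neg s⟩)
      simp [hN, this]
  have s1 : S ⊆ A := by grind
  have s2 : S' ⊆ A := by grind
  have s3 : T.image (fun s => -s) ⊆ A := by grind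
  have s4 : T'.image (fun s => -s) ⊆ A := by grind
  have hI := expPoly_eq_zero A (fun s => P S c s - N T d s - (P S' c' s - N T' d' s)) fun t => by
    have := sub_eq_zero.2 (hzero a b t)
    rw [e1, e2, e1', e2', ePos S c t s1, ePos S' c' t s2, eNeg T d t s3, eNeg T' d' t s4] at this
    rw [← this]
    simp only [Polynomial.eval_sub, sub_mul, Finset.sum_sub_distrib]
  rw [e1, e1', ePos S c t s1, ePos S' c' t s2]
  refine Finset.sum_congr rfl fun s hs => ?_
  congr 2
  have h := hI s hs
  have neg4 : ∀ s, mink (four (-s) (-q)) p.v = -mink (four s q) p.v := by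
    intro s; rw [mink_four_v hp, mink_four_v hp, xStar_neg]; ring
  by_cases hpos : 0 < mink (four s q) p.v
  · have n1 : N T d s = 0 := if_neg fun h' => by
      have := hT _ h'; rw [neg4] at this; linarith
    have n2 : N T' d' s = 0 := if_neg fun h' => by
      have := hT' _ h'; rw [neg4] at this; linarith
    rw [n1, n2, sub_zero, sub_zero] at h
    exact sub_eq_zero.1 h
  · have n1 : P S c s = 0 := if_neg fun h' => hpos (hS _ h')
    have n2 : P S' c' s = 0 := if_neg fun h' => hpos (hS' _ h')
    rw [n1, n2]

end

/-! ### Hermiticity -/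

/-- For real momenta the propagator is Hermitian. -/
theorem regProp_star (p : Medium) (s w : ℂ) (k : ℂ⁴) (a b : FieldIx) :
    conj (regProp p s w k a b) = regProp p (conj s) (conj w) (fun μ => conj (k μ)) b a := by
  have he : ∀ μ ν, conj (eta μ ν) = eta ν μ := by
    intro μ ν; fin_cases μ <;> fin_cases ν <;> simp [eta]
  have hv : ∀ μ, conj (p.vC μ) = p.vC μ := by simp [Medium.vC, toC]
  have ho : conj (p.omC k) = p.omC (fun μ => conj (k μ)) := by simp [Medium.omC, mink, hv]
  have hu : conj (denU p w k) = denU p (conj w) (fun μ => conj (k μ)) := by simp [denU, ho]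
  have hD : conj (denD p s w k) = denD p (conj s) (conj w) (fun μ => conj (k μ)) := by
    simp [denD, hu, ho, Complex.conj_ofNat]
  have hH : conj (denH p w k) = denH p (conj w) (fun μ => conj (k μ)) := by
    simp [denH, hu, Complex.conj_ofNat]
  rcases a with μ | μ | _ <;> rcases b with ν | ν | _ <;>
    simp only [regProp, Matrix.of_apply, tens, map_add, map_mul, map_div₀, map_neg, map_sub,
      map_pow, map_zero, Complex.conj_ofReal, Complex.conj_ofNat, Complex.conj_I, hv, ho,
      hu, hD, hH, he] <;> ring

theorem HasPole.conj {f : ℂ → ℂ} {a c d : ℂ} (h : HasPole f a c d) :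
    HasPole (fun z => conj (f (conj z))) (conj a) (conj c) (conj d) := by
  have ht : Tendsto (fun z : ℂ => conj z) (𝓝[≠] (conj a)) (𝓝[≠] a) := by
    refine tendsto_nhdsWithin_iff.2 ⟨?_, ?_⟩
    · have : Tendsto (fun z : ℂ => conj z) (𝓝 (conj a)) (𝓝 (conj (conj a))) :=
        Complex.continuous_conj.tendsto _
      rw [Complex.conj_conj] at this
      exact this.mono_left nhdsWithin_le_nhds
    · filter_upwards [self_mem_nhdsWithin] with z hz h
      refine hz ?_
      rw [Set.mem_singleton_iff] at h ⊢
      rw [← h, Complex.conj_conj]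
  refine ((Asymptotics.IsBigO.comp_tendsto h ht).norm_left.congr_left fun z => ?_).of_norm_left
  rw [Function.comp, ← Complex.norm_conj]
  simp only [map_sub, map_add, map_div₀, map_pow, Complex.conj_conj]

section

variable {p : Medium} (hp : p.Good) {q : ℝ³}
include hp

theorem resPair_conj (hG : Generic p q) {z : ℂ} (hz : z ∈ nodes p q) (a b : FieldIx) :
    resC p q b a z = conj (resC p q a b z) ∧ resD p q b a z = conj (resD p q a b z) := by
  have hr : conj z = z := Complex.conj_eq_iff_im.2
    (real_of_mem_nodeSet hp hG ((mem_nodes hp hG.ne_zero).1 hz)).1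
  refine resPair_eq ?_
  have := (hasPole_resolvent hp hG hz a b).conj
  rw [hr] at this
  refine this.congr (.of_forall fun y => ?_)
  have e : (fun μ => conj (fourC (conj y) q μ)) = fourC y q := by
    funext μ; refine Fin.cases ?_ (fun j => ?_) μ <;> simp [fourC]
  have e' : conj (mink (fourC (conj y) q) (fourC (conj y) q)) = mink (fourC y q) (fourC y q) := by
    rw [← e]; simp [mink]
  simp only [resolvent, regProp_star, e, e', map_pow, Complex.conj_ofReal]

theorem vacuumFunction_conj (hG : Generic p q) (t : ℝ) (a b : FieldIx) :
    vacuumFunction p q t b a = conj (vacuumFunction p q (-t) a b) := by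
  simp only [vacuumFunction, Matrix.of_apply, expSum, map_neg, map_sum, map_mul, map_sub,
    ← Complex.exp_conj, Complex.conj_I, Complex.conj_ofReal]
  congr 1
  refine Finset.sum_congr rfl fun z hz => ?_
  have hz' := (Finset.mem_filter.1 hz).1
  have hr : conj z = z := Complex.conj_eq_iff_im.2
    (real_of_mem_nodeSet hp hG ((mem_nodes hp hG.ne_zero).1 hz')).1
  rw [(resPair_conj hp hG hz' a b).1, (resPair_conj hp hG hz' a b).2, hr]
  push_cast
  congr 1
  · ring
  · congr 1; ring

/-! ### The explicit two-point functions -/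

omit hp in
theorem kBar_zero (q : ℝ³) : kBar p q 0 = xStar p q + bar p / p.v 0 := by
  show (bar p + ∑ j : Fin 3, p.v j.succ * q j) / p.v 0 = _
  rw [xStar]; ring

/-- The poles with `ω > 0`. -/
theorem sum_positive_nodes (hG : Generic p q) (F : ℂ → ℂ) :
    ∑ z ∈ (nodes p q).filter (fun z => xStar p q < z.re), F z
      = F (len q) + F (kBar p q 0) + ∑ᶠ s ∈ transverseModes p q, F s := by
  have hq := hG.ne_zero
  have hfin := finite_transverseModes hp hq
  have hx := abs_lt.1 (show |xStar p q| < len q from by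
    refine abs_lt_of_sq_lt_sq ?_ (len_nonneg q)
    rw [len_sq]; have := mSq_pos hp hq; rw [mSq] at this; linarith)
  have hS : zS q (len q) = 0 := zS_eq_zero_iff.2 (.inl rfl)
  have hH : zH p q (kBar p q 0) = 0 := (zH_eq_zero_iff hp).2 (.inl (by rw [kBar_zero]; push_cast; rfl))
  have hb : 0 < bar p / p.v 0 := div_pos (bar_pos hp) hp.hv0
  have hT : ∀ s ∈ transverseModes p q, zD p q s = 0 := fun s hs =>
    (zD_eq_zero_iff hp hq).2 ⟨s, rfl, .inl hs⟩
  have hset : (nodes p q).filter (fun z => xStar p q < z.re)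
      = insert (len q : ℂ) (insert (kBar p q 0 : ℂ) (hfin.toFinset.image (fun s : ℝ => (s : ℂ)))) := by
    ext z
    simp only [Finset.mem_filter, mem_nodes hp hq, Finset.mem_insert, Finset.mem_image,
      Set.Finite.mem_toFinset]
    constructor
    · rintro ⟨h | h | h, hz⟩
      · rcases zS_eq_zero_iff.1 h with rfl | rfl
        · exact .inl rfl
        · simp at hz; linarith
      · rcases (zH_eq_zero_iff hp).1 h with rfl | rfl
        · right; left; rw [kBar_zero]; push_cast; rfl
        · rw [← Complex.ofReal_div, ← Complex.ofReal_sub, Complex.ofReal_re] at hz; linarith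
      · obtain ⟨s, rfl, hs | hs⟩ := (zD_eq_zero_iff hp hq).1 h
        · exact .inr (.inr ⟨s, hs, rfl⟩)
        · have := ((mem_transverseModes_iff hp (neg_ne_zero.2 hq)).1 hs).2.2
          rw [xStar_neg] at this
          simp at hz; linarith
    · rintro (rfl | rfl | ⟨s, hs, rfl⟩)
      · exact ⟨.inl hS, by simpa using hx.2⟩
      · exact ⟨.inr (.inl hH), by rw [kBar_zero, Complex.ofReal_re]; linarith⟩
      · exact ⟨.inr (.inr (hT s hs)), by
          simpa using ((mem_transverseModes_iff hp hq).1 hs).2.2⟩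
  have n1 : (kBar p q 0 : ℂ) ∉ hfin.toFinset.image (fun s : ℝ => (s : ℂ)) := by
    intro h
    obtain ⟨s, hs, e⟩ := Finset.mem_image.1 h
    have := hT s ((Set.Finite.mem_toFinset hfin).1 hs)
    rw [e] at this
    exact zD_ne_zero_of_zH hp hG hH this
  have n2 : (len q : ℂ) ∉ insert (kBar p q 0 : ℂ) (hfin.toFinset.image (fun s : ℝ => (s : ℂ))) := by
    intro h
    rcases Finset.mem_insert.1 h with h | h
    · exact hG.bar_ne_zero _ hH (h ▸ hS)
    · obtain ⟨s, hs, e⟩ := Finset.mem_image.1 h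
      have := hT s ((Set.Finite.mem_toFinset hfin).1 hs)
      rw [e] at this
      exact zD_ne_zero_of_zS hp hq hS this
  rw [hset, Finset.sum_insert n2, Finset.sum_insert n1, Finset.sum_image
    (fun _ _ _ _ h => Complex.ofReal_injective h), finsum_mem_eq_finite_toFinset_sum _ hfin, add_assoc]

/-- Assembles an entry of the vacuum two-point function from its residues. -/
theorem vacuumFunction_eq (hG : Generic p q) (t : ℝ) {a b : FieldIx} {c d c' : ℂ} {c'' : ℝ → ℂ}
    (h1 : HasPole (fun y => resolvent p q y a b) (len q) (-c) (-d))
    (h2 : HasPole (fun y => resolvent p q y a b) (kBar p q 0) (-c') 0)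
    (h3 : ∀ s ∈ transverseModes p q, HasPole (fun y => resolvent p q y a b) s (-c'' s) 0) :
    vacuumFunction p q t a b = phase (len q) t * (c - I * t * d) + phase (kBar p q 0) t * c'
      + ∑ᶠ s ∈ transverseModes p q, phase s t * c'' s := by
  have hfin := finite_transverseModes hp hG.ne_zero
  simp only [vacuumFunction, Matrix.of_apply, expSum]
  rw [sum_positive_nodes hp hG (fun z => (resC p q a b z - I * t * resD p q a b z)
    * cexp (-I * z * t)), neg_add, neg_add, finsum_mem_eq_finite_toFinset_sum _ hfin,
    finsum_mem_eq_finite_toFinset_sum _ hfin, ← Finset.sum_neg_distrib, (resPair_eq h1).1,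
    (resPair_eq h1).2, (resPair_eq h2).1, (resPair_eq h2).2]
  congr 1
  · simp only [phase]; ring
  · refine Finset.sum_congr rfl fun s hs => ?_
    have := resPair_eq (h3 s ((Set.Finite.mem_toFinset hfin).1 hs))
    rw [this.1, this.2, phase]
    ring

omit hp in
theorem toC_four' (q : ℝ³) (s : ℝ) (μ : Fin 4) : ((four s q μ : ℝ) : ℂ) = fourC s q μ := by
  refine Fin.cases ?_ (fun j => ?_) μ <;> simp [four, fourC]

end

section

variable {p : Medium} (hp : p.Good) {q : ℝ³}

include hp

/-- The values of the denominators on the light cone. -/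
theorem photon_values (hG : Generic p q) : (len q : ℂ) ≠ 0 ∧ (omPlus p q : ℂ) ≠ 0 ∧
    (omPlus p q : ℂ) ^ 2 - barSq p ≠ 0 ∧ zS q (len q) = 0 ∧ zO p q (len q) = omPlus p q ∧
    zU p q (len q) = (omPlus p q : ℂ) ^ 2 - (p.ω₀ : ℂ) ^ 2 ∧
    zH p q (len q) = (omPlus p q : ℂ) ^ 2 - barSq p ∧
    zD p q (len q) = -(p.g ^ 2 * p.χ * (p.ω₀ : ℂ) ^ 2 * (omPlus p q : ℂ) ^ 2) ∧
    ∀ μ, ((kPlus q μ : ℝ) : ℂ) = fourC (len q) q μ := by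
  have hS : zS q (len q) = 0 := zS_eq_zero_iff.2 (.inl rfl)
  have hO : zO p q (len q) = omPlus p q := zO_real hp (len q)
  have hH := zH_eq (p := p) q (len q)
  rw [hO] at hH
  refine ⟨by exact_mod_cast (len_pos hG.ne_zero).ne', hO ▸ zO_photon_ne_zero hp hG.ne_zero hS,
    fun h => hG.bar_ne_zero _ (hH.trans h) hS, hS, hO, by rw [zU, hO], hH, ?_,
    fun μ => toC_four' q (len q) μ⟩
  rw [zD, hS, hO]; ring

/-- The values of the denominators at the b-mode. -/
theorem bar_values (hG : Generic p q) : (bar p : ℂ) ≠ 0 ∧ zH p q (kBar p q 0) = 0 ∧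
    zO p q (kBar p q 0) = bar p ∧ zU p q (kBar p q 0) = gap p ∧
    zS q (kBar p q 0) = (mink (kBar p q) (kBar p q) : ℝ) ∧ zS q (kBar p q 0) ≠ 0 ∧
    (barSq p : ℂ) = (bar p : ℂ) ^ 2 ∧ (bar p : ℂ) ^ 2 - zS q (kBar p q 0) ≠ 0 ∧
    zS q (kBar p q 0) - (bar p : ℂ) ^ 2 ≠ 0 ∧ zD p q (kBar p q 0) = gap p / (4 * π) * (zS q (kBar p q 0) - (bar p : ℂ) ^ 2) ∧
    ∀ μ, ((kBar p q μ : ℝ) : ℂ) = fourC (kBar p q 0) q μ := by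
  have hH : zH p q (kBar p q 0) = 0 := (zH_eq_zero_iff hp).2 (.inl (by rw [kBar_zero]; push_cast; rfl))
  have hb : (bar p : ℂ) ^ 2 = barSq p := by exact_mod_cast bar_sq hp
  have hn : zS q (kBar p q 0) - (bar p : ℂ) ^ 2 ≠ 0 := fun h =>
    hG.bar_ne _ hH ((sub_eq_zero.1 h).trans hb)
  have hv := v0_ne hp
  have e : (kBar p q) = four (kBar p q 0) q := rfl
  have hπ := piC_ne
  refine ⟨by exact_mod_cast (bar_pos hp).ne', hH, ?_, sub_eq_zero.1 (by rw [gap]; exact hH),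
    (zS_ofReal q _).trans (by rw [← e]), hG.bar_ne_zero _ hH,
    hb.symm, neg_sub (zS q _) _ ▸ neg_ne_zero.2 hn, hn, ?_, fun μ => ?_⟩
  · rw [zO, kBar_zero]; push_cast; field_simp; ring
  · rw [zD_of_zH hH, hb, gap]; field_simp
  · rw [← toC_four', ← e]

/-- The values of the denominators at a transverse mode. -/
theorem transverse_values (hG : Generic p q) {s : ℝ} (hs : s ∈ transverseModes p q) :
    zD p q s = 0 ∧ zS q s ≠ 0 ∧ zH p q s ≠ 0 ∧ zU p q s ≠ 0 ∧ zO p q s ≠ 0 ∧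
    ((deriv (DR p q) s : ℝ) : ℂ) ≠ 0 ∧ zS q s * zU p q s = gap p * zO p q s ^ 2 ∧
    deriv (zD p q) s = zU p q s * (deriv (DR p q) s : ℝ) ∧
    zO p q s = (mink (four s q) p.v : ℝ) ∧
    zU p q s = ((mink (four s q) p.v : ℝ) : ℂ) ^ 2 - (p.ω₀ : ℂ) ^ 2 := by
  have hq := hG.ne_zero
  have hD : zD p q s = 0 := (zD_eq_zero_iff hp hq).2 ⟨s, rfl, .inl hs⟩
  have hm := (mem_transverseModes_iff hp hq).1 hs
  have hπ := piC_ne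
  refine ⟨hD, fun h => zD_ne_zero_of_zS hp hq h hD, fun h => zD_ne_zero_of_zH hp hG h hD,
    zU_ne_zero_of_zD hp hD, zO_ne_zero_of_zD hp hq hD, by exact_mod_cast hs.2.2.ne', ?_,
    deriv_zD hp hm.1 hm.2.1, zO_real hp s, by rw [zU, zO_real hp]⟩
  rw [zD] at hD
  rw [gap]; field_simp at hD; linear_combination hD

/-- Completeness of the polarization vectors. -/
theorem polarization_sum {e : ℝ³ → ℝ → Fin 2 → ℝ⁴} (he : IsPolarization p e)
    (hG : Generic p q) {s : ℝ} (hs : s ∈ transverseModes p q) (μ ν : Fin 4) :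
    ((∑ i, e q s i μ * e q s i ν : ℝ) : ℂ) = -tens (fourC s q) p.vC 1
      (gap p / (zH p q s * zS q s)) (-(gap p * zO p q s / (zH p q s * zS q s)))
      (-(gap p * zO p q s / (zH p q s * zS q s))) (gap p / zH p q s) μ ν := by
  have hv := hp.hv
  obtain ⟨-, hS, hH, hU, -, -, eS, -, eo, -⟩ := transverse_values hp hG hs
  have eH : zH p q s = zU p q s - gap p := rfl
  have hg := gap_ne_zero hp
  -- the square of the part of the momentum orthogonal to `v`
  obtain ⟨o, ho⟩ : ∃ o, o = mink (four s q) p.v := ⟨_, rfl⟩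
  rw [← ho] at eo
  obtain ⟨S, hSd⟩ : ∃ S, S = mink (four s q) (four s q) := ⟨_, rfl⟩
  have es : zS q s = (S : ℂ) := by rw [hSd]; exact zS_ofReal q s
  have hHS : zH p q s * zS q s = -(gap p * ((S : ℂ) - o ^ 2)) := by
    rw [eH, sub_mul, mul_comm (zU p q s), eS, eo, es]; ring
  have hκ' : (S : ℂ) - o ^ 2 ≠ 0 := fun h => mul_ne_zero hH hS (by rw [hHS, h]; ring)
  have hκ : S - o ^ 2 ≠ 0 := by exact_mod_cast hκ'
  have hκH : gap p / zH p q s = -((S : ℂ) / (S - o ^ 2)) := by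
    have hS' : (S : ℂ) ≠ 0 := es ▸ hS
    have : zH p q s = -(gap p * ((S : ℂ) - o ^ 2)) / S := by rw [← hHS, es]; field_simp
    rw [this]; field_simp
  obtain ⟨m0, v0, e0⟩ := he q s hs 0
  obtain ⟨m1, v1, e1⟩ := he q s hs 1
  have a0 := e0 0
  have a01 := e0 1
  have a1 := e1 1
  have bil : ∀ (x y z : ℝ⁴) (r : ℝ), mink x (fun μ => y μ - r * z μ) = mink x y - r * mink x z :=
    fun x y z r => by simp only [mink]; ring
  have hc : ∀ x y : ℝ⁴, mink x y = mink y x := fun x y => by simp only [mink]; ring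
  -- the basis `v`, `k - ω v`, `e₀`, `e₁` is orthogonal
  obtain ⟨E, hE⟩ : ∃ E : Matrix (Fin 4) (Fin 4) ℝ, E = Matrix.of
    ![p.v, fun μ => four s q μ - o * p.v μ, e q s 0, e q s 1] := ⟨_, rfl⟩
  obtain ⟨N, hN⟩ : ∃ N : Matrix (Fin 4) (Fin 4) ℝ, N = Matrix.diagonal
    ![1, 1 / (S - o ^ 2), -1, -1] := ⟨_, rfl⟩
  obtain ⟨G, hGd⟩ : ∃ G : Matrix (Fin 4) (Fin 4) ℝ, G = Matrix.diagonal ![1, -1, -1, -1] := ⟨_, rfl⟩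
  have hEE : E * G * E.transpose = Matrix.diagonal ![1, S - o ^ 2, -1, -1] := by
    have hm : ∀ i j, (E * G * E.transpose) i j = mink (E i) (E j) := by
      intro i j
      rw [Matrix.mul_apply, Fin.sum_univ_four]
      simp [hGd, mink, Matrix.mul_diagonal]
      ring
    have hκv : mink (fun μ => four s q μ - o * p.v μ) p.v = 0 := by
      rw [hc, bil, hv, hc, ← ho]; ring
    have hκe : ∀ x : ℝ⁴, mink x (four s q) = 0 → mink x p.v = 0 →
        mink (fun μ => four s q μ - o * p.v μ) x = 0 := by
      intro x h1 h2; rw [hc, bil, h1, h2]; ring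
    have hκκ : mink (fun μ => four s q μ - o * p.v μ) (fun μ => four s q μ - o * p.v μ)
        = S - o ^ 2 := by
      rw [bil, hκv, hc, bil, ← hSd, ← ho]; ring
    ext i j
    rw [hm]
    have E0 : E 0 = p.v := by rw [hE]; rfl
    have E1 : E 1 = fun μ => four s q μ - o * p.v μ := by rw [hE]; rfl
    have E2 : E 2 = e q s 0 := by rw [hE]; rfl
    have E3 : E 3 = e q s 1 := by rw [hE]; rfl
    fin_cases i <;> fin_cases j <;>
      simp [E0, E1, E2, E3, hv, hκv, hκκ, hκe _ m0 v0, hκe _ m1 v1, v0, v1, a0, a01, a1, hc p.v,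
        hc (e q s 0) (fun μ => four s q μ - o * p.v μ), hc (e q s 1) (e q s 0),
        hc (e q s 1) (fun μ => four s q μ - o * p.v μ)]
  have hNE : (N * E * G) * E.transpose = 1 := by
    rw [Matrix.mul_assoc N, Matrix.mul_assoc N, hEE, hN, Matrix.diagonal_mul_diagonal,
      ← Matrix.diagonal_one]
    congr 1
    funext i; fin_cases i <;> simp [hκ]
  have h := congrFun (congrFun (congrArg (fun M => M * G) (mul_eq_one_comm.1 hNE)) μ) ν
  have hr : p.v μ * p.v ν + 1 / (S - o ^ 2) * ((four s q μ - o * p.v μ) * (four s q ν - o * p.v ν))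
      - ∑ i, e q s i μ * e q s i ν = if μ = ν then (if μ = 0 then 1 else -1) else 0 := by
    have hGG : G * G = 1 := by
      rw [hGd, Matrix.diagonal_mul_diagonal, ← Matrix.diagonal_one]
      congr 1; funext i; fin_cases i <;> simp
    have hG1 : G μ ν = if μ = ν then (if μ = 0 then 1 else -1) else 0 := by
      rw [hGd]; fin_cases μ <;> fin_cases ν <;> simp
    rw [← hG1]
    change (E.transpose * (N * E * G) * G) μ ν = ((1 : Matrix (Fin 4) (Fin 4) ℝ) * G) μ ν at h
    rw [one_mul] at h
    rw [← h, Matrix.mul_assoc, Matrix.mul_assoc (N * E), hGG, mul_one, Matrix.mul_apply,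
      Fin.sum_univ_four, Fin.sum_univ_two, hN, hE]
    simp [Matrix.diagonal_mul]
    ring
  have hr' := congrArg (fun x : ℝ => (x : ℂ)) hr
  push_cast at hr' ⊢
  rw [toC_four', toC_four'] at hr'
  have hη : (((if μ = ν then (if μ = 0 then 1 else -1) else 0 : ℝ)) : ℂ) = eta μ ν := by
    simp only [eta]; split_ifs <;> simp
  rw [hη] at hr'
  simp only [tens, hHS, hκH, eo, ← hr', Medium.vC, toC]
  field_simp
  ring

variable {e : ℝ³ → ℝ → Fin 2 → ℝ⁴} (he : IsPolarization p e)
include he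

/-- Assembles an entry of the vacuum two-point function from its residues. -/
theorem vacuumFunction_eq_transverseSum (hG : Generic p q) (t : ℝ) {a b : FieldIx} {c d c' : ℂ}
    (f : ℝ → ℂ) {μ ν : Fin 4} (h1 : HasPole (fun y => resolvent p q y a b) (len q) (-c) (-d))
    (h2 : HasPole (fun y => resolvent p q y a b) (kBar p q 0) (-c') 0)
    (h3 : ∀ s ∈ transverseModes p q, HasPole (fun y => resolvent p q y a b) s
      (f (mink (four s q) p.v) * tens (fourC s q) p.vC 1 (gap p / (zH p q s * zS q s))
        (-(gap p * zO p q s / (zH p q s * zS q s))) (-(gap p * zO p q s / (zH p q s * zS q s)))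
        (gap p / zH p q s) μ ν / (deriv (DR p q) s : ℝ)) 0) :
    vacuumFunction p q t a b = phase (len q) t * (c - I * t * d) + phase (kBar p q 0) t * c'
      + transverseSum p e f q t μ ν := by
  rw [vacuumFunction_eq hp hG t (c'' := fun s => f (mink (four s q) p.v)
    * ((∑ i, e q s i μ * e q s i ν : ℝ) : ℂ) / (deriv (DR p q) s : ℝ)) h1 h2 fun s hs => ?_]
  · congr 1
    refine finsum_mem_congr rfl fun s _ => ?_
    push_cast
    rw [Fin.sum_univ_two, Fin.sum_univ_two]
    ring
  · convert h3 s hs using 1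
    rw [polarization_sum hp he hG hs]; ring

theorem vacuumFunction_AA (hG : Generic p q) (t : ℝ) (μ ν : Fin 4) :
    vacuumFunction p q t (iA μ) (iA ν) = photonAA p q t μ ν + bAA p q t μ ν
      + transverseSum p e (fun _ => 1) q t μ ν := by
  have hπ := piC_ne
  have hv : p.vC 0 ≠ 0 := v0_ne hp
  obtain ⟨hg, hχ, hω⟩ := hp.ne_zero
  refine (vacuumFunction_eq_transverseSum hp he hG t (μ := μ) (ν := ν)
    (c := photonAA p q 0 μ ν)
    (d := -((((p.ξ - 4 * π * ((omPlus p q ^ 2 - p.ω₀ ^ 2) / (omPlus p q ^ 2 - barSq p)))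
      / (4 * len q ^ 2) * (kPlus q μ * kPlus q ν) : ℝ) : ℂ)))
    (c' := bAA p q 0 μ ν) (fun _ => 1) ?_ ?_ ?_).trans ?_
  · obtain ⟨ha, hO, hb, hS, eO, eU, eH, eD, hk⟩ := photon_values hp hG
    convert hasPole_photon_AA hp ha hS (eH ▸ hb) (zD_ne_zero_of_zS hp hG.ne_zero hS) μ ν using 1
    · simp only [photonAA, phase, tens, eO, eU, eH, eD, gap, ofReal_v]
      push_cast
      simp only [hk]
      rw [mul_zero, Complex.exp_zero]
      split_ifs
      all_goals
        push_cast
        simp only [hk, ofReal_v]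
        field_simp
        ring
    · simp only [eU, eH]
      push_cast
      simp only [hk]
      ring
  · obtain ⟨hbar, hH, eO, eU, eS, hS, hb2, hSb, hSb', eD, hk⟩ := bar_values hp hG
    have hg0 := gap_ne_zero hp
    convert hasPole_bar_AA hp hS hH (zD_ne_zero_of_zH hp hG hH) μ ν using 1
    simp only [bAA, phase, tens, eO, eU, eD]
    push_cast
    rw [mul_zero, Complex.exp_zero, ← eS, hb2]
    simp only [hk μ, hk ν, ofReal_v]
    rw [show 8 * (π : ℂ) ^ 2 * p.g ^ 2 * p.χ * (p.ω₀ : ℂ) ^ 2 = 2 * π * gap p by rw [gap]; ring]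
    field_simp
    ring
  · intro s hs
    obtain ⟨hD, hS, hH, hU, hO, hd, eS, eD, -, -⟩ := transverse_values hp hG hs
    convert hasPole_transverse_AA hp hG.ne_zero hS hH hD μ ν using 1
    rw [eD]
    simp only [tens]
    field_simp
  · congr 2
    · simp only [photonAA, phase]
      push_cast
      simp
      ring
    · simp only [bAA, phase]
      push_cast
      simp

theorem vacuumFunction_AP (hG : Generic p q) (t : ℝ) (μ ν : Fin 4) :
    vacuumFunction p q t (iA μ) (iP ν) = twoPointAP p e q t μ ν := by
  have hπ := piC_ne
  have hv : p.vC 0 ≠ 0 := v0_ne hp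
  obtain ⟨hg, hχ, hω⟩ := hp.ne_zero
  have hg0 := gap_ne_zero hp
  refine (vacuumFunction_eq_transverseSum hp he hG t (μ := μ) (ν := ν)
    (c := I * ((2 * π * p.g * p.χ * p.ω₀ ^ 2 / (len q * omPlus p q)
        * (omPlus p q * kPlus q μ * p.v ν - kPlus q μ * kPlus q ν) / (omPlus p q ^ 2 - barSq p) : ℝ) : ℂ))
    (d := 0)
    (c' := -(I * ((2 * π * p.g * p.χ * p.ω₀ ^ 2 / (bar p * p.v 0)
        * (1 / (barSq p - mink (kBar p q) (kBar p q)))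
        * (p.v μ - bar p / mink (kBar p q) (kBar p q) * kBar p q μ)
        * (bar p * p.v ν - kBar p q ν) : ℝ) : ℂ)))
    (fun om => -I * ((p.g * p.χ * p.ω₀ ^ 2 * om / (om ^ 2 - p.ω₀ ^ 2) : ℝ) : ℂ)) ?_ ?_ ?_).trans ?_
  · obtain ⟨ha, hO, hb, hS, eO, eU, eH, eD, hk⟩ := photon_values hp hG
    rw [neg_zero]
    convert hasPole_photon_AP hp ha hS (eH ▸ hb) (zD_ne_zero_of_zS hp hG.ne_zero hS) μ ν using 1
    simp only [tens, eO, eH, eD, gap]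
    push_cast
    simp only [hk, ofReal_v]
    field_simp
    ring
  · obtain ⟨hbar, hH, eO, eU, eS, hS, hb2, hSb, hSb', eD, hk⟩ := bar_values hp hG
    convert hasPole_bar_AP hp hS hH (zD_ne_zero_of_zH hp hG hH) μ ν using 1
    simp only [tens, eO, eU, eD]
    push_cast
    rw [← eS, hb2]
    simp only [hk μ, hk ν, ofReal_v]
    field_simp
    ring
  · intro s hs
    obtain ⟨hD, hS, hH, hU, hO, hd, eS, eD, eO, eU⟩ := transverse_values hp hG hs
    convert hasPole_transverse_AP hp hG.ne_zero hS hH hD μ ν using 1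
    rw [eD]
    have eS' : zS q s = gap p * zO p q s ^ 2 / zU p q s := by rw [← eS]; field_simp
    push_cast
    rw [← eU, ← eO]
    simp only [tens, eS']
    field_simp
  · rw [twoPointAP]; ring

theorem vacuumFunction_PP (hG : Generic p q) (t : ℝ) (μ ν : Fin 4) :
    vacuumFunction p q t (iP μ) (iP ν) = twoPointPP p e q t μ ν := by
  have hπ := piC_ne
  have hv : p.vC 0 ≠ 0 := v0_ne hp
  obtain ⟨hg, hχ, hω⟩ := hp.ne_zero
  have hg0 := gap_ne_zero hp
  refine (vacuumFunction_eq_transverseSum hp he hG t (μ := μ) (ν := ν) (c := 0) (d := 0)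
    (c' := ((p.χ * p.ω₀ ^ 2 / (2 * bar p * p.v 0) * (1 / (barSq p - mink (kBar p q) (kBar p q)))
      * (bar p * p.v μ - kBar p q μ) * (bar p * p.v ν - kBar p q ν) : ℝ) : ℂ))
    (fun om => ((p.g ^ 2 * p.χ ^ 2 * p.ω₀ ^ 4 * om ^ 2 / (om ^ 2 - p.ω₀ ^ 2) ^ 2 : ℝ) : ℂ))
    ?_ ?_ ?_).trans ?_
  · obtain ⟨ha, hO, hb, hS, eO, eU, eH, eD, hk⟩ := photon_values hp hG
    rw [neg_zero]
    exact hasPole_photon_PP hp (eH ▸ hb) (zD_ne_zero_of_zS hp hG.ne_zero hS) μ ν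
  · obtain ⟨hbar, hH, eO, eU, eS, hS, hb2, hSb, hSb', eD, hk⟩ := bar_values hp hG
    convert hasPole_bar_PP hp hH (zD_ne_zero_of_zH hp hG hH) μ ν using 1
    simp only [tens, eO, eU, eD]
    push_cast
    rw [← eS, hb2]
    simp only [hk μ, hk ν, ofReal_v]
    have hgap : gap p = 4 * π * p.g ^ 2 * p.χ * (p.ω₀ : ℂ) ^ 2 := rfl
    field_simp
    rw [hgap]
    field_simp
    ring
  · intro s hs
    obtain ⟨hD, hS, hH, hU, hO, hd, eS, eD, eO, eU⟩ := transverse_values hp hG hs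
    convert hasPole_transverse_PP hp hG.ne_zero hH hD μ ν using 1
    rw [eD]
    have eS' : zS q s = gap p * zO p q s ^ 2 / zU p q s := by rw [← eS]; field_simp
    push_cast
    rw [← eU, ← eO]
    have hgap : gap p = 4 * π * p.g ^ 2 * p.χ * (p.ω₀ : ℂ) ^ 2 := rfl
    simp only [tens, eS', hgap]
    field_simp
    ring
  · rw [twoPointPP]; ring

omit he in
theorem vacuumFunction_AB (hG : Generic p q) (t : ℝ) (μ : Fin 4) :
    vacuumFunction p q t (iA μ) iB = twoPointAB q t μ := by
  obtain ⟨ha, -, -, hS, -, -, -, -, hk⟩ := photon_values hp hG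
  have hz : ∀ z, zS q z ≠ 0 → HasPole (fun y => resolvent p q y (iA μ) iB) z (-0) 0 := by
    intro z hS
    rw [neg_zero]
    refine HasPole.of_continuousAt ?_
    simp only [resolvent_AB]
    exact ((continuousAt_const.mul (analyticAt_fourC q μ z).continuousAt).div
      (analyticAt_zS q z).continuousAt hS)
  refine (vacuumFunction_eq hp hG t (c := I / 2 * ((kPlus q μ / len q : ℝ) : ℂ)) (d := 0)
    (c' := 0) (c'' := fun _ => 0) ?_ (hz _ (bar_values hp hG).2.2.2.2.2.1)
    fun s hs => hz _ (transverse_values hp hG hs).2.1).trans ?_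
  · rw [neg_zero]
    convert hasPole_photon_AB (p := p) ha hS μ using 1
    push_cast
    rw [hk]
    field_simp
  · rw [twoPointAB]
    simp
    ring

omit hp he in
theorem vacuumFunction_zero (t : ℝ) :
    (∀ μ, vacuumFunction p q t (iP μ) iB = 0) ∧ vacuumFunction p q t iB iB = 0 := by
  have h : ∀ a b, (fun y => resolvent p q y a b) = (fun _ => (0 : ℂ)) → vacuumFunction p q t a b = 0 := by
    intro a b h
    have h0 : ∀ z, HasPole (fun y => resolvent p q y a b) z 0 0 := fun z => by
      rw [h]; exact HasPole.of_continuousAt continuousAt_const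
    simp [vacuumFunction, expSum, fun z => (resPair_eq (h0 z)).1, fun z => (resPair_eq (h0 z)).2]
  exact ⟨fun μ => h _ _ rfl, h _ _ rfl⟩

omit he in
/-- In the rest frame of the medium the photon part takes its covariant form. -/
theorem photonAA_rest (hG : Generic p q) (h0 : ∀ j : Fin 3, p.v j.succ = 0) (t : ℝ) (μ ν : Fin 4) :
    photonAA p q t μ ν = photonAArest p q t μ ν := by
  obtain ⟨ha, hO, hb, -, -, -, -, -, hk⟩ := photon_values hp hG
  have h1 : p.v 1 = 0 := h0 0
  have h2 : p.v 2 = 0 := h0 1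
  have h3 : p.v 3 = 0 := h0 2
  have hv0 : p.v 0 = 1 := by
    have h := hp.hv
    simp only [mink, h1, h2, h3] at h
    nlinarith [hp.hv0]
  have ho : omPlus p q = len q := by
    simp [omPlus, mink, h1, h2, h3, hv0, kPlus, four]
  have hv : ∀ μ, (if μ = 0 then (1 : ℝ) else 0) = p.v μ := by
    intro μ; fin_cases μ <;> simp [h1, h2, h3, hv0]
  have hi : ∀ μ (x : ℝ), (if μ = 0 then x else 0) = p.v μ * x := by
    intro μ x; rw [← hv]; split_ifs <;> simp
  have hπ := piC_ne
  rw [ho] at hb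
  simp only [photonAA, photonAArest, ho, hi]
  congr 1
  push_cast
  rw [hv0]
  push_cast
  field_simp
  ring

end

/-! ### Fourier transforms of test functions -/

open LineDeriv in
/-- The partial derivatives of a test function. -/
def partialDeriv (μ : Fin 4) (f : 𝓢(ℝ⁴, ℂ)) :
    𝓢(ℝ⁴, ℂ) := ∂_{(Pi.single μ 1 : ℝ⁴)} f

theorem hasLineDerivAt_partialDeriv (μ : Fin 4) (f : 𝓢(ℝ⁴, ℂ)) (x : ℝ⁴) :
    HasLineDerivAt ℝ f (partialDeriv μ f x) x (Pi.single μ 1) := by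
  rw [partialDeriv, SchwartzMap.lineDerivOp_apply]
  exact f.differentiableAt.lineDifferentiableAt.hasLineDerivAt

/-- The Fourier transform turns derivatives into multiplication. -/
theorem integral_lineDeriv_mul_exp {n : ℕ} {g g' : (Fin n → ℝ) → ℂ} {j : Fin n}
    (hg : ∀ x, HasLineDerivAt ℝ g (g' x) x (Pi.single j 1)) (hi : Integrable g)
    (hi' : Integrable g') (l : Fin n → ℝ) :
    ∫ x, g' x * cexp (I * (∑ i, l i * x i : ℝ))
      = -(I * l j) * ∫ x, g x * cexp (I * (∑ i, l i * x i : ℝ)) := by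
  obtain ⟨e, he⟩ : ∃ e : (Fin n → ℝ) → ℂ,
    e = fun x => cexp (I * (∑ i, l i * x i : ℝ)) := ⟨_, rfl⟩
  have hd : ∀ x, HasLineDerivAt ℝ e (I * l j * e x) x (Pi.single j 1) := by
    intro x
    have h1 : HasDerivAt (fun t : ℝ => I * ((∑ i, l i * x i : ℝ) + (t : ℂ) * l j))
        (I * l j) 0 := by
      simpa using (((hasDerivAt_id (0 : ℝ)).ofReal_comp.mul_const (l j : ℂ)).const_add
        (((∑ i, l i * x i : ℝ)) : ℂ)).const_mul I
    have h2 := h1.cexp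
    have e2 : (fun t : ℝ => e (x + t • Pi.single j 1))
        = fun t : ℝ => cexp (I * ((∑ i, l i * x i : ℝ) + (t : ℂ) * l j)) := by
      funext t
      have : ∑ i, l i * (x + t • (Pi.single j 1 : Fin n → ℝ)) i = ∑ i, l i * x i + t * l j := by
        simp [mul_add, Finset.sum_add_distrib, Pi.single_apply, mul_comm]
      rw [he]; beta_reduce; rw [this]; push_cast; rfl
    rw [HasLineDerivAt, e2]
    refine h2.congr_deriv ?_
    rw [he]; simp only [Complex.ofReal_zero, zero_mul, add_zero]; ring
  have hn : ∀ x, ‖e x‖ = 1 := fun x => by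
    rw [he]; beta_reduce; rw [mul_comm]; exact Complex.norm_exp_ofReal_mul_I _
  have hc : Continuous e := by rw [he]; fun_prop
  have hb : ∀ {h : (Fin n → ℝ) → ℂ}, Integrable h → Integrable fun x => h x * e x := fun h =>
    h.mul_bdd (c := 1) hc.aestronglyMeasurable (.of_forall fun x => (hn x).le)
  have h := integral_bilinear_hasLineDerivAt_right_eq_neg_left_of_integrable (μ := volume)
    (f := g) (f' := g') (g := e) (g' := fun x => I * l j * e x)
    (v := Pi.single j 1) (B := ContinuousLinearMap.mul ℝ ℂ) (hb hi')
    (by simpa [mul_left_comm] using (hb hi).const_mul (I * l j)) (hb hi)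
    (fun x _ => hg x) (fun x _ => hd x)
  simp only [ContinuousLinearMap.mul_apply'] at h
  have h3 : ∫ x, g x * (I * l j * e x) = I * l j * ∫ x, g x * e x := by
    rw [← integral_const_mul]; congr 1; funext x; ring
  rw [h3] at h
  rw [he] at h
  rw [neg_mul, h, neg_neg]

theorem norm_schwartz_le (f : 𝓢(ℝ⁴, ℂ)) (n : ℕ) :
    ∃ C, 0 ≤ C ∧ ∀ x, ‖f x‖ ≤ C / (1 + ‖x‖) ^ n := by
  have hC := apply_nonneg ((Finset.Iic (n, 0)).sup fun m : ℕ × ℕ =>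
    SchwartzMap.seminorm ℝ (E := ℝ⁴) (F := ℂ) m.1 m.2) f
  refine ⟨2 ^ n * (Finset.Iic (n, 0)).sup (fun m : ℕ × ℕ => SchwartzMap.seminorm ℝ m.1 m.2) f,
    by positivity, fun x => ?_⟩
  · rw [le_div_iff₀ (by positivity), mul_comm]
    have := SchwartzMap.one_add_le_sup_seminorm_apply (𝕜 := ℝ) (m := (n, 0)) (k := n) (n := 0)
      le_rfl le_rfl f x
    rwa [norm_iteratedFDeriv_zero] at this

theorem norm_four (t : ℝ) (x : ℝ³) : ‖four t x‖ = max |t| ‖x‖ := by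
  apply le_antisymm
  · refine (pi_norm_le_iff_of_nonneg (by positivity)).2 fun μ => ?_
    refine Fin.cases (le_max_left _ _) (fun j => ?_) μ
    exact (norm_le_pi_norm x j).trans (le_max_right _ _)
  · refine max_le (norm_le_pi_norm (four t x) 0) ((pi_norm_le_iff_of_nonneg (norm_nonneg _)).2 fun j => ?_)
    exact norm_le_pi_norm (four t x) j.succ

theorem norm_schwartz_four_le (f : 𝓢(ℝ⁴, ℂ)) (n m : ℕ) :
    ∃ C, 0 ≤ C ∧ ∀ t x, ‖f (four t x)‖ ≤ C / (1 + |t|) ^ n / (1 + ‖x‖) ^ m := by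
  obtain ⟨C, hC, h⟩ := norm_schwartz_le f (n + m)
  refine ⟨C, hC, fun t x => (h _).trans ?_⟩
  rw [div_div, pow_add, norm_four]
  gcongr
  · exact le_max_left _ _
  · exact le_max_right _ _

theorem continuous_four : Continuous fun z : ℝ × ℝ³ => four z.1 z.2 :=
  continuous_pi fun μ => Fin.cases continuous_fst (fun j => (continuous_apply j).comp continuous_snd) μ

theorem integrable_inv_one_add_norm_pow {E : Type*} [NormedAddCommGroup E] [NormedSpace ℝ E]
    [FiniteDimensional ℝ E] [MeasurableSpace E] [BorelSpace E] (μ : Measure E) [μ.IsAddHaarMeasure]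
    {n : ℕ} (hn : Module.finrank ℝ E < n) : Integrable (fun x : E => ((1 + ‖x‖) ^ n)⁻¹) μ := by
  have := integrable_one_add_norm (μ := μ) (E := E) (r := n) (by exact_mod_cast hn)
  refine this.congr (.of_forall fun x => ?_)
  simp only [Real.rpow_neg (by positivity : (0 : ℝ) ≤ 1 + ‖x‖), Real.rpow_natCast]

theorem integrable_slice (f : 𝓢(ℝ⁴, ℂ)) (t : ℝ) :
    Integrable fun x : ℝ³ => f (four t x) := by
  obtain ⟨C, hC, h⟩ := norm_schwartz_four_le f 0 4
  refine ((integrable_inv_one_add_norm_pow (E := ℝ³) volume (n := 4)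
    (by simp)).const_mul C).mono' ?_ (.of_forall fun x => ?_)
  · exact (f.continuous.comp (continuous_four.comp (continuous_const.prodMk continuous_id))).aestronglyMeasurable
  · simpa [div_eq_mul_inv] using h t x

theorem norm_exp_I_mul (x : ℝ) : ‖cexp (I * x)‖ = 1 := by
  rw [mul_comm]; exact Complex.norm_exp_ofReal_mul_I _

theorem continuous_fourier3 (f : 𝓢(ℝ⁴, ℂ)) :
    Continuous fun z : ℝ × ℝ³ => fourier3 f z.1 z.2 := by
  obtain ⟨C, hC, h⟩ := norm_schwartz_four_le f 0 4
  refine continuous_of_dominated (bound := fun x => C * ((1 + ‖x‖) ^ 4)⁻¹) (fun z => ?_) (fun z => .of_forall fun x => ?_)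
    ((integrable_inv_one_add_norm_pow (E := ℝ³) volume (n := 4) (by simp)).const_mul C)
    (.of_forall fun x => ?_)
  · exact (integrable_slice f z.1).aestronglyMeasurable.mul
      (Continuous.aestronglyMeasurable (by fun_prop))
  · rw [norm_mul, norm_exp_I_mul, mul_one]; simpa [div_eq_mul_inv] using h z.1 x
  · exact (f.continuous.comp (continuous_four.comp (continuous_fst.prodMk continuous_const))).mul
      (by fun_prop)

theorem fourier3_deriv (f : 𝓢(ℝ⁴, ℂ)) (j : Fin 3) (t : ℝ) (q : ℝ³) :
    fourier3 (partialDeriv j.succ f) t q = -(I * q j) * fourier3 f t q := by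
  refine integral_lineDeriv_mul_exp (g := fun x => f (four t x)) (fun x => ?_) (integrable_slice f t)
    (integrable_slice _ t) q
  have h := hasLineDerivAt_partialDeriv j.succ f (four t x)
  rw [HasLineDerivAt] at h ⊢
  convert h using 3 with s
  funext μ
  refine Fin.cases ?_ (fun i => ?_) μ
  · simp [four]
  · simp [four, Pi.single_apply]

theorem fourier4_deriv (f : 𝓢(ℝ⁴, ℂ)) (μ : Fin 4) (k : ℝ⁴) :
    fourier4 (partialDeriv μ f) k
      = (if μ = 0 then I * k 0 else -(I * k μ)) * fourier4 f k := by
  have e : ∀ x : ℝ⁴, -I * (mink k x : ℝ)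
      = I * (∑ i, (if i = 0 then -k 0 else k i) * x i : ℝ) := by
    intro x
    simp [Fin.sum_univ_four, mink]; ring
  simp only [fourier4, e]
  rw [integral_lineDeriv_mul_exp (fun x => hasLineDerivAt_partialDeriv μ f x) f.integrable
    (SchwartzMap.integrable _)]
  split_ifs with h
  · subst h; simp
  · simp

theorem norm_fourier3_le_aux (n m : ℕ) : ∀ f : 𝓢(ℝ⁴, ℂ),
    ∃ C, 0 ≤ C ∧ ∀ t q, ‖q‖ ^ m * ‖fourier3 f t q‖ ≤ C / (1 + |t|) ^ n := by
  induction m with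
  | zero =>
    intro f
    obtain ⟨C, hC, h⟩ := norm_schwartz_four_le f n 4
    have hi := integrable_inv_one_add_norm_pow (E := ℝ³) volume (n := 4) (by simp)
    refine ⟨C * ∫ x : ℝ³, ((1 + ‖x‖) ^ 4)⁻¹,
      mul_nonneg hC (integral_nonneg fun x => by positivity), fun t q => ?_⟩
    rw [pow_zero, one_mul, mul_div_right_comm, ← integral_const_mul]
    refine norm_integral_le_of_norm_le (hi.const_mul _) (.of_forall fun x => ?_)
    rw [norm_mul, norm_exp_I_mul, mul_one, ← div_eq_mul_inv]
    exact h t x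
  | succ m ih =>
    intro f
    choose C hC h using fun j : Fin 3 => ih (partialDeriv j.succ f)
    refine ⟨∑ j : Fin 3, C j, Finset.sum_nonneg fun j _ => hC j, fun t q => ?_⟩
    have hq : ‖q‖ ≤ ∑ j, |q j| := (pi_norm_le_iff_of_nonneg (Finset.sum_nonneg fun _ _ => abs_nonneg _)).2
      fun j => Finset.single_le_sum (f := fun j => |q j|) (fun _ _ => abs_nonneg _) (Finset.mem_univ j)
    calc ‖q‖ ^ (m + 1) * ‖fourier3 f t q‖ = ‖q‖ * (‖q‖ ^ m * ‖fourier3 f t q‖) := by ring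
      _ ≤ (∑ j, |q j|) * (‖q‖ ^ m * ‖fourier3 f t q‖) :=
        mul_le_mul_of_nonneg_right hq (by positivity)
      _ = ∑ j : Fin 3, ‖q‖ ^ m * ‖fourier3 (partialDeriv j.succ f) t q‖ := by
        rw [Finset.sum_mul]
        refine Finset.sum_congr rfl fun j _ => ?_
        rw [fourier3_deriv]; simp; ring
      _ ≤ ∑ j, C j / (1 + |t|) ^ n := by
        refine Finset.sum_le_sum fun j _ => ?_
        exact h j t q
      _ = (∑ j, C j) / (1 + |t|) ^ n := by rw [Finset.sum_div]

theorem one_add_pow_mul_le {x y A B : ℝ} (hx : 0 ≤ x) {m : ℕ} (h0 : x ^ 0 * y ≤ A) (hy : 0 ≤ y)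
    (h : x ^ m * y ≤ B) : y ≤ 2 ^ m * (A + B) / (1 + x) ^ m := by
  rw [le_div_iff₀ (by positivity)]
  have h1 : (1 + x) ^ m ≤ 2 ^ m * (1 + x ^ m) := by
    rcases le_total x 1 with h | h
    · calc (1 + x) ^ m ≤ 2 ^ m := by gcongr; linarith
        _ ≤ _ := by have : 0 ≤ x ^ m := by positivity
                    nlinarith [pow_pos (two_pos (α := ℝ)) m]
    · calc (1 + x) ^ m ≤ (2 * x) ^ m := by gcongr; linarith
        _ = 2 ^ m * x ^ m := mul_pow _ _ _
        _ ≤ _ := by nlinarith [pow_pos (two_pos (α := ℝ)) m]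
  calc y * (1 + x) ^ m ≤ y * (2 ^ m * (1 + x ^ m)) := by gcongr
    _ = 2 ^ m * (x ^ 0 * y + x ^ m * y) := by ring
    _ ≤ _ := by gcongr

/-- The spatial Fourier transform of a test function decreases rapidly in time and momentum. -/
theorem norm_fourier3_le (f : 𝓢(ℝ⁴, ℂ)) (n m : ℕ) :
    ∃ C, 0 ≤ C ∧ ∀ t q, ‖fourier3 f t q‖ ≤ C / (1 + |t|) ^ n / (1 + ‖q‖) ^ m := by
  obtain ⟨A, hA, h1⟩ := norm_fourier3_le_aux n 0 f
  obtain ⟨B, hB, h2⟩ := norm_fourier3_le_aux n m f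
  refine ⟨2 ^ m * (A + B), by positivity, fun t q => ?_⟩
  convert one_add_pow_mul_le (norm_nonneg q) (h1 t q) (norm_nonneg _) (h2 t q) using 2
  ring

theorem norm_fourier4_le_aux (m : ℕ) : ∀ f : 𝓢(ℝ⁴, ℂ),
    ∃ C, 0 ≤ C ∧ ∀ k, ‖k‖ ^ m * ‖fourier4 f k‖ ≤ C := by
  induction m with
  | zero =>
    intro f
    refine ⟨∫ x, ‖f x‖, integral_nonneg fun x => norm_nonneg _, fun k => ?_⟩
    rw [pow_zero, one_mul]
    refine (norm_integral_le_integral_norm _).trans_eq (integral_congr_ae (.of_forall fun x => ?_))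
    have := norm_exp_I_mul (-mink k x)
    push_cast at this
    simp only [norm_mul, neg_mul]
    rw [← mul_neg, this, mul_one]
  | succ m ih =>
    intro f
    choose C hC h using fun j : Fin 4 => ih (partialDeriv j f)
    refine ⟨∑ j, C j, Finset.sum_nonneg fun j _ => hC j, fun k => ?_⟩
    have hq : ‖k‖ ≤ ∑ j, |k j| := (pi_norm_le_iff_of_nonneg (Finset.sum_nonneg fun _ _ => abs_nonneg _)).2
      fun j => Finset.single_le_sum (f := fun j => |k j|) (fun _ _ => abs_nonneg _) (Finset.mem_univ j)
    calc ‖k‖ ^ (m + 1) * ‖fourier4 f k‖ = ‖k‖ * (‖k‖ ^ m * ‖fourier4 f k‖) := by ring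
      _ ≤ (∑ j, |k j|) * (‖k‖ ^ m * ‖fourier4 f k‖) :=
        mul_le_mul_of_nonneg_right hq (by positivity)
      _ = ∑ j : Fin 4, ‖k‖ ^ m * ‖fourier4 (partialDeriv j f) k‖ := by
        rw [Finset.sum_mul]
        refine Finset.sum_congr rfl fun j _ => ?_
        rw [fourier4_deriv]
        split_ifs with h0
        · subst h0; simp; ring
        · simp; ring
      _ ≤ ∑ j, C j := Finset.sum_le_sum fun j _ => h j k

theorem norm_fourier4_le (f : 𝓢(ℝ⁴, ℂ)) (m : ℕ) :
    ∃ C, 0 ≤ C ∧ ∀ k, ‖fourier4 f k‖ ≤ C / (1 + ‖k‖) ^ m := by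
  obtain ⟨A, hA, h1⟩ := norm_fourier4_le_aux 0 f
  obtain ⟨B, hB, h2⟩ := norm_fourier4_le_aux m f
  exact ⟨2 ^ m * (A + B), by positivity, fun k =>
    one_add_pow_mul_le (norm_nonneg k) (h1 k) (norm_nonneg _) (h2 k)⟩

theorem continuous_fourier4 (f : 𝓢(ℝ⁴, ℂ)) : Continuous (fourier4 f) := by
  refine continuous_of_dominated (bound := fun x => ‖f x‖) (fun k => ?_)
    (fun k => .of_forall fun x => ?_) f.integrable.norm (.of_forall fun x => ?_)
  · exact f.continuous.aestronglyMeasurable.mul (by unfold mink; fun_prop)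
  · have := norm_exp_I_mul (-mink k x)
    push_cast at this
    rw [norm_mul, neg_mul, ← mul_neg, this, mul_one]
  · unfold mink; fun_prop

/-- Splitting space-time into time and space. -/
def splitting : (ℝ × ℝ³) ≃ᵐ ℝ⁴ :=
  (MeasurableEquiv.piFinSuccAbove (fun _ : Fin 4 => ℝ) 0).symm

theorem splitting_apply (z : ℝ × ℝ³) : splitting z = four z.1 z.2 := by
  funext μ
  refine Fin.cases ?_ (fun j => ?_) μ
  · exact Fin.insertNth_apply_same (α := fun _ : Fin 4 => ℝ) 0 z.1 z.2
  · exact Fin.insertNth_apply_succAbove (α := fun _ : Fin 4 => ℝ) 0 z.1 z.2 j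

theorem measurePreserving_splitting : MeasurePreserving splitting :=
  (volume_preserving_piFinSuccAbove (fun _ : Fin 4 => ℝ) 0).symm

theorem integrable_comp_four {F : ℝ⁴ → ℂ} :
    Integrable (fun z : ℝ × ℝ³ => F (four z.1 z.2)) ↔ Integrable F := by
  simp only [← splitting_apply]
  exact measurePreserving_splitting.integrable_comp_emb splitting.measurableEmbedding

theorem integral_comp_four (F : ℝ⁴ → ℂ) :
    ∫ z : ℝ × ℝ³, F (four z.1 z.2) = ∫ k, F k := by
  simp only [← splitting_apply]
  exact measurePreserving_splitting.integral_comp splitting.measurableEmbedding F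

theorem fourier4_four (f : 𝓢(ℝ⁴, ℂ)) (s : ℝ) (q : ℝ³) :
    fourier4 f (four s q) = ∫ t : ℝ, cexp (-I * s * t) * fourier3 f t q := by
  have hi : Integrable fun x => f x * cexp (-I * (mink (four s q) x : ℝ)) := by
    refine f.integrable.mul_bdd (c := 1) ?_ (.of_forall fun x => ?_)
    · exact Continuous.aestronglyMeasurable (by unfold mink; fun_prop)
    · have := norm_exp_I_mul (-mink (four s q) x)
      push_cast at this
      rw [neg_mul, ← mul_neg, this]
  rw [fourier4, ← integral_comp_four, Measure.volume_eq_prod, integral_prod _ (integrable_comp_four.2 hi)]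
  congr 1; funext t
  rw [fourier3, ← integral_const_mul]
  congr 1; funext x
  rw [mul_left_comm, ← Complex.exp_add]
  congr 2
  have h2 : four s q 2 = q 1 := rfl
  have h3 : four s q 3 = q 2 := rfl
  have h2' : four t x 2 = x 1 := rfl
  have h3' : four t x 3 = x 2 := rfl
  simp [mink, h2, h3, h2', h3', Fin.sum_univ_three]
  simp [four]
  ring

/-! ### The regularized propagator on and off the real axis -/

/-- The regularized propagator for complex `ε`. -/
def contProp (p : Medium) (q : ℝ³) (y : ℂ × ℂ) : Matrix FieldIx FieldIx ℂ :=
  propMatrix p (mink (fourC y.2 q) (fourC y.2 q) + I * y.1)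
    ((p.ω₀ : ℂ) ^ 2 - I * y.1) (fourC y.2 q)

/-- The denominators of the propagator do not vanish. -/
structure Regular (p : Medium) (q : ℝ³) (y : ℂ × ℂ) : Prop where
  s : mink (fourC y.2 q) (fourC y.2 q) + I * y.1 ≠ 0
  u : p.omC (fourC y.2 q) ^ 2 - ((p.ω₀ : ℂ) ^ 2 - I * y.1) ≠ 0
  d : dispC p (mink (fourC y.2 q) (fourC y.2 q) + I * y.1)
    ((p.ω₀ : ℂ) ^ 2 - I * y.1) (fourC y.2 q) ≠ 0
  h : 1 / (4 * (π : ℂ)) - polX p ((p.ω₀ : ℂ) ^ 2 - I * y.1) (fourC y.2 q) ≠ 0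

theorem differentiableAt_contProp {p : Medium} {q : ℝ³} {y : ℂ × ℂ} (h : Regular p q y)
    (a b : FieldIx) : DifferentiableAt ℂ (fun y => contProp p q y a b) y := by
  obtain ⟨hs, hu, hd, hh⟩ := h
  have hk : ∀ μ, DifferentiableAt ℂ (fun y : ℂ × ℂ => fourC y.2 q μ) y := fun μ =>
    Fin.cases differentiableAt_snd (fun j => differentiableAt_const _) μ
  have hS : DifferentiableAt ℂ (fun y : ℂ × ℂ => mink (fourC y.2 q) (fourC y.2 q) + I * y.1) y := by
    unfold mink; fun_prop
  have hO : DifferentiableAt ℂ (fun y : ℂ × ℂ => p.omC (fourC y.2 q)) y := by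
    unfold Medium.omC mink; fun_prop
  have hX : DifferentiableAt ℂ (fun y : ℂ × ℂ => polX p ((p.ω₀ : ℂ) ^ 2 - I * y.1) (fourC y.2 q)) y := by
    unfold polX; fun_prop (disch := assumption)
  have hD : DifferentiableAt ℂ (fun y : ℂ × ℂ => dispC p (mink (fourC y.2 q) (fourC y.2 q)
      + I * y.1) ((p.ω₀ : ℂ) ^ 2 - I * y.1) (fourC y.2 q)) y := by
    unfold dispC; fun_prop (disch := simp [Real.pi_ne_zero])
  have hs2 := pow_ne_zero 2 hs
  rcases a with μ | μ | a <;> rcases b with ν | ν | b <;>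
    simp only [contProp, propMatrix, Matrix.of_apply] <;> fun_prop (disch := assumption)

theorem measurable_regMatrix (p : Medium) (ε : ℝ) (a b : FieldIx) :
    Measurable fun k => regMatrix p ε k a b := by
  have hk : ∀ μ, Measurable fun k : ℝ⁴ => toC k μ := fun μ => by unfold toC; fun_prop
  have hS : Measurable fun k : ℝ⁴ => mink (toC k) (toC k) + I * (ε : ℂ) := by
    unfold mink; fun_prop
  have hO : Measurable fun k : ℝ⁴ => p.omC (toC k) := by unfold Medium.omC mink; fun_prop
  have hX : Measurable fun k : ℝ⁴ => polX p ((p.ω₀ : ℂ) ^ 2 - I * ε) (toC k) := by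
    unfold polX; fun_prop
  have hD : Measurable fun k : ℝ⁴ => dispC p (mink (toC k) (toC k) + I * ε)
      ((p.ω₀ : ℂ) ^ 2 - I * ε) (toC k) := by
    unfold dispC; fun_prop
  rcases a with μ | μ | a <;> rcases b with ν | ν | b <;>
    simp only [regMatrix, propMatrix, Matrix.of_apply] <;> fun_prop

section

variable {p : Medium} (hp : p.Good) {q : ℝ³}
include hp

theorem regular_of {ε : ℝ} {ζ : ℂ} (h1 : sqS (xStar p q) (mSq p q) ε ζ ≠ 0)
    (h2 : (p.v 0 : ℂ) ^ 2 * ζ ^ 2 - (((p.ω₀ ^ 2 : ℝ) : ℂ) - I * ε) ≠ 0)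
    (h3 : dispS (xStar p q) (mSq p q) (p.v 0) (p.g ^ 2 * p.χ) (p.ω₀ ^ 2) ε ζ ≠ 0)
    (h4 : 1 / (4 * π : ℂ) - polS (p.v 0) (p.g ^ 2 * p.χ) (p.ω₀ ^ 2) ε ζ ≠ 0) :
    Regular p q ((ε : ℂ), xStar p q + ζ) where
  s := by simpa only [sq_add_eq_sqS] using h1
  u := by
    rw [omC_fourC hp]
    convert h2 using 1
    push_cast; ring
  d := by
    rw [dispC_eq_dispS hp]
    exact div_ne_zero h3 (by simp [Real.pi_ne_zero])
  h := by rw [polX_eq_polS hp]; exact h4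

theorem regular_of_inQuads {ε : ℝ} {ζ : ℂ} (h : InQuads ε ζ) :
    Regular p q ((ε : ℂ), xStar p q + ζ) :=
  have hm := mSq_nonneg hp q
  regular_of hp (sqS_ne_zero h hm) (polS_den_ne_zero hp.w_pos hp.hv0 h)
    (dispS_ne_zero hp.α_pos hp.w_pos hp.hv0 h hm) (resS_pos hp.α_pos hp.w_pos hp.hv0 h).1

theorem regular_zero {ε : ℝ} (hε : 0 < ε) : Regular p q ((ε : ℂ), xStar p q + 0) := by
  have hw : ((p.ω₀ ^ 2 : ℝ) : ℂ) - I * ε ≠ 0 := fun h => by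
    have := congrArg Complex.im h; simp [pow_two] at this; exact hε.ne' this
  have hS : sqS (xStar p q) (mSq p q) ε 0 ≠ 0 := fun h => by
    have := congrArg Complex.im h; simp [sqS] at this; exact hε.ne' this
  have hw' : I * ε - ((p.ω₀ ^ 2 : ℝ) : ℂ) ≠ 0 := fun h => hw (by linear_combination -h)
  refine regular_of hp hS (by simpa using hw') (by simpa [dispS] using hS) ?_
  have e : polS (p.v 0) (p.g ^ 2 * p.χ) (p.ω₀ ^ 2) ε 0 = -((p.g ^ 2 * p.χ : ℝ) : ℂ) := by
    simp only [polS]; rw [div_eq_iff (by simpa using hw')]; ring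
  rw [e]
  have h0 : (0 : ℝ) < 1 / (4 * π) + p.g ^ 2 * p.χ := by
    have := hp.α_pos; have := Real.pi_pos; positivity
  intro h
  apply h0.ne'
  have : (((1 / (4 * π) + p.g ^ 2 * p.χ : ℝ)) : ℂ) = 0 := by push_cast at h ⊢; linear_combination h
  exact_mod_cast this

theorem regular_of_mem_cornerRegion {ε δ : ℝ} (hε : 0 < ε) {ζ : ℂ} (h : ζ ∈ cornerRegion δ) :
    Regular p q ((ε : ℂ), xStar p q + ζ) := by
  rcases eq_or_ne ζ 0 with rfl | h0
  · exact regular_zero hp hε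
  refine regular_of_inQuads hp ?_
  have hne : ζ.re ≠ 0 ∨ ζ.im ≠ 0 := by
    by_contra hc; push Not at hc; exact h0 (Complex.ext hc.1 hc.2)
  rcases h with h | h
  · right
    simp only [InQuad, Complex.neg_im, Complex.neg_re]
    have : ε * -ζ.re = ε * |ζ.re| := by rw [abs_of_nonpos h.1]
    refine ⟨by linarith [h.2], by rw [this]; positivity, ?_⟩
    rcases hne with h' | h'
    · have := mul_pos hε (neg_pos.2 (lt_of_le_of_ne h.1 h')); linarith [h.2]
    · have := lt_of_le_of_ne h.2 h'; have := mul_nonneg hε.le (neg_nonneg.2 h.1); linarith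
  · left
    refine ⟨h.2.1, mul_nonneg hε.le h.1, ?_⟩
    rcases hne with h' | h'
    · have := mul_pos hε (lt_of_le_of_ne h.1 h'.symm); linarith [h.2.1]
    · have := lt_of_le_of_ne h.2.1 h'.symm; have := mul_nonneg hε.le h.1; linarith

theorem regular_of_im_ne_zero {ζ : ℂ} (h : ζ.im ≠ 0) : Regular p q (((0 : ℝ) : ℂ), xStar p q + ζ) := by
  refine regular_of_inQuads hp ?_
  rcases lt_or_gt_of_ne h with h | h
  · right; simp [InQuad, h, h.le]
  · left; simp [InQuad, h, h.le]

theorem contMatrix_zero {ζ : ℂ} (h : ζ.im ≠ 0) (a b : FieldIx) :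
    contMatrix p 0 q (xStar p q + ζ) a b = resolvent p q (xStar p q + ζ) a b := by
  obtain ⟨hs, hu, hd, hh⟩ := regular_of_im_ne_zero hp (q := q) h
  have e0 : I * ((0 : ℝ) : ℂ) = 0 := by simp
  simp only [e0, add_zero, sub_zero] at hs hu hd hh
  have hπ := piC_ne
  rw [contMatrix, resolvent, e0, add_zero, sub_zero, propMatrix_eq_regProp]
  · exact hs
  · exact hu
  · intro h0
    apply hd
    simp only [dispC, polX, denD, denU] at h0 ⊢
    field_simp at h0 ⊢
    linear_combination h0
  · intro h0
    apply hh
    simp only [polX, denH, denU] at h0 ⊢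
    field_simp
    linear_combination h0

/-- Continuity in the regularization off the real axis. -/
theorem tendsto_contMatrix {ζ : ℂ} (h : ζ.im ≠ 0) (a b : FieldIx) :
    Tendsto (fun ε : ℝ => contMatrix p ε q (xStar p q + ζ) a b) (𝓝[>] 0)
      (𝓝 (resolvent p q (xStar p q + ζ) a b)) := by
  rw [← contMatrix_zero hp h]
  have h1 := (differentiableAt_contProp (regular_of_im_ne_zero hp (q := q) h) a b).continuousAt
  have h2 : ContinuousAt (fun ε : ℝ => ((ε : ℂ), (xStar p q : ℂ) + ζ)) 0 := by fun_prop
  exact (ContinuousAt.comp (f := fun ε : ℝ => ((ε : ℂ), (xStar p q : ℂ) + ζ)) h1 h2).tendsto.mono_left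
    nhdsWithin_le_nhds

theorem differentiableOn_contMatrix {ε δ : ℝ} (hε : 0 < ε) (a b : FieldIx) :
    DifferentiableOn ℂ (fun ζ => contMatrix p ε q (xStar p q + ζ) a b) (cornerRegion δ) := by
  intro ζ hζ
  have h1 := differentiableAt_contProp (regular_of_mem_cornerRegion hp (q := q) hε hζ) a b
  have h2 : DifferentiableAt ℂ (fun ζ : ℂ => ((ε : ℂ), (xStar p q : ℂ) + ζ)) ζ := by fun_prop
  exact (DifferentiableAt.comp (f := fun ζ : ℂ => ((ε : ℂ), (xStar p q : ℂ) + ζ)) ζ h1 h2).differentiableWithinAt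

/-- At fixed `ε > 0` the propagator is polynomially bounded. -/
theorem norm_contMatrix_le_real {ε : ℝ} (hε : 0 < ε) : ∃ K, 0 ≤ K ∧ ∀ (q : ℝ³) (x : ℝ)
    (a b : FieldIx), Diag a b →
    ‖contMatrix p ε q (xStar p q + (x : ℂ)) a b‖ ≤ K * (1 + len q + |x|) ^ 22 := by
  have hα := hp.α_pos; have hw := hp.w_pos; have hπ := Real.pi_pos; have hv := hp.hv0
  have hsz := hp.one_le_size
  obtain ⟨B, hB⟩ : ∃ B, B = p.size + 4 * π * (p.v 0 ^ 2 + p.ω₀ ^ 2 + ε + 1) / ε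
    + 2 * (p.g ^ 2 * p.χ) * (p.ω₀ ^ 2 + ε) / ε := ⟨_, rfl⟩
  have h1 : 0 ≤ 4 * π * (p.v 0 ^ 2 + p.ω₀ ^ 2 + ε + 1) / ε := by positivity
  have h2 : 0 ≤ 2 * (p.g ^ 2 * p.χ) * (p.ω₀ ^ 2 + ε) / ε := by positivity
  have hB0 : 0 < B := by linarith
  refine ⟨10 * B ^ 12, by positivity, fun q x a b hab => ?_⟩
  have hQ := len_nonneg q
  have hm0 := mSq_nonneg hp q
  obtain ⟨ρ, hρ⟩ : ∃ ρ, ρ = 1 + len q + |x| := ⟨_, rfl⟩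
  have hx0 := abs_nonneg x
  have hρ1 : 1 ≤ ρ := by linarith
  have hρ2 : 1 ≤ ρ ^ 2 := one_le_pow₀ hρ1
  have hxρ : x ^ 2 ≤ ρ ^ 2 := by rw [← sq_abs]; gcongr; linarith
  have hBε : 4 * π * (p.v 0 ^ 2 + p.ω₀ ^ 2 + ε + 1) ≤ B * ε := by
    have : 4 * π * (p.v 0 ^ 2 + p.ω₀ ^ 2 + ε + 1) / ε ≤ B := by linarith
    rwa [div_le_iff₀ hε] at this
  have hS : ε ≤ ‖sqS (xStar p q) (mSq p q) ε x‖ := by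
    refine le_trans (le_of_eq ?_) ((le_abs_self _).trans (Complex.abs_im_le_norm _))
    simp [sqS, pow_two]
  have hD : ε ≤ ‖dispS (xStar p q) (mSq p q) (p.v 0) (p.g ^ 2 * p.χ) (p.ω₀ ^ 2) ε x‖ := by
    rcases eq_or_ne x 0 with rfl | hx
    · simpa [dispS] using hS
    · have hq : InQuads ε (x : ℂ) := by
        rcases lt_or_gt_of_ne hx with h | h
        · right
          have := mul_pos hε (neg_pos.2 h)
          refine ⟨by simp, by simpa using this.le, by simpa using this⟩
        · left
          have := mul_pos hε h
          refine ⟨by simp, by simpa using this.le, by simpa using this⟩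
      have h := le_norm_dispS (x := xStar p q) (m := mSq p q) hα hw hv hq
      simp only [Complex.ofReal_im, abs_zero, zero_mul, zero_add, Complex.ofReal_re, abs_mul,
        Complex.norm_real, Real.norm_eq_abs, abs_of_pos hε] at h
      exact le_of_mul_le_mul_right h (abs_pos.2 hx)
  obtain ⟨U, hU⟩ : ∃ U : ℂ, U = (p.v 0 : ℂ) ^ 2 * x ^ 2 - (((p.ω₀ ^ 2 : ℝ) : ℂ) - I * ε) := ⟨_, rfl⟩
  have hUε : ε ≤ ‖U‖ := by
    refine le_trans (le_of_eq ?_) ((le_abs_self _).trans (Complex.abs_im_le_norm _))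
    rw [hU]; simp [pow_two]
  have hU0 : U ≠ 0 := norm_pos_iff.1 (hε.trans_le hUε)
  have hwε : ‖((p.ω₀ ^ 2 : ℝ) : ℂ) - I * ε‖ ≤ p.ω₀ ^ 2 + ε := by
    refine (norm_sub_le _ _).trans (le_of_eq ?_)
    rw [norm_mul, Complex.norm_I, Complex.norm_real, Complex.norm_real, one_mul,
      Real.norm_of_nonneg hw.le, Real.norm_of_nonneg hε.le]
  have hUle : ‖U‖ ≤ p.v 0 ^ 2 * x ^ 2 + (p.ω₀ ^ 2 + ε) := by
    rw [hU]
    refine (norm_sub_le _ _).trans (add_le_add (le_of_eq ?_) hwε)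
    simp
  have hpol : polS (p.v 0) (p.g ^ 2 * p.χ) (p.ω₀ ^ 2) ε x
      = ((p.g ^ 2 * p.χ : ℝ) : ℂ) * (((p.ω₀ ^ 2 : ℝ) : ℂ) - I * ε) / U := by
    rw [polS, hU]
  have hh : ε ≤ ‖U - 4 * π * (((p.g ^ 2 * p.χ : ℝ) : ℂ) * (((p.ω₀ ^ 2 : ℝ) : ℂ) - I * ε))‖ := by
    refine le_trans ?_ ((le_abs_self _).trans (Complex.abs_im_le_norm _))
    have e : (U - 4 * π * (((p.g ^ 2 * p.χ : ℝ) : ℂ) * (((p.ω₀ ^ 2 : ℝ) : ℂ) - I * ε))).im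
        = ε + 4 * π * (p.g ^ 2 * p.χ) * ε := by
      have : (U - 4 * π * (((p.g ^ 2 * p.χ : ℝ) : ℂ) * (((p.ω₀ ^ 2 : ℝ) : ℂ) - I * ε)))
        = ((p.v 0 ^ 2 * x ^ 2 - p.ω₀ ^ 2 - 4 * π * (p.g ^ 2 * p.χ) * p.ω₀ ^ 2 : ℝ) : ℂ)
          + ((ε + 4 * π * (p.g ^ 2 * p.χ) * ε : ℝ) : ℂ) * I := by
        rw [hU]; push_cast; ring
      rw [this]
      simp only [Complex.add_im, Complex.ofReal_im, Complex.im_ofReal_mul, Complex.I_im]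
      ring
    rw [e]
    have : 0 ≤ 4 * π * (p.g ^ 2 * p.χ) * ε := by positivity
    linarith
  have key := norm_contMatrix_le_of hp (ε := ε) (q := q) (ζ := x) (B := B * ρ ^ 2) (ρ := ρ)
    (by nlinarith) (by linarith) ?_ ?_ ?_ ?_ (by simp; linarith) ?_ hab
  · refine key.trans (le_of_eq ?_)
    rw [← hρ]; field_simp
  · have h3 : 1 ≤ B * ε := by nlinarith [Real.pi_gt_three, sq_nonneg (p.v 0)]
    calc ρ ^ 2 ≤ (B * ε) * ρ ^ 2 := by nlinarith
      _ = B * ρ ^ 2 * ε := by ring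
      _ ≤ _ := by gcongr
  · have h3 : 4 * π ≤ B * ε := by nlinarith [sq_nonneg (p.v 0)]
    calc 4 * π * ρ ^ 2 ≤ (B * ε) * ρ ^ 2 := by gcongr
      _ = B * ρ ^ 2 * ε := by ring
      _ ≤ _ := by gcongr
  · have e : 1 / (4 * π : ℂ) - polS (p.v 0) (p.g ^ 2 * p.χ) (p.ω₀ ^ 2) ε x
        = (U - 4 * π * (((p.g ^ 2 * p.χ : ℝ) : ℂ) * (((p.ω₀ ^ 2 : ℝ) : ℂ) - I * ε)))
          / (4 * π * U) := by
      have : (π : ℂ) ≠ 0 := by simp [Real.pi_ne_zero]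
      rw [hpol]; field_simp
    have hn : ‖(4 * π * U : ℂ)‖ = 4 * π * ‖U‖ := by
      simp [abs_of_pos hπ]
    have hUpos : 0 < ‖U‖ := norm_pos_iff.2 hU0
    rw [e, norm_div, hn, ← mul_div_assoc, le_div_iff₀ (by positivity), one_mul]
    calc 4 * π * ‖U‖ ≤ 4 * π * (p.v 0 ^ 2 * x ^ 2 + (p.ω₀ ^ 2 + ε)) := by gcongr
      _ ≤ 4 * π * ((p.v 0 ^ 2 + p.ω₀ ^ 2 + ε + 1) * ρ ^ 2) := by
        gcongr
        nlinarith [mul_le_mul_of_nonneg_left hxρ (sq_nonneg (p.v 0))]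
      _ = 4 * π * (p.v 0 ^ 2 + p.ω₀ ^ 2 + ε + 1) * ρ ^ 2 := by ring
      _ ≤ (B * ε) * ρ ^ 2 := by gcongr
      _ = B * ρ ^ 2 * ε := by ring
      _ ≤ _ := by gcongr
  · have : ‖polS (p.v 0) (p.g ^ 2 * p.χ) (p.ω₀ ^ 2) ε x‖ ≤ p.g ^ 2 * p.χ * (p.ω₀ ^ 2 + ε) / ε := by
      rw [hpol, norm_div, norm_mul, Complex.norm_real, Real.norm_of_nonneg hα.le]
      gcongr
    calc _ ≤ p.g ^ 2 * p.χ * (p.ω₀ ^ 2 + ε) / ε * (1 + ρ ^ 2) := by gcongr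
      _ ≤ p.g ^ 2 * p.χ * (p.ω₀ ^ 2 + ε) / ε * (2 * ρ ^ 2) := by gcongr; linarith
      _ = 2 * (p.g ^ 2 * p.χ) * (p.ω₀ ^ 2 + ε) / ε * ρ ^ 2 := by ring
      _ ≤ _ := by gcongr; linarith
  · refine (mSq_le q).trans ?_
    gcongr; linarith

end

theorem regMatrix_AB (p : Medium) (ε : ℝ) (k : ℝ⁴) (μ : Fin 4) :
    regMatrix p ε k (iA μ) iB = -I * k μ / (mink k k + I * ε) := by
  simp [regMatrix, propMatrix, toC, mink]

theorem regMatrix_BA (p : Medium) (ε : ℝ) (k : ℝ⁴) (μ : Fin 4) :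
    regMatrix p ε k iB (iA μ) = I * k μ / (mink k k + I * ε) := by
  simp [regMatrix, propMatrix, toC, mink]

theorem len_le_norm (q : ℝ³) : len q ≤ 2 * ‖q‖ := by
  refine Real.sqrt_le_iff.2 ⟨by positivity, ?_⟩
  have h : ∀ j, q j ^ 2 ≤ ‖q‖ ^ 2 := fun j => sq_le_sq.2 (by simpa using norm_le_pi_norm q j)
  rw [Fin.sum_univ_three]
  nlinarith [h 0, h 1, h 2, sq_nonneg ‖q‖]

theorem norm_le_len (q : ℝ³) : ‖q‖ ≤ len q :=
  (pi_norm_le_iff_of_nonneg (len_nonneg q)).2 (abs_le_len q)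

theorem diag_or (a b : FieldIx) : Diag a b ∨ (∃ μ, a = iA μ ∧ b = iB) ∨ ∃ μ, a = iB ∧ b = iA μ := by
  by_cases h : Diag a b
  · exact .inl h
  · simp only [Diag, not_forall] at h
    obtain ⟨μ, h⟩ := h
    rcases not_and_or.1 h with h | h
    · exact .inr (.inl ⟨μ, not_not.1 h⟩)
    · exact .inr (.inr ⟨μ, not_not.1 h⟩)

theorem integrable_feynmanIntegrand {p : Medium} (hp : p.Good) {ε : ℝ} (hε : 0 < ε) (a b : FieldIx)
    (f : 𝓢(ℝ⁴, ℂ)) : Integrable (feynmanIntegrand p ε a b f) := by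
  have hb : ∃ K, 0 ≤ K ∧ ∀ k, ‖regMatrix p ε k a b‖ ≤ K * (1 + ‖k‖) ^ 22 := by
    have hAB : ∀ (k : ℝ⁴) (μ : Fin 4) (c : ℂ), ‖c‖ = 1 →
        ‖c * k μ / (mink k k + I * ε)‖ ≤ 1 / ε * (1 + ‖k‖) ^ 22 := by
      intro k μ c hc
      have h1 : ε ≤ ‖((mink k k : ℝ) : ℂ) + I * ε‖ := by
        refine le_trans (le_of_eq ?_) ((le_abs_self _).trans (Complex.abs_im_le_norm _))
        simp
      have h2 : |k μ| ≤ (1 + ‖k‖) ^ 22 := by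
        have h3 : |k μ| ≤ ‖k‖ := norm_le_pi_norm k μ
        have h4 : (1 + ‖k‖) ^ 1 ≤ (1 + ‖k‖) ^ 22 := pow_le_pow_right₀ (by simp) (by norm_num)
        linarith
      rw [norm_div, norm_mul, hc, one_mul, Complex.norm_real, Real.norm_eq_abs, one_div_mul_eq_div]
      gcongr
    rcases diag_or a b with h | ⟨μ, rfl, rfl⟩ | ⟨μ, rfl, rfl⟩
    · obtain ⟨K, hK, h'⟩ := norm_contMatrix_le_real hp hε
      refine ⟨K * 7 ^ 22, by positivity, fun k => ?_⟩
      obtain ⟨s, q, rfl⟩ : ∃ s q, k = four s q :=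
        ⟨k 0, fun j => k j.succ, funext fun μ => Fin.cases rfl (fun _ => rfl) μ⟩
      have h1 := h' q (s - xStar p q) a b h
      rw [show (xStar p q : ℂ) + ((s - xStar p q : ℝ) : ℂ) = s by push_cast; ring] at h1
      rw [regMatrix_four]
      refine h1.trans ?_
      rw [mul_assoc, ← mul_pow]
      have h2 := abs_sub s (xStar p q)
      have h3 := abs_xStar_le hp q
      have h4 := len_le_norm q
      have h5 := norm_four s q
      have h6 : |s| ≤ ‖four s q‖ := by rw [h5]; exact le_max_left _ _
      have h7 : ‖q‖ ≤ ‖four s q‖ := by rw [h5]; exact le_max_right _ _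
      have := len_nonneg q
      gcongr
      linarith
    · exact ⟨1 / ε, by positivity, fun k => by rw [regMatrix_AB]; exact hAB k μ _ (by simp)⟩
    · exact ⟨1 / ε, by positivity, fun k => by rw [regMatrix_BA]; exact hAB k μ _ (by simp)⟩
  obtain ⟨K, hK, hb⟩ := hb
  obtain ⟨C, hC, hf⟩ := norm_fourier4_le f 27
  have h5 := (integrable_inv_one_add_norm_pow (E := ℝ⁴) volume (n := 5) (by simp)).const_mul (K * C)
  refine Integrable.const_mul (h5.mono' ?_ (.of_forall fun k => ?_)) _
  · exact (measurable_regMatrix p ε a b).aestronglyMeasurable.mul (continuous_fourier4 f).aestronglyMeasurable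
  · rw [norm_mul]
    calc _ ≤ K * (1 + ‖k‖) ^ 22 * (C / (1 + ‖k‖) ^ 27) := by gcongr; exacts [hb k, hf k]
      _ = _ := by field_simp

/-! ### The propagator in time and spatial momentum -/

section corner

variable {G : ℂ → ℂ} {F : ℝ → ℂ → ℂ} {δ B : ℝ}

theorem norm_cornerIntegral_le (hv : ∀ y : ℝ, y ≤ δ → y ≠ 0 → ‖G (y * I)‖ ≤ B / (1 + y ^ 2))
    (hh : ∀ x : ℝ, 0 < x → ‖G (x + δ * I)‖ ≤ B / (1 + x ^ 2)) :
    ‖cornerIntegral δ G‖ ≤ 2 * π * B := by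
  have hi := integrable_inv_one_add_sq.const_mul B
  have hB : ∀ x : ℝ, 0 ≤ B * (1 + x ^ 2)⁻¹ := fun x => by
    rw [← div_eq_mul_inv]
    have := (norm_nonneg _).trans (hh 1 one_pos)
    have h0 : 0 ≤ B := by
      by_contra h; have := div_neg_of_neg_of_pos (not_le.1 h) (by norm_num : (0 : ℝ) < 1 + 1 ^ 2); linarith
    positivity
  have key : ∀ S : Set ℝ, ∫ x in S, B * (1 + x ^ 2)⁻¹ ≤ B * π := fun S => by
    refine (setIntegral_le_integral hi (.of_forall hB)).trans (le_of_eq ?_)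
    rw [integral_const_mul, integral_univ_inv_one_add_sq]
  have h1 : ‖∫ y in Iic δ, G (y * I)‖ ≤ B * π := by
    refine (norm_integral_le_of_norm_le hi.integrableOn ?_).trans (key _)
    filter_upwards [ae_restrict_mem measurableSet_Iic,
      ae_restrict_of_ae (Measure.ae_ne volume (0 : ℝ))] with y hy h0
    rw [← div_eq_mul_inv]; exact hv y hy h0
  have h2 : ‖∫ x in Ioi (0 : ℝ), G (x + δ * I)‖ ≤ B * π := by
    refine (norm_integral_le_of_norm_le hi.integrableOn ?_).trans (key _)
    filter_upwards [ae_restrict_mem measurableSet_Ioi] with x hx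
    rw [← div_eq_mul_inv]; exact hh x hx
  refine (norm_add_le _ _).trans ?_
  rw [norm_mul, Complex.norm_I, one_mul]
  linarith

theorem tendsto_cornerIntegral (hF : ∀ᶠ ε in 𝓝[>] (0 : ℝ), ContinuousOn (F ε) (cornerRegion δ))
    (hv : ∀ᶠ ε in 𝓝[>] (0 : ℝ), ∀ y : ℝ, y ≤ δ → y ≠ 0 → ‖F ε (y * I)‖ ≤ B / (1 + y ^ 2))
    (hh : ∀ᶠ ε in 𝓝[>] (0 : ℝ), ∀ x : ℝ, 0 < x → ‖F ε (x + δ * I)‖ ≤ B / (1 + x ^ 2))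
    (hδ : 0 < δ) (hG : ∀ ζ : ℂ, ζ.im ≠ 0 → Tendsto (fun ε => F ε ζ) (𝓝[>] 0) (𝓝 (G ζ))) :
    Tendsto (fun ε => cornerIntegral δ (F ε)) (𝓝[>] 0) (𝓝 (cornerIntegral δ G)) := by
  have hi := integrable_inv_one_add_sq.const_mul B
  refine Tendsto.add (Tendsto.const_mul _ ?_) ?_
  · refine tendsto_integral_filter_of_dominated_convergence _ ?_ ?_ hi.integrableOn ?_
    · filter_upwards [hF] with ε h
      refine ContinuousOn.aestronglyMeasurable (h.comp (f := fun y : ℝ => (y * I : ℂ))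
        (by fun_prop) fun y hy => ?_) measurableSet_Iic
      rcases le_total y 0 with h0 | h0
      · exact .inl (by simp [h0])
      · exact .inr (by simp [h0, mem_Iic.1 hy])
    · filter_upwards [hv] with ε h
      filter_upwards [ae_restrict_mem measurableSet_Iic,
        ae_restrict_of_ae (Measure.ae_ne volume (0 : ℝ))] with y hy h0
      rw [← div_eq_mul_inv]; exact h y hy h0
    · filter_upwards [ae_restrict_of_ae (Measure.ae_ne volume (0 : ℝ))] with y h0
      exact hG _ (by simpa using h0)
  · refine tendsto_integral_filter_of_dominated_convergence _ ?_ ?_ hi.integrableOn ?_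
    · filter_upwards [hF] with ε h
      refine ContinuousOn.aestronglyMeasurable (h.comp (f := fun x : ℝ => (x + δ * I : ℂ))
        (by fun_prop) fun x hx => ?_) measurableSet_Ioi
      exact .inr (by simp [(mem_Ioi.1 hx).le, hδ.le])
    · filter_upwards [hh] with ε h
      filter_upwards [ae_restrict_mem measurableSet_Ioi] with x hx
      rw [← div_eq_mul_inv]; exact h x hx
    · exact .of_forall fun x => hG _ (by simpa using hδ.ne')

end corner

/-- The time Fourier transform of the regularized propagator. -/
def kernel (p : Medium) (ε : ℝ) (a b : FieldIx) (z : ℝ × ℝ³) : ℂ :=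
  1 / (2 * π) * ∫ s : ℝ, cexp (-I * s * z.1) * regMatrix p ε (four s z.2) a b

theorem stronglyMeasurable_kernel (p : Medium) (ε : ℝ) (a b : FieldIx) :
    StronglyMeasurable (kernel p ε a b) := by
  refine StronglyMeasurable.const_mul (StronglyMeasurable.integral_prod_right'
    (f := fun w : (ℝ × ℝ³) × ℝ => cexp (-I * w.2 * w.1.1)
      * regMatrix p ε (four w.2 w.1.2) a b) (Measurable.stronglyMeasurable ?_)) _
  refine Measurable.mul (by fun_prop) ((measurable_regMatrix p ε a b).comp ?_)
  exact (continuous_four.comp (continuous_snd.prodMk (continuous_snd.comp continuous_fst))).measurable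

theorem regMatrix_neg (p : Medium) (ε s : ℝ) (q : ℝ³) (a b : FieldIx) :
    regMatrix p ε (four (-s) q) a b = regMatrix p ε (four s (-q)) b a := by
  have e : toC (four (-s) q) = -toC (four s (-q)) := by
    ext μ; refine Fin.cases ?_ (fun j => ?_) μ <;> simp [toC, four]
  have e2 : mink (-toC (four s (-q))) (-toC (four s (-q))) = mink (toC (four s (-q))) (toC (four s (-q))) := by
    simp [mink]
  rw [regMatrix, e, propMatrix_neg, e2]; rfl

theorem kernel_neg (p : Medium) (ε t : ℝ) (q : ℝ³) (a b : FieldIx) :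
    kernel p ε a b (-t, -q) = kernel p ε b a (t, q) := by
  rw [kernel, kernel, ← integral_neg_eq_self]
  congr 2; funext s
  rw [regMatrix_neg, neg_neg]; push_cast; ring_nf

section

variable {p : Medium} (hp : p.Good) {q : ℝ³}
include hp

theorem exists_bound_contMatrix {ε : ℝ} (hε : 0 < ε) (q : ℝ³) (δ : ℝ) {a b : FieldIx}
    (hab : Diag a b) :
    ∃ C, ∀ ζ ∈ cornerRegion δ, ‖contMatrix p ε q (xStar p q + ζ) a b‖ ≤ C / (1 + ‖ζ‖ ^ 2) := by
  obtain ⟨R, hR⟩ : ∃ R, R = p.rad * (1 + len q + ε) := ⟨_, rfl⟩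
  have hQ := len_nonneg q
  have hR1 : 1 ≤ R := by rw [hR]; nlinarith [hp.le_rad]
  obtain ⟨M, hM⟩ := ((isCompact_closedBall (0 : ℂ) R).inter_right
    (isClosed_cornerRegion δ)).exists_bound_of_continuousOn
    ((differentiableOn_contMatrix hp (q := q) (δ := δ) hε a b).continuousOn.mono inter_subset_right)
  obtain ⟨A, hA⟩ : ∃ A, A = 10 * ((p.size + 120 + 6 * (p.g ^ 2 * p.χ) * (p.ω₀ ^ 2 + 1))
    * (1 + len q + ε)) ^ 12 := ⟨_, rfl⟩
  have hA0 : 0 ≤ A := by rw [hA]; positivity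
  refine ⟨max (M * (1 + R ^ 2)) (2 * A), fun ζ hζ => ?_⟩
  rcases le_total ‖ζ‖ R with h | h
  · have h1 := hM ζ ⟨by simpa using h, hζ⟩
    have h2 := (norm_nonneg _).trans h1
    rw [le_div_iff₀ (by positivity)]
    refine le_trans ?_ (le_max_left _ _)
    gcongr
  · have h1 := norm_contMatrix_le_large hp hε.le (by rw [← hR]; exact h) hab
    rw [← hA] at h1
    clear hA
    have h3 : 1 ≤ ‖ζ‖ ^ 2 := one_le_pow₀ (hR1.trans h)
    have hm := mSq_nonneg hp q
    refine (h1.trans ?_).trans (div_le_div_of_nonneg_right (le_max_right _ _) (by positivity))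
    rw [div_le_div_iff₀ (by positivity) (by positivity)]
    nlinarith [mul_nonneg hA0 hm, mul_nonneg hA0 (sub_nonneg.2 h3)]

omit hp in
/-- The exponential is bounded on the region, so that the integrand inherits the bound. -/
theorem bound_exp_mul_contMatrix {ε t δ C : ℝ} (ht : 0 ≤ t) (hδ : 0 ≤ δ) {a b : FieldIx}
    (h : ∀ ζ ∈ cornerRegion δ, ‖contMatrix p ε q (xStar p q + ζ) a b‖ ≤ C / (1 + ‖ζ‖ ^ 2)) :
    ∀ ζ ∈ cornerRegion δ, ‖cexp (-I * (xStar p q + ζ) * t)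
      * contMatrix p ε q (xStar p q + ζ) a b‖ ≤ Real.exp (δ * t) * C / (1 + ‖ζ‖ ^ 2) := by
  intro ζ hζ
  rw [norm_mul, mul_div_assoc]
  refine mul_le_mul (norm_exp_le ht ?_) (h ζ hζ) (norm_nonneg _) (Real.exp_pos _).le
  simpa using im_le_of_mem_cornerRegion hδ hζ

theorem kernel_eq_cornerIntegral {ε t δ : ℝ} (hε : 0 < ε) (ht : 0 ≤ t) (hδ : 0 ≤ δ)
    (q : ℝ³) {a b : FieldIx} (hab : Diag a b) :
    kernel p ε a b (t, q) = 1 / (2 * π) * cornerIntegral δ (fun ζ =>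
      cexp (-I * (xStar p q + ζ) * t) * contMatrix p ε q (xStar p q + ζ) a b) := by
  obtain ⟨C, hC⟩ := exists_bound_contMatrix hp hε q δ hab
  rw [← integral_eq_cornerIntegral hδ (DifferentiableOn.fun_mul (by fun_prop)
    (differentiableOn_contMatrix hp hε a b)) (bound_exp_mul_contMatrix ht hδ hC), kernel,
    ← integral_add_left_eq_self (μ := volume) _ (xStar p q)]
  congr 2; funext s
  rw [regMatrix_four]; push_cast; rfl

theorem integrable_regMatrix {ε : ℝ} (hε : 0 < ε) (q : ℝ³) {a b : FieldIx} (hab : Diag a b) :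
    Integrable fun s : ℝ => regMatrix p ε (four s q) a b := by
  obtain ⟨C, hC⟩ := exists_bound_contMatrix hp hε q 0 hab
  have hd := (differentiableOn_contMatrix hp (q := q) (δ := 0) hε a b).continuousOn
  have h1 := integrableOn_real_neg hd hC
  have h2 := integrableOn_horizontal hd hC le_rfl le_rfl
  have h3 : Integrable fun s : ℝ => contMatrix p ε q (xStar p q + (s : ℂ)) a b := by
    rw [← integrableOn_univ, ← Iic_union_Ioi (a := (0 : ℝ))]
    exact h1.union (by simpa using h2)
  refine (h3.comp_add_left (-xStar p q)).congr (.of_forall fun s => ?_)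
  simp only [regMatrix_four]; push_cast; congr 2; ring

/-- A bound of the propagator in time and spatial momentum which is uniform in the
regularization. -/
def _root_.Hopfield.kernelBound (p : Medium) (z : ℝ × ℝ³) : ℝ :=
  30 * (p.const * ((1 + len z.2) ^ 3 * (1 + |z.1|))) ^ 12 * (1 + p.v 0 ^ 2 / len z.2 ^ 2)

/-- A horizontal leg at height `1 / (1 + t)` stays off the real poles and keeps `e^{-izt}` bounded,
which gives a bound uniform in `ε`. -/
theorem contour_bounds {ε t : ℝ} (hε : 0 < ε) (hε1 : ε ≤ 1) (ht : 0 ≤ t) (hq : q ≠ 0) {a b : FieldIx}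
    (hab : Diag a b) : (∀ y : ℝ, y ≤ 1 / (1 + t) → y ≠ 0 →
      ‖cexp (-I * (xStar p q + y * I) * t)
        * contMatrix p ε q (xStar p q + y * I) a b‖ ≤ kernelBound p (t, q) / (1 + y ^ 2)) ∧
    ∀ x : ℝ, 0 < x →
      ‖cexp (-I * (xStar p q + (x + (1 / (1 + t) : ℝ) * I)) * t)
        * contMatrix p ε q (xStar p q + (x + (1 / (1 + t) : ℝ) * I)) a b‖
        ≤ kernelBound p (t, q) / (1 + x ^ 2) := by
  have hQ := len_pos hq
  have hm := mSq_pos hp hq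
  have hc : 0 < p.const := by linarith [hp.const_bounds.1]
  have hv := hp.hv0
  have hδ1 : 1 / (1 + t) ≤ 1 := by rw [div_le_one (by positivity)]; linarith
  have hexp : ∀ ζ : ℂ, ζ.im ≤ 1 / (1 + t) → ‖cexp (-I * ζ * t)‖ ≤ 3 := by
    intro ζ h
    refine (norm_exp_le ht h).trans ?_
    have h1 : 1 / (1 + t) * t ≤ 1 := by rw [one_div_mul_eq_div, div_le_one (by positivity)]; linarith
    exact (Real.exp_le_exp.2 h1).trans (by linarith [Real.exp_one_lt_d9])
  have hden : ∀ {A x y : ℝ}, 0 ≤ A → x ^ 2 ≤ y →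
      A / (mSq p q + y) ≤ A * (1 + p.v 0 ^ 2 / len q ^ 2) / (1 + x ^ 2) := by
    intro A x y hA h
    have h1 : 1 ≤ p.v 0 ^ 2 / len q ^ 2 * mSq p q := by
      rw [div_mul_eq_mul_div, le_div_iff₀ (by positivity), one_mul]; exact le_mSq hp q
    have hx := sq_nonneg x
    rw [div_le_div_iff₀ (by linarith) (by linarith), mul_assoc]
    refine mul_le_mul_of_nonneg_left ?_ hA
    have h2 : 0 ≤ p.v 0 ^ 2 / len q ^ 2 * y := mul_nonneg (by positivity) (hx.trans h)
    nlinarith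
  constructor
  · intro y hy h0
    rw [norm_mul]
    calc _ ≤ 3 * (10 * (p.const * (1 + len q) ^ 3) ^ 12 / (mSq p q + y ^ 2)) := by
          gcongr
          · exact hexp _ (by simpa using hy)
          · exact norm_contMatrix_le_axis hp hε.le hε1 q h0 hab
      _ ≤ 3 * (10 * (p.const * ((1 + len q) ^ 3 * (1 + t))) ^ 12 / (mSq p q + y ^ 2)) := by
          gcongr
          exact le_mul_of_one_le_right (by positivity) (by linarith)
      _ = 30 * (p.const * ((1 + len q) ^ 3 * (1 + t))) ^ 12 / (mSq p q + y ^ 2) := by ring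
      _ ≤ _ := by
          rw [kernelBound, abs_of_nonneg ht]
          exact hden (by positivity) le_rfl
  · intro x hx
    have him : ((x : ℂ) + (1 / (1 + t) : ℝ) * I).im = 1 / (1 + t) := by
      simp only [Complex.add_im, Complex.ofReal_im, Complex.im_ofReal_mul, Complex.I_im]; ring
    have hre : ((x : ℂ) + (1 / (1 + t) : ℝ) * I).re = x := by
      simp only [Complex.add_re, Complex.ofReal_re, Complex.re_ofReal_mul, Complex.I_re]; ring
    have hδ0 : 0 < 1 / (1 + t) := by positivity
    have h1 := norm_contMatrix_le_strip hp hε.le hε1 q (ζ := x + (1 / (1 + t) : ℝ) * I)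
      (by rw [hre]; exact hx.le) (by rw [him]; exact hδ0) (by rw [him]; exact hδ1) hab
    rw [him, div_div_eq_mul_div, div_one] at h1
    have h2 : x ^ 2 ≤ ‖(x : ℂ) + (1 / (1 + t) : ℝ) * I‖ ^ 2 := by
      have := sq_le_norm_sq_re ((x : ℂ) + (1 / (1 + t) : ℝ) * I)
      rwa [hre] at this
    rw [norm_mul]
    calc _ ≤ 3 * _ := by
          refine mul_le_mul (hexp _ ?_) h1 (norm_nonneg _) (by norm_num)
          rw [Complex.add_im, him, Complex.ofReal_im, zero_add]
      _ = 30 * (p.const * ((1 + len q) ^ 3 * (1 + t))) ^ 12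
          / (mSq p q + ‖(x : ℂ) + (1 / (1 + t) : ℝ) * I‖ ^ 2) := by ring
      _ ≤ _ := by
          rw [kernelBound, abs_of_nonneg ht]
          exact hden (by positivity) h2

omit hp in
theorem kernelBound_nonneg (p : Medium) (z : ℝ × ℝ³) : 0 ≤ kernelBound p z := by
  unfold kernelBound; positivity

omit hp in
theorem kernelBound_neg (p : Medium) (t : ℝ) (q : ℝ³) :
    kernelBound p (-t, -q) = kernelBound p (t, q) := by simp [kernelBound, len_neg]

omit hp in
theorem Diag.symm {a b : FieldIx} (h : Diag a b) : Diag b a := fun μ =>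
  ⟨fun h' => (h μ).2 ⟨h'.2, h'.1⟩, fun h' => (h μ).1 ⟨h'.2, h'.1⟩⟩

theorem norm_kernel_le {ε t : ℝ} (hε : 0 < ε) (hε1 : ε ≤ 1) (hq : q ≠ 0) {a b : FieldIx}
    (hab : Diag a b) : ‖kernel p ε a b (t, q)‖ ≤ kernelBound p (t, q) := by
  have key : ∀ {t : ℝ} {q : ℝ³} {a b : FieldIx}, 0 ≤ t → q ≠ 0 → Diag a b →
      ‖kernel p ε a b (t, q)‖ ≤ kernelBound p (t, q) := by
    intro t q a b ht hq hab
    have hb := contour_bounds hp hε hε1 ht hq hab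
    rw [kernel_eq_cornerIntegral hp hε ht (by positivity : 0 ≤ 1 / (1 + t)) q hab, norm_mul]
    have hn : ‖(1 / (2 * π) : ℂ)‖ = 1 / (2 * π) := by
      simp [abs_of_pos Real.pi_pos]
    rw [hn, one_div_mul_eq_div, div_le_iff₀ (by positivity), mul_comm (kernelBound _ _)]
    exact norm_cornerIntegral_le hb.1 hb.2
  rcases le_total 0 t with ht | ht
  · exact key ht hq hab
  · rw [← kernelBound_neg, ← neg_neg q, ← neg_neg t, kernel_neg, neg_neg, neg_neg]
    exact key (by linarith) (neg_ne_zero.2 hq) hab.symm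

/-- For `t > 0` the contour closes below, around the poles with `ω > 0`. -/
theorem tendsto_kernel_pos (hG : Generic p q) {t : ℝ} (ht : 0 < t) {a b : FieldIx} (hab : Diag a b) :
    Tendsto (fun ε => kernel p ε a b (t, q)) (𝓝[>] 0)
      (𝓝 (I * vacuumFunction p q t a b)) := by
  have hδ : 0 < 1 / (1 + t) := by positivity
  have hnode : ∀ ζ : ℂ, ζ.im ≠ 0 → (xStar p q : ℂ) + ζ ∉ nodes p q := fun ζ h hn => by
    have := (real_of_mem_nodeSet hp hG ((mem_nodes hp hG.ne_zero).1 hn)).1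
    exact h (by simpa using this)
  have hsum : ∑ z ∈ nodes p q, resC p q a b z = 0 := by
    rw [((hasExp_resolvent hp q a b).sums (resolvent_eq_fracSum hp hG a b)).1, neg_eq_zero]
    have hab' := fun μ => hab μ
    rcases a with μ | μ | _ <;> rcases b with ν | ν | _ <;> try rfl
    · exact absurd ⟨rfl, rfl⟩ (hab μ).1
    · exact absurd ⟨rfl, rfl⟩ (hab ν).2
  have h1 := cornerIntegral_fracSum hsum (xStar p q) (d := resD p q a b)
    (fun z hz => real_of_mem_nodeSet hp hG ((mem_nodes hp hG.ne_zero).1 hz)) hδ ht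
  have h2 : I * vacuumFunction p q t a b = 1 / (2 * π) * cornerIntegral (1 / (1 + t))
      (fun ζ => cexp (-I * (xStar p q + ζ) * t)
        * fracSum (nodes p q) (resC p q a b) (resD p q a b) (xStar p q + ζ)) := by
    have hπ := piC_ne
    rw [h1, vacuumFunction, Matrix.of_apply]
    field_simp
  rw [h2]
  have hev : ∀ᶠ ε : ℝ in 𝓝[>] 0, 0 < ε ∧ ε ≤ 1 := by
    filter_upwards [Ioc_mem_nhdsGT (zero_lt_one' ℝ)] with ε h using h
  refine (Tendsto.const_mul _ (tendsto_cornerIntegral (B := kernelBound p (t, q))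
    (F := fun ε ζ => cexp (-I * (xStar p q + ζ) * t)
      * contMatrix p ε q (xStar p q + ζ) a b) ?_ ?_ ?_ hδ ?_)).congr' ?_
  · filter_upwards [hev] with ε h
    exact ContinuousOn.mul (by fun_prop) (differentiableOn_contMatrix hp h.1 a b).continuousOn
  · filter_upwards [hev] with ε h using (contour_bounds hp h.1 h.2 ht.le hG.ne_zero hab).1
  · filter_upwards [hev] with ε h using (contour_bounds hp h.1 h.2 ht.le hG.ne_zero hab).2
  · intro ζ hζ
    rw [← resolvent_eq_fracSum hp hG a b _ (hnode ζ hζ)]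
    exact (tendsto_contMatrix hp hζ a b).const_mul _
  · filter_upwards [hev] with ε h
    exact (kernel_eq_cornerIntegral hp h.1 ht.le hδ.le q hab).symm

end

/-! ### Pairing with test functions of time -/

theorem integral_mul_transform {f g : ℝ → ℂ} (hf : Integrable f) (hg : Integrable g) {c : ℂ}
    (hc : c.re = 0) : ∫ s, f s * ∫ t : ℝ, cexp (c * s * t) * g t
      = ∫ t : ℝ, (∫ s : ℝ, cexp (c * s * t) * f s) * g t := by
  have h : Integrable (Function.uncurry fun s t : ℝ => cexp (c * s * t) * (f s * g t))
      (volume.prod volume) := by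
    refine (hf.mul_prod hg).bdd_mul (c := 1) (by fun_prop) (.of_forall fun z => ?_)
    rw [Complex.norm_exp]; simp [hc]
  have h2 := integral_integral_swap h
  simp_rw [← integral_const_mul, ← integral_mul_const]
  have e1 : ∀ s t : ℝ, f s * (cexp (c * s * t) * g t) = cexp (c * s * t) * (f s * g t) :=
    fun s t => by ring
  have e2 : ∀ s t : ℝ, cexp (c * s * t) * f s * g t = cexp (c * s * t) * (f s * g t) :=
    fun s t => by ring
  simp only [e1, e2]
  exact h2

/-- Fourier inversion on the real line. -/
theorem integral_exp_mul_transform {φ : ℝ → ℂ} (hc : Continuous φ) (hi : Integrable φ)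
    (hi' : Integrable fun s : ℝ => ∫ t : ℝ, cexp (-I * s * t) * φ t) (t : ℝ) :
    ∫ s : ℝ, cexp (I * s * t) * ∫ t : ℝ, cexp (-I * s * t) * φ t
      = 2 * π * φ t := by
  obtain ⟨g, hg⟩ : ∃ g : ℝ → ℂ, g = fun s : ℝ => ∫ t : ℝ, cexp (-I * s * t) * φ t :=
    ⟨_, rfl⟩
  have e : FourierTransform.fourier φ = fun w => g (2 * π * w) := by
    funext w
    rw [Real.fourier_eq', hg]
    refine integral_congr_ae (.of_forall fun t => ?_)
    simp only [smul_eq_mul, RCLike.inner_apply, conj_trivial]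
    push_cast; ring_nf
  have h2 : (2 * π : ℝ) ≠ 0 := by simp [Real.pi_ne_zero]
  rw [← hg] at hi'
  have hint : Integrable (FourierTransform.fourier φ) := by rw [e]; exact hi'.comp_mul_left' h2
  have h := congrFun (hc.fourierInv_fourier_eq hi hint) t
  rw [Real.fourierInv_eq', e] at h
  have h3 := Measure.integral_comp_mul_left (fun s : ℝ => cexp (I * s * t) * g s)
    (2 * π)
  have h4 : ∫ w : ℝ, cexp (I * (2 * π * w : ℝ) * t) * g (2 * π * w) = φ t := by
    rw [← h]
    refine integral_congr_ae (.of_forall fun w => ?_)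
    simp only [smul_eq_mul, RCLike.inner_apply, conj_trivial]
    push_cast; ring_nf
  rw [h4, abs_of_pos (by positivity)] at h3
  rw [show (fun s : ℝ => cexp (I * s * t)
    * ∫ t : ℝ, cexp (-I * s * t) * φ t) = fun s : ℝ => cexp (I * s * t) * g s
    by rw [hg], h3, Complex.real_smul, ← mul_assoc]
  push_cast
  rw [mul_inv_cancel₀ (by simp), one_mul]

/-- `R` is the Fourier transform of `K`, in the sense of distributions. -/
def IsTimeKernel (R K : ℝ → ℂ) : Prop := ∀ φ : ℝ → ℂ, Continuous φ → Integrable φ →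
  Integrable (fun s : ℝ => ∫ t : ℝ, cexp (-I * s * t) * φ t) →
    ∫ s : ℝ, R s * ∫ t : ℝ, cexp (-I * s * t) * φ t = 2 * π * ∫ t, K t * φ t

theorem IsTimeKernel.of_integrable {R : ℝ → ℂ} (h : Integrable R) :
    IsTimeKernel R fun t => 1 / (2 * π) * ∫ s : ℝ, cexp (-I * s * t) * R s := by
  intro φ _ hi _
  have hπ := piC_ne
  rw [integral_mul_transform h hi (by simp), ← integral_const_mul]
  congr 1; funext t
  beta_reduce
  generalize (∫ s : ℝ, cexp (-I * s * t) * R s) = J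
  field_simp

theorem IsTimeKernel.of_eq {R K : ℝ → ℂ} (hK : Integrable K)
    (h : ∀ s : ℝ, ∫ t : ℝ, cexp (I * s * t) * K t = R s) : IsTimeKernel R K := by
  intro φ hc hi hi'
  simp_rw [← h]
  calc _ = ∫ s : ℝ, (∫ t : ℝ, cexp (-I * s * t) * φ t)
        * ∫ t : ℝ, cexp (I * s * t) * K t := by
        congr 1; funext s; rw [mul_comm]
    _ = ∫ t : ℝ, 2 * π * φ t * K t := by
        rw [integral_mul_transform hi' hK (by simp)]
        congr 1; funext t
        rw [integral_exp_mul_transform hc hi hi']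
    _ = _ := by
        rw [← integral_const_mul]
        congr 1; funext t; ring

theorem IsTimeKernel.neg {R K : ℝ → ℂ} (h : IsTimeKernel R K) :
    IsTimeKernel (fun s => -R s) fun t => -K t := by
  intro φ hc hi hi'
  simp only [neg_mul (R _), neg_mul (K _), integral_neg, mul_neg, h φ hc hi hi']

/-! ### The propagators that mix `A` and `B` -/

/-- The root of `k² + iε` with negative imaginary part. -/
def photonRoot (ε : ℝ) (q : ℝ³) : ℂ :=
  (√((√(len q ^ 4 + ε ^ 2) + len q ^ 2) / 2) : ℝ)
    - I * (√((√(len q ^ 4 + ε ^ 2) - len q ^ 2) / 2) : ℝ)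

theorem photonRoot_spec {ε : ℝ} (hε : 0 < ε) (q : ℝ³) :
    photonRoot ε q ^ 2 = ((len q ^ 2 : ℝ) : ℂ) - I * ε ∧ (photonRoot ε q).im < 0 ∧
      len q ≤ ‖photonRoot ε q‖ := by
  have hQ := len_nonneg q
  obtain ⟨N, hN⟩ : ∃ N, N = √(len q ^ 4 + ε ^ 2) := ⟨_, rfl⟩
  have hN2 : N ^ 2 = len q ^ 4 + ε ^ 2 := by rw [hN]; exact Real.sq_sqrt (by positivity)
  have hN0 : 0 ≤ N := by rw [hN]; exact Real.sqrt_nonneg _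
  have hNQ : len q ^ 2 < N := by
    apply lt_of_pow_lt_pow_left₀ 2 hN0
    rw [hN2]; nlinarith [pow_pos hε 2]
  obtain ⟨x, hx⟩ : ∃ x, x = √((N + len q ^ 2) / 2) := ⟨_, rfl⟩
  obtain ⟨y, hy⟩ : ∃ y, y = √((N - len q ^ 2) / 2) := ⟨_, rfl⟩
  have hx2 : x ^ 2 = (N + len q ^ 2) / 2 := by rw [hx]; exact Real.sq_sqrt (by positivity)
  have hy2 : y ^ 2 = (N - len q ^ 2) / 2 := by rw [hy]; exact Real.sq_sqrt (by linarith)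
  have hx0 : 0 ≤ x := by rw [hx]; exact Real.sqrt_nonneg _
  have hy0 : 0 < y := by rw [hy]; exact Real.sqrt_pos.2 (by linarith)
  have e : photonRoot ε q = x - I * y := by rw [photonRoot, hx, hy, hN]
  have hxy : 2 * (x * y) = ε := by
    have : (2 * (x * y)) ^ 2 = ε ^ 2 := by
      calc _ = 4 * (x ^ 2 * y ^ 2) := by ring
        _ = N ^ 2 - len q ^ 4 := by rw [hx2, hy2]; ring
        _ = _ := by rw [hN2]; ring
    exact (pow_left_inj₀ (by positivity) hε.le two_ne_zero).1 this
  rw [e]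
  refine ⟨?_, by simpa using hy0, ?_⟩
  · have h1 : ((x : ℂ)) ^ 2 - (y : ℂ) ^ 2 = ((len q ^ 2 : ℝ) : ℂ) := by
      rw [← Complex.ofReal_pow, ← Complex.ofReal_pow, hx2, hy2]; push_cast; ring
    have h2 : 2 * ((x : ℂ) * y) = ε := by exact_mod_cast hxy
    linear_combination h1 - I * h2 + (y : ℂ) ^ 2 * Complex.I_sq
  · refine le_trans ?_ (Complex.abs_re_le_norm _)
    have : ((x : ℂ) - I * y).re = x := by simp
    rw [this, abs_of_nonneg hx0]
    apply le_of_sq_le_sq _ hx0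
    rw [hx2]; linarith

theorem tendsto_photonRoot (q : ℝ³) :
    Tendsto (fun ε => photonRoot ε q) (𝓝[>] 0) (𝓝 (len q)) := by
  have h : Continuous fun ε => photonRoot ε q := by unfold photonRoot; fun_prop
  convert (h.tendsto 0).mono_left nhdsWithin_le_nhds using 2
  have h1 : √(len q ^ 4 + 0 ^ 2) = len q ^ 2 := by
    rw [show len q ^ 4 + 0 ^ 2 = (len q ^ 2) ^ 2 by ring, Real.sqrt_sq (sq_nonneg _)]
  rw [photonRoot, h1, add_self_div_two, Real.sqrt_sq (len_nonneg q)]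
  simp

theorem continuous_len : Continuous len := by unfold len; fun_prop

theorem measurable_photonRoot (ε : ℝ) : Measurable (photonRoot ε) := by
  have := continuous_len
  exact Continuous.measurable (by unfold photonRoot; fun_prop)

/-- The time Fourier transform of the `A`-`B` entries of the regularized propagator. -/
def mixedKernel (μ : Fin 4) (ε : ℝ) (z : ℝ × ℝ³) : ℂ :=
  let a := photonRoot ε z.2
  if 0 < z.1 then -(fourC a z.2 μ / (2 * a) * cexp (-I * a * z.1))
  else if z.1 < 0 then fourC a (-z.2) μ / (2 * a) * cexp (I * a * z.1) else 0

theorem stronglyMeasurable_mixedKernel (μ : Fin 4) (ε : ℝ) : StronglyMeasurable (mixedKernel μ ε) := by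
  have ha : Measurable fun z : ℝ × ℝ³ => photonRoot ε z.2 :=
    (measurable_photonRoot ε).comp measurable_snd
  have hk : ∀ μ, Measurable (fun z : ℝ × ℝ³ => fourC (photonRoot ε z.2) z.2 μ) := fun μ =>
    Fin.cases ha (fun j => by simp only [fourC, Matrix.cons_val_succ]; fun_prop) μ
  have hk' : ∀ μ, Measurable (fun z : ℝ × ℝ³ => fourC (photonRoot ε z.2) (-z.2) μ) := fun μ =>
    Fin.cases ha (fun j => by simp only [fourC, Matrix.cons_val_succ, Pi.neg_apply]; fun_prop) μ
  refine Measurable.stronglyMeasurable ?_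
  unfold mixedKernel
  refine Measurable.ite (measurableSet_lt measurable_const measurable_fst) (by fun_prop) ?_
  exact Measurable.ite (measurableSet_lt measurable_fst measurable_const) (by fun_prop) (by fun_prop)

theorem norm_fourC_div_le {a : ℂ} {q : ℝ³} (hq : q ≠ 0) (h : len q ≤ ‖a‖) (μ : Fin 4) :
    ‖fourC a q μ / (2 * a)‖ ≤ 1 := by
  have ha : 0 < ‖a‖ := (len_pos hq).trans_le h
  have hk : ‖fourC a q μ‖ ≤ ‖a‖ := by
    refine Fin.cases le_rfl (fun j => ?_) μ
    refine le_trans (le_of_eq ?_) ((abs_le_len q j).trans h)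
    simp [fourC]
  rw [norm_div, norm_mul, div_le_one (by simpa using ha)]
  simp only [Complex.norm_ofNat]
  linarith

theorem norm_mixedKernel_le {ε : ℝ} (hε : 0 < ε) (μ : Fin 4) (t : ℝ) {q : ℝ³} (hq : q ≠ 0) :
    ‖mixedKernel μ ε (t, q)‖ ≤ 1 := by
  obtain ⟨-, him, hle⟩ := photonRoot_spec hε q
  have h1 := norm_fourC_div_le hq hle μ
  have h2 := norm_fourC_div_le (neg_ne_zero.2 hq) (len_neg q ▸ hle) μ
  unfold mixedKernel
  split_ifs with h h'
  · rw [norm_neg, norm_mul]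
    refine mul_le_one₀ h1 (norm_nonneg _) ?_
    rw [Complex.norm_exp, Real.exp_le_one_iff]
    simpa using mul_nonpos_of_nonpos_of_nonneg him.le (h : 0 < t).le
  · rw [norm_mul]
    refine mul_le_one₀ h2 (norm_nonneg _) ?_
    rw [Complex.norm_exp, Real.exp_le_one_iff]
    simpa using mul_nonneg_of_nonpos_of_nonpos him.le (h' : t < 0).le
  · simp

/-- The `A`-`B` entries decay only like `1/k⁰`, so that their transform exists as a distribution. -/
theorem isTimeKernel_mixedKernel (p : Medium) {ε : ℝ} (hε : 0 < ε) (q : ℝ³) (μ : Fin 4) :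
    IsTimeKernel (fun s => regMatrix p ε (four s q) (iA μ) iB) fun t => mixedKernel μ ε (t, q) := by
  obtain ⟨hsq, him, -⟩ := photonRoot_spec hε q
  obtain ⟨a, ha⟩ : ∃ a, a = photonRoot ε q := ⟨_, rfl⟩
  rw [← ha] at hsq him
  have ha0 : a ≠ 0 := by rintro rfl; simp at him
  have him' : ¬ (-a).im < 0 := by simp; linarith
  have e : ∀ t, mixedKernel μ ε (t, q) = -I * (poleTransform a (fourC a q μ / (2 * a)) 0 t
      + poleTransform (-a) (fourC a (-q) μ / (2 * a)) 0 t) := by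
    intro t
    have hI := Complex.I_mul_I
    simp only [mixedKernel, poleTransform, if_pos him, if_neg him', ← ha]
    rcases lt_trichotomy t 0 with h | rfl | h
    · rw [if_neg h.not_gt, if_pos h, if_neg h.not_gt, if_pos h]
      simp only [neg_mul_neg]
      linear_combination (fourC a (-q) μ / (2 * a) * cexp (I * a * t)) * hI
    · simp
    · rw [if_pos h, if_pos h, if_neg h.not_gt]
      linear_combination (-(fourC a q μ / (2 * a) * cexp (-I * a * t))) * hI
  have h1 := poleTransform_spec him.ne (fourC a q μ / (2 * a)) 0
  have h2 := poleTransform_spec (a := -a) (by simpa using him.ne) (fourC a (-q) μ / (2 * a)) 0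
  refine IsTimeKernel.of_eq ?_ fun s => ?_
  · simp only [e]
    have h3 := ((h1 0).1.add (h2 0).1).const_mul (-I)
    refine h3.congr (.of_forall fun t => ?_)
    simp
  · simp only [e]
    have h3 : ∀ t : ℝ, cexp (I * s * t) * (-I * (poleTransform a (fourC a q μ / (2 * a)) 0 t
      + poleTransform (-a) (fourC a (-q) μ / (2 * a)) 0 t)) = -I
        * (cexp (I * s * t) * poleTransform a (fourC a q μ / (2 * a)) 0 t
        + cexp (I * s * t) * poleTransform (-a) (fourC a (-q) μ / (2 * a)) 0 t) :=
      fun t => by ring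
    have hs1 : (s : ℂ) - a ≠ 0 := fun h => him.ne (by
      have := congrArg Complex.im h; simpa using this)
    have hs2 : (s : ℂ) + a ≠ 0 := fun h => him.ne (by
      have := congrArg Complex.im h; simpa using this)
    simp only [h3]
    rw [integral_const_mul, integral_add (h1 s).1 (h2 s).1, (h1 s).2, (h2 s).2, regMatrix_AB]
    have hS : ((mink (four s q) (four s q) : ℝ) : ℂ) + I * ε = (s - a) * (s + a) := by
      have : ((mink (four s q) (four s q) : ℝ) : ℂ) = s ^ 2 - ((len q ^ 2 : ℝ) : ℂ) := by
        rw [← zS_ofReal, zS, len_sq]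
      rw [this]; linear_combination hsq
    rw [hS, zero_div, zero_div, sub_neg_eq_add, add_zero, add_zero]
    refine Fin.cases ?_ (fun j => ?_) μ
    · simp only [fourC, four, Matrix.cons_val_zero]; field_simp; ring
    · simp only [fourC, four, Matrix.cons_val_succ, Pi.neg_apply]; push_cast; field_simp; ring

theorem tendsto_mixedKernel (μ : Fin 4) {t : ℝ} (ht : t ≠ 0) {q : ℝ³} (hq : q ≠ 0) :
    Tendsto (fun ε => mixedKernel μ ε (t, q)) (𝓝[>] 0)
      (𝓝 (I * if 0 ≤ t then twoPointAB q t μ else -twoPointAB (-q) (-t) μ)) := by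
  have hl := len_pos hq
  have hl0 : (len q : ℂ) ≠ 0 := by exact_mod_cast hl.ne'
  have hI := Complex.I_mul_I
  have hlim : ∀ (c : ℂ) (q' : ℝ³), ContinuousAt (fun a : ℂ => fourC a q' μ / (2 * a)
      * cexp (c * a * t)) (len q) := by
    intro c q'
    have hk : ContinuousAt (fun a : ℂ => fourC a q' μ) (len q : ℂ) := (analyticAt_fourC q' μ _).continuousAt
    have h2 : (2 * (len q : ℂ)) ≠ 0 := by simpa using hl0
    exact (hk.div (by fun_prop) h2).mul (by fun_prop)
  have hT : ∀ (c : ℂ) (q' : ℝ³), Tendsto (fun ε => fourC (photonRoot ε q) q' μ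
      / (2 * photonRoot ε q) * cexp (c * photonRoot ε q * t)) (𝓝[>] 0)
      (𝓝 (fourC (len q) q' μ / (2 * len q) * cexp (c * len q * t))) := fun c q' =>
    Tendsto.comp (g := fun a : ℂ => fourC a q' μ / (2 * a) * cexp (c * a * t))
      (hlim c q').tendsto (tendsto_photonRoot q)
  rcases lt_or_gt_of_ne ht with h | h
  · simp only [mixedKernel, if_neg h.not_gt, if_pos h, if_neg h.not_ge]
    convert hT I (-q) using 2
    simp only [twoPointAB, phase, kPlus, len_neg]
    push_cast
    rw [toC_four', show -I * (len q : ℂ) * -(t : ℂ) = I * len q * t by ring]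
    field_simp
    linear_combination -(fourC (len q) (-q) μ) * hI
  · simp only [mixedKernel, if_pos h, if_pos h.le]
    convert (hT (-I) q).neg using 2
    simp only [twoPointAB, phase, kPlus]
    push_cast
    rw [toC_four']
    field_simp
    linear_combination (fourC (len q) q μ) * hI

/-- Every entry of the propagator has a time kernel, uniformly bounded in the regularization, that
converges to the time-ordered vacuum two-point function. -/
theorem exists_timeKernel {p : Medium} (hp : p.Good) (a b : FieldIx) :
    ∃ K : ℝ → ℝ × ℝ³ → ℂ, (∀ ε, StronglyMeasurable (K ε)) ∧
      (∀ ε, 0 < ε → ∀ q, IsTimeKernel (fun s => regMatrix p ε (four s q) a b) fun t => K ε (t, q)) ∧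
      (∀ ε, 0 < ε → ε ≤ 1 → ∀ t q, q ≠ 0 → ‖K ε (t, q)‖ ≤ kernelBound p (t, q) + 1) ∧
      ∀ t q, t ≠ 0 → Generic p q → Generic p (-q) → Tendsto (fun ε => K ε (t, q)) (𝓝[>] 0)
        (𝓝 (I * if 0 ≤ t then vacuumFunction p q t a b else vacuumFunction p (-q) (-t) b a)) := by
  have hBA : ∀ {q : ℝ³}, Generic p q → ∀ t μ, vacuumFunction p q t iB (iA μ) = -twoPointAB q t μ := by
    intro q hG t μ
    rw [vacuumFunction_conj hp hG, vacuumFunction_AB hp hG, twoPointAB, twoPointAB, phase, phase]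
    simp only [map_mul, map_div₀, Complex.conj_I, Complex.conj_ofReal, ← Complex.exp_conj, map_neg]
    push_cast
    simp only [map_ofNat]
    ring_nf
  rcases diag_or a b with h | ⟨μ, rfl, rfl⟩ | ⟨μ, rfl, rfl⟩
  · refine ⟨fun ε => kernel p ε a b, fun ε => stronglyMeasurable_kernel p ε a b,
      fun ε hε q => .of_integrable (integrable_regMatrix hp hε q h),
      fun ε hε hε1 t q hq => (norm_kernel_le hp hε hε1 hq h).trans (by linarith), fun t q ht hG hG' => ?_⟩
    rcases lt_or_gt_of_ne ht with h0 | h0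
    · rw [if_neg h0.not_ge]
      simpa only [kernel_neg] using tendsto_kernel_pos hp hG' (neg_pos.2 h0) h.symm
    · rw [if_pos h0.le]; exact tendsto_kernel_pos hp hG h0 h
  · refine ⟨mixedKernel μ, stronglyMeasurable_mixedKernel μ, fun ε hε q => isTimeKernel_mixedKernel p hε q μ,
      fun ε hε _ t q hq => (norm_mixedKernel_le hε μ t hq).trans (by linarith [kernelBound_nonneg p (t, q)]),
      fun t q ht hG hG' => ?_⟩
    rw [vacuumFunction_AB hp hG, hBA hG']
    exact tendsto_mixedKernel μ ht hG.ne_zero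
  · refine ⟨fun ε z => -mixedKernel μ ε z, fun ε => (stronglyMeasurable_mixedKernel μ ε).neg, fun ε hε q => ?_,
      fun ε hε _ t q hq => by
        rw [norm_neg]; exact (norm_mixedKernel_le hε μ t hq).trans (by linarith [kernelBound_nonneg p (t, q)]),
      fun t q ht hG hG' => ?_⟩
    · convert (isTimeKernel_mixedKernel p hε q μ).neg using 2
      rw [regMatrix_AB, regMatrix_BA]; ring
    · rw [vacuumFunction_AB hp hG', hBA hG]
      convert (tendsto_mixedKernel μ ht hG.ne_zero).neg using 2
      split_ifs <;> ring

/-! ### The limit of the regularized propagators -/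

theorem integrable_radial : Integrable fun q : ℝ³ => ((1 + ‖q‖) ^ 4)⁻¹ * (1 + (‖q‖ ^ 2)⁻¹) := by
  refine (integrable_fun_norm_addHaar (E := ℝ³) volume
    (f := fun y : ℝ => ((1 + y) ^ 4)⁻¹ * (1 + (y ^ 2)⁻¹))).2 ?_
  refine (integrable_inv_one_add_sq.integrableOn (s := Ioi (0 : ℝ))).mono' ?_ ?_
  · exact Measurable.aestronglyMeasurable (by fun_prop)
  · filter_upwards [ae_restrict_mem measurableSet_Ioi] with y hy
    have hy : 0 < y := hy
    rw [Real.norm_of_nonneg (by positivity), Module.finrank_fin_fun, smul_eq_mul]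
    have e : y ^ (3 - 1) * (((1 + y) ^ 4)⁻¹ * (1 + (y ^ 2)⁻¹)) = (y ^ 2 + 1) / (1 + y) ^ 4 := by
      norm_num; field_simp
    rw [e, inv_eq_one_div, div_le_div_iff₀ (by positivity) (by positivity)]
    have : 0 < y ^ 3 := by positivity
    nlinarith [sq_nonneg y]

section

variable {p : Medium} (hp : p.Good)
include hp

set_option maxHeartbeats 1000000 in
-- the powers make `positivity` and `field_simp` slow
theorem integrable_kernelBound (f : 𝓢(ℝ⁴, ℂ)) :
    Integrable fun z : ℝ × ℝ³ => (kernelBound p z + 1) * ‖fourier3 f z.1 z.2‖ := by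
  obtain ⟨C, hC, hf⟩ := norm_fourier3_le f 14 40
  have hc := hp.const_bounds.1
  have hA : 0 ≤ 30 * (p.const * 8) ^ 12 * (1 + p.v 0 ^ 2) := by positivity
  have h1 := ((integrable_inv_one_add_norm_pow (E := ℝ) volume (n := 2) (by simp)).mul_prod
    integrable_radial).const_mul ((30 * (p.const * 8) ^ 12 * (1 + p.v 0 ^ 2) + 1) * C)
  have hl := continuous_len
  refine h1.mono' ?_ (.of_forall fun z => ?_)
  · refine AEStronglyMeasurable.mul (Measurable.aestronglyMeasurable ?_)
      (continuous_fourier3 f).norm.aestronglyMeasurable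
    have := hl.measurable
    unfold kernelBound; fun_prop
  · obtain ⟨t, q⟩ := z
    have hQ := len_nonneg q
    have hlq := len_le_norm q
    have h2 : 1 + p.v 0 ^ 2 / len q ^ 2 ≤ (1 + p.v 0 ^ 2) * (1 + (‖q‖ ^ 2)⁻¹) := by
      have h3 : p.v 0 ^ 2 / len q ^ 2 ≤ p.v 0 ^ 2 * (‖q‖ ^ 2)⁻¹ := by
        rcases eq_or_ne q 0 with rfl | hq
        · simp [len]
        · rw [← div_eq_mul_inv]
          have := norm_pos_iff.2 hq
          gcongr
          exact norm_le_len q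
      have : 0 ≤ (‖q‖ ^ 2)⁻¹ := by positivity
      nlinarith [sq_nonneg (p.v 0)]
    have h4 : (1 + len q) ^ 3 * (1 + |t|) ≤ 8 * ((1 + ‖q‖) ^ 3 * (1 + |t|)) := by
      calc (1 + len q) ^ 3 * (1 + |t|) ≤ (2 * (1 + ‖q‖)) ^ 3 * (1 + |t|) := by gcongr; linarith
        _ = _ := by ring
    have h5 : kernelBound p (t, q) ≤ 30 * (p.const * 8) ^ 12 * (1 + p.v 0 ^ 2)
        * ((1 + ‖q‖) ^ 36 * (1 + |t|) ^ 12 * (1 + (‖q‖ ^ 2)⁻¹)) := by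
      unfold kernelBound
      calc _ ≤ 30 * (p.const * (8 * ((1 + ‖q‖) ^ 3 * (1 + |t|)))) ^ 12
            * ((1 + p.v 0 ^ 2) * (1 + (‖q‖ ^ 2)⁻¹)) := by gcongr
        _ = _ := by simp only [mul_pow, ← pow_mul]; ring
    have h6 : 1 ≤ (1 + ‖q‖) ^ 36 * (1 + |t|) ^ 12 * (1 + (‖q‖ ^ 2)⁻¹) := by
      have a1 : 1 ≤ (1 + ‖q‖) ^ 36 := one_le_pow₀ (by simp)
      have a2 : 1 ≤ (1 + |t|) ^ 12 := one_le_pow₀ (by simp)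
      have a3 : 1 ≤ 1 + (‖q‖ ^ 2)⁻¹ := by simp
      exact one_le_mul_of_one_le_of_one_le (one_le_mul_of_one_le_of_one_le a1 a2) a3
    have h0 := kernelBound_nonneg p (t, q)
    generalize kernelBound p (t, q) = B at h0 h5 ⊢
    generalize 30 * (p.const * 8) ^ 12 * (1 + p.v 0 ^ 2) = A at h5 hA ⊢
    rw [Real.norm_of_nonneg (mul_nonneg (by linarith) (norm_nonneg _))]
    calc _ ≤ ((A + 1)
          * ((1 + ‖q‖) ^ 36 * (1 + |t|) ^ 12 * (1 + (‖q‖ ^ 2)⁻¹)))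
          * (C / (1 + |t|) ^ 14 / (1 + ‖q‖) ^ 40) := by
          refine mul_le_mul ?_ (hf t q) (norm_nonneg _) (mul_nonneg (by linarith) (zero_le_one.trans h6))
          rw [add_mul, one_mul]; exact add_le_add h5 h6
      _ = _ := by
          simp only [Real.norm_eq_abs]
          have : (1 + ‖q‖) ^ 40 = (1 + ‖q‖) ^ 36 * (1 + ‖q‖) ^ 4 := by ring
          have : (1 + |t|) ^ 14 = (1 + |t|) ^ 12 * (1 + |t|) ^ 2 := by ring
          simp only [*]
          field_simp

theorem feynman_eq {ε : ℝ} (hε : 0 < ε) {a b : FieldIx} {K : ℝ × ℝ³ → ℂ}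
    (hK : ∀ q, IsTimeKernel (fun s => regMatrix p ε (four s q) a b) fun t => K (t, q))
    (f : 𝓢(ℝ⁴, ℂ))
    (hi : Integrable fun z => 1 / (2 * π) ^ 3 * (K z * fourier3 f z.1 z.2)) :
    feynman p ε a b f = ∫ z : ℝ × ℝ³, 1 / (2 * π) ^ 3 * (K z * fourier3 f z.1 z.2) := by
  have hπ := piC_ne
  rw [feynman, ← integral_comp_four, Measure.volume_eq_prod,
    integral_prod_symm _ (integrable_comp_four.2 (integrable_feynmanIntegrand hp hε a b f)),
    integral_prod_symm _ hi]
  congr 1; funext q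
  obtain ⟨C, hC, h3⟩ := norm_fourier3_le f 2 0
  obtain ⟨C', hC', h4⟩ := norm_fourier4_le f 2
  have hc : Continuous fun t => fourier3 f t q :=
    (continuous_fourier3 f).comp (continuous_id.prodMk continuous_const)
  have hI := integrable_inv_one_add_norm_pow (E := ℝ) volume (n := 2) (by simp)
  have h := hK q (fun t => fourier3 f t q) hc ?_ ?_
  · simp only [feynmanIntegrand, fourier4_four, integral_const_mul]
    rw [h]
    generalize (∫ t, K (t, q) * fourier3 f t q) = J
    field_simp
  · refine (hI.const_mul C).mono' hc.aestronglyMeasurable (.of_forall fun t => ?_)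
    simpa [div_eq_mul_inv] using h3 t q
  · simp only [← fourier4_four]
    refine (hI.const_mul C').mono' ((continuous_fourier4 f).comp
      (continuous_four.comp (continuous_id.prodMk continuous_const))).aestronglyMeasurable
      (.of_forall fun s => ?_)
    refine (h4 _).trans ?_
    rw [div_eq_mul_inv]
    gcongr
    rw [norm_four]; exact le_max_left _ _

/-- The canonical propagator is the Feynman propagator. -/
theorem IsVacuumTwoPoint.tendsto_feynman {W : ℝ³ → ℝ → Matrix FieldIx FieldIx ℂ}
    (hW : IsVacuumTwoPoint p W) (a b : FieldIx) (f : 𝓢(ℝ⁴, ℂ)) :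
    Integrable (propagatorIntegrand W a b f) ∧
      Tendsto (fun ε => feynman p ε a b f) (𝓝[>] 0) (𝓝 (propagator W a b f)) := by
  obtain ⟨K, hm, hK, hb, hlim⟩ := exists_timeKernel hp a b
  have hev : ∀ᶠ ε : ℝ in 𝓝[>] 0, 0 < ε ∧ ε ≤ 1 := by
    filter_upwards [Ioc_mem_nhdsGT (zero_lt_one' ℝ)] with ε h using h
  obtain ⟨D, hD⟩ : ∃ D : ℝ × ℝ³ → ℝ, D = fun z =>
    1 / (2 * π) ^ 3 * ((kernelBound p z + 1) * ‖fourier3 f z.1 z.2‖) := ⟨_, rfl⟩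
  have hDi : Integrable D := by rw [hD]; exact (integrable_kernelBound hp f).const_mul _
  have hq : ∀ᵐ z : ℝ × ℝ³, z.2 ≠ 0 ∧ z.1 ≠ 0 ∧ Generic p z.2 ∧ Generic p (-z.2)
      ∧ W z.2 = vacuumFunction p z.2 ∧ W (-z.2) = vacuumFunction p (-z.2) := by
    have hu := hW.unique hp (isVacuumTwoPoint_vacuumFunction hp)
    have h2 : ∀ᵐ q : ℝ³, q ≠ 0 ∧ Generic p q ∧ Generic p (-q)
        ∧ W q = vacuumFunction p q ∧ W (-q) = vacuumFunction p (-q) := by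
      filter_upwards [ae_generic hp, ae_neg (ae_generic hp), hu, ae_neg hu] with q h1 h2 h3 h4
      exact ⟨h1.ne_zero, h1, h2, h3, h4⟩
    rw [Measure.volume_eq_prod]
    filter_upwards [Measure.quasiMeasurePreserving_snd.ae h2,
      Measure.quasiMeasurePreserving_fst.ae (Measure.ae_ne volume (0 : ℝ))] with z h1 h2
    exact ⟨h1.1, h2, h1.2⟩
  obtain ⟨F, hF⟩ : ∃ F : ℝ → ℝ × ℝ³ → ℂ, F = fun ε z =>
    1 / (2 * π) ^ 3 * (K ε z * fourier3 f z.1 z.2) := ⟨_, rfl⟩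
  have hFm : ∀ ε, AEStronglyMeasurable (F ε) := fun ε => by
    rw [hF]
    exact ((hm ε).aestronglyMeasurable.mul (continuous_fourier3 f).aestronglyMeasurable).const_mul _
  have hFb : ∀ ε, 0 < ε → ε ≤ 1 → ∀ᵐ z, ‖F ε z‖ ≤ D z := fun ε h0 h1 => by
    filter_upwards [hq] with z hz
    rw [hF, hD]
    simp only [norm_mul]
    have : ‖(1 / (2 * π) ^ 3 : ℂ)‖ = 1 / (2 * π) ^ 3 := by simp [abs_of_pos Real.pi_pos]
    rw [this]
    gcongr
    exact hb ε h0 h1 _ _ hz.1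
  have hFl : ∀ᵐ z, Tendsto (fun ε => F ε z) (𝓝[>] 0) (𝓝 (propagatorIntegrand W a b f z)) := by
    filter_upwards [hq] with z ⟨_, ht, hG, hG', e1, e2⟩
    rw [hF, propagatorIntegrand, e1, e2]
    exact ((hlim z.1 z.2 ht hG hG').mul_const _).const_mul _
  have hPm : AEStronglyMeasurable (propagatorIntegrand W a b f) :=
    aestronglyMeasurable_of_tendsto_ae (𝓝[>] (0 : ℝ)) hFm hFl
  have hseq : Tendsto (fun n : ℕ => 1 / ((n : ℝ) + 1)) atTop (𝓝[>] 0) := by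
    refine tendsto_nhdsWithin_iff.2 ⟨tendsto_one_div_add_atTop_nhds_zero_nat, .of_forall fun n => ?_⟩
    exact mem_Ioi.2 (by positivity)
  have hFb' : ∀ᵐ z, ∀ n : ℕ, ‖F (1 / ((n : ℝ) + 1)) z‖ ≤ D z :=
    ae_all_iff.2 fun n => hFb _ (by positivity) (by
      rw [div_le_one (by positivity)]; linarith [n.cast_nonneg (α := ℝ)])
  refine ⟨hDi.mono' hPm ?_, ?_⟩
  · filter_upwards [hFl, hFb'] with z h1 h2
    exact le_of_tendsto (h1.comp hseq).norm (.of_forall h2)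
  · have h := tendsto_integral_filter_of_dominated_convergence D (l := 𝓝[>] (0 : ℝ))
      (.of_forall hFm) (hev.mono fun ε h => hFb ε h.1 h.2) hDi hFl
    refine h.congr' ?_
    filter_upwards [hev] with ε h
    rw [hF]
    refine (feynman_eq hp h.1 (hK ε h.1) f ?_).symm
    have := hDi.mono' (hFm ε) (hFb ε h.1 h.2)
    rwa [hF] at this

end

/-! ### Lorentz covariance -/

/-- The Minkowski metric as a real matrix. -/
def etaMat : Matrix (Fin 4) (Fin 4) ℝ := Matrix.diagonal ![1, -1, -1, -1]

theorem mink_eq_dotProduct (x y : ℝ⁴) : mink x y = x ⬝ᵥ etaMat.mulVec y := by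
  simp [mink, etaMat, Matrix.mulVec_diagonal, dotProduct, Fin.sum_univ_four]
  ring

theorem etaMat_sq : etaMat * etaMat = 1 := by
  rw [etaMat, Matrix.diagonal_mul_diagonal, ← Matrix.diagonal_one]
  congr 1; funext i; fin_cases i <;> simp

section

variable {L : Matrix (Fin 4) (Fin 4) ℝ}
  (hL : ∀ x y : ℝ⁴, mink (L.mulVec x) (L.mulVec y) = mink x y)
include hL

theorem transpose_mul_etaMat_mul : L.transpose * etaMat * L = etaMat := by
  ext i j
  have h := hL (Pi.single i 1) (Pi.single j 1)
  simp only [mink_eq_dotProduct, Matrix.mulVec_mulVec] at h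
  rw [← Matrix.vecMul_transpose, ← Matrix.dotProduct_mulVec, Matrix.mulVec_mulVec] at h
  simpa [← Matrix.mul_assoc] using h

theorem mul_etaMat_mul_transpose : L * etaMat * L.transpose = etaMat := by
  have h1 : (etaMat * L.transpose * etaMat) * L = 1 := by
    rw [Matrix.mul_assoc, Matrix.mul_assoc, ← Matrix.mul_assoc L.transpose,
      transpose_mul_etaMat_mul hL, etaMat_sq]
  have h2 := mul_eq_one_comm.1 h1
  calc L * etaMat * L.transpose = L * (etaMat * L.transpose * etaMat) * etaMat := by
        simp only [Matrix.mul_assoc, etaMat_sq, Matrix.mul_one]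
    _ = etaMat := by rw [h2, Matrix.one_mul]

theorem abs_det_eq_one : |L.det| = 1 := by
  have h := congrArg Matrix.det (transpose_mul_etaMat_mul hL)
  have hE : etaMat.det ≠ 0 := by
    intro h0
    have := congrArg Matrix.det etaMat_sq
    simp [h0] at this
  rw [Matrix.det_mul, Matrix.det_mul, Matrix.det_transpose] at h
  have h2 : L.det ^ 2 = 1 := by
    apply mul_right_cancel₀ hE; linear_combination h
  exact (pow_eq_one_iff_of_nonneg (abs_nonneg _) two_ne_zero).1 ((sq_abs _).trans h2)

theorem measurePreserving_lorentz : MeasurePreserving (fun x => L.mulVec x) ∧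
    MeasurableEmbedding (fun x : ℝ⁴ => L.mulVec x) := by
  have h1 := abs_det_eq_one hL
  have h0 : L.det ≠ 0 := fun h => by simp [h] at h1
  refine ⟨⟨Continuous.measurable (by fun_prop), ?_⟩, ?_⟩
  · have := Real.map_matrix_volume_pi_eq_smul_volume_pi h0
    rw [abs_inv, h1, inv_one, ENNReal.ofReal_one, one_smul] at this
    exact this
  · exact (LinearMap.isClosedEmbedding_of_injective (f := Matrix.toLin' L)
      (LinearMap.ker_eq_bot.2 (Matrix.mulVec_injective_iff_isUnit.2
        ((Matrix.isUnit_iff_isUnit_det L).2 h0.isUnit)))).measurableEmbedding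

theorem fourier4_lorentz {f f' : 𝓢(ℝ⁴, ℂ)} (hf : ∀ x, f' x = f (L.mulVec x))
    (k : ℝ⁴) : fourier4 f (L.mulVec k) = fourier4 f' k := by
  obtain ⟨h1, h2⟩ := measurePreserving_lorentz hL
  rw [fourier4, ← h1.integral_comp h2]
  simp only [hL, ← hf]
  rfl

theorem sum_lorentz_eta (μ ν : Fin 4) :
    ∑ α, ∑ β, ((L μ α : ℝ) : ℂ) * (L ν β : ℝ) * eta α β = eta μ ν := by
  have hE : ∀ α β, eta α β = ((etaMat α β : ℝ) : ℂ) := by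
    intro α β; fin_cases α <;> fin_cases β <;> simp [eta, etaMat]
  have h := congrFun (congrFun (mul_etaMat_mul_transpose hL) μ) ν
  rw [hE μ ν, ← h, Matrix.mul_apply]
  simp only [hE, Matrix.mul_apply, Matrix.transpose_apply, Finset.sum_mul]
  push_cast
  rw [Finset.sum_comm]
  exact Finset.sum_congr rfl fun _ _ => Finset.sum_congr rfl fun _ _ => by ring

omit hL in
theorem toC_mulVec (k : ℝ⁴) (μ : Fin 4) :
    toC (L.mulVec k) μ = ∑ α, ((L μ α : ℝ) : ℂ) * toC k α := by
  simp [toC, Matrix.mulVec, dotProduct]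

theorem tens_lorentz (a b c d e : ℂ) (k v : ℝ⁴) (μ ν : Fin 4) :
    tens (toC (L.mulVec k)) (toC (L.mulVec v)) a b c d e μ ν
      = ∑ α, ∑ β, ((L μ α : ℝ) : ℂ) * (L ν β : ℝ) * tens (toC k) (toC v) a b c d e α β := by
  have h2 : ∀ x y : ℝ⁴, toC (L.mulVec x) μ * toC (L.mulVec y) ν
      = ∑ α, ∑ β, ((L μ α : ℝ) : ℂ) * (L ν β : ℝ) * (toC x α * toC y β) := by
    intro x y
    rw [toC_mulVec, toC_mulVec, Finset.sum_mul_sum]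
    exact Finset.sum_congr rfl fun _ _ => Finset.sum_congr rfl fun _ _ => by ring
  simp only [tens, ← sum_lorentz_eta hL μ ν, h2, Finset.mul_sum, ← Finset.sum_add_distrib]
  exact Finset.sum_congr rfl fun _ _ => Finset.sum_congr rfl fun _ _ => by ring

theorem mink_toC_lorentz (x y : ℝ⁴) :
    mink (toC (L.mulVec x)) (toC (L.mulVec y)) = mink (toC x) (toC y) := by
  have h : ∀ x y : ℝ⁴, mink (toC x) (toC y) = ((mink x y : ℝ) : ℂ) := by
    intro x y; simp [mink, toC]
  rw [h, h, hL]

theorem regMatrix_lorentz (p : Medium) (ε : ℝ) (k : ℝ⁴) (a b : FieldIx) :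
    regMatrix { p with v := L.mulVec p.v } ε (L.mulVec k) a b
      = ∑ c, ∑ d, (fieldRep L a c : ℂ) * (fieldRep L b d : ℂ) * regMatrix p ε k c d := by
  have ekk := mink_toC_lorentz hL k k
  have eom : Medium.omC { p with v := L.mulVec p.v } (toC (L.mulVec k)) = p.omC (toC k) :=
    mink_toC_lorentz hL k p.v
  have eX : ∀ w, polX { p with v := L.mulVec p.v } w (toC (L.mulVec k)) = polX p w (toC k) := fun w => by
    simp only [polX, eom]
  have eD : ∀ s w, dispC { p with v := L.mulVec p.v } s w (toC (L.mulVec k)) = dispC p s w (toC k) :=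
    fun s w => by simp only [dispC, eom, eX]
  have ev : Medium.vC { p with v := L.mulVec p.v } = toC (L.mulVec p.v) := rfl
  have ev' : p.vC = toC p.v := rfl
  simp only [regMatrix, ekk]
  generalize mink (toC k) (toC k) + I * ε = s
  generalize (p.ω₀ : ℂ) ^ 2 - I * ε = w
  have hT : ∀ (i j : Fin 4 → FieldIx) (a b c d e : ℂ),
      (∀ μ ν, propMatrix p s w (toC k) (i μ) (j ν) = tens (toC k) (toC p.v) a b c d e μ ν) →
      (∀ μ ν, propMatrix { p with v := L.mulVec p.v } s w (toC (L.mulVec k)) (i μ) (j ν)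
        = tens (toC (L.mulVec k)) (toC (L.mulVec p.v)) a b c d e μ ν) → ∀ μ ν,
      propMatrix { p with v := L.mulVec p.v } s w (toC (L.mulVec k)) (i μ) (j ν)
        = ∑ α, ∑ β, ((L μ α : ℝ) : ℂ) * (L ν β : ℝ) * propMatrix p s w (toC k) (i α) (j β) := by
    intro i j a b c d e h1 h2 μ ν
    simp only [h1, h2, tens_lorentz hL]
  obtain ⟨om, hom⟩ : ∃ om, p.omC (toC k) = om := ⟨_, rfl⟩
  obtain ⟨X, hX⟩ : ∃ X, polX p w (toC k) = X := ⟨_, rfl⟩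
  obtain ⟨D, hD⟩ : ∃ D, dispC p s w (toC k) = D := ⟨_, rfl⟩
  obtain ⟨h, hh⟩ : ∃ h : ℂ, h = 1 / (1 / (4 * π) - X) := ⟨_, rfl⟩
  obtain ⟨c, hc⟩ : ∃ c, c = -I * p.g * (p.χ * w / (om ^ 2 - w)) * (1 / D) := ⟨_, rfl⟩
  obtain ⟨c', hc'⟩ : ∃ c, c = p.g ^ 2 * (p.χ * w / (om ^ 2 - w)) ^ 2 * (1 / D) := ⟨_, rfl⟩
  have hAA := hT iA iA
  have hAP := hT iA iP
  have hPA := hT iP iA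
  have hPP := hT iP iP
  rcases a with μ | μ | a <;> rcases b with ν | ν | b <;>
    simp only [Fintype.sum_sum_type, fieldRep, Matrix.fromBlocks_apply₁₁, Matrix.fromBlocks_apply₁₂,
      Matrix.fromBlocks_apply₂₁, Matrix.fromBlocks_apply₂₂, Matrix.zero_apply, Complex.ofReal_zero,
      zero_mul, mul_zero, Finset.sum_const_zero, add_zero, zero_add, Finset.univ_unique,
      Finset.sum_singleton, Matrix.one_apply_eq, Complex.ofReal_one, one_mul, mul_one]
  · refine hAA (1 / D) (1 / s ^ 2 * (p.ξ - h) + 1 / D * (1 / s) * h * X) (-(1 / D * h * X * om / s))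
      (-(1 / D * h * X * om / s)) (1 / D * h * X) ?_ ?_ μ ν <;> intro μ ν <;>
      simp only [propMatrix, Matrix.of_apply, eom, eX, eD, ev, ev', tens, hX, hD, hom,
        ← hh] <;> ring
  · refine hAP (c * om) (c * om * h * X / s) (-(c * om * h * X * om / s)) (-(c * h / (4 * π)))
      (c * om * h * X) ?_ ?_ μ ν <;> intro μ ν <;>
      simp only [propMatrix, Matrix.of_apply, eom, eX, eD, ev, ev', tens, hX, hD, hom,
        ← hh, hc] <;> ring
  · simp only [propMatrix, Matrix.of_apply, toC_mulVec, Finset.mul_sum, Finset.sum_div]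
    exact Finset.sum_congr rfl fun _ _ => by ring
  · refine hPA (-c * om) (-c * om * h * X / s) (c * h / (4 * π)) (c * om * h * X * om / s)
      (-c * om * h * X) ?_ ?_ μ ν <;> intro μ ν <;>
      simp only [propMatrix, Matrix.of_apply, eom, eX, eD, ev, ev', tens, hX, hD, hom,
        ← hh, hc] <;> ring
  · refine hPP (c' * om ^ 2 + p.χ * w / (om ^ 2 - w)) (c' * h / (4 * π)) (-(c' * h * om / (4 * π)))
      (-(c' * h * om / (4 * π))) (c' * h * X * om ^ 2 - p.χ * w / (om ^ 2 - w)) ?_ ?_ μ ν <;>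
      intro μ ν <;>
      simp only [propMatrix, Matrix.of_apply, eom, eX, eD, ev, ev', tens, hX, hD, hom,
        ← hh, hc'] <;> ring
  · simp [propMatrix]
  · simp only [propMatrix, Matrix.of_apply, toC_mulVec, Finset.mul_sum, Finset.sum_div]
    exact Finset.sum_congr rfl fun _ _ => by ring
  · simp [propMatrix]
  · simp [propMatrix]

end

/-- The regularized propagators are Lorentz covariant. -/
theorem feynman_lorentz {p : Medium} (hp : p.Good) {L : Matrix (Fin 4) (Fin 4) ℝ}
    (hL : ∀ x y : ℝ⁴, mink (L.mulVec x) (L.mulVec y) = mink x y) {ε : ℝ} (hε : 0 < ε)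
    {f f' : 𝓢(ℝ⁴, ℂ)} (hf : ∀ x, f' x = f (L.mulVec x)) (a b : FieldIx) :
    feynman { p with v := L.mulVec p.v } ε a b f
      = ∑ c, ∑ d, (fieldRep L a c : ℂ) * (fieldRep L b d : ℂ) * feynman p ε c d f' := by
  obtain ⟨h1, h2⟩ := measurePreserving_lorentz hL
  have hi : ∀ c d, Integrable fun k => (fieldRep L a c : ℂ) * (fieldRep L b d : ℂ)
      * feynmanIntegrand p ε c d f' k := fun c d => (integrable_feynmanIntegrand hp hε c d f').const_mul _
  simp only [feynman, ← integral_const_mul]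
  simp_rw [← integral_finsetSum _ fun d _ => hi _ d]
  rw [← integral_finsetSum _ fun c _ => integrable_finsetSum _ fun d _ => hi c d, ← h1.integral_comp h2]
  congr 1; funext k
  simp only [feynmanIntegrand, fourier4_lorentz hL hf, regMatrix_lorentz hL, Finset.sum_mul, Finset.mul_sum]
  exact Finset.sum_congr rfl fun _ _ => Finset.sum_congr rfl fun _ _ => by ring

end

end Hopfield

theorem proposition1 (p : Hopfield.Medium)
    (hg : p.g ≠ 0) (hχ : 0 < p.χ) (hω : 0 < p.ω₀)
    (hv : Hopfield.mink p.v p.v = 1) (hv0 : 0 < p.v 0) :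
    -- the matrix of the propagator is the reduced inverse of the matrix of the action
    (∀ (w : ℂ) (k : Fin 4 → ℂ), w ≠ 0 → Hopfield.mink k k ≠ 0 → p.omC k ^ 2 ≠ w →
      Hopfield.dispC p (Hopfield.mink k k) w k ≠ 0 →
      Hopfield.polX p w k ≠ 1 / (4 * Real.pi) →
      IsUnit (Hopfield.fieldMatrix p w k).det ∧
      (Hopfield.fieldMatrix p w k)⁻¹.submatrix Sum.inl Sum.inl
        = Hopfield.propMatrix p (Hopfield.mink k k) w k) ∧
    -- there are two transverse modes of positive norm
    (∀ q : Fin 3 → ℝ, q ≠ 0 → (Hopfield.transverseModes p q).ncard = 2) ∧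
    -- the vacuum two-point function of the canonical quantization exists
    (∃ W, Hopfield.IsVacuumTwoPoint p W) ∧
    ∀ W, Hopfield.IsVacuumTwoPoint p W →
      -- it is given by the explicit formulas
      (∀ e, Hopfield.IsPolarization p e →
        ∀ᵐ q : Fin 3 → ℝ, ∀ t : ℝ,
          (∀ μ ν, W q t (Hopfield.iA μ) (Hopfield.iA ν)
            = Hopfield.photonAA p q t μ ν + Hopfield.bAA p q t μ ν
              + Hopfield.transverseSum p e (fun _ => 1) q t μ ν) ∧
          ((∀ j : Fin 3, p.v j.succ = 0) →
            ∀ μ ν, W q t (Hopfield.iA μ) (Hopfield.iA ν)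
              = Hopfield.photonAArest p q t μ ν + Hopfield.bAA p q t μ ν
                + Hopfield.transverseSum p e (fun _ => 1) q t μ ν) ∧
          (∀ μ ν, W q t (Hopfield.iA μ) (Hopfield.iP ν) = Hopfield.twoPointAP p e q t μ ν) ∧
          (∀ μ, W q t (Hopfield.iA μ) Hopfield.iB = Hopfield.twoPointAB q t μ) ∧
          (∀ μ ν, W q t (Hopfield.iP μ) (Hopfield.iP ν) = Hopfield.twoPointPP p e q t μ ν) ∧
          (∀ μ, W q t (Hopfield.iP μ) Hopfield.iB = 0) ∧
          W q t Hopfield.iB Hopfield.iB = 0 ∧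
          (∀ a b, W q t b a = (starRingEnd ℂ) (W q (-t) a b))) ∧
      -- the propagator is the Feynman propagator
      (∀ (a b : Hopfield.FieldIx) (f : SchwartzMap (Fin 4 → ℝ) ℂ),
        MeasureTheory.Integrable (Hopfield.propagatorIntegrand W a b f)) ∧
      (∀ a b : Hopfield.FieldIx,
        Hopfield.IsFeynmanPropagator p a b (Hopfield.propagator W a b)) ∧
      -- the propagator is Lorentz covariant
      (∀ (L : Matrix (Fin 4) (Fin 4) ℝ) (W' : (Fin 3 → ℝ) → ℝ →
          Matrix Hopfield.FieldIx Hopfield.FieldIx ℂ),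
        (∀ x y : Fin 4 → ℝ, Hopfield.mink (L.mulVec x) (L.mulVec y) = Hopfield.mink x y) →
        0 < L.mulVec p.v 0 →
        Hopfield.IsVacuumTwoPoint { p with v := L.mulVec p.v } W' →
        ∀ (f f' : SchwartzMap (Fin 4 → ℝ) ℂ), (∀ x, f' x = f (L.mulVec x)) →
          ∀ a b : Hopfield.FieldIx,
            Hopfield.propagator W' a b f
              = ∑ c : Hopfield.FieldIx, ∑ d : Hopfield.FieldIx,
                  (Hopfield.fieldRep L a c : ℂ) * (Hopfield.fieldRep L b d : ℂ)
                    * Hopfield.propagator W c d f') := by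
  have hp : p.Good := ⟨hg, hχ, hω, hv, hv0⟩
  have hV := Hopfield.isVacuumTwoPoint_vacuumFunction hp
  refine ⟨fun w k hw hs hu hD hX => Hopfield.fieldMatrix_inv p hχ.ne' hv w k hw
      hs hu hD hX,
    fun q hq => Hopfield.ncard_transverseModes hp hq, ⟨_, hV⟩, fun W hW => ⟨fun e he => ?_,
    fun a b f => (hW.tendsto_feynman hp a b f).1,
    fun a b f => ⟨fun ε hε => Hopfield.integrable_feynmanIntegrand hp hε a b f,
      (hW.tendsto_feynman hp a b f).2⟩, ?_⟩⟩
  · have hu := hW.unique hp hV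
    filter_upwards [Hopfield.ae_generic hp, hu] with q hG h t
    simp only [h]
    refine ⟨fun μ ν => Hopfield.vacuumFunction_AA hp he hG t μ ν, fun h0 μ ν => ?_,
      fun μ ν => Hopfield.vacuumFunction_AP hp he hG t μ ν, fun μ => Hopfield.vacuumFunction_AB hp hG t μ,
      fun μ ν => Hopfield.vacuumFunction_PP hp he hG t μ ν, (Hopfield.vacuumFunction_zero t).1,
      (Hopfield.vacuumFunction_zero t).2, fun a b => Hopfield.vacuumFunction_conj hp hG t a b⟩
    rw [← Hopfield.photonAA_rest hp hG h0, Hopfield.vacuumFunction_AA hp he hG t μ ν]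
  · intro L W' hL hL0 hW' f f' hf a b
    have hp' : Hopfield.Medium.Good { p with v := L.mulVec p.v } :=
      ⟨hg, hχ, hω, (hL p.v p.v).trans hv, hL0⟩
    refine tendsto_nhds_unique (hW'.tendsto_feynman hp' a b f).2 ?_
    have h : Filter.Tendsto (fun ε => ∑ c, ∑ d, (Hopfield.fieldRep L a c : ℂ) * (Hopfield.fieldRep L b d : ℂ)
        * Hopfield.feynman p ε c d f') (nhdsWithin 0 (Set.Ioi 0))
        (nhds (∑ c, ∑ d, (Hopfield.fieldRep L a c : ℂ) * (Hopfield.fieldRep L b d : ℂ)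
          * Hopfield.propagator W c d f')) :=
      tendsto_finsetSum _ fun c _ => tendsto_finsetSum _ fun d _ =>
        ((hW.tendsto_feynman hp c d f').2).const_mul _
    refine h.congr' ?_
    filter_upwards [self_mem_nhdsWithin] with ε hε
    exact (Hopfield.feynman_lorentz hp hL hε hf a b).symm
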